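/- **Theorem (Convergence).** Let $V:\mathbb R\to\mathbb R$ be an even Schwartz function with $\int_{\mathbb R}V\,dx\le 0$, let $\omega\in\mathbb R$ (possibly $0$), $\beta\in(0,1)$, $b_0=\left|\int_{\mathbb R}V(x)\,dx\right|$, and for $N\ge 1$ let $$H_N=\sum_{j=1}^{N}\Big(-\tfrac12\partial_{x_j}^2+\tfrac{\omega^2}{2}x_j^2\Big)+\frac1N\sum_{1\le i<j\le N}N^{\beta}V\big(N^{\beta}(x_i-x_j)\big).$$ Let $\psi_N(t)$ be the solution of $i\partial_t\psi_N=H_N\psi_N$ in the space of permutation symmetric functions in $L^2(\mathbb R^N)$, i.e. $\psi_N(t)=e^{-itH_N}\psi_N(0)$, with $\|\psi_N(0)\|_{L^2}=1$. Let $$\gamma_N^{(k)}(t,\mathbf x_k;\mathbf x_k')=\int\psi_N(t,\mathbf x_k,\mathbf x_{N-k})\overline{\psi_N}(t,\mathbf x_k',\mathbf x_{N-k})\,d\mathbf x_{N-k}$$ be its marginal densities, and assume that $\lim_{N\to\infty}\operatorname{Tr}\big|\gamma_N^{(1)}(0)-|\phi_0\rangle\langle\phi_0|\big|=0$ for some $\phi_0\in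 L^2(\mathbb R)$. Put $g(\tau)=(1+\omega^2\tau^2)^{-1/2}$ and let $$u_N^{(k)}(\tau,\mathbf y_k;\mathbf y_k')=e^{\,i\frac{\omega^2\tau}{1+\omega^2\tau^2}\frac{|\mathbf y_k|^2-|\mathbf y_k'|^2}{2}}\,g(\tau)^{k}\,\gamma_N^{(k)}\Big(\tfrac{\arctan(\omega\tau)}{\omega},g(\tau)\mathbf y_k;g(\tau)\mathbf y_k'\Big),\qquad 1\le k\le N,$$ be the lens transformed marginals (for $\omega=0$ read $\arctan(\omega\tau)/\omega=\tau$, so that $u_N^{(k)}=\gamma_N^{(k)}$); set $u_N^{(k)}=0$ for $k>N$. Let $T>0$, let $L^{(k)}=\prod_{j=1}^k(1-\partial_{y_j}^2)^{1/2}$, and assume the energy condition: there is a constant $C$, independent of $k$ and $N$, such that for every $k\ge1$ there is $N_0(k)$ with $$\sup_{\tau\in[0,T]}\operatorname{Tr}L^{(k)}u_N^{(k)}(\tau)L^{(k)}\le C^k\qquad\text{for all }N\ge N_0(k).$$ For each $k\ge1$ let $(J_i^{(k)})_{i\ge1}$ be a dense sequence in the unit ball of the compact operators on $L^2(\mathbb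 R^k)$. Let $C([0,T],\mathcal L^1_k)$ be the space of paths of trace class operators on $L^2(\mathbb R^k)$ that are continuous for $d_k(\gamma,\tilde\gamma)=\sum_i2^{-i}|\operatorname{Tr}J_i^{(k)}(\gamma-\tilde\gamma)|$, with the metric $\hat d_k=\sup_{\tau\in[0,T]}d_k$, and give $\bigoplus_{k\ge1}C([0,T],\mathcal L^1_k)$ the product topology. If $\Gamma=\{u^{(k)}\}_{k\ge1}$ is a limit point of the sequence $\Gamma_N=\{u_N^{(k)}\}_k$ in this topology, then $\Gamma$ solves the one-dimensional focusing Gross-Pitaevskii hierarchy in lens form with coupling constant $b_0$ and initial data $|\phi_0\rangle\langle\phi_0|^{\otimes k}$. That is, for all $k\ge1$ and $\tau\in[0,T]$, $u^{(k)}(0)=|\phi_0\rangle\langle\phi_0|^{\otimes k}$ and $$u^{(k)}(\tau)=U^{(k)}(\tau)u^{(k)}(0)+ib_0\sum_{j=1}^k\int_0^\tau U^{(k)}(\tau-s)\operatorname{Tr}_{k+1}\big[g(s)\delta(y_j-y_{k+1}),u^{(k+1)}(s)\big]\,ds .$$ Here $U^{(k)}(\tau)A=e^{i\tau\Delta/2}A\,e^{-i\tau\Delta/2}$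 with $\Delta$ the Laplacian on $\mathbb R^k$. Each $u^{(k+1)}(s)$, $s\in[0,T]$, has a continuous kernel, $\operatorname{Tr}_{k+1}[\delta(y_j-y_{k+1}),u^{(k+1)}(s)]$ is the bounded operator with kernel $u^{(k+1)}(s,\mathbf y_k,y_j;\mathbf y_k',y_j)-u^{(k+1)}(s,\mathbf y_k,y_j';\mathbf y_k',y_j')$, and the integrals converge as Bochner integrals in operator norm. -/

import Mathlib

open MeasureTheory Filter Topology
open scoped ENNReal ComplexConjugate SchwartzMap InnerProductSpace

noncomputable section

namespace GPHierarchy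

/-! ### Trace and trace norm on a complex Hilbert space -/

section Trace

variable {H : Type*} [NormedAddCommGroup H] [InnerProductSpace ℂ H] [CompleteSpace H]

/-- An orthonormal (Hilbert) basis of `H`, as a set of vectors. -/
def onb (H : Type*) [NormedAddCommGroup H] [InnerProductSpace ℂ H] [CompleteSpace H] : Set H :=
  Classical.choose (exists_hilbertBasis ℂ H)

/-- `Tr A = ∑ ⟨e, A e⟩`. For trace class `A` this sum converges absolutely and
does not depend on the basis. -/
def trace (A : H →L[ℂ] H) : ℂ := ∑' e : onb H, ⟪(e : H), A e⟫_ℂ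

/-- `Tr |A|` with `|A| = (A* A)^{1/2}`, a number in `[0, ∞]`. -/
def traceNorm (A : H →L[ℂ] H) : ℝ≥0∞ :=
  ∑' e : onb H, ENNReal.ofReal (⟪(e : H), CFC.abs A e⟫_ℂ).re

def IsTraceClass (A : H →L[ℂ] H) : Prop := traceNorm A < ⊤

end Trace

/-! ### Function spaces -/

/-- Configuration space `ℝᵏ` of `k` particles on the line. -/
abbrev E (k : ℕ) : Type := EuclideanSpace ℝ (Fin k)

/-- `L²(ℝᵏ; ℂ)`. -/
abbrev L2 (k : ℕ) : Type := Lp ℂ 2 (volume : Measure (E k))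

/-- Bounded operators on `L²(ℝᵏ)`. -/
abbrev Op (k : ℕ) : Type := L2 k →L[ℂ] L2 k

/-- The bounded operator `A` has the integral kernel `K`. -/
def HasKernel {k : ℕ} (A : Op k) (K : E k → E k → ℂ) : Prop :=
  ∀ f : L2 k, ∀ᵐ y : E k, Integrable (fun y' => K y y' * f y') ∧
    A f y = ∫ y', K y y' * f y'

open Classical in
/-- The bounded operator with kernel `K` (it is unique; `0` if there is none, which does not
happen for square integrable kernels). -/
def opOfKernel {k : ℕ} (K : E k → E k → ℂ) : Op k :=
  if h : ∃ A : Op k, HasKernel A K then h.choose else 0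

/-! ### The `N`-body Schrödinger evolution -/

/-- `H_N f = ∑ⱼ (-½ ∂ⱼ² + ½ ω² xⱼ²) f + N⁻¹ ∑_{i<j} N^β V(N^β (xᵢ - xⱼ)) f`. -/
def hamiltonian (V : 𝓢(ℝ, ℝ)) (ω β : ℝ) (N : ℕ) (f : 𝓢(E N, ℂ)) (x : E N) : ℂ :=
  -(1 / 2 : ℂ) * Laplacian.laplacian (f : E N → ℂ) x
    + ((ω ^ 2 / 2 * ‖x‖ ^ 2 : ℝ) : ℂ) * f x
    + ((1 / (N : ℝ) * ∑ i : Fin N, ∑ j ∈ Finset.Ioi i,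
        (N : ℝ) ^ β * V ((N : ℝ) ^ β * (x i - x j)) : ℝ) : ℂ) * f x

/-- Bosonic symmetry: invariance under permutations of the particles. -/
def IsBosonic {N : ℕ} (ψ : L2 N) : Prop :=
  ∀ σ : Equiv.Perm (Fin N),
    (fun x : E N => ψ (WithLp.toLp 2 (fun i => x (σ i)))) =ᵐ[volume] ψ

/-- `ψ(t) = e^{-itH_N} ψ(0)` in the bosonic space: `ψ` is continuous with values in the
symmetric subspace of `L²(ℝᴺ)` and solves `i ∂ₜ ψ = H_N ψ` in the sense of distributions in `x`
(integrated in time). As `H_N` is essentially self-adjoint on Schwartz functions, this determines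
`ψ` from `ψ(0)`. -/
structure IsNBodyEvolution (V : 𝓢(ℝ, ℝ)) (ω β : ℝ) (N : ℕ) (ψ : ℝ → L2 N) : Prop where
  continuous : Continuous ψ
  bosonic : ∀ t, IsBosonic (ψ t)
  schrodinger : ∀ (f : 𝓢(E N, ℂ)) (t : ℝ),
    (∫ x, ψ t x * f x) - ∫ x, ψ 0 x * f x
      = -Complex.I * ∫ s in (0 : ℝ)..t, ∫ x, ψ s x * hamiltonian V ω β N f x

/-! ### Marginal densities and the lens transform -/

/-- The point `(x, z) ∈ ℝᵏ × ℝ^{N-k}` as a point of `ℝᴺ` (used for `k ≤ N`). -/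
def join {k N : ℕ} (x : E k) (z : E (N - k)) : E N :=
  WithLp.toLp 2 fun i : Fin N =>
    if h : (i : ℕ) < k then x ⟨i, h⟩ else z ⟨(i : ℕ) - k, by omega⟩

/-- Kernel of the `k`-particle marginal: `∫ ψ(x, z) conj ψ(x', z) dz`. -/
def marginalKernel {N : ℕ} (k : ℕ) (ψ : L2 N) (x x' : E k) : ℂ :=
  ∫ z : E (N - k), ψ (join x z) * conj (ψ (join x' z))

/-- `t = arctan(ω τ) / ω`, which is `τ` when `ω = 0`. -/
def lensTime (ω τ : ℝ) : ℝ := if ω = 0 then τ else Real.arctan (ω * τ) / ω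

/-- `g(τ) = (1 + ω² τ²)^{-1/2}`. -/
def lensFactor (ω τ : ℝ) : ℝ := (Real.sqrt (1 + ω ^ 2 * τ ^ 2))⁻¹

/-- Inverse lens transform `T_k⁻¹` of a time dependent kernel; since `g = (1 + ω² τ²)^{-1/2}`,
the prefactor `(1 + ω² τ²)^{-k/2}` is `gᵏ`. -/
def invLens (ω : ℝ) {k : ℕ} (γ : ℝ → E k → E k → ℂ) (τ : ℝ) (y y' : E k) : ℂ :=
  Complex.exp (Complex.I * ((ω ^ 2 * τ / (1 + ω ^ 2 * τ ^ 2)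
      * ((‖y‖ ^ 2 - ‖y'‖ ^ 2) / 2) : ℝ) : ℂ))
    * ((lensFactor ω τ ^ k : ℝ) : ℂ)
    * γ (lensTime ω τ) (lensFactor ω τ • y) (lensFactor ω τ • y')

/-- `γ_N^{(k)}` as an operator. -/
def marginal {N : ℕ} (k : ℕ) (ψ : L2 N) : Op k := opOfKernel (marginalKernel k ψ)

/-- `u_N^{(k)}(τ) = (T_k⁻¹ γ_N^{(k)})(τ)` as an operator, for `1 ≤ k ≤ N`; the finite family
is continued by `0` for `k > N`. -/
def lensMarginal (ω : ℝ) {N : ℕ} (ψ : ℝ → L2 N) (k : ℕ) (τ : ℝ) : Op k :=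
  if k ≤ N then opOfKernel (invLens ω (fun t => marginalKernel k (ψ t)) τ) else 0

/-- Kernel of `|φ⟩⟨φ|^{⊗k}`. -/
def pureKernel (φ : Lp ℂ 2 (volume : Measure ℝ)) (k : ℕ) (y y' : E k) : ℂ :=
  ∏ j : Fin k, φ (y j) * conj (φ (y' j))

/-- `|φ⟩⟨φ|^{⊗k}` as an operator. -/
def pureState (φ : Lp ℂ 2 (volume : Measure ℝ)) (k : ℕ) : Op k := opOfKernel (pureKernel φ k)

/-! ### Fourier multipliers: `L^{(k)}` and the free evolution -/

/-- The operator `𝓕⁻¹ m 𝓕` on `L²(ℝᵏ)` for a bounded measurable symbol `m`, where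
`𝓕 f(ξ) = ∫ e^{-2πi x·ξ} f(x) dx`. -/
def fourierMultiplier {k : ℕ} (m : E k → ℂ) (hm : MemLp m ∞ volume) : Op k :=
  ((Lp.fourierTransformₗᵢ (E k) ℂ).symm.toContinuousLinearEquiv : L2 k →L[ℂ] L2 k) ∘L
    ((ContinuousLinearMap.mul ℂ ℂ).holderL volume ∞ 2 2 (hm.toLp m)) ∘L
    ((Lp.fourierTransformₗᵢ (E k) ℂ).toContinuousLinearEquiv : L2 k →L[ℂ] L2 k)

/-- Symbol of `∏ⱼ (1 - ∂ⱼ²)^{-1/2}`. -/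
def energySymbol (k : ℕ) (ξ : E k) : ℂ :=
  ((∏ j : Fin k, (Real.sqrt (1 + (2 * Real.pi * ξ j) ^ 2))⁻¹ : ℝ) : ℂ)

theorem memLp_energySymbol (k : ℕ) : MemLp (energySymbol k) ∞ volume := by
  refine memLp_top_of_bound (Continuous.aestronglyMeasurable ?_) 1 (ae_of_all _ fun ξ => ?_)
  · refine Complex.continuous_ofReal.comp (continuous_finsetProd _ fun j _ => ?_)
    refine Continuous.inv₀ (by fun_prop) fun ξ => ?_
    positivity
  · rw [energySymbol, Complex.norm_real, Real.norm_eq_abs, abs_of_nonneg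
      (Finset.prod_nonneg fun j _ => by positivity)]
    refine Finset.prod_le_one (fun j _ => by positivity) fun j _ => inv_le_one_of_one_le₀ ?_
    rw [Real.one_le_sqrt]
    nlinarith [sq_nonneg (2 * Real.pi * ξ j)]

/-- `(L^{(k)})⁻¹` where `L^{(k)} = ∏ⱼ (1 - ∂ⱼ²)^{1/2}`. -/
def energyWeightInv (k : ℕ) : Op k := fourierMultiplier (energySymbol k) (memLp_energySymbol k)

/-- `Tr L^{(k)} A L^{(k)}` in `[0, ∞]` for `A ≥ 0`: the trace of the nonnegative bounded operator
`B = L^{(k)} A L^{(k)}`, that is, of the (unique) `B` with `A = (L^{(k)})⁻¹ B (L^{(k)})⁻¹`;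
it is `∞` if there is none. -/
def energy {k : ℕ} (A : Op k) : ℝ≥0∞ :=
  ⨅ (B : Op k) (_ : B.IsPositive ∧ A = energyWeightInv k ∘L B ∘L energyWeightInv k), traceNorm B

/-- Symbol of `e^{iτΔ/2}`. -/
def freeSymbol (k : ℕ) (τ : ℝ) (ξ : E k) : ℂ :=
  Complex.exp (Complex.I * ((-(τ * (2 * Real.pi ^ 2 * ‖ξ‖ ^ 2)) : ℝ) : ℂ))

theorem memLp_freeSymbol (k : ℕ) (τ : ℝ) : MemLp (freeSymbol k τ) ∞ volume := by
  refine memLp_top_of_bound (Continuous.aestronglyMeasurable ?_) 1 (ae_of_all _ fun ξ => ?_)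
  · unfold freeSymbol
    fun_prop
  · rw [freeSymbol, Complex.norm_exp_I_mul_ofReal]

/-- `e^{iτΔ/2}` on `L²(ℝᵏ)`. -/
def freeGroup (k : ℕ) (τ : ℝ) : Op k := fourierMultiplier (freeSymbol k τ) (memLp_freeSymbol k τ)

/-- `U^{(k)}(τ) A = e^{iτΔ/2} A e^{-iτΔ/2}`; on kernels this is
`∏ⱼ exp(iτ∂²_{yⱼ}/2) exp(-iτ∂²_{y'ⱼ}/2)`. -/
def freeEvolution {k : ℕ} (τ : ℝ) (A : Op k) : Op k :=
  freeGroup k τ ∘L A ∘L freeGroup k (-τ)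

/-! ### The product weak* topology -/

/-- `J` is a countable dense family in the unit ball of the compact operators on `L²(ℝᵏ)`. -/
def IsObservableFamily {k : ℕ} (J : ℕ → Op k) : Prop :=
  (∀ i, IsCompactOperator (J i) ∧ ‖J i‖ ≤ 1) ∧
    ∀ A : Op k, IsCompactOperator A → ‖A‖ ≤ 1 → A ∈ closure (Set.range J)

/-- `d_k(A, A') = ∑_{i ≥ 1} 2^{-i} |Tr Jᵢ (A - A')|` (the index `i` starts at `0` here). -/
def weakDist {k : ℕ} (J : ℕ → Op k) (A A' : Op k) : ℝ≥0∞ :=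
  ∑' i : ℕ, (2⁻¹ : ℝ≥0∞) ^ (i + 1) * ‖trace (J i ∘L (A - A'))‖ₑ

/-- `sup_{τ ∈ [0,T]} d_k(u(τ), v(τ))`. -/
def pathDist {k : ℕ} (J : ℕ → Op k) (T : ℝ) (u v : ℝ → Op k) : ℝ≥0∞ :=
  ⨆ τ ∈ Set.Icc (0 : ℝ) T, weakDist J (u τ) (v τ)

/-- `u ∈ C([0,T], 𝓛¹_k)`: trace class values, continuous for `d_k`. -/
def IsWeakContinuousPath {k : ℕ} (J : ℕ → Op k) (T : ℝ) (u : ℝ → Op k) : Prop :=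
  (∀ τ ∈ Set.Icc (0 : ℝ) T, IsTraceClass (u τ)) ∧
    ∀ τ₀ ∈ Set.Icc (0 : ℝ) T,
      Tendsto (fun τ => weakDist J (u τ) (u τ₀)) (𝓝[Set.Icc 0 T] τ₀) (𝓝 0)

/-- `Γ = {u^{(k)}}_{k ≥ 1}` lies in the product of the spaces `C([0,T], 𝓛¹_k)` and is a limit
point of the sequence `Γ_N` in the product of the metric topologies: every basic neighbourhood
of `Γ` contains `Γ_N` for infinitely many `N`. -/
def IsLimitPoint (J : (k : ℕ) → ℕ → Op k) (T : ℝ) (ΓN : ℕ → (k : ℕ) → ℝ → Op k)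
    (Γ : (k : ℕ) → ℝ → Op k) : Prop :=
  (∀ k, 1 ≤ k → IsWeakContinuousPath (J k) T (Γ k)) ∧
    ∀ (m : ℕ) (ε : ℝ≥0∞), 0 < ε →
      ∃ᶠ N in atTop, ∀ k, 1 ≤ k → k ≤ m → pathDist (J k) T (ΓN N k) (Γ k) < ε

/-! ### The focusing Gross-Pitaevskii hierarchy in lens form -/

/-- `(y, a) ∈ ℝ^{k+1}`. -/
def append {k : ℕ} (y : E k) (a : ℝ) : E (k + 1) :=
  WithLp.toLp 2 (Fin.snoc (α := fun _ => ℝ) (fun i => y i) a)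

/-- `B = Tr_{k+1} [δ(yⱼ - y_{k+1}), A]`: the operator `A` on `L²(ℝ^{k+1})` has a continuous kernel
`K` (which is then unique), and `B` is the operator on `L²(ℝᵏ)` with kernel
`K(y, yⱼ; y', yⱼ) - K(y, y'ⱼ; y', y'ⱼ)`. -/
def IsCollision {k : ℕ} (j : Fin k) (A : Op (k + 1)) (B : Op k) : Prop :=
  ∃ K : E (k + 1) → E (k + 1) → ℂ, Continuous (Function.uncurry K) ∧ HasKernel A K ∧
    HasKernel B (fun y y' =>
      K (append y (y j)) (append y' (y j)) - K (append y (y' j)) (append y' (y' j)))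

/-- `{u^{(k)}}` solves on `[0,T]` the focusing hierarchy with coupling constant `b₀` and
`u^{(k)}(0) = |φ₀⟩⟨φ₀|^{⊗k}`:
`u^{(k)}(τ) = U^{(k)}(τ) u^{(k)}(0)
  + i b₀ ∑ⱼ ∫₀^τ U^{(k)}(τ-s) Tr_{k+1} [g(s) δ(yⱼ - y_{k+1}), u^{(k+1)}(s)] ds`,
with convergent Bochner integrals. -/
def SolvesLensGP (ω b₀ T : ℝ) (φ₀ : Lp ℂ 2 (volume : Measure ℝ))
    (u : (k : ℕ) → ℝ → Op k) : Prop :=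
  ∀ k, 1 ≤ k →
    HasKernel (u k 0) (pureKernel φ₀ k) ∧
    ∃ B : Fin k → ℝ → Op k,
      (∀ j, ∀ s ∈ Set.Icc (0 : ℝ) T, IsCollision j (u (k + 1) s) (B j s)) ∧
      ∀ τ ∈ Set.Icc (0 : ℝ) T,
        (∀ j, IntervalIntegrable
          (fun s => freeEvolution (τ - s) ((lensFactor ω s : ℂ) • B j s)) volume 0 τ) ∧
        u k τ = freeEvolution τ (u k 0)
          + (Complex.I * (b₀ : ℂ)) • ∑ j : Fin k,
              ∫ s in (0 : ℝ)..τ, freeEvolution (τ - s) ((lensFactor ω s : ℂ) • B j s)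

end GPHierarchy

end

open GPHierarchy

set_option linter.unusedSectionVars false

noncomputable section

namespace GPHierarchy

open scoped FourierTransform

/-! ### Nuclear representations and the trace -/

section Nuclear

variable {H : Type*} [NormedAddCommGroup H] [InnerProductSpace ℂ H] [CompleteSpace H]

/-! The lens transform turns the trapped dynamics into a free one with interaction g² · potential(g
y). Conjugating with the free group leaves only a bounded perturbation, so the N-body state in the
interaction picture is differentiable in norm (`IsNBodyEvolution.hasDerivAt_interPath`).
Self-adjointness of H_N plays no role: every identity is tested on Gaussians, which span a dense
subspace, are Schwartz functions, and stay Gaussian under the free flow and the lens transform.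

Differentiating matrix elements of the k-particle marginal between freely evolved vectors gives the
BBGKY hierarchy (`IsNBodyEvolution.hasDerivAt_marginal`). Pairs among the first k particles
contribute O(N^{β-1}), which vanishes since β < 1; pairs among the traced-out particles cancel; by
bosonic symmetry the mixed pairs are N - k equal copies of a trace against the (k+1)-particle
marginal.

The energy condition controls these traces. It writes the marginal as L⁻¹ B L⁻¹ with Tr B bounded,
and with one dimension per particle L⁻¹δ_y (`green y`) lies in L² and depends continuously on y.
Hence the marginal has the bounded continuous kernel ⟨green y, B green y'⟩, and weak convergence of
B gives convergence of kernels even at moving points (`tendsto_inner_of_weak`). After scaling, a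
mixed term integrates V(r) against the kernel with the last particle at distance r/(N^β g) from
contact (`trace_pairObs`); since β > 0, dominated convergence yields ∫V times the collision term
(`tendsto_mixedTerm`), and ∫V = -b₀ gives the focusing sign.

Energy bounds pass to limit points and make them weakly continuous in the weighted sense
(`exists_energyPath`). Collision operators are uniformly Hilbert–Schmidt (`exists_collision`), so
weakly measurable paths of them are measurable in operator norm and Bochner integrable. Integrating
BBGKY in time and passing to the limit (`integral_equation_gauss`) gives the equation on Gaussians,
which determine the operator (`ext_inner_gauss`).

For the initial data, trace norm convergence of the one-particle marginal says that the overlap with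
φ₀ tends to 1 (`condensation`); this propagates to k particles by induction (`eventually_overlap`)
and forces the pure tensor power as weak limit. -/

/-- The Hilbert basis underlying `onb H`. -/
def onbBasis (H : Type*) [NormedAddCommGroup H] [InnerProductSpace ℂ H] [CompleteSpace H] :
    HilbertBasis (onb H) ℂ H :=
  (Classical.choose_spec (exists_hilbertBasis ℂ H)).choose

theorem onbBasis_apply (e : onb H) : onbBasis H e = (e : H) :=
  congrFun (Classical.choose_spec (exists_hilbertBasis ℂ H)).choose_spec e

/-- Cauchy–Schwarz and Bessel for the coefficients in a Hilbert basis. -/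
theorem _root_.HilbertBasis.tsum_norm_inner_mul_le {κ : Type*} (b : HilbertBasis κ ℂ H) (x y : H) :
    ∑' i, ‖⟪x, b i⟫_ℂ * ⟪b i, y⟫_ℂ‖ ≤ ‖x‖ * ‖y‖ := by
  refine (b.summable_inner_mul_inner x y).norm.tsum_le_of_sum_le fun s => ?_
  simp_rw [norm_mul]
  refine (Real.sum_mul_le_sqrt_mul_sqrt s _ _).trans ?_
  refine mul_le_mul ?_ ?_ (Real.sqrt_nonneg _) (norm_nonneg _)
  · rw [← Real.sqrt_sq (norm_nonneg x)]
    refine Real.sqrt_le_sqrt ?_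
    simp_rw [norm_inner_symm x]
    exact b.orthonormal.sum_inner_products_le x
  · rw [← Real.sqrt_sq (norm_nonneg y)]
    exact Real.sqrt_le_sqrt (b.orthonormal.sum_inner_products_le y)

/-- `A = ∑ᵢ |xᵢ⟩⟨yᵢ|` weakly, with `∑ᵢ ‖xᵢ‖ ‖yᵢ‖ < ∞`. -/
structure NuclearRep {ι : Type*} (A : H →L[ℂ] H) (x y : ι → H) : Prop where
  summable : Summable fun i => ‖x i‖ * ‖y i‖
  hasSum : ∀ f g, HasSum (fun i => ⟪g, x i⟫_ℂ * ⟪y i, f⟫_ℂ) ⟪g, A f⟫_ℂ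

namespace NuclearRep

variable {ι κ : Type*} {A A' : H →L[ℂ] H} {x y : ι → H} {x' y' : κ → H}

/-- Cauchy–Schwarz and Bessel in the basis index bound the inner sums by the nuclear terms. Absolute
summability licenses the exchange of sums behind the independence of the trace from the
representation. -/
theorem summable_prod (h : NuclearRep A x y) (J : H →L[ℂ] H) :
    Summable fun p : onb H × ι =>
      ⟪ContinuousLinearMap.adjoint J p.1, x p.2⟫_ℂ * ⟪y p.2, (p.1 : H)⟫_ℂ := by
  have key : ∀ i, (fun e : onb H => ⟪ContinuousLinearMap.adjoint J e, x i⟫_ℂ * ⟪y i, (e : H)⟫_ℂ)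
      = fun e => ⟪y i, onbBasis H e⟫_ℂ * ⟪onbBasis H e, J (x i)⟫_ℂ := fun i => by
    ext e
    rw [onbBasis_apply, ContinuousLinearMap.adjoint_inner_left, mul_comm]
  rw [← (Equiv.prodComm ι (onb H)).summable_iff]
  refine Summable.of_norm ?_
  rw [summable_prod_of_nonneg fun _ => norm_nonneg _]
  refine ⟨fun i => ?_, ?_⟩
  · have := ((onbBasis H).summable_inner_mul_inner (y i) (J (x i))).norm
    refine this.congr fun e => ?_
    rw [← congrFun (key i) e]
    rfl
  · refine Summable.of_nonneg_of_le (fun i => tsum_nonneg fun e => norm_nonneg _) (fun i => ?_)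
      (h.summable.mul_left ‖J‖)
    have := (onbBasis H).tsum_norm_inner_mul_le (y i) (J (x i))
    have k2 : ∀ e : onb H, ‖(⟪y i, onbBasis H e⟫_ℂ * ⟪onbBasis H e, J (x i)⟫_ℂ)‖
      = ‖⟪ContinuousLinearMap.adjoint J e, x i⟫_ℂ * ⟪y i, (e : H)⟫_ℂ‖ :=
      fun e => by rw [← congrFun (key i) e]
    simp_rw [k2] at this
    refine this.trans ?_
    calc ‖y i‖ * ‖J (x i)‖ ≤ ‖y i‖ * (‖J‖ * ‖x i‖) := by gcongr; exact J.le_opNorm _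
      _ = _ := by ring

theorem summable_diag (h : NuclearRep A x y) (J : H →L[ℂ] H) :
    HasSum (fun e : onb H => ⟪(e : H), J (A e)⟫_ℂ)
      (∑' p : onb H × ι, ⟪ContinuousLinearMap.adjoint J p.1, x p.2⟫_ℂ * ⟪y p.2, (p.1 : H)⟫_ℂ) := by
  refine (h.summable_prod J).hasSum.prod_fiberwise fun e => ?_
  have := h.hasSum e (ContinuousLinearMap.adjoint J e)
  rwa [ContinuousLinearMap.adjoint_inner_left] at this

/-- The trace does not depend on the representation. -/
theorem hasSum_trace (h : NuclearRep A x y) (J : H →L[ℂ] H) :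
    HasSum (fun i => ⟪y i, J (x i)⟫_ℂ) (trace (J ∘L A)) := by
  have e1 : trace (J ∘L A) = _ := (h.summable_diag J).tsum_eq
  rw [e1]
  -- The same double family summed first over the basis collapses by Parseval.
  have hs := (Equiv.prodComm ι (onb H)).hasSum_iff.mpr (h.summable_prod J).hasSum
  refine hs.prod_fiberwise fun i => ?_
  have := (onbBasis H).hasSum_inner_mul_inner (y i) (J (x i))
  refine this.congr_fun fun e => ?_
  simp only [Function.comp, Equiv.prodComm_apply, Prod.swap]
  rw [onbBasis_apply, ContinuousLinearMap.adjoint_inner_left, mul_comm]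

theorem norm_trace_le (h : NuclearRep A x y) (J : H →L[ℂ] H) :
    ‖trace (J ∘L A)‖ ≤ ‖J‖ * ∑' i, ‖x i‖ * ‖y i‖ := by
  rw [← (h.hasSum_trace J).tsum_eq, ← tsum_mul_left]
  refine tsum_of_norm_bounded (h.summable.mul_left ‖J‖).hasSum fun i => ?_
  calc ‖⟪y i, J (x i)⟫_ℂ‖ ≤ ‖y i‖ * ‖J (x i)‖ := norm_inner_le_norm _ _
    _ ≤ ‖y i‖ * (‖J‖ * ‖x i‖) := by gcongr; exact J.le_opNorm _
    _ = _ := by ring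

theorem trace_comp_sub (h : NuclearRep A x y) (h' : NuclearRep A' x' y') (J : H →L[ℂ] H) :
    trace (J ∘L (A - A')) = trace (J ∘L A) - trace (J ∘L A') := by
  have h1 := h.summable_diag J
  have h2 := h'.summable_diag J
  have := (h1.summable.tsum_sub h2.summable)
  simp only [trace, ContinuousLinearMap.comp_apply, _root_.sub_apply, map_sub,
    inner_sub_right]
  exact this

theorem trace_sub_left (h : NuclearRep A x y) (J J' : H →L[ℂ] H) :
    trace ((J - J') ∘L A) = trace (J ∘L A) - trace (J' ∘L A) := by
  have := ((h.summable_diag J).summable.tsum_sub (h.summable_diag J').summable)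
  simp only [trace, ContinuousLinearMap.comp_apply, _root_.sub_apply,
    inner_sub_right]
  exact this

theorem norm_inner_le (h : NuclearRep A x y) (f g : H) :
    ‖⟪g, A f⟫_ℂ‖ ≤ (∑' i, ‖x i‖ * ‖y i‖) * ‖f‖ * ‖g‖ := by
  rw [← (h.hasSum f g).tsum_eq, mul_assoc, ← tsum_mul_right]
  refine tsum_of_norm_bounded (h.summable.mul_right _).hasSum fun i => ?_
  rw [norm_mul]
  calc _ ≤ (‖g‖ * ‖x i‖) * (‖y i‖ * ‖f‖) := by gcongr <;> exact norm_inner_le_norm _ _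
    _ = _ := by ring

/-- Conjugation by a bounded operator. -/
theorem conjugate (h : NuclearRep A x y) (S : H →L[ℂ] H) :
    NuclearRep (S ∘L A ∘L ContinuousLinearMap.adjoint S) (fun i => S (x i)) (fun i => S (y i)) := by
  refine ⟨?_, fun f g => ?_⟩
  · refine Summable.of_nonneg_of_le (fun i => by positivity) (fun i => ?_)
      (h.summable.mul_left (‖S‖ * ‖S‖))
    calc ‖S (x i)‖ * ‖S (y i)‖ ≤ (‖S‖ * ‖x i‖) * (‖S‖ * ‖y i‖) := by
          gcongr <;> exact S.le_opNorm _
      _ = _ := by ring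
  · have := h.hasSum (ContinuousLinearMap.adjoint S f) (ContinuousLinearMap.adjoint S g)
    simpa [ContinuousLinearMap.adjoint_inner_left, ContinuousLinearMap.adjoint_inner_right]
      using this

end NuclearRep

/-- Polar decomposition, in the form `A = W |A|` with `‖W‖ ≤ 1`. -/
theorem exists_polar (A : H →L[ℂ] H) :
    ∃ W : H →L[ℂ] H, ‖W‖ ≤ 1 ∧ A = W ∘L CFC.abs A := by
  set P := CFC.abs A with hP
  have hPsa : IsSelfAdjoint P := (CFC.abs_nonneg A).isSelfAdjoint
  -- Since |A|² = A*A, the map |A|x ↦ Ax is an isometry on the range of |A|. It extends to the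
  -- closure and is then precomposed with the orthogonal projection.
  have hnorm : ∀ x, ‖A x‖ = ‖P x‖ := fun x => by
    have h1 : ‖A x‖ ^ 2 = ‖P x‖ ^ 2 := by
      have e1 := ContinuousLinearMap.apply_norm_sq_eq_inner_adjoint_left A x
      have e2 := ContinuousLinearMap.apply_norm_sq_eq_inner_adjoint_left P x
      rw [e1, e2]
      have : ContinuousLinearMap.adjoint P ∘L P = ContinuousLinearMap.adjoint A ∘L A := by
        have := CFC.abs_mul_abs A
        rw [← hP] at this
        rw [← ContinuousLinearMap.star_eq_adjoint, ← ContinuousLinearMap.star_eq_adjoint,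
          hPsa.star_eq]
        exact this
      change RCLike.re ⟪(ContinuousLinearMap.adjoint A ∘L A) x, x⟫_ℂ
        = RCLike.re ⟪(ContinuousLinearMap.adjoint P ∘L P) x, x⟫_ℂ
      rw [this]
    exact (sq_eq_sq₀ (norm_nonneg _) (norm_nonneg _)).mp h1
  let K : Submodule ℂ H := (LinearMap.range (P : H →ₗ[ℂ] H)).topologicalClosure
  have hK : ∀ x, P x ∈ K := fun x =>
    Submodule.le_topologicalClosure _ (LinearMap.mem_range_self (P : H →ₗ[ℂ] H) x)
  let e : H →L[ℂ] K := P.codRestrict K hK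
  have hd : DenseRange e := by
    intro y
    have hy := y.2
    change (y : H) ∈ closure (LinearMap.range (P : H →ₗ[ℂ] H) : Set H) at hy
    rw [Metric.mem_closure_iff] at hy ⊢
    intro ε hε
    obtain ⟨z, ⟨x, rfl⟩, hz⟩ := hy ε hε
    exact ⟨e x, ⟨x, rfl⟩, hz⟩
  have : CompleteSpace K := (Submodule.isClosed_topologicalClosure _).completeSpace_coe
  let W0 : K →L[ℂ] H := LinearMap.extendOfNorm (A : H →ₗ[ℂ] H) (e : H →ₗ[ℂ] K)
  have hbd : ∀ x, ‖(A : H →ₗ[ℂ] H) x‖ ≤ 1 * ‖(e : H →ₗ[ℂ] K) x‖ := fun x => by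
    rw [one_mul]; exact (hnorm x).le
  have hW0 : ∀ x, W0 (e x) = A x := fun x => LinearMap.extendOfNorm_eq hd ⟨1, hbd⟩ x
  have hW0n : ‖W0‖ ≤ 1 := LinearMap.opNorm_extendOfNorm_le hd zero_le_one hbd
  refine ⟨W0 ∘L K.orthogonalProjectionOnto, ?_, ?_⟩
  · refine (ContinuousLinearMap.opNorm_comp_le _ _).trans ?_
    exact mul_le_one₀ hW0n (norm_nonneg _) (Submodule.orthogonalProjectionOnto_norm_le K)
  · ext x
    have : K.orthogonalProjectionOnto (P x) = e x :=
      Submodule.orthogonalProjectionOnto_mem_subspace_eq_self (e x)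
    simp only [ContinuousLinearMap.comp_apply]
    rw [this, hW0]

theorem inner_sqrt_left (B : H →L[ℂ] H) (f g : H) :
    ⟪CFC.sqrt B g, f⟫_ℂ = ⟪g, CFC.sqrt B f⟫_ℂ := by
  have hs : IsSelfAdjoint (CFC.sqrt B) := (CFC.sqrt_nonneg B).isSelfAdjoint
  rw [← ContinuousLinearMap.adjoint_inner_left, ← ContinuousLinearMap.star_eq_adjoint, hs.star_eq]

theorem inner_sqrt_sqrt {B : H →L[ℂ] H} (hB : 0 ≤ B) (f g : H) :
    ⟪CFC.sqrt B g, CFC.sqrt B f⟫_ℂ = ⟪g, B f⟫_ℂ := by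
  have h2 : CFC.sqrt B ∘L CFC.sqrt B = B := CFC.sqrt_mul_sqrt_self B hB
  conv_rhs => rw [← h2]
  rw [inner_sqrt_left]
  rfl

theorem norm_sqrt_sq {B : H →L[ℂ] H} (hB : 0 ≤ B) (f : H) :
    ‖CFC.sqrt B f‖ ^ 2 = (⟪f, B f⟫_ℂ).re := by
  rw [← inner_sqrt_sqrt hB, inner_self_eq_norm_sq_to_K]
  norm_cast

/-- A trace class operator has a nuclear representation. -/
theorem exists_nuclearRep {A : H →L[ℂ] H} (hA : IsTraceClass A) :
    ∃ x y : onb H → H, NuclearRep A x y ∧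
      ENNReal.ofReal (∑' e, ‖x e‖ * ‖y e‖) ≤ traceNorm A := by
  obtain ⟨W, hW, hAW⟩ := exists_polar A
  have hP : 0 ≤ CFC.abs A := CFC.abs_nonneg A
  -- Factor A = (W S) S; inserting the basis between the two Hilbert–Schmidt factors produces the
  -- vectors W S e and S e.
  set S := CFC.sqrt (CFC.abs A) with hS
  have hsum : Summable fun e : onb H => ‖S e‖ ^ 2 := by
    have := ENNReal.summable_toReal (f := fun e : onb H =>
      ENNReal.ofReal (⟪(e : H), CFC.abs A e⟫_ℂ).re) (ne_of_lt hA)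
    refine this.congr fun e => ?_
    rw [← norm_sqrt_sq hP, ENNReal.toReal_ofReal (by positivity)]
  have hle : ∀ e : onb H, ‖W (S e)‖ * ‖S e‖ ≤ ‖S e‖ ^ 2 := fun e => by
    rw [pow_two]
    gcongr
    calc _ ≤ ‖W‖ * ‖S e‖ := W.le_opNorm _
      _ ≤ 1 * ‖S e‖ := by gcongr
      _ = _ := one_mul _
  have hsum2 := Summable.of_nonneg_of_le (fun e : onb H => by positivity) hle hsum
  refine ⟨fun e => W (S e), fun e => S e, ⟨hsum2, fun f g => ?_⟩, ?_⟩
  · have h := (onbBasis H).hasSum_inner_mul_inner (S (ContinuousLinearMap.adjoint W g)) (S f)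
    have e1 : ⟪S (ContinuousLinearMap.adjoint W g), S f⟫_ℂ = ⟪g, A f⟫_ℂ := by
      rw [inner_sqrt_sqrt hP, ContinuousLinearMap.adjoint_inner_left]
      conv_rhs => rw [hAW]
      rfl
    rw [e1] at h
    refine h.congr_fun fun e => ?_
    rw [onbBasis_apply, ← ContinuousLinearMap.adjoint_inner_left W, inner_sqrt_left,
      inner_sqrt_left]
  · have h1 : ∑' e : onb H, ‖W (S e)‖ * ‖S e‖ ≤ ∑' e : onb H, ‖S e‖ ^ 2 :=
      hsum2.tsum_le_tsum hle hsum
    refine (ENNReal.ofReal_le_ofReal h1).trans ?_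
    rw [ENNReal.ofReal_tsum_of_nonneg (fun _ => by positivity) hsum]
    refine le_of_eq (tsum_congr fun e => ?_)
    rw [norm_sqrt_sq hP]

/-- `B ≥ 0` with `Tr B ≤ M`, expressed through the vectors `√B e`. -/
structure PosTrace (B : H →L[ℂ] H) (M : ℝ) : Prop where
  nonneg : 0 ≤ B
  sum_le : ∀ s : Finset (onb H), ∑ e ∈ s, ‖CFC.sqrt B e‖ ^ 2 ≤ M

namespace PosTrace

variable {B : H →L[ℂ] H} {M : ℝ}

theorem bound_nonneg (h : PosTrace B M) : 0 ≤ M := by simpa using h.sum_le ∅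

theorem summable (h : PosTrace B M) : Summable fun e : onb H => ‖CFC.sqrt B e‖ ^ 2 :=
  summable_of_sum_le (fun _ => by positivity) h.sum_le

theorem tsum_le (h : PosTrace B M) : ∑' e : onb H, ‖CFC.sqrt B e‖ ^ 2 ≤ M :=
  h.summable.tsum_le_of_sum_le h.sum_le

theorem rep (h : PosTrace B M) :
    NuclearRep B (fun e : onb H => CFC.sqrt B e) (fun e : onb H => CFC.sqrt B e) := by
  refine ⟨by simpa [pow_two] using h.summable, fun f g => ?_⟩
  have := (onbBasis H).hasSum_inner_mul_inner (CFC.sqrt B g) (CFC.sqrt B f)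
  rw [inner_sqrt_sqrt h.nonneg] at this
  refine this.congr_fun fun e => ?_
  rw [onbBasis_apply, inner_sqrt_left, inner_sqrt_left]

theorem norm_inner_le (h : PosTrace B M) (f g : H) : ‖⟪g, B f⟫_ℂ‖ ≤ M * ‖f‖ * ‖g‖ := by
  refine (h.rep.norm_inner_le f g).trans ?_
  gcongr
  simpa [pow_two] using h.tsum_le

end PosTrace

theorem posTrace_of_traceNorm {B : H →L[ℂ] H} {M : ℝ} (hM : 0 ≤ M) (hB : B.IsPositive)
    (h : traceNorm B ≤ ENNReal.ofReal M) : PosTrace B M := by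
  have hB' : 0 ≤ B := (ContinuousLinearMap.nonneg_iff_isPositive B).mpr hB
  refine ⟨hB', fun s => ?_⟩
  rw [← ENNReal.ofReal_le_ofReal_iff hM]
  refine le_trans ?_ h
  rw [ENNReal.ofReal_sum_of_nonneg (fun _ _ => by positivity)]
  refine (le_of_eq (Finset.sum_congr rfl fun e _ => ?_)).trans (ENNReal.sum_le_tsum s)
  rw [CFC.abs_of_nonneg B hB', norm_sqrt_sq hB']

end Nuclear

/-! ### Weak limits of operators -/

section WeakLimits

variable {H : Type*} [NormedAddCommGroup H] [InnerProductSpace ℂ H] [CompleteSpace H]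

/-- `Tr |A| ≤ M`, through a nuclear representation. -/
def NuclearBound (A : H →L[ℂ] H) (M : ℝ) : Prop :=
  ∃ x y : onb H → H, NuclearRep A x y ∧ ∑' e, ‖x e‖ * ‖y e‖ ≤ M

theorem NuclearBound.bound_nonneg {A : H →L[ℂ] H} {M : ℝ} (h : NuclearBound A M) : 0 ≤ M := by
  obtain ⟨x, y, -, h⟩ := h
  exact (tsum_nonneg fun e => by positivity).trans h

theorem PosTrace.nuclearBound {B : H →L[ℂ] H} {M : ℝ} (h : PosTrace B M) : NuclearBound B M :=
  ⟨_, _, h.rep, by simpa [pow_two] using h.tsum_le⟩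

theorem IsTraceClass.nuclearBound {A : H →L[ℂ] H} (h : IsTraceClass A) :
    NuclearBound A (traceNorm A).toReal := by
  obtain ⟨x, y, hxy, hle⟩ := exists_nuclearRep h
  refine ⟨x, y, hxy, ?_⟩
  rw [← ENNReal.ofReal_le_ofReal_iff ENNReal.toReal_nonneg, ENNReal.ofReal_toReal h.ne]
  exact hle

theorem NuclearBound.conjugate {A S : H →L[ℂ] H} {M : ℝ} (h : NuclearBound A M)
    (hS : ContinuousLinearMap.adjoint S = S) (hn : ‖S‖ ≤ 1) : NuclearBound (S ∘L A ∘L S) M := by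
  obtain ⟨x, y, hxy, hle⟩ := h
  have h1 := hxy.conjugate S
  rw [hS] at h1
  refine ⟨_, _, h1, le_trans (h1.summable.tsum_le_tsum (fun i => ?_) hxy.summable) hle⟩
  calc ‖S (x i)‖ * ‖S (y i)‖ ≤ (‖S‖ * ‖x i‖) * (‖S‖ * ‖y i‖) := by
        gcongr <;> exact S.le_opNorm _
    _ ≤ (1 * ‖x i‖) * (1 * ‖y i‖) := by gcongr
    _ = _ := by ring

theorem NuclearBound.norm_inner_le {A : H →L[ℂ] H} {M : ℝ} (h : NuclearBound A M) (f g : H) :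
    ‖⟪g, A f⟫_ℂ‖ ≤ M * ‖f‖ * ‖g‖ := by
  obtain ⟨x, y, hxy, hle⟩ := h
  refine (hxy.norm_inner_le f g).trans ?_
  gcongr

/-- Weak convergence of a bounded family needs to be tested on a total set only. -/
theorem tendsto_inner_of_total {γ : Type*} {l : Filter γ} {u : γ → H} {v : H} {C : ℝ}
    (hb : ∀ᶠ n in l, ‖u n‖ ≤ C) {G : Set H} (hG : Dense (Submodule.span ℂ G : Set H))
    (h : ∀ g ∈ G, Tendsto (fun n => ⟪g, u n⟫_ℂ) l (𝓝 ⟪g, v⟫_ℂ)) (g : H) :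
    Tendsto (fun n => ⟪g, u n⟫_ℂ) l (𝓝 ⟪g, v⟫_ℂ) := by
  have hspan : ∀ g ∈ Submodule.span ℂ G, Tendsto (fun n => ⟪g, u n⟫_ℂ) l (𝓝 ⟪g, v⟫_ℂ) := by
    intro g hg
    induction hg using Submodule.span_induction with
    | mem x hx => exact h x hx
    | zero => simpa using tendsto_const_nhds
    | add x y _ _ hx hy => simpa [inner_add_left] using hx.add hy
    | smul a x _ hx => simpa [inner_smul_left, mul_comm] using hx.const_mul (conj a)
  rw [Metric.tendsto_nhds]
  intro ε hε
  set D := |C| + ‖v‖ + 1 with hD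
  have hDpos : 0 < D := by positivity
  obtain ⟨g', hg', hgg⟩ := Metric.mem_closure_iff.mp (hG g) (ε / (2 * D)) (by positivity)
  filter_upwards [hb, Metric.tendsto_nhds.mp (hspan g' hg') (ε / 2) (by positivity)] with n h1 h2
  rw [dist_eq_norm] at hgg h2 ⊢
  have e1 : ⟪g, u n⟫_ℂ - ⟪g, v⟫_ℂ = ⟪g - g', u n - v⟫_ℂ + (⟪g', u n⟫_ℂ - ⟪g', v⟫_ℂ) := by
    simp only [inner_sub_left, inner_sub_right]; ring
  rw [e1]
  have e2 : ‖⟪g - g', u n - v⟫_ℂ‖ ≤ ε / (2 * D) * D := by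
    refine (norm_inner_le_norm _ _).trans ?_
    gcongr
    refine (norm_sub_le _ _).trans ?_
    rw [hD]
    linarith [le_abs_self C]
  have e3 : ε / (2 * D) * D = ε / 2 := by field_simp
  calc _ ≤ _ := norm_add_le _ _
    _ < ε / 2 + ε / 2 := by linarith
    _ = ε := by ring

/-- Weak convergence and convergence of norms give strong convergence. -/
theorem tendsto_of_weak_of_norm {γ : Type*} {l : Filter γ} {u : γ → H} {v : H}
    (h : Tendsto (fun n => ⟪v, u n⟫_ℂ) l (𝓝 ⟪v, v⟫_ℂ))
    (hn : Tendsto (fun n => ‖u n‖) l (𝓝 ‖v‖)) : Tendsto u l (𝓝 v) := by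
  rw [tendsto_iff_norm_sub_tendsto_zero]
  have h1 : Tendsto (fun n => ‖u n - v‖ ^ 2) l (𝓝 0) := by
    have e : ∀ n, ‖u n - v‖ ^ 2 = ‖u n‖ ^ 2 - 2 * (⟪v, u n⟫_ℂ).re + ‖v‖ ^ 2 := fun n => by
      rw [@norm_sub_sq ℂ, ← inner_conj_symm, RCLike.conj_re]
      rfl
    simp_rw [e]
    have := ((hn.pow 2).sub (((Complex.continuous_re.tendsto _).comp h).const_mul 2)).add_const
      (‖v‖ ^ 2)
    refine this.trans (le_of_eq ?_)
    have e2 : (⟪v, v⟫_ℂ).re = ‖v‖ ^ 2 := inner_self_eq_norm_sq (𝕜 := ℂ) v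
    rw [e2]
    ring_nf
  have := (Real.continuous_sqrt.tendsto 0).comp h1
  simpa [Function.comp_def, Real.sqrt_sq (norm_nonneg _)] using this

/-- Positivity and the finite partial sums of the trace are closed conditions on matrix elements, so
they survive weak limits, as in Fatou's lemma. -/
theorem PosTrace.of_tendsto {γ : Type*} {l : Filter γ} [l.NeBot] {B : γ → H →L[ℂ] H} {M : ℝ}
    (hB : ∀ᶠ n in l, PosTrace (B n) M) {B' : H →L[ℂ] H}
    (h : ∀ f g, Tendsto (fun n => ⟪g, B n f⟫_ℂ) l (𝓝 ⟪g, B' f⟫_ℂ)) : PosTrace B' M := by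
  have hpos : 0 ≤ B' := by
    rw [ContinuousLinearMap.nonneg_iff_isPositive, ContinuousLinearMap.isPositive_iff_complex]
    intro x
    have hx : ∀ᶠ n in l, (((⟪x, B n x⟫_ℂ).re : ℝ) : ℂ) = ⟪x, B n x⟫_ℂ ∧
        0 ≤ (⟪x, B n x⟫_ℂ).re := by
      filter_upwards [hB] with n hn
      have e1 := inner_sqrt_sqrt hn.nonneg x x
      rw [inner_self_eq_norm_sq_to_K] at e1
      rw [← norm_sqrt_sq hn.nonneg, ← e1]
      exact ⟨by push_cast; rfl, by positivity⟩
    have hre := (Complex.continuous_re.tendsto _).comp (h x x)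
    have h1 : ((⟪x, B' x⟫_ℂ).re : ℂ) = ⟪x, B' x⟫_ℂ := by
      refine tendsto_nhds_unique ((Complex.continuous_ofReal.tendsto _).comp hre)
        ((h x x).congr' ?_)
      filter_upwards [hx] with n hn using hn.1.symm
    have h2 : 0 ≤ (⟪x, B' x⟫_ℂ).re := ge_of_tendsto hre (hx.mono fun n hn => hn.2)
    rw [← inner_conj_symm]
    simp only [RCLike.re_to_complex, Complex.conj_re]
    refine ⟨?_, h2⟩
    rw [← h1, Complex.conj_ofReal, Complex.ofReal_re]
  refine ⟨hpos, fun s => ?_⟩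
  have : Tendsto (fun n => ∑ e ∈ s, (⟪(e : H), B n e⟫_ℂ).re) l
      (𝓝 (∑ e ∈ s, (⟪(e : H), B' e⟫_ℂ).re)) :=
    tendsto_finsetSum s fun e _ => (Complex.continuous_re.tendsto _).comp (h e e)
  simp_rw [norm_sqrt_sq hpos]
  refine le_of_tendsto this ?_
  filter_upwards [hB] with n hn
  have := hn.sum_le s
  simp_rw [norm_sqrt_sq hn.nonneg] at this
  exact this

/-- Along an ultrafilter every bounded scalar family converges, so all matrix elements converge at
once without extracting subsequences. The limits form a bounded sesquilinear form, hence an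
operator. -/
theorem exists_weak_limit_ultrafilter {γ : Type*} (U : Ultrafilter γ) {B : γ → H →L[ℂ] H} {M : ℝ}
    (hB : ∀ᶠ n in U, PosTrace (B n) M) :
    ∃ B' : H →L[ℂ] H, ∀ f g, Tendsto (fun n => ⟪g, B n f⟫_ℂ) U (𝓝 ⟪g, B' f⟫_ℂ) := by
  have hlim : ∀ f g : H, ∃ c : ℂ, ‖c‖ ≤ M * ‖f‖ * ‖g‖ ∧
      Tendsto (fun n => ⟪g, B n f⟫_ℂ) U (𝓝 c) := fun f g => by
    obtain ⟨c, hc, hle⟩ := (isCompact_closedBall (0 : ℂ) (M * ‖f‖ * ‖g‖)).ultrafilter_le_nhds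
      (U.map fun n => ⟪g, B n f⟫_ℂ) (by
        rw [le_principal_iff]
        rw [Ultrafilter.mem_coe, Ultrafilter.mem_map, ← Ultrafilter.mem_coe]
        filter_upwards [hB] with n hn
        simpa using hn.norm_inner_le f g)
    exact ⟨c, by simpa using hc, hle⟩
  choose c hc hlim using hlim
  have uniq : ∀ {f g : H} {z : ℂ}, Tendsto (fun n => ⟪g, B n f⟫_ℂ) U (𝓝 z) → c f g = z :=
    fun h => tendsto_nhds_unique (hlim _ _) h
  let S : H →ₗ⋆[ℂ] H →ₗ[ℂ] ℂ := LinearMap.mk₂'ₛₗ (starRingEnd ℂ) (RingHom.id ℂ)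
    (fun g f => c f g)
    (fun g g' f => uniq (by simpa [inner_add_left] using (hlim f g).add (hlim f g')))
    (fun a g f => uniq (by simpa [inner_smul_left, mul_comm] using (hlim f g).const_mul (conj a)))
    (fun g f f' => uniq (by simpa [inner_add_right] using (hlim f g).add (hlim f' g)))
    (fun a g f => uniq (by simpa [inner_smul_right] using (hlim f g).const_mul a))
  let S' : H →L⋆[ℂ] H →L[ℂ] ℂ := S.mkContinuous₂ M fun g f => by
    have := hc f g
    calc ‖c f g‖ ≤ _ := this
      _ = _ := by ring
  refine ⟨ContinuousLinearMap.adjoint (InnerProductSpace.continuousLinearMapOfBilin S'),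
    fun f g => ?_⟩
  rw [ContinuousLinearMap.adjoint_inner_right,
    InnerProductSpace.continuousLinearMapOfBilin_apply]
  exact hlim f g

/-- Weak limits of `S Bₙ S`, where `S` is self-adjoint with dense range and `Bₙ ≥ 0` have bounded
traces. -/
theorem exists_weak_limit {γ : Type*} {l : Filter γ} [l.NeBot] {B : γ → H →L[ℂ] H} {M : ℝ}
    (hB : ∀ᶠ n in l, PosTrace (B n) M) {S A : H →L[ℂ] H}
    (hS : ContinuousLinearMap.adjoint S = S) (hd : DenseRange S)
    (h : ∀ f g, Tendsto (fun n => ⟪g, (S ∘L B n ∘L S) f⟫_ℂ) l (𝓝 ⟪g, A f⟫_ℂ)) :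
    ∃ B' : H →L[ℂ] H, PosTrace B' M ∧ A = S ∘L B' ∘L S ∧
      ∀ f g, Tendsto (fun n => ⟪g, B n f⟫_ℂ) l (𝓝 ⟪g, B' f⟫_ℂ) := by
  have hmove : ∀ (D : H →L[ℂ] H) f g, ⟪g, (S ∘L D ∘L S) f⟫_ℂ = ⟪S g, D (S f)⟫_ℂ := fun D f g => by
    conv_rhs => rw [← hS, ContinuousLinearMap.adjoint_inner_left, hS]
    rfl
  -- A limit along any finer ultrafilter is determined by `A` on the range of `S`. Density of that
  -- range makes all these limits equal, which is convergence along `l`.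
  have key : ∀ U : Ultrafilter γ, (U : Filter γ) ≤ l → ∃ B' : H →L[ℂ] H,
      (∀ f g, Tendsto (fun n => ⟪g, B n f⟫_ℂ) U (𝓝 ⟪g, B' f⟫_ℂ)) ∧
      ∀ f g, ⟪S g, B' (S f)⟫_ℂ = ⟪g, A f⟫_ℂ := fun U hU => by
    obtain ⟨B', hB'⟩ := exists_weak_limit_ultrafilter U (hB.filter_mono hU)
    refine ⟨B', hB', fun f g => tendsto_nhds_unique (hB' (S f) (S g)) ?_⟩
    have := (h f g).mono_left hU
    simp_rw [hmove] at this
    exact this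
  obtain ⟨B', hB', hA⟩ := key (Ultrafilter.of l) (Ultrafilter.of_le l)
  have hall : ∀ f g, Tendsto (fun n => ⟪g, B n f⟫_ℂ) l (𝓝 ⟪g, B' f⟫_ℂ) := fun f g => by
    rw [tendsto_iff_ultrafilter]
    intro U hU
    obtain ⟨B'', hB'', hA''⟩ := key U hU
    have : B' = B'' := by
      refine ContinuousLinearMap.ext fun f => ?_
      refine hd.induction_on (p := fun f => B' f = B'' f) f
        (isClosed_eq B'.continuous B''.continuous) fun f => ?_
      refine ext_inner_left ℂ fun g => ?_
      refine hd.induction_on (p := fun g => ⟪g, B' (S f)⟫_ℂ = ⟪g, B'' (S f)⟫_ℂ) g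
        (isClosed_eq (by fun_prop) (by fun_prop)) fun g => ?_
      rw [hA, hA'']
    rw [this]
    exact hB'' f g
  refine ⟨B', PosTrace.of_tendsto hB hall, ?_, hall⟩
  refine ContinuousLinearMap.ext fun f => ext_inner_left ℂ fun g => ?_
  rw [hmove, hA]

theorem isCompactOperator_rankOne (f g : H) :
    IsCompactOperator (InnerProductSpace.rankOne ℂ f g) := by
  rw [InnerProductSpace.rankOne_def']
  exact (isCompactOperator_of_locallyCompactSpace_rng
    (ContinuousLinearMap.toSpanSingleton ℂ f)).comp_clm (innerSL ℂ g)

theorem NuclearRep.trace_rankOne {ι : Type*} {A : H →L[ℂ] H} {x y : ι → H} (h : NuclearRep A x y)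
    (c : ℂ) (f g : H) : trace ((c • InnerProductSpace.rankOne ℂ f g) ∘L A) = c * ⟪g, A f⟫_ℂ := by
  refine (h.hasSum_trace _).unique (((h.hasSum f g).mul_left c).congr_fun fun i => ?_)
  simp

end WeakLimits

/-- Convergence against a dense family of observables is weak convergence, for bounded traces. -/
theorem IsObservableFamily.tendsto_inner {k : ℕ} {J : ℕ → Op k} (hJ : IsObservableFamily J)
    {γ : Type*} {l : Filter γ} {A : γ → Op k} {A' : Op k} {M M' : ℝ}
    (hA : ∀ᶠ n in l, NuclearBound (A n) M) (hA' : NuclearBound A' M')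
    (h : ∀ i, Tendsto (fun n => trace (J i ∘L (A n - A'))) l (𝓝 0)) (f g : L2 k) :
    Tendsto (fun n => ⟪g, A n f⟫_ℂ) l (𝓝 ⟪g, A' f⟫_ℂ) := by
  -- The factor `c` puts the rank-one observable into the unit ball, where the family is dense.
  set c : ℝ := (1 + ‖f‖ * ‖g‖)⁻¹ with hc
  have hcpos : 0 < c := by positivity
  set R : Op k := (c : ℂ) • InnerProductSpace.rankOne ℂ f g with hR
  have hRc : IsCompactOperator R := (isCompactOperator_rankOne f g).smul (c : ℂ)
  have hRn : ‖R‖ ≤ 1 := by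
    rw [hR, norm_smul, InnerProductSpace.norm_rankOne, Complex.norm_real, Real.norm_eq_abs,
      abs_of_pos hcpos, hc, inv_mul_le_iff₀ (by positivity)]
    linarith
  obtain ⟨x', y', hxy', hle'⟩ := id hA'
  suffices hs : Tendsto (fun n => (c : ℂ) * ⟪g, A n f⟫_ℂ) l (𝓝 ((c : ℂ) * ⟪g, A' f⟫_ℂ)) by
    have := hs.const_mul (c : ℂ)⁻¹
    have hc0 : (c : ℂ) ≠ 0 := by exact_mod_cast hcpos.ne'
    simpa [← mul_assoc, inv_mul_cancel₀ hc0] using this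
  rw [Metric.tendsto_nhds]
  intro ε hε
  have hM' := hA'.bound_nonneg
  set D := |M| + M' + 1 with hD
  have hDpos : 0 < D := by positivity
  obtain ⟨_, ⟨i, rfl⟩, hi⟩ := Metric.mem_closure_iff.mp (hJ.2 R hRc hRn) (ε / (2 * D))
    (by positivity)
  filter_upwards [hA, Metric.tendsto_nhds.mp (h i) (ε / 2) (by positivity)] with n hn h2
  obtain ⟨x, y, hxy, hle⟩ := id hn
  rw [dist_eq_norm] at hi h2 ⊢
  rw [← hxy.trace_rankOne, ← hxy'.trace_rankOne, ← hR]
  -- The first two terms are small uniformly in `n` because the nuclear norms are bounded; the last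
  -- tends to zero by hypothesis.
  have e1 : trace (R ∘L A n) - trace (R ∘L A')
      = trace ((R - J i) ∘L A n) - trace ((R - J i) ∘L A') + trace (J i ∘L (A n - A')) := by
    rw [hxy.trace_sub_left, hxy'.trace_sub_left, hxy.trace_comp_sub hxy']
    ring
  rw [e1]
  have b1 := hxy.norm_trace_le (R - J i)
  have b2 := hxy'.norm_trace_le (R - J i)
  have e3 : ε / (2 * D) * D = ε / 2 := by field_simp
  have b3 : ‖trace ((R - J i) ∘L A n)‖ + ‖trace ((R - J i) ∘L A')‖ ≤ ε / 2 := by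
    calc _ ≤ ‖R - J i‖ * |M| + ‖R - J i‖ * M' := by
          gcongr
          · exact b1.trans (by gcongr; exact hle.trans (le_abs_self M))
          · exact b2.trans (by gcongr)
      _ ≤ ‖R - J i‖ * D := by rw [hD]; nlinarith [norm_nonneg (R - J i)]
      _ ≤ ε / (2 * D) * D := by gcongr
      _ = ε / 2 := e3
  calc _ ≤ _ := norm_add_le _ _
    _ ≤ (‖trace ((R - J i) ∘L A n)‖ + ‖trace ((R - J i) ∘L A')‖)
        + ‖trace (J i ∘L (A n - A'))‖ := by gcongr; exact norm_sub_le _ _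
    _ < ε / 2 + ε / 2 := by rw [sub_zero] at h2; linarith
    _ = ε := by ring

/-- One summand is at most the whole series, so undoing its weight isolates a single observable. -/
theorem tendsto_trace_of_weakDist {k : ℕ} {J : ℕ → Op k} {γ : Type*} {l : Filter γ}
    {A : γ → Op k} {A' : Op k} (h : Tendsto (fun n => weakDist J (A n) A') l (𝓝 0)) (i : ℕ) :
    Tendsto (fun n => trace (J i ∘L (A n - A'))) l (𝓝 0) := by
  have h1 : ∀ n, ‖trace (J i ∘L (A n - A'))‖ₑ ≤ (2 : ℝ≥0∞) ^ (i + 1) * weakDist J (A n) A' :=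
    fun n => by
      have := ENNReal.le_tsum (f := fun i => (2⁻¹ : ℝ≥0∞) ^ (i + 1) *
        ‖trace (J i ∘L (A n - A'))‖ₑ) i
      calc _ = (2 : ℝ≥0∞) ^ (i + 1) * ((2⁻¹ : ℝ≥0∞) ^ (i + 1) *
            ‖trace (J i ∘L (A n - A'))‖ₑ) := by
            rw [← mul_assoc, ← mul_pow, ENNReal.mul_inv_cancel (by simp) (by simp), one_pow,
              one_mul]
        _ ≤ _ := by gcongr; exact this
  rw [tendsto_zero_iff_enorm_tendsto_zero]
  refine tendsto_of_tendsto_of_tendsto_of_le_of_le tendsto_const_nhds ?_ (fun _ => zero_le) h1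
  have := ENNReal.Tendsto.const_mul (a := (2 : ℝ≥0∞) ^ (i + 1)) h (Or.inr (by simp))
  simpa using this

/-! ### Tensor products in `L²` of a split measure space -/

instance : Fact ((2 : ℝ≥0∞) ≠ ⊤) := ⟨by simp⟩

/-- `L²(X; ℂ)`. -/
abbrev LL (X : Type*) [MeasureSpace X] : Type _ := Lp ℂ 2 (volume : Measure X)

section Basics

variable {X : Type*} [MeasureSpace X]

theorem inner_eq_integral (f g : LL X) : ⟪f, g⟫_ℂ = ∫ x, conj (f x) * g x := by
  rw [L2.inner_def]
  refine integral_congr_ae (ae_of_all _ fun x => ?_)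
  simp [mul_comm]

theorem integrable_conj_mul {f g : X → ℂ} (hf : MemLp f 2 volume) (hg : MemLp g 2 volume) :
    Integrable (fun x => conj (f x) * g x) :=
  MemLp.integrable_mul hf.star hg

theorem lintegral_enorm_sq (f : LL X) : ∫⁻ x, ‖f x‖ₑ ^ 2 = ENNReal.ofReal (‖f‖ ^ 2) := by
  have h : ‖f‖ ^ 2 = ∫ x, ‖f x‖ ^ 2 := by
    have e := inner_self_eq_norm_sq (𝕜 := ℂ) f
    rw [← e, inner_eq_integral]
    have : ∀ x, conj (f x) * f x = ((‖f x‖ ^ 2 : ℝ) : ℂ) := fun x => by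
      rw [mul_comm, Complex.mul_conj, Complex.normSq_eq_norm_sq]
    simp_rw [this]
    rw [integral_complex_ofReal]
    simp
  rw [h, ofReal_integral_eq_lintegral_ofReal
    ((memLp_two_iff_integrable_sq_norm (Lp.aestronglyMeasurable f)).mp (Lp.memLp f))
    (ae_of_all _ fun x => by positivity)]
  refine lintegral_congr fun x => ?_
  rw [ENNReal.ofReal_pow (norm_nonneg _), ofReal_norm]

/-- Multiplication by a bounded function. -/
def mulL (v : X → ℂ) (hv : MemLp v ∞ volume) : LL X →L[ℂ] LL X :=
  (ContinuousLinearMap.mul ℂ ℂ).holderL volume ∞ 2 2 (hv.toLp v)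

theorem mulL_coe (v : X → ℂ) (hv : MemLp v ∞ volume) (f : LL X) :
    mulL v hv f =ᵐ[volume] fun x => v x * f x := by
  filter_upwards [ContinuousLinearMap.coeFn_holder (r := 2) (ContinuousLinearMap.mul ℂ ℂ)
    (hv.toLp v) f, hv.coeFn_toLp] with x h1 h2
  change (ContinuousLinearMap.holder 2 (ContinuousLinearMap.mul ℂ ℂ) (hv.toLp v) f) x = _
  rw [h1, h2]
  rfl

theorem adjoint_mulL (v : X → ℂ) (hv : MemLp v ∞ volume) :
    ContinuousLinearMap.adjoint (mulL v hv) = mulL (fun x => conj (v x)) hv.star := by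
  symm
  rw [ContinuousLinearMap.eq_adjoint_iff]
  intro f g
  rw [inner_eq_integral, inner_eq_integral]
  refine integral_congr_ae ?_
  have h0 : mulL (fun x => conj (v x)) hv.star f =ᵐ[volume] fun x => conj (v x) * f x :=
    mulL_coe _ _ f
  filter_upwards [mulL_coe v hv g, h0] with x h1 h2
  rw [h1, h2]
  simp
  ring

theorem norm_mulL_apply_le (v : X → ℂ) (hv : MemLp v ∞ volume) {C : ℝ} (hC : ∀ x, ‖v x‖ ≤ C)
    (f : LL X) : ‖mulL v hv f‖ ≤ C * ‖f‖ := by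
  refine Lp.norm_le_mul_norm_of_ae_le_mul ?_
  filter_upwards [mulL_coe v hv f] with x h
  rw [h, norm_mul]
  gcongr
  exact hC x

end Basics

/-- A measure preserving identification `X ≃ α × β`. -/
structure Split (X α β : Type*) [MeasureSpace X] [MeasureSpace α] [MeasureSpace β] where
  toEquiv : X ≃ᵐ α × β
  mp : MeasurePreserving toEquiv volume volume

namespace Split

variable {X Y Z α β γ : Type*} [MeasureSpace X] [MeasureSpace Y] [MeasureSpace Z] [MeasureSpace α]
  [MeasureSpace β] [MeasureSpace γ] [SigmaFinite (volume : Measure α)]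
  [SigmaFinite (volume : Measure β)] [SigmaFinite (volume : Measure γ)]

/-- Exchange the two factors. -/
def swap (p : Split X α β) : Split X β α where
  toEquiv := p.toEquiv.trans MeasurableEquiv.prodComm
  mp := (Measure.measurePreserving_swap).comp p.mp

theorem swap_symm_apply (p : Split X α β) (z : β × α) :
    p.swap.toEquiv.symm z = p.toEquiv.symm (z.2, z.1) := rfl

theorem mp_symm (p : Split X α β) : MeasurePreserving p.toEquiv.symm volume volume :=
  p.mp.symm p.toEquiv

theorem ae_fst (p : Split X α β) {P : α → Prop} (h : ∀ᵐ a, P a) : ∀ᵐ x, P (p.toEquiv x).1 :=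
  p.mp.quasiMeasurePreserving.ae (Measure.quasiMeasurePreserving_fst.ae h)

theorem ae_snd (p : Split X α β) {P : β → Prop} (h : ∀ᵐ a, P a) : ∀ᵐ x, P (p.toEquiv x).2 :=
  p.mp.quasiMeasurePreserving.ae (Measure.quasiMeasurePreserving_snd.ae h)

theorem integral_eq (p : Split X α β) (F : X → ℂ) :
    ∫ x, F x = ∫ z : α × β, F (p.toEquiv.symm z) := by
  have := p.mp.integral_comp p.toEquiv.measurableEmbedding (fun z => F (p.toEquiv.symm z))
  simpa using this

theorem lintegral_eq (p : Split X α β) (F : X → ℝ≥0∞) :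
    ∫⁻ x, F x = ∫⁻ z : α × β, F (p.toEquiv.symm z) := by
  have := p.mp.lintegral_comp_emb p.toEquiv.measurableEmbedding (fun z => F (p.toEquiv.symm z))
  simpa using this

theorem integrable_comp_symm (p : Split X α β) {F : X → ℂ} :
    Integrable (fun z : α × β => F (p.toEquiv.symm z)) ↔ Integrable F :=
  p.mp_symm.integrable_comp_emb p.toEquiv.symm.measurableEmbedding

theorem memLp_tensor (p : Split X α β) (f : LL α) (φ : LL β) :
    MemLp (fun x => f (p.toEquiv x).1 * φ (p.toEquiv x).2) 2 volume := by
  have h : MemLp (fun z : α × β => f z.1 * φ z.2) 2 volume := by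
    have hm : AEStronglyMeasurable (fun z : α × β => f z.1 * φ z.2) volume :=
      (Lp.aestronglyMeasurable f).comp_fst.mul (Lp.aestronglyMeasurable φ).comp_snd
    rw [memLp_two_iff_integrable_sq_norm hm]
    have h1 := (memLp_two_iff_integrable_sq_norm (Lp.aestronglyMeasurable f)).mp (Lp.memLp f)
    have h2 := (memLp_two_iff_integrable_sq_norm (Lp.aestronglyMeasurable φ)).mp (Lp.memLp φ)
    refine (h1.mul_prod h2).congr (ae_of_all _ fun z => ?_)
    simp [mul_pow]
  exact h.comp_measurePreserving p.mp

/-- `f ⊗ φ`. -/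
def tensor (p : Split X α β) (f : LL α) (φ : LL β) : LL X := (p.memLp_tensor f φ).toLp _

theorem tensor_coe (p : Split X α β) (f : LL α) (φ : LL β) :
    p.tensor f φ =ᵐ[volume] fun x => f (p.toEquiv x).1 * φ (p.toEquiv x).2 :=
  MemLp.coeFn_toLp _

theorem tensor_add_right (p : Split X α β) (f : LL α) (φ φ' : LL β) :
    p.tensor f (φ + φ') = p.tensor f φ + p.tensor f φ' := by
  refine Lp.ext ?_
  filter_upwards [p.tensor_coe f (φ + φ'), p.tensor_coe f φ, p.tensor_coe f φ',
    Lp.coeFn_add (p.tensor f φ) (p.tensor f φ'), p.ae_snd (Lp.coeFn_add φ φ')] with x h1 h2 h3 h4 h5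
  rw [h1, h4, Pi.add_apply, h2, h3, h5, Pi.add_apply, mul_add]

theorem tensor_smul_right (p : Split X α β) (f : LL α) (c : ℂ) (φ : LL β) :
    p.tensor f (c • φ) = c • p.tensor f φ := by
  refine Lp.ext ?_
  filter_upwards [p.tensor_coe f (c • φ), p.tensor_coe f φ,
    Lp.coeFn_smul c (p.tensor f φ), p.ae_snd (Lp.coeFn_smul c φ)] with x h1 h2 h3 h4
  rw [h1, h3, Pi.smul_apply, h2, h4, Pi.smul_apply, smul_eq_mul, smul_eq_mul]
  ring

theorem inner_tensor (p : Split X α β) (f f' : LL α) (φ φ' : LL β) :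
    ⟪p.tensor f φ, p.tensor f' φ'⟫_ℂ = ⟪f, f'⟫_ℂ * ⟪φ, φ'⟫_ℂ := by
  simp_rw [inner_eq_integral]
  rw [← integral_prod_mul]
  have e := p.mp.integral_comp p.toEquiv.measurableEmbedding
    (fun z : α × β => conj (f z.1) * f' z.1 * (conj (φ z.2) * φ' z.2))
  rw [show (volume : Measure (α × β)) = (volume : Measure α).prod (volume : Measure β) from rfl]
    at e
  rw [← e]
  refine integral_congr_ae ?_
  filter_upwards [p.tensor_coe f φ, p.tensor_coe f' φ'] with x h1 h2
  rw [h1, h2]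
  simp
  ring

theorem norm_tensor (p : Split X α β) (f : LL α) (φ : LL β) : ‖p.tensor f φ‖ = ‖f‖ * ‖φ‖ := by
  have h := p.inner_tensor f f φ φ
  simp only [inner_self_eq_norm_sq_to_K] at h
  have h2 : ‖p.tensor f φ‖ ^ 2 = (‖f‖ * ‖φ‖) ^ 2 := by
    rw [mul_pow]
    exact_mod_cast h
  exact (sq_eq_sq₀ (norm_nonneg _) (by positivity)).mp h2

/-- The operator `φ ↦ f ⊗ φ`. -/
def T (p : Split X α β) (f : LL α) : LL β →L[ℂ] LL X :=
  LinearMap.mkContinuous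
    { toFun := p.tensor f
      map_add' := p.tensor_add_right f
      map_smul' := p.tensor_smul_right f } ‖f‖ fun φ => (p.norm_tensor f φ).le

theorem T_coe (p : Split X α β) (f : LL α) (φ : LL β) :
    p.T f φ =ᵐ[volume] fun x => f (p.toEquiv x).1 * φ (p.toEquiv x).2 := p.tensor_coe f φ

theorem inner_T_T (p : Split X α β) (f f' : LL α) (φ φ' : LL β) :
    ⟪p.T f φ, p.T f' φ'⟫_ℂ = ⟪f, f'⟫_ℂ * ⟪φ, φ'⟫_ℂ := p.inner_tensor f f' φ φ'

theorem norm_T_apply (p : Split X α β) (f : LL α) (φ : LL β) : ‖p.T f φ‖ = ‖f‖ * ‖φ‖ :=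
  p.norm_tensor f φ

/-- The partial inner product `⟨f, ψ⟩_α`, adjoint of `φ ↦ f ⊗ φ`. -/
def C (p : Split X α β) (f : LL α) : LL X →L[ℂ] LL β := ContinuousLinearMap.adjoint (p.T f)

theorem inner_C (p : Split X α β) (f : LL α) (φ : LL β) (ψ : LL X) :
    ⟪φ, p.C f ψ⟫_ℂ = ⟪p.T f φ, ψ⟫_ℂ := ContinuousLinearMap.adjoint_inner_right _ _ _

theorem norm_C_apply_le (p : Split X α β) (f : LL α) (ψ : LL X) : ‖p.C f ψ‖ ≤ ‖f‖ * ‖ψ‖ := by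
  refine (ContinuousLinearMap.le_opNorm _ _).trans ?_
  gcongr
  rw [C, LinearIsometryEquiv.norm_map]
  exact LinearMap.mkContinuous_norm_le _ (norm_nonneg _) _

theorem C_T (p : Split X α β) (f f' : LL α) (φ : LL β) :
    p.C f (p.T f' φ) = ⟪f, f'⟫_ℂ • φ := by
  refine ext_inner_left ℂ fun φ' => ?_
  rw [inner_C, inner_T_T, inner_smul_right]

theorem swap_T (p : Split X α β) (f : LL α) (φ : LL β) : p.swap.T φ f = p.T f φ := by
  refine Lp.ext ?_
  filter_upwards [p.T_coe f φ, p.swap.T_coe φ f] with x h1 h2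
  rw [h1, h2, mul_comm]
  rfl

/-- Both sides pair ψ with f ⊗ φ; this trades one contracted factor for the other. -/
theorem inner_swap_C (p : Split X α β) (f : LL α) (φ : LL β) (ψ : LL X) :
    ⟪f, p.swap.C φ ψ⟫_ℂ = ⟪φ, p.C f ψ⟫_ℂ := by
  rw [inner_C, inner_C, swap_T]

theorem integrable_tensor_mul (p : Split X α β) (f : LL α) (φ : LL β) (ψ : LL X) :
    Integrable (fun z : β × α => conj (φ z.1) * (conj (f z.2) * ψ (p.toEquiv.symm (z.2, z.1)))) := by
  have h0 : Integrable (fun x => conj (p.T f φ x) * ψ x) :=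
    integrable_conj_mul (Lp.memLp _) (Lp.memLp _)
  have h1 : Integrable (fun x =>
      conj (φ (p.toEquiv x).2) * (conj (f (p.toEquiv x).1) * ψ x)) := by
    refine h0.congr ?_
    filter_upwards [p.T_coe f φ] with x h
    rw [h]
    simp
    ring
  rw [← p.swap.integrable_comp_symm] at h1
  refine h1.congr (ae_of_all _ fun z => ?_)
  simp [swap_symm_apply]

/-- The abstract adjoint is the expected fiber integral: testing on indicators and Fubini show that
both functions have the same integral over every set of finite measure. -/
theorem C_coe (p : Split X α β) (f : LL α) (ψ : LL X) :
    p.C f ψ =ᵐ[volume] fun z => ∫ a, conj (f a) * ψ (p.toEquiv.symm (a, z)) := by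
  have hint : ∀ s : Set β, MeasurableSet s → volume s < ∞ →
      IntegrableOn (fun z => ∫ a, conj (f a) * ψ (p.toEquiv.symm (a, z))) s ∧
      ∫ z in s, p.C f ψ z = ∫ z in s, ∫ a, conj (f a) * ψ (p.toEquiv.symm (a, z)) := by
    intro s hs hμ
    set φ : LL β := indicatorConstLp 2 hs hμ.ne (1 : ℂ) with hφ
    have hφc : φ =ᵐ[volume] s.indicator fun _ => (1 : ℂ) := indicatorConstLp_coeFn
    have h1 := (p.integrable_tensor_mul f φ ψ).integral_prod_left
    simp_rw [integral_const_mul] at h1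
    have h2 : (fun z => conj (φ z) * ∫ a, conj (f a) * ψ (p.toEquiv.symm (a, z))) =ᵐ[volume]
        s.indicator fun z => ∫ a, conj (f a) * ψ (p.toEquiv.symm (a, z)) := by
      filter_upwards [hφc] with z hz
      rw [hz]
      by_cases hzs : z ∈ s <;> simp [hzs]
    refine ⟨(integrable_indicator_iff hs).mp (h1.congr h2), ?_⟩
    have h3 : ⟪φ, p.C f ψ⟫_ℂ = ∫ z in s, p.C f ψ z := L2.inner_indicatorConstLp_one hs hμ.ne _
    rw [← h3, inner_C, ← integral_indicator hs, ← integral_congr_ae h2, inner_eq_integral]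
    have h4 : ∫ x, conj (p.T f φ x) * ψ x
        = ∫ x, conj (φ (p.toEquiv x).2) * (conj (f (p.toEquiv x).1) * ψ x) := by
      refine integral_congr_ae ?_
      filter_upwards [p.T_coe f φ] with x h
      rw [h]
      simp
      ring
    rw [h4, p.swap.integral_eq]
    have h5 := integral_prod _ (p.integrable_tensor_mul f φ ψ)
    simp_rw [integral_const_mul] at h5
    rw [← h5]
    refine integral_congr_ae (ae_of_all _ fun z => ?_)
    simp [swap_symm_apply]
  refine ae_eq_of_forall_setIntegral_eq_of_sigmaFinite (fun s hs hμ => ?_)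
    (fun s hs hμ => (hint s hs hμ).1) fun s hs hμ => (hint s hs hμ).2
  have : Fact (volume s < ∞) := ⟨hμ⟩
  exact ((Lp.memLp (p.C f ψ)).restrict s).integrable (by norm_num)

/-- Parseval for the partial coefficients in a Hilbert basis of the second factor. -/
theorem hasSum_norm_sq_C {κ : Type*} [Countable κ] (p : Split X α β) (b : HilbertBasis κ ℂ (LL β))
    (ψ : LL X) : HasSum (fun n => ‖p.swap.C (b n) ψ‖ ^ 2) (‖ψ‖ ^ 2) := by
  -- Parseval holds on almost every fiber and is integrated over the other variable by Tonelli. In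
  -- `ℝ≥0∞` this needs no prior summability, which is read off afterwards.
  have key : ∑' n, ENNReal.ofReal (‖p.swap.C (b n) ψ‖ ^ 2) = ENNReal.ofReal (‖ψ‖ ^ 2) := by
    simp_rw [← lintegral_enorm_sq]
    rw [p.lintegral_eq]
    have hmeas : AEStronglyMeasurable (fun z : α × β => ψ (p.toEquiv.symm z)) volume :=
      (Lp.aestronglyMeasurable ψ).comp_measurePreserving p.mp_symm
    rw [show (volume : Measure (α × β)) = (volume : Measure α).prod (volume : Measure β) from rfl,
      lintegral_prod _ (hmeas.enorm.pow_const 2),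
      ← lintegral_tsum fun n => ((Lp.aestronglyMeasurable _).enorm.pow_const 2)]
    have hfin : ∀ᵐ a : α, MemLp (fun z => ψ (p.toEquiv.symm (a, z))) 2 volume := by
      have hi : Integrable (fun z : α × β => ‖ψ (p.toEquiv.symm z)‖ ^ 2) :=
        (memLp_two_iff_integrable_sq_norm hmeas).mp
          ((Lp.memLp ψ).comp_measurePreserving p.mp_symm)
      filter_upwards [hi.prod_right_ae, hmeas.prodMk_left] with a h1 h2
      exact (memLp_two_iff_integrable_sq_norm h2).mpr h1
    refine lintegral_congr_ae ?_
    -- Countability of the basis puts the fiber formulas for all coefficients on one set of full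
    -- measure.
    have hC : ∀ᵐ a : α, ∀ n, p.swap.C (b n) ψ a
        = ∫ z, conj (b n z) * ψ (p.toEquiv.symm (a, z)) := by
      rw [ae_all_iff]
      intro n
      filter_upwards [p.swap.C_coe (b n) ψ] with a h
      rw [h]
      rfl
    filter_upwards [hfin, hC] with a ha hCa
    set v : LL β := ha.toLp _ with hv
    have hvc := ha.coeFn_toLp
    have e1 : ∫⁻ z, ‖ψ (p.toEquiv.symm (a, z))‖ₑ ^ 2 = ENNReal.ofReal (‖v‖ ^ 2) := by
      rw [← lintegral_enorm_sq]
      refine lintegral_congr_ae ?_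
      filter_upwards [hvc] with z hz
      rw [← hz]
    have e2 : ∀ n, ‖p.swap.C (b n) ψ a‖ₑ ^ 2 = ENNReal.ofReal (‖⟪b n, v⟫_ℂ‖ ^ 2) := fun n => by
      rw [hCa, inner_eq_integral, ENNReal.ofReal_pow (norm_nonneg _), ofReal_norm]
      congr 2
      refine integral_congr_ae ?_
      filter_upwards [hvc] with z hz
      rw [← hz]
    simp_rw [e2]
    rw [e1]
    have hs : HasSum (fun n => ‖⟪b n, v⟫_ℂ‖ ^ 2) (‖v‖ ^ 2) := by
      have h := b.hasSum_inner_mul_inner v v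
      rw [inner_self_eq_norm_sq_to_K] at h
      rw [← Complex.hasSum_ofReal]
      push_cast
      refine h.congr_fun fun n => ?_
      rw [← inner_conj_symm v (b n), mul_comm, Complex.mul_conj, Complex.normSq_eq_norm_sq]
      push_cast
      rfl
    rw [← hs.tsum_eq, ENNReal.ofReal_tsum_of_nonneg (fun _ => by positivity) hs.summable]
  have hsum : Summable fun n => ‖p.swap.C (b n) ψ‖ ^ 2 := by
    have h := ENNReal.summable_toReal (f := fun n => ENNReal.ofReal (‖p.swap.C (b n) ψ‖ ^ 2))
      (by rw [key]; exact ENNReal.ofReal_ne_top)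
    exact h.congr fun n => ENNReal.toReal_ofReal (by positivity)
  rw [← ENNReal.ofReal_tsum_of_nonneg (fun _ => by positivity) hsum,
    ENNReal.ofReal_eq_ofReal_iff (tsum_nonneg fun _ => by positivity) (by positivity)] at key
  rw [← key]
  exact hsum.hasSum

/-- Polarization of the Parseval identity for the norms. -/
theorem hasSum_inner_C {κ : Type*} [Countable κ] (p : Split X α β) (b : HilbertBasis κ ℂ (LL β))
    (ψ ψ' : LL X) :
    HasSum (fun n => ⟪p.swap.C (b n) ψ, p.swap.C (b n) ψ'⟫_ℂ) ⟪ψ, ψ'⟫_ℂ := by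
  have h : ∀ χ : LL X, HasSum (fun n => ((‖p.swap.C (b n) χ‖ : ℂ)) ^ 2) ((‖χ‖ : ℂ) ^ 2) :=
    fun χ => by exact_mod_cast Complex.hasSum_ofReal.mpr (p.hasSum_norm_sq_C b χ)
  have key := (((h (ψ + ψ')).sub (h (ψ - ψ'))).add
    (((h (ψ - Complex.I • ψ')).sub (h (ψ + Complex.I • ψ'))).mul_right Complex.I)).div_const 4
  have e := inner_eq_sum_norm_sq_div_four (𝕜 := ℂ) ψ ψ'
  rw [show (RCLike.I : ℂ) = Complex.I from rfl] at e
  refine HasSum.congr_fun (e ▸ key) fun n => ?_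
  have e' := inner_eq_sum_norm_sq_div_four (𝕜 := ℂ) (p.swap.C (b n) ψ) (p.swap.C (b n) ψ')
  rw [show (RCLike.I : ℂ) = Complex.I from rfl] at e'
  simp only [map_add, map_sub, map_smul]
  exact e'

end Split

/-! ### Countability of orthonormal families in separable spaces -/

section Separable

variable {H : Type*} [NormedAddCommGroup H] [InnerProductSpace ℂ H] [CompleteSpace H]

/-- Distinct orthonormal vectors are at distance √2, so their range is discrete, and a discrete
subspace of a second countable space is countable. -/
theorem _root_.Orthonormal.countable_index [SecondCountableTopology H] {κ : Type*} {v : κ → H}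
    (hv : Orthonormal ℂ v) : Countable κ := by
  have hinj : Function.Injective v := hv.linearIndependent.injective
  have hd : DiscreteTopology (Set.range v) := by
    refine DiscreteTopology.of_forall_le_dist one_pos ?_
    rintro ⟨_, i, rfl⟩ ⟨_, j, rfl⟩ hij
    have hne : i ≠ j := fun h => hij (by simp [h])
    have h1 : ‖v i - v j‖ ^ 2 = 2 := by
      rw [@norm_sub_sq ℂ, hv.2 hne, hv.1 i, hv.1 j]
      norm_num
    change 1 ≤ dist (v i) (v j)
    rw [dist_eq_norm]
    nlinarith [norm_nonneg (v i - v j)]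
  have hc : Countable (Set.range v) := countable_of_Lindelof_of_discrete
  exact (Set.rangeFactorization_injective.mpr hinj).countable

instance [SecondCountableTopology H] : Countable (onb H) :=
  (onbBasis H).orthonormal.countable_index

end Separable

/-! ### Totality of pure tensors, compatible splittings and partial traces -/

namespace Split

variable {X Y Z α β γ : Type*} [MeasureSpace X] [MeasureSpace Y] [MeasureSpace Z] [MeasureSpace α]
  [MeasureSpace β] [MeasureSpace γ] [SigmaFinite (volume : Measure α)]
  [SigmaFinite (volume : Measure β)] [SigmaFinite (volume : Measure γ)]
  [SigmaFinite (volume : Measure Y)] [SigmaFinite (volume : Measure Z)]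

/-- A function orthogonal to all pure tensors vanishes. -/
theorem eq_zero_of_C [SecondCountableTopology (LL β)] (p : Split X α β) {ψ : LL X}
    (h : ∀ φ : LL β, p.swap.C φ ψ = 0) : ψ = 0 := by
  have := p.hasSum_norm_sq_C (onbBasis (LL β)) ψ
  simp only [h, norm_zero] at this
  have h2 : ‖ψ‖ ^ 2 = 0 := this.unique (by
    simpa using (hasSum_zero : HasSum (fun _ : onb (LL β) => (0 : ℝ)) 0))
  simpa using h2

theorem ext_tensor [SecondCountableTopology (LL β)] (p : Split X α β) {ψ ψ' : LL X}
    (h : ∀ (f : LL α) (φ : LL β), ⟪p.T f φ, ψ⟫_ℂ = ⟪p.T f φ, ψ'⟫_ℂ) : ψ = ψ' := by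
  rw [← sub_eq_zero]
  refine p.eq_zero_of_C fun φ => ext_inner_left ℂ fun f => ?_
  rw [inner_swap_C, inner_C, inner_sub_right, h, sub_self, inner_zero_right]

/-- Two ways of splitting off both `α` and `β` from `X ≃ α × β × γ`. -/
structure Compat (p₁ : Split X α Y) (q₁ : Split Y β γ) (p₂ : Split X β Z) (q₂ : Split Z α γ) :
    Prop where
  fst : ∀ x, (p₁.toEquiv x).1 = (q₂.toEquiv (p₂.toEquiv x).2).1
  mid : ∀ x, (q₁.toEquiv (p₁.toEquiv x).2).1 = (p₂.toEquiv x).1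
  snd : ∀ x, (q₁.toEquiv (p₁.toEquiv x).2).2 = (q₂.toEquiv (p₂.toEquiv x).2).2

namespace Compat

variable {p₁ : Split X α Y} {q₁ : Split Y β γ} {p₂ : Split X β Z} {q₂ : Split Z α γ}

theorem T_T (h : Compat p₁ q₁ p₂ q₂) (f : LL α) (b : LL β) (c : LL γ) :
    p₁.T f (q₁.T b c) = p₂.T b (q₂.T f c) := by
  refine Lp.ext ?_
  filter_upwards [p₁.T_coe f (q₁.T b c), p₂.T_coe b (q₂.T f c), p₁.ae_snd (q₁.T_coe b c),
    p₂.ae_snd (q₂.T_coe f c)] with x h1 h2 h3 h4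
  rw [h1, h2, h3, h4, h.fst, h.mid, h.snd]
  ring

theorem C_C (h : Compat p₁ q₁ p₂ q₂) (f : LL α) (b : LL β) (ψ : LL X) :
    q₁.C b (p₁.C f ψ) = q₂.C f (p₂.C b ψ) := by
  refine ext_inner_left ℂ fun c => ?_
  simp_rw [inner_C]
  rw [h.T_T]

/-- Contracting one group of variables and tensoring with another commute; it suffices to test on
pure tensors, which are total. -/
theorem C_T [SecondCountableTopology (LL γ)] (h : Compat p₁ q₁ p₂ q₂) (f : LL α) (b : LL β)
    (ξ : LL Z) : p₁.C f (p₂.T b ξ) = q₁.T b (q₂.C f ξ) := by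
  refine q₁.ext_tensor fun b' c => ?_
  rw [inner_C, h.T_T, inner_T_T, inner_T_T, inner_C]

end Compat

/-- The expectation of an observable of the first factor. -/
theorem hasSum_partialTrace [SecondCountableTopology (LL β)] (p : Split X α β)
    {Y : LL α →L[ℂ] LL α} {ψ ψ' : LL X} (h : ∀ b, p.swap.C b ψ' = Y (p.swap.C b ψ)) :
    HasSum (fun e : onb (LL β) => ⟪p.swap.C e ψ, Y (p.swap.C e ψ)⟫_ℂ) ⟪ψ, ψ'⟫_ℂ := by
  have := p.hasSum_inner_C (onbBasis (LL β)) ψ ψ'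
  simp_rw [onbBasis_apply] at this
  refine this.congr_fun fun e => ?_
  rw [h]

theorem summable_norm_sq_C [SecondCountableTopology (LL β)] (p : Split X α β) (ψ : LL X) :
    HasSum (fun e : onb (LL β) => ‖p.swap.C e ψ‖ ^ 2) (‖ψ‖ ^ 2) := by
  have := p.hasSum_norm_sq_C (onbBasis (LL β)) ψ
  simp_rw [onbBasis_apply] at this
  exact this

/-- The reduced density operator as a sum of projections. -/
theorem nuclearRep_of_inner_C [SecondCountableTopology (LL β)] (p : Split X α β) (ψ : LL X)
    {A : LL α →L[ℂ] LL α} (hA : ∀ f g, ⟪g, A f⟫_ℂ = ⟪p.C f ψ, p.C g ψ⟫_ℂ) :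
    NuclearRep A (fun e : onb (LL β) => p.swap.C e ψ) (fun e : onb (LL β) => p.swap.C e ψ) := by
  refine ⟨by simpa [pow_two] using (p.summable_norm_sq_C ψ).summable, fun f g => ?_⟩
  rw [hA]
  have := (onbBasis (LL β)).hasSum_inner_mul_inner (p.C f ψ) (p.C g ψ)
  refine this.congr_fun fun e => ?_
  rw [onbBasis_apply, inner_swap_C, ← inner_conj_symm _ f, inner_swap_C, inner_conj_symm, mul_comm]

theorem C_mulL (p : Split X α β) {v : X → ℂ} {hv : MemLp v ∞ volume} {w : β → ℂ}
    {hw : MemLp w ∞ volume} (h : ∀ x, v x = w (p.toEquiv x).2) (f : LL α) (ψ : LL X) :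
    p.C f (mulL v hv ψ) = mulL w hw (p.C f ψ) := by
  refine ext_inner_left ℂ fun φ => ?_
  rw [inner_C, ← ContinuousLinearMap.adjoint_inner_left, adjoint_mulL,
    ← ContinuousLinearMap.adjoint_inner_left (mulL w hw), adjoint_mulL, inner_C]
  congr 1
  refine Lp.ext ?_
  have h0 := mulL_coe (fun x => conj (v x)) hv.star (p.T f φ)
  have h1 := mulL_coe (fun x => conj (w x)) hw.star φ
  filter_upwards [h0, p.T_coe f φ, p.T_coe f (mulL (fun x => conj (w x)) hw.star φ),
    p.ae_snd h1] with x h2 h3 h4 h5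
  rw [h2, h3, h4, h5, h]
  ring

end Split

/-! ### Hilbert–Schmidt operators -/

section HilbertSchmidt

variable {H : Type*} [NormedAddCommGroup H] [InnerProductSpace ℂ H] [CompleteSpace H]

/-- The squared Hilbert–Schmidt norm is at most `M`. -/
def HSBound (A : H →L[ℂ] H) (M : ℝ) : Prop :=
  ∀ (n : ℕ) (v : Fin n → H), Orthonormal ℂ v → ∑ i, ‖A (v i)‖ ^ 2 ≤ M

theorem HSBound.bound_nonneg {A : H →L[ℂ] H} {M : ℝ} (h : HSBound A M) : 0 ≤ M := by
  simpa using h 0 Fin.elim0 ⟨fun i => i.elim0, fun i => i.elim0⟩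

theorem HSBound.sum_le {A : H →L[ℂ] H} {M : ℝ} (h : HSBound A M) {κ : Type*} {v : κ → H}
    (hv : Orthonormal ℂ v) (s : Finset κ) : ∑ i ∈ s, ‖A (v i)‖ ^ 2 ≤ M := by
  have := h s.card (fun i => v (s.equivFin.symm i))
    (hv.comp _ (Subtype.val_injective.comp s.equivFin.symm.injective))
  rw [Equiv.sum_comp s.equivFin.symm (fun i : s => ‖A (v i)‖ ^ 2)] at this
  rwa [← Finset.sum_coe_sort]

/-- `U'` carries orthonormal families to orthonormal families, and `U` does not increase the norms
of the images. -/
theorem HSBound.comp {A U U' : H →L[ℂ] H} {M : ℝ} (h : HSBound A M) (hU : ∀ x, ‖U x‖ ≤ ‖x‖)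
    (hU' : ∀ x y, ⟪U' x, U' y⟫_ℂ = ⟪x, y⟫_ℂ) : HSBound (U ∘L A ∘L U') M := by
  intro n v hv
  refine le_trans (Finset.sum_le_sum fun i _ => ?_) (h n (fun i => U' (v i)) ?_)
  · gcongr
    exact hU _
  · classical
    rw [orthonormal_iff_ite] at hv ⊢
    intro i j
    rw [hU', hv]

theorem HSBound.smul {A : H →L[ℂ] H} {M : ℝ} (h : HSBound A M) (c : ℂ) :
    HSBound (c • A) (‖c‖ ^ 2 * M) := by
  intro n v hv
  simp only [_root_.smul_apply, norm_smul, mul_pow, ← Finset.mul_sum]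
  gcongr
  exact h n v hv

/-- Tested on the one-element orthonormal family of a normalized vector. -/
theorem HSBound.norm_le {A : H →L[ℂ] H} {M : ℝ} (h : HSBound A M) : ‖A‖ ≤ √M := by
  refine A.opNorm_le_bound (Real.sqrt_nonneg _) fun x => ?_
  by_cases hx : x = 0
  · simp [hx]
  have hn : ‖x‖ ≠ 0 := norm_ne_zero_iff.mpr hx
  have hv : Orthonormal ℂ (fun _ : Fin 1 => ((‖x‖⁻¹ : ℝ) : ℂ) • x) := by
    refine ⟨fun i => ?_, fun i j hij => (hij (Subsingleton.elim i j)).elim⟩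
    rw [norm_smul, Complex.norm_real, norm_inv, norm_norm, inv_mul_cancel₀ hn]
  have := h 1 _ hv
  simp only [Fin.sum_univ_one, map_smul, norm_smul, Complex.norm_real, norm_inv, norm_norm] at this
  have h2 := Real.le_sqrt_of_sq_le this
  rwa [inv_mul_le_iff₀ (by positivity), mul_comm] at h2

theorem HSBound.summable {A : H →L[ℂ] H} {M : ℝ} (h : HSBound A M) :
    Summable fun e : onb H => ‖A e‖ ^ 2 :=
  summable_of_sum_le (fun _ => by positivity) fun s => by
    simpa [onbBasis_apply] using h.sum_le (onbBasis H).orthonormal s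

/-- Truncations to finitely many basis vectors converge in operator norm. -/
theorem HSBound.tendsto_sum_rankOne {A : H →L[ℂ] H} {M : ℝ} (h : HSBound A M) :
    Tendsto (fun s : Finset (onb H) => ∑ e ∈ s, InnerProductSpace.rankOne ℂ (A e) (e : H)) atTop
      (𝓝 A) := by
  have hs := h.summable
  set t := ∑' e : onb H, ‖A e‖ ^ 2 with ht
  have hle : ∀ s : Finset (onb H), ∑ e ∈ s, ‖A e‖ ^ 2 ≤ t := fun s =>
    hs.sum_le_tsum s fun _ _ => by positivity
  have key : ∀ s : Finset (onb H),
      ‖(∑ e ∈ s, InnerProductSpace.rankOne ℂ (A e) (e : H)) - A‖ ≤ √(t - ∑ e ∈ s, ‖A e‖ ^ 2) := by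
    intro s
    refine ContinuousLinearMap.opNorm_le_bound _ (Real.sqrt_nonneg _) fun x => ?_
    have hx : HasSum (fun e : onb H => ⟪(e : H), x⟫_ℂ • A e) (A x) := by
      have := ((onbBasis H).hasSum_repr x).mapL A
      refine this.congr_fun fun e => ?_
      rw [HilbertBasis.repr_apply_apply, onbBasis_apply, map_smul]
    have hlim : Tendsto (fun s' : Finset (onb H) => ‖(∑ e ∈ s, ⟪(e : H), x⟫_ℂ • A e)
        - ∑ e ∈ s', ⟪(e : H), x⟫_ℂ • A e‖) atTop
        (𝓝 ‖(∑ e ∈ s, ⟪(e : H), x⟫_ℂ • A e) - A x‖) := (tendsto_const_nhds.sub hx).norm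
    have e0 : ((∑ e ∈ s, InnerProductSpace.rankOne ℂ (A e) (e : H)) - A) x
        = (∑ e ∈ s, ⟪(e : H), x⟫_ℂ • A e) - A x := by
      simp [_root_.sum_apply]
    rw [e0]
    refine le_of_tendsto hlim ?_
    -- For `s ⊆ s'` the difference is the sum over `s' \ s`; Cauchy–Schwarz bounds it by the
    -- Hilbert–Schmidt tail times Bessel's bound for `x`.
    filter_upwards [eventually_ge_atTop s] with s' hss
    classical
    rw [norm_sub_rev, ← Finset.sum_sdiff hss, add_sub_cancel_right]
    refine (norm_sum_le _ _).trans ?_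
    simp_rw [norm_smul]
    refine (Real.sum_mul_le_sqrt_mul_sqrt _ _ _).trans ?_
    rw [mul_comm]
    gcongr
    · have h1 := Finset.sum_sdiff (f := fun e : onb H => ‖A e‖ ^ 2) hss
      have h2 := hle s'
      linarith
    · rw [← Real.sqrt_sq (norm_nonneg x)]
      refine Real.sqrt_le_sqrt ?_
      have := (onbBasis H).orthonormal.sum_inner_products_le (s := s' \ s) x
      simpa [onbBasis_apply] using this
  rw [tendsto_iff_norm_sub_tendsto_zero]
  refine squeeze_zero (fun _ => norm_nonneg _) key ?_
  have h1 : Tendsto (fun s : Finset (onb H) => t - ∑ e ∈ s, ‖A e‖ ^ 2) atTop (𝓝 (t - t)) :=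
    tendsto_const_nhds.sub hs.hasSum
  rw [sub_self] at h1
  simpa [Function.comp_def] using (Real.continuous_sqrt.tendsto 0).comp h1

/-- Weak measurability of a path of Hilbert–Schmidt operators implies strong measurability. -/
theorem aestronglyMeasurable_of_hsBound [SecondCountableTopology H] {Ω : Type*}
    [MeasurableSpace Ω] {μ : Measure Ω} {F : Ω → H →L[ℂ] H}
    (hF : ∀ᵐ s ∂μ, ∃ M, HSBound (F s) M)
    (hw : ∀ f g : H, AEStronglyMeasurable (fun s => ⟪g, F s f⟫_ℂ) μ) :
    AEStronglyMeasurable F μ := by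
  -- Vectors of a separable Hilbert space inherit measurability from their coordinates. Bounded
  -- operators need not form a separable space in norm, so a second step approximates by finite rank
  -- truncations, which converge in norm for Hilbert–Schmidt operators.
  have hv : ∀ f : H, AEStronglyMeasurable (fun s => F s f) μ := fun f => by
    refine aestronglyMeasurable_of_tendsto_ae (atTop : Filter (Finset (onb H)))
      (f := fun t s => ∑ e ∈ t, ⟪(e : H), F s f⟫_ℂ • (e : H)) (fun t => ?_)
      (ae_of_all _ fun s => ?_)
    · exact Finset.aestronglyMeasurable_fun_sum t fun e _ => (hw f e).smul_const _
    · have := (onbBasis H).hasSum_repr (F s f)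
      refine this.congr_fun fun e => ?_
      rw [HilbertBasis.repr_apply_apply, onbBasis_apply]
  refine aestronglyMeasurable_of_tendsto_ae (atTop : Filter (Finset (onb H)))
    (f := fun t s => ∑ e ∈ t, InnerProductSpace.rankOne ℂ (F s e) (e : H)) (fun t => ?_) ?_
  · refine Finset.aestronglyMeasurable_fun_sum t fun e _ => ?_
    have hc : Continuous fun x : H => InnerProductSpace.rankOne ℂ x (e : H) := by fun_prop
    exact hc.comp_aestronglyMeasurable (hv e)
  · filter_upwards [hF] with s ⟨M, hs⟩
    exact hs.tendsto_sum_rankOne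

end HilbertSchmidt

/-! ### Fourier transform on `L²(ℝᵏ)` -/

open scoped FourierTransform

section MulLimit

variable {X : Type*} [MeasureSpace X]

/-- Dominated convergence for |v_n - v₀|²|f|² with majorant (2C)²|f|². -/
theorem tendsto_mulL {γ : Type*} {l : Filter γ} [l.IsCountablyGenerated] {v : γ → X → ℂ}
    {v₀ : X → ℂ} (hv : ∀ n, MemLp (v n) ∞ volume) (hv₀ : MemLp v₀ ∞ volume) {C : ℝ}
    (hC : ∀ n x, ‖v n x‖ ≤ C) (hC₀ : ∀ x, ‖v₀ x‖ ≤ C)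
    (h : ∀ᵐ x, Tendsto (fun n => v n x) l (𝓝 (v₀ x))) (f : LL X) :
    Tendsto (fun n => mulL (v n) (hv n) f) l (𝓝 (mulL v₀ hv₀ f)) := by
  rw [tendsto_iff_norm_sub_tendsto_zero]
  have hsq : ∀ n, ‖mulL (v n) (hv n) f - mulL v₀ hv₀ f‖ ^ 2
      = ∫ x, ‖v n x - v₀ x‖ ^ 2 * ‖f x‖ ^ 2 := fun n => by
    set g := mulL (v n) (hv n) f - mulL v₀ hv₀ f with hg
    have e : ‖g‖ ^ 2 = ∫ x, ‖g x‖ ^ 2 := by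
      have e := inner_self_eq_norm_sq (𝕜 := ℂ) g
      rw [← e, inner_eq_integral]
      have : ∀ x, conj (g x) * g x = ((‖g x‖ ^ 2 : ℝ) : ℂ) := fun x => by
        rw [mul_comm, Complex.mul_conj, Complex.normSq_eq_norm_sq]
      simp_rw [this]
      rw [integral_complex_ofReal]
      simp
    rw [e]
    refine integral_congr_ae ?_
    filter_upwards [Lp.coeFn_sub (mulL (v n) (hv n) f) (mulL v₀ hv₀ f), mulL_coe _ (hv n) f,
      mulL_coe _ hv₀ f] with x h1 h2 h3
    rw [hg, h1, Pi.sub_apply, h2, h3, ← sub_mul, norm_mul, mul_pow]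
  have hf2 := (memLp_two_iff_integrable_sq_norm (Lp.aestronglyMeasurable f)).mp (Lp.memLp f)
  have key : Tendsto (fun n => ∫ x, ‖v n x - v₀ x‖ ^ 2 * ‖f x‖ ^ 2) l (𝓝 (∫ x : X, (0 : ℝ))) := by
    refine tendsto_integral_filter_of_dominated_convergence (fun x => (2 * C) ^ 2 * ‖f x‖ ^ 2)
      (Eventually.of_forall fun n => ?_) (Eventually.of_forall fun n => ae_of_all _ fun x => ?_)
      (hf2.const_mul _) ?_
    · exact (((hv n).1.sub hv₀.1).norm.pow 2).mul ((Lp.aestronglyMeasurable f).norm.pow 2)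
    · rw [Real.norm_of_nonneg (by positivity)]
      gcongr
      exact (norm_sub_le _ _).trans (by linarith [hC n x, hC₀ x])
    · filter_upwards [h] with x hx
      have h1 := (((hx.sub_const (v₀ x)).norm).pow 2).mul_const (‖f x‖ ^ 2)
      simpa using h1
  simp_rw [← hsq] at key
  rw [integral_zero] at key
  have := (Real.continuous_sqrt.tendsto 0).comp key
  simpa [Function.comp_def, Real.sqrt_sq (norm_nonneg _)] using this

/-- A bounded, pointwise continuous family of multipliers acts continuously on `L²`. -/
theorem continuousAt_mulL {P : Type*} [TopologicalSpace P] [FirstCountableTopology P]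
    {v : P → X → ℂ} (hv : ∀ s, MemLp (v s) ∞ volume) {s₀ : P}
    {C : ℝ} (hC : ∀ s x, ‖v s x‖ ≤ C) (h : ∀ x, ContinuousAt (fun s => v s x) s₀) {u : P → LL X}
    (hu : ContinuousAt u s₀) : ContinuousAt (fun s => mulL (v s) (hv s) (u s)) s₀ := by
  have h1 := tendsto_mulL (l := 𝓝 s₀) hv (hv s₀) hC (hC s₀) (ae_of_all _ h) (u s₀)
  have h2 : Tendsto (fun s => mulL (v s) (hv s) (u s - u s₀)) (𝓝 s₀) (𝓝 0) := by
    refine squeeze_zero_norm (fun s => norm_mulL_apply_le _ (hv s) (hC s) _) ?_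
    have h3 : Tendsto (fun s => u s - u s₀) (𝓝 s₀) (𝓝 0) := by
      simpa using hu.tendsto.sub_const (u s₀)
    simpa using h3.norm.const_mul C
  have h4 := h2.add h1
  simpa [ContinuousAt, ← map_add] using h4

end MulLimit

/-- The Fourier transform on `L²(ℝᵏ)`. -/
abbrev FT (k : ℕ) : L2 k ≃ₗᵢ[ℂ] L2 k := Lp.fourierTransformₗᵢ (E k) ℂ

theorem fourierMultiplier_apply {k : ℕ} (m : E k → ℂ) (hm : MemLp m ∞ volume) (f : L2 k) :
    fourierMultiplier m hm f = (FT k).symm (mulL m hm (FT k f)) := rfl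

/-- The unitary extension and the absolutely convergent integral agree on L¹ ∩ L²: against smooth
compactly supported functions, both transfer the inverse transform onto the test function. -/
theorem FT_symm_ae_eq {k : ℕ} (w : L2 k) (hw : Integrable (w : E k → ℂ)) :
    (FT k).symm w =ᵐ[volume] fun x => 𝓕⁻ (w : E k → ℂ) x := by
  have hcont : Continuous fun x => 𝓕⁻ (w : E k → ℂ) x := by
    have := VectorFourier.fourierIntegral_continuous (e := 𝐞) (μ := (volume : Measure (E k)))
      (L := -innerₗ (E k)) Real.continuous_fourierChar (by
        simp only [LinearMap.neg_apply, innerₗ_apply_apply]; fun_prop) hw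
    exact this
  refine ae_eq_of_integral_contDiff_smul_eq
    ((Lp.memLp ((FT k).symm w)).locallyIntegrable (by norm_num)) hcont.locallyIntegrable ?_
  intro g hg hgc
  have hg' : ContDiff ℝ ((⊤ : ℕ∞) : WithTop ℕ∞) fun x => (g x : ℂ) := Complex.ofRealCLM.contDiff.comp hg
  have hgc' : HasCompactSupport fun x => (g x : ℂ) := hgc.comp_left (g := Complex.ofReal) rfl
  set h : 𝓢(E k, ℂ) := hgc'.toSchwartzMap hg' with hh
  have hhc : ∀ x, h x = (g x : ℂ) := fun x => rfl
  have e1 : ∫ x, g x • (FT k).symm w x = ∫ x, h x • (FT k).symm w x :=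
    integral_congr_ae (ae_of_all _ fun x => by simp [hhc])
  have e2 : ∫ x, g x • 𝓕⁻ (w : E k → ℂ) x = ∫ x, h x • 𝓕⁻ (w : E k → ℂ) x :=
    integral_congr_ae (ae_of_all _ fun x => by simp [hhc])
  rw [e1, e2]
  have e3 : ∫ x, h x • (FT k).symm w x = ∫ x, (𝓕⁻ h) x • w x := by
    have := congrArg (fun D : 𝓢'(E k, ℂ) => D h) (Lp.fourierInv_toTemperedDistribution_eq w)
    simp only [TemperedDistribution.fourierInv_apply, Lp.toTemperedDistribution_apply] at this
    exact this.symm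
  rw [e3]
  have := VectorFourier.integral_fourierIntegral_smul_eq_flip (e := 𝐞)
    (μ := (volume : Measure (E k))) (ν := (volume : Measure (E k))) (L := -innerₗ (E k))
    (f := h) (g := (w : E k → ℂ)) Real.continuous_fourierChar (by
        simp only [LinearMap.neg_apply, innerₗ_apply_apply]; fun_prop) h.integrable hw
  have hflip : (-innerₗ (E k)).flip = -innerₗ (E k) := by
    ext x y
    simp [real_inner_comm]
  rw [hflip] at this
  rw [SchwartzMap.fourierInv_coe]
  exact this

/-! ### The energy weight and its Green function -/

theorem energySymbol_pos (k : ℕ) (ξ : E k) :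
    0 < ∏ j : Fin k, (Real.sqrt (1 + (2 * Real.pi * ξ j) ^ 2))⁻¹ :=
  Finset.prod_pos fun j _ => by positivity

theorem norm_energySymbol_le (k : ℕ) (ξ : E k) : ‖energySymbol k ξ‖ ≤ 1 := by
  rw [energySymbol, Complex.norm_real, Real.norm_eq_abs, abs_of_pos (energySymbol_pos k ξ)]
  refine Finset.prod_le_one (fun j _ => by positivity) fun j _ => inv_le_one_of_one_le₀ ?_
  rw [Real.one_le_sqrt]
  nlinarith [sq_nonneg (2 * Real.pi * ξ j)]

theorem continuous_energySymbol (k : ℕ) : Continuous (energySymbol k) := by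
  refine Complex.continuous_ofReal.comp (continuous_finsetProd _ fun j _ => ?_)
  refine Continuous.inv₀ (by fun_prop) fun ξ => ?_
  positivity

/-- Here one dimension per particle enters: the squared symbol is a product of the functions (1 +
(2πξ)²)⁻¹, each integrable on the line. This places L⁻¹δ_y in L². -/
theorem memLp_two_energySymbol (k : ℕ) : MemLp (energySymbol k) 2 volume := by
  rw [memLp_two_iff_integrable_sq_norm (continuous_energySymbol k).aestronglyMeasurable]
  have h1 : Integrable fun x : Fin k → ℝ => ∏ j, (1 + (2 * Real.pi * x j) ^ 2)⁻¹ := by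
    refine Integrable.fintype_prod (f := fun _ (t : ℝ) => (1 + (2 * Real.pi * t) ^ 2)⁻¹) fun j => ?_
    exact integrable_inv_one_add_sq.comp_mul_left' (by positivity)
  have h2 := (EuclideanSpace.volume_preserving_symm_measurableEquiv_toLp (Fin k)).integrable_comp_emb
    (MeasurableEquiv.measurableEmbedding _) |>.mpr h1
  refine h2.congr (ae_of_all _ fun ξ => ?_)
  simp only [Function.comp]
  rw [energySymbol, Complex.norm_real, Real.norm_eq_abs, abs_of_pos (energySymbol_pos k ξ),
    ← Finset.prod_pow]
  refine Finset.prod_congr rfl fun j _ => ?_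
  rw [inv_pow, Real.sq_sqrt (by positivity)]
  rfl

theorem adjoint_fourierMultiplier {k : ℕ} (m : E k → ℂ) (hm : MemLp m ∞ volume) :
    ContinuousLinearMap.adjoint (fourierMultiplier m hm)
      = fourierMultiplier (fun ξ => conj (m ξ)) hm.star := by
  symm
  rw [ContinuousLinearMap.eq_adjoint_iff]
  intro f g
  have h1 : ∀ a g : L2 k, ⟪(FT k).symm a, g⟫_ℂ = ⟪a, FT k g⟫_ℂ := fun a g => by
    rw [← LinearIsometryEquiv.inner_map_map (FT k), LinearIsometryEquiv.apply_symm_apply]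
  have h2 : ∀ a g : L2 k, ⟪g, (FT k).symm a⟫_ℂ = ⟪FT k g, a⟫_ℂ := fun a g => by
    rw [← LinearIsometryEquiv.inner_map_map (FT k), LinearIsometryEquiv.apply_symm_apply]
  rw [fourierMultiplier_apply, fourierMultiplier_apply, h1, h2, ← adjoint_mulL,
    ContinuousLinearMap.adjoint_inner_left]

theorem fourierMultiplier_congr {k : ℕ} {m m' : E k → ℂ} (h : m = m') (hm : MemLp m ∞ volume)
    (hm' : MemLp m' ∞ volume) : fourierMultiplier m hm = fourierMultiplier m' hm' := by
  subst h; rfl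

theorem adjoint_energyWeightInv (k : ℕ) :
    ContinuousLinearMap.adjoint (energyWeightInv k) = energyWeightInv k := by
  rw [energyWeightInv, adjoint_fourierMultiplier]
  exact fourierMultiplier_congr (funext fun ξ => by rw [energySymbol, Complex.conj_ofReal]) _ _

theorem norm_energyWeightInv_le (k : ℕ) : ‖energyWeightInv k‖ ≤ 1 := by
  refine ContinuousLinearMap.opNorm_le_bound _ zero_le_one fun f => ?_
  rw [energyWeightInv, fourierMultiplier_apply, LinearIsometryEquiv.norm_map,
    ← LinearIsometryEquiv.norm_map (FT k) f]
  exact norm_mulL_apply_le _ _ (norm_energySymbol_le k) _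

theorem energyWeightInv_injective (k : ℕ) (f : L2 k) (h : energyWeightInv k f = 0) : f = 0 := by
  rw [energyWeightInv, fourierMultiplier_apply, LinearIsometryEquiv.map_eq_zero_iff] at h
  rw [← LinearIsometryEquiv.map_eq_zero_iff (FT k)]
  refine Lp.ext ?_
  have h1 := mulL_coe (energySymbol k) (memLp_energySymbol k) (FT k f)
  rw [h] at h1
  filter_upwards [h1, Lp.coeFn_zero ℂ 2 (volume : Measure (E k))] with ξ h2 h3
  rw [h3] at h2 ⊢
  have h4 : energySymbol k ξ ≠ 0 := by
    rw [energySymbol]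
    exact_mod_cast (energySymbol_pos k ξ).ne'
  simpa [h4] using h2.symm

/-- A vector orthogonal to the range is killed by the adjoint, which is the operator itself, and
this is injective because its symbol has no zeros. -/
theorem denseRange_energyWeightInv (k : ℕ) : DenseRange (energyWeightInv k) := by
  have h : (LinearMap.range (energyWeightInv k : L2 k →ₗ[ℂ] L2 k))ᗮ = ⊥ := by
    rw [Submodule.eq_bot_iff]
    intro f hf
    refine energyWeightInv_injective k f (ext_inner_left ℂ fun g => ?_)
    rw [inner_zero_right, ← ContinuousLinearMap.adjoint_inner_left, adjoint_energyWeightInv]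
    exact hf _ ⟨g, rfl⟩
  have h2 := (Submodule.topologicalClosure_eq_top_iff).mpr h
  exact (Submodule.dense_iff_topologicalClosure_eq_top).mpr h2

/-- The character `ξ ↦ e^{-2πi⟨y, ξ⟩}`. -/
def planeWave {k : ℕ} (y ξ : E k) : ℂ :=
  Complex.exp ((((-2 * Real.pi * ⟪y, ξ⟫_ℝ : ℝ)) : ℂ) * Complex.I)

theorem norm_planeWave {k : ℕ} (y ξ : E k) : ‖planeWave y ξ‖ = 1 :=
  Complex.norm_exp_ofReal_mul_I _

theorem continuous_planeWave {k : ℕ} : Continuous fun p : E k × E k => planeWave p.1 p.2 := by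
  unfold planeWave
  fun_prop

theorem memLp_planeWave {k : ℕ} (y : E k) : MemLp (planeWave y) ∞ volume :=
  memLp_top_of_bound (continuous_planeWave.comp (by fun_prop : Continuous fun ξ => (y, ξ))).aestronglyMeasurable 1
    (ae_of_all _ fun ξ => (norm_planeWave y ξ).le)

/-- `(L^{(k)})⁻¹ δ_y`. -/
def green {k : ℕ} (y : E k) : L2 k :=
  (FT k).symm (mulL (planeWave y) (memLp_planeWave y) ((memLp_two_energySymbol k).toLp _))

theorem continuous_green {k : ℕ} : Continuous (green : E k → L2 k) := by
  refine (FT k).symm.continuous.comp (continuous_iff_continuousAt.mpr fun y => ?_)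
  exact continuousAt_mulL (fun y => memLp_planeWave y) (fun y ξ => (norm_planeWave y ξ).le)
    (fun ξ => (continuous_planeWave.comp
      (by fun_prop : Continuous fun y => (y, ξ))).continuousAt) continuousAt_const

/-- The norm of `green y`, which does not depend on `y`. -/
def greenConst (k : ℕ) : ℝ := ‖(memLp_two_energySymbol k).toLp (energySymbol k)‖

theorem norm_green_le {k : ℕ} (y : E k) : ‖green y‖ ≤ greenConst k := by
  rw [green, LinearIsometryEquiv.norm_map, greenConst]
  simpa using norm_mulL_apply_le _ (memLp_planeWave y) (fun ξ => (norm_planeWave y ξ).le)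
    ((memLp_two_energySymbol k).toLp (energySymbol k))

theorem greenConst_nonneg (k : ℕ) : 0 ≤ greenConst k := norm_nonneg _

/-- The symbol times an L² function is integrable, so Fourier inversion is a genuine integral,
namely the pairing with `green y`. This selects the continuous representative. -/
theorem energyWeightInv_coe {k : ℕ} (v : L2 k) :
    energyWeightInv k v =ᵐ[volume] fun y => ⟪green y, v⟫_ℂ := by
  set w := mulL (energySymbol k) (memLp_energySymbol k) (FT k v) with hw
  have hwc := mulL_coe (energySymbol k) (memLp_energySymbol k) (FT k v)
  have hint : Integrable (w : E k → ℂ) :=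
    (MemLp.integrable_mul (memLp_two_energySymbol k) (Lp.memLp (FT k v))).congr hwc.symm
  filter_upwards [FT_symm_ae_eq w hint] with y hy
  rw [energyWeightInv, fourierMultiplier_apply, ← hw, hy, green,
    LinearIsometryEquiv.inner_map_eq_flip, LinearIsometryEquiv.symm_symm, inner_eq_integral,
    Real.fourierInv_eq']
  refine integral_congr_ae ?_
  filter_upwards [hwc, mulL_coe (planeWave y) (memLp_planeWave y)
    ((memLp_two_energySymbol k).toLp (energySymbol k)), (memLp_two_energySymbol k).coeFn_toLp]
    with ξ h1 h2 h3
  rw [hw, h1, h2, h3, map_mul, planeWave, ← Complex.exp_conj, energySymbol, Complex.conj_ofReal]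
  simp only [map_mul, Complex.conj_ofReal, Complex.conj_I, smul_eq_mul]
  rw [real_inner_comm y ξ, ← mul_assoc]
  congr 3
  push_cast
  ring

/-- The continuous kernel of `L⁻¹ B L⁻¹`. -/
def sandwichKernel {k : ℕ} (B : Op k) (y y' : E k) : ℂ := ⟪green y, B (green y')⟫_ℂ

theorem continuous_sandwichKernel {k : ℕ} (B : Op k) :
    Continuous (Function.uncurry (sandwichKernel B)) := by
  unfold sandwichKernel Function.uncurry
  have h1 : Continuous fun p : E k × E k => green p.1 := continuous_green.comp continuous_fst
  have h2 : Continuous fun p : E k × E k => B (green p.2) :=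
    B.continuous.comp (continuous_green.comp continuous_snd)
  exact h1.inner h2

/-- The outer weight is evaluated at `y` by `green y`; after moving `B` and the inner weight across
the inner product, the inner weight is evaluated by `green` as well. -/
theorem hasKernel_sandwich {k : ℕ} (B : Op k) :
    HasKernel (energyWeightInv k ∘L B ∘L energyWeightInv k) (sandwichKernel B) := by
  intro f
  filter_upwards [energyWeightInv_coe (B (energyWeightInv k f))] with y hy
  set v : L2 k := energyWeightInv k (ContinuousLinearMap.adjoint B (green y)) with hv
  have hvc := energyWeightInv_coe (ContinuousLinearMap.adjoint B (green y))
  have hvc' : ∀ᵐ y', conj (v y') * f y' = sandwichKernel B y y' * f y' := by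
    filter_upwards [hvc] with y' h
    rw [hv, h, inner_conj_symm, ContinuousLinearMap.adjoint_inner_left, sandwichKernel]
  refine ⟨(integrable_conj_mul (Lp.memLp v) (Lp.memLp f)).congr hvc', ?_⟩
  rw [← integral_congr_ae hvc', ← inner_eq_integral]
  simp only [ContinuousLinearMap.comp_apply]
  rw [hy, hv, ← ContinuousLinearMap.adjoint_inner_left B]
  conv_lhs => rw [← adjoint_energyWeightInv k]
  rw [ContinuousLinearMap.adjoint_inner_right]

/-! ### The free group -/

theorem norm_freeSymbol (k : ℕ) (τ : ℝ) (ξ : E k) : ‖freeSymbol k τ ξ‖ = 1 := by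
  rw [freeSymbol, Complex.norm_exp_I_mul_ofReal]

theorem mulL_mulL {X : Type*} [MeasureSpace X] {v w u : X → ℂ} (hv : MemLp v ∞ volume)
    (hw : MemLp w ∞ volume) (hu : MemLp u ∞ volume) (h : ∀ x, v x * w x = u x) (f : LL X) :
    mulL v hv (mulL w hw f) = mulL u hu f := by
  refine Lp.ext ?_
  filter_upwards [mulL_coe v hv (mulL w hw f), mulL_coe w hw f, mulL_coe u hu f] with x h1 h2 h3
  rw [h1, h2, h3, ← mul_assoc, h]

theorem freeGroup_freeGroup (k : ℕ) (τ τ' : ℝ) (f : L2 k) :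
    freeGroup k τ (freeGroup k τ' f) = freeGroup k (τ + τ') f := by
  simp only [freeGroup, fourierMultiplier_apply, LinearIsometryEquiv.apply_symm_apply]
  rw [mulL_mulL (memLp_freeSymbol k τ) (memLp_freeSymbol k τ') (memLp_freeSymbol k (τ + τ'))]
  intro ξ
  rw [freeSymbol, freeSymbol, freeSymbol, ← Complex.exp_add, ← mul_add, ← Complex.ofReal_add]
  congr 3
  ring

theorem freeGroup_zero (k : ℕ) (f : L2 k) : freeGroup k 0 f = f := by
  simp only [freeGroup, fourierMultiplier_apply]
  have : mulL (freeSymbol k 0) (memLp_freeSymbol k 0) (FT k f) = FT k f := by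
    refine Lp.ext ?_
    filter_upwards [mulL_coe (freeSymbol k 0) (memLp_freeSymbol k 0) (FT k f)] with x h1
    rw [h1]
    simp [freeSymbol]
  rw [this, LinearIsometryEquiv.symm_apply_apply]

theorem freeGroup_neg_self (k : ℕ) (τ : ℝ) (f : L2 k) :
    freeGroup k (-τ) (freeGroup k τ f) = f := by
  rw [freeGroup_freeGroup, neg_add_cancel, freeGroup_zero]

theorem freeGroup_self_neg (k : ℕ) (τ : ℝ) (f : L2 k) :
    freeGroup k τ (freeGroup k (-τ) f) = f := by
  rw [freeGroup_freeGroup, add_neg_cancel, freeGroup_zero]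

theorem adjoint_freeGroup (k : ℕ) (τ : ℝ) :
    ContinuousLinearMap.adjoint (freeGroup k τ) = freeGroup k (-τ) := by
  rw [freeGroup, adjoint_fourierMultiplier]
  refine fourierMultiplier_congr (funext fun ξ => ?_) _ _
  rw [freeSymbol, freeSymbol, ← Complex.exp_conj, map_mul, Complex.conj_I, Complex.conj_ofReal]
  congr 1
  push_cast
  ring

theorem inner_freeGroup_left (k : ℕ) (τ : ℝ) (f g : L2 k) :
    ⟪freeGroup k τ f, g⟫_ℂ = ⟪f, freeGroup k (-τ) g⟫_ℂ := by
  rw [← adjoint_freeGroup, ContinuousLinearMap.adjoint_inner_right]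

theorem inner_freeGroup (k : ℕ) (τ : ℝ) (f g : L2 k) :
    ⟪freeGroup k τ f, freeGroup k τ g⟫_ℂ = ⟪f, g⟫_ℂ := by
  rw [inner_freeGroup_left, freeGroup_neg_self]

theorem norm_freeGroup (k : ℕ) (τ : ℝ) (f : L2 k) : ‖freeGroup k τ f‖ = ‖f‖ := by
  have h := inner_freeGroup k τ f f
  rw [inner_self_eq_norm_sq_to_K, inner_self_eq_norm_sq_to_K] at h
  have h2 : ‖freeGroup k τ f‖ ^ 2 = ‖f‖ ^ 2 := by exact_mod_cast h
  exact (sq_eq_sq₀ (norm_nonneg _) (norm_nonneg _)).mp h2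

/-- Joint strong continuity: the symbols are unimodular and converge pointwise. -/
theorem continuousAt_freeGroup {k : ℕ} {P : Type*} [TopologicalSpace P] [FirstCountableTopology P]
    {τ : P → ℝ} {u : P → L2 k} {s₀ : P} (hτ : ContinuousAt τ s₀) (hu : ContinuousAt u s₀) :
    ContinuousAt (fun s => freeGroup k (τ s) (u s)) s₀ := by
  simp only [freeGroup, fourierMultiplier_apply]
  refine (FT k).symm.continuous.continuousAt.comp ?_
  refine continuousAt_mulL (fun s => memLp_freeSymbol k (τ s))
    (fun s ξ => (norm_freeSymbol k (τ s) ξ).le) (fun ξ => ?_)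
    ((FT k).continuous.continuousAt.comp hu)
  have hc : Continuous fun t : ℝ => freeSymbol k t ξ := by
    unfold freeSymbol
    fun_prop
  exact hc.continuousAt.comp hτ

/-! ### Gaussians -/

section CexpSchwartz

variable {W : Type*} [NormedAddCommGroup W] [NormedSpace ℝ W]

/-- Induction on the order with D(e^q) = e^q Dq and the Leibniz rule: each derivative costs a
polynomial factor only, since the derivatives of q grow polynomially. -/
theorem exists_norm_iteratedFDeriv_cexp_le {q : W → ℂ} (hq : q.HasTemperateGrowth) (n : ℕ) :
    ∃ (k : ℕ) (C : ℝ), 0 ≤ C ∧ ∀ i ≤ n, ∀ x,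
      ‖iteratedFDeriv ℝ i (fun y => Complex.exp (q y)) x‖
        ≤ C * (1 + ‖x‖) ^ k * Real.exp (q x).re := by
  have hF : ContDiff ℝ ((⊤ : ℕ∞) : WithTop ℕ∞) fun y => Complex.exp (q y) := hq.1.cexp
  induction n with
  | zero =>
    refine ⟨0, 1, zero_le_one, fun i hi x => ?_⟩
    obtain rfl : i = 0 := by omega
    simp [Complex.norm_exp]
  | succ n ih =>
    obtain ⟨k, C, hC, h⟩ := ih
    obtain ⟨k', C', hC', h'⟩ := hq.norm_iteratedFDeriv_le_uniform (n + 1)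
    have hfd : fderiv ℝ (fun y => Complex.exp (q y)) = fun x => Complex.exp (q x) • fderiv ℝ q x := by
      funext x
      exact ((hq.1.differentiable (by simp)).differentiableAt.hasFDerivAt.cexp).fderiv
    have hq' : ContDiff ℝ n (fderiv ℝ q) := hq.1.fderiv_right (by exact_mod_cast le_top)
    have hF' : ContDiff ℝ n fun y => Complex.exp (q y) := hF.of_le (by exact_mod_cast le_top)
    have key : ∀ x, ‖iteratedFDeriv ℝ (n + 1) (fun y => Complex.exp (q y)) x‖
        ≤ (2 ^ n * C * C') * (1 + ‖x‖) ^ (k + k') * Real.exp (q x).re := fun x => by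
      rw [← norm_iteratedFDeriv_fderiv, hfd]
      refine (norm_iteratedFDeriv_smul_le hF' hq' x (le_refl _)).trans ?_
      have : ∀ i ∈ Finset.range (n + 1), (n.choose i : ℝ)
          * ‖iteratedFDeriv ℝ i (fun y => Complex.exp (q y)) x‖
          * ‖iteratedFDeriv ℝ (n - i) (fderiv ℝ q) x‖
          ≤ (n.choose i : ℝ) * (C * (1 + ‖x‖) ^ k * Real.exp (q x).re)
            * (C' * (1 + ‖x‖) ^ k') := fun i hi => by
        have hi := Finset.mem_range.mp hi
        gcongr
        · exact h i (by omega) x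
        · rw [norm_iteratedFDeriv_fderiv]
          exact h' _ (by omega) x
      refine (Finset.sum_le_sum this).trans (le_of_eq ?_)
      rw [← Finset.sum_mul, ← Finset.sum_mul]
      have h2 : ∑ i ∈ Finset.range (n + 1), (n.choose i : ℝ) = 2 ^ n := by
        exact_mod_cast Nat.sum_range_choose n
      rw [h2]
      ring
    refine ⟨k + k', C + 2 ^ n * C * C', by positivity, fun i hi x => ?_⟩
    have h1 : 1 ≤ 1 + ‖x‖ := by linarith [norm_nonneg x]
    rcases Nat.lt_or_ge n i with hlt | hle
    · obtain rfl : i = n + 1 := by omega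
      refine (key x).trans ?_
      gcongr
      linarith
    · refine (h i hle x).trans ?_
      have : (0 : ℝ) ≤ 2 ^ n * C * C' := by positivity
      gcongr
      · linarith
      · omega

/-- The power is at most p! e^{1+r}, and completing the square in the remaining exponent gives the
constant. -/
theorem pow_mul_exp_le {a : ℝ} (ha : 0 < a) (b d : ℝ) (p : ℕ) :
    ∃ M : ℝ, ∀ r : ℝ, 0 ≤ r → (1 + r) ^ p * Real.exp (-a * r ^ 2 + b * r + d) ≤ M := by
  refine ⟨p.factorial * Real.exp (1 + (b + 1) ^ 2 / (4 * a) + d), fun r hr => ?_⟩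
  have h1 : (1 + r) ^ p ≤ p.factorial * Real.exp (1 + r) := by
    have := Real.pow_div_factorial_le_exp (1 + r) (by linarith) p
    rwa [div_le_iff₀ (by positivity), mul_comm] at this
  have h2 : -a * r ^ 2 + b * r + d ≤ (1 + (b + 1) ^ 2 / (4 * a) + d) - (1 + r) := by
    have : (b + 1) ^ 2 / (4 * a) = a * r ^ 2 - (a * r ^ 2 - (b + 1) ^ 2 / (4 * a)) := by ring
    have h3 : 0 ≤ a * r ^ 2 - (b + 1) * r + (b + 1) ^ 2 / (4 * a) := by
      have : a * r ^ 2 - (b + 1) * r + (b + 1) ^ 2 / (4 * a)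
          = (2 * a * r - (b + 1)) ^ 2 / (4 * a) := by
        field_simp
        ring
      rw [this]
      positivity
    linarith
  calc _ ≤ (p.factorial * Real.exp (1 + r))
        * Real.exp ((1 + (b + 1) ^ 2 / (4 * a) + d) - (1 + r)) := by gcongr
    _ = _ := by rw [mul_assoc, ← Real.exp_add]; congr 2; ring

/-- The exponential of a function of temperate growth is a Schwartz function if its real part is
bounded above by a negative definite quadratic polynomial of the norm. -/
theorem exists_schwartz_cexp {q : W → ℂ} (hq : q.HasTemperateGrowth) {a : ℝ} (ha : 0 < a) (b d : ℝ)
    (hre : ∀ x, (q x).re ≤ -a * ‖x‖ ^ 2 + b * ‖x‖ + d) :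
    ∃ F : 𝓢(W, ℂ), ∀ x, F x = Complex.exp (q x) := by
  refine ⟨⟨fun x => Complex.exp (q x), hq.1.cexp, fun m n => ?_⟩, fun x => rfl⟩
  obtain ⟨k, C, hC, h⟩ := exists_norm_iteratedFDeriv_cexp_le hq n
  obtain ⟨M, hM⟩ := pow_mul_exp_le ha b d (m + k)
  refine ⟨C * M, fun x => ?_⟩
  calc _ ≤ (1 + ‖x‖) ^ m * (C * (1 + ‖x‖) ^ k
        * Real.exp (-a * ‖x‖ ^ 2 + b * ‖x‖ + d)) := by
        gcongr
        · linarith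
        · refine (h n le_rfl x).trans ?_
          gcongr
          exact hre x
    _ = C * ((1 + ‖x‖) ^ (m + k) * Real.exp (-a * ‖x‖ ^ 2 + b * ‖x‖ + d)) := by
        rw [pow_add]; ring
    _ ≤ C * M := by
        gcongr
        exact hM _ (norm_nonneg x)

end CexpSchwartz

/-! ### Gaussians with complex quadratic exponents -/

section GaussFn

variable {n : ℕ}

/-- `exp(A‖x‖² + B⟨x₀, x⟩ + D)`. -/
def gaussFn (A B D : ℂ) (x₀ x : E n) : ℂ :=
  Complex.exp (A * ((‖x‖ ^ 2 : ℝ) : ℂ) + B * ((⟪x₀, x⟫_ℝ : ℝ) : ℂ) + D)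

theorem norm_gaussFn (A B D : ℂ) (x₀ x : E n) :
    ‖gaussFn A B D x₀ x‖ = Real.exp (A.re * ‖x‖ ^ 2 + B.re * ⟪x₀, x⟫_ℝ + D.re) := by
  rw [gaussFn, Complex.norm_exp]
  simp [-Complex.ofReal_pow]

theorem exists_schwartz_gaussFn {A : ℂ} (hA : A.re < 0) (B D : ℂ) (x₀ : E n) :
    ∃ F : 𝓢(E n, ℂ), ∀ x, F x = gaussFn A B D x₀ x := by
  refine exists_schwartz_cexp (a := -A.re) (b := |B.re| * ‖x₀‖) (d := D.re) ?_ (by linarith)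
    fun x => ?_
  · have h1 : (fun x : E n => ((‖x‖ ^ 2 : ℝ) : ℂ)).HasTemperateGrowth :=
      Function.Complex.hasTemperateGrowth_ofReal.comp (Function.hasTemperateGrowth_norm_sq (E n))
    have h2 : (fun x : E n => ((⟪x₀, x⟫_ℝ : ℝ) : ℂ)).HasTemperateGrowth :=
      Function.Complex.hasTemperateGrowth_ofReal.comp (Function.hasTemperateGrowth_inner_right x₀)
    exact (((Function.HasTemperateGrowth.const A).mul h1).add
      ((Function.HasTemperateGrowth.const B).mul h2)).add (Function.HasTemperateGrowth.const D)
  · have h1 : B.re * ⟪x₀, x⟫_ℝ ≤ |B.re| * ‖x₀‖ * ‖x‖ := by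
      refine (le_abs_self _).trans ?_
      rw [abs_mul, mul_assoc]
      gcongr
      exact abs_real_inner_le_norm _ _
    simp [-Complex.ofReal_pow]
    linarith

theorem continuous_gaussFn (A B D : ℂ) (x₀ : E n) : Continuous (gaussFn A B D x₀) := by
  unfold gaussFn
  fun_prop

theorem memLp_gaussFn {A : ℂ} (hA : A.re < 0) (B D : ℂ) (x₀ : E n) (p : ℝ≥0∞) :
    MemLp (gaussFn A B D x₀) p volume := by
  obtain ⟨F, hF⟩ := exists_schwartz_gaussFn hA B D x₀
  rw [show gaussFn A B D x₀ = F from funext fun x => (hF x).symm]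
  exact F.memLp p

theorem hasFDerivAt_gaussFn (A B D : ℂ) (x₀ x : E n) :
    HasFDerivAt (gaussFn A B D x₀) (gaussFn A B D x₀ x •
      ((2 * A) • Complex.ofRealCLM ∘L innerSL ℝ x + B • Complex.ofRealCLM ∘L innerSL ℝ x₀)) x := by
  have h1 : HasFDerivAt (fun x : E n => ((‖x‖ ^ 2 : ℝ) : ℂ))
      (Complex.ofRealCLM ∘L (2 • innerSL ℝ x)) x :=
    Complex.ofRealCLM.hasFDerivAt.comp x (hasStrictFDerivAt_norm_sq x).hasFDerivAt
  have h2 : HasFDerivAt (fun x : E n => ((⟪x₀, x⟫_ℝ : ℝ) : ℂ))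
      (Complex.ofRealCLM ∘L innerSL ℝ x₀) x :=
    Complex.ofRealCLM.hasFDerivAt.comp x (innerSL ℝ x₀).hasFDerivAt
  have h3 := (((h1.const_mul A).add (h2.const_mul B)).add_const D).cexp
  refine h3.congr_fderiv ?_
  ext v
  simp [gaussFn]
  ring_nf

/-- The result is a quadratic polynomial times the same Gaussian, which reduces the oscillator
equation on Gaussians to scalar equations for the coefficients. -/
theorem laplacian_gaussFn (A B D : ℂ) (x₀ x : E n) :
    Laplacian.laplacian (gaussFn A B D x₀) x
      = (4 * A ^ 2 * ((‖x‖ ^ 2 : ℝ) : ℂ) + 4 * A * B * ((⟪x₀, x⟫_ℝ : ℝ) : ℂ)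
        + B ^ 2 * ((‖x₀‖ ^ 2 : ℝ) : ℂ) + 2 * A * n) * gaussFn A B D x₀ x := by
  have hfd : fderiv ℝ (gaussFn A B D x₀) = fun x => gaussFn A B D x₀ x •
      ((2 * A) • Complex.ofRealCLM ∘L innerSL ℝ x + B • Complex.ofRealCLM ∘L innerSL ℝ x₀) :=
    funext fun x => (hasFDerivAt_gaussFn A B D x₀ x).fderiv
  have hL : HasFDerivAt (fun x : E n => (2 * A) • (Complex.ofRealCLM ∘L innerSL ℝ x)
      + B • Complex.ofRealCLM ∘L innerSL ℝ x₀)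
      ((2 * A) • (ContinuousLinearMap.compL ℝ (E n) ℝ ℂ Complex.ofRealCLM ∘L innerSL ℝ)) x := by
    have h0 : HasFDerivAt (fun x : E n => Complex.ofRealCLM ∘L innerSL ℝ x)
      (ContinuousLinearMap.compL ℝ (E n) ℝ ℂ Complex.ofRealCLM ∘L innerSL ℝ) x :=
      (ContinuousLinearMap.compL ℝ (E n) ℝ ℂ Complex.ofRealCLM ∘L innerSL ℝ).hasFDerivAt
    exact (h0.const_smul (2 * A)).add_const _
  have h2 : ∀ v : E n, fderiv ℝ (fderiv ℝ (gaussFn A B D x₀)) x v v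
      = ((2 * A * (⟪x, v⟫_ℝ : ℝ) + B * (⟪x₀, v⟫_ℝ : ℝ)) ^ 2 + 2 * A * (⟪v, v⟫_ℝ : ℝ))
        * gaussFn A B D x₀ x := fun v => by
    rw [hfd, HasFDerivAt.fderiv ((hasFDerivAt_gaussFn A B D x₀ x).fun_smul hL)]
    simp
    rw [show innerSL ℝ v v = ‖v‖ ^ 2 from real_inner_self_eq_norm_sq v]
    push_cast
    ring
  rw [InnerProductSpace.laplacian_eq_iteratedFDeriv_orthonormalBasis _
    (EuclideanSpace.basisFun (Fin n) ℝ)]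
  simp_rw [iteratedFDeriv_two_apply]
  simp only [Matrix.cons_val_zero, Matrix.cons_val_one, h2]
  rw [← Finset.sum_mul]
  congr 1
  have e1 : ∑ i, ((x i : ℂ)) ^ 2 = ((‖x‖ ^ 2 : ℝ) : ℂ) := by
    rw [EuclideanSpace.real_norm_sq_eq]; push_cast; rfl
  have e2 : ∑ i, ((x₀ i : ℂ)) ^ 2 = ((‖x₀‖ ^ 2 : ℝ) : ℂ) := by
    rw [EuclideanSpace.real_norm_sq_eq]; push_cast; rfl
  have e3 : ∑ i, (x i : ℂ) * (x₀ i : ℂ) = ((⟪x₀, x⟫_ℝ : ℝ) : ℂ) := by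
    rw [PiLp.inner_apply]; push_cast; simp
  rw [← e1, ← e2, ← e3, Finset.mul_sum, Finset.mul_sum, Finset.mul_sum, ← Finset.sum_add_distrib,
    ← Finset.sum_add_distrib]
  rw [Finset.sum_add_distrib]
  congr 1
  · refine Finset.sum_congr rfl fun i _ => ?_
    simp [EuclideanSpace.inner_single_right]
    ring
  · simp
    ring

end GaussFn

/-! ### Splitting configuration space -/

section SplitE

variable {k m N : ℕ}

/-- Relabelling of coordinates. -/
def relabel (e : Fin m ≃ Fin N) : E N ≃ᵐ E m :=
  (LinearIsometryEquiv.piLpCongrLeft 2 ℝ ℝ e.symm).toHomeomorph.toMeasurableEquiv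

theorem relabel_apply (e : Fin m ≃ Fin N) (x : E N) (i : Fin m) : relabel e x i = x (e i) := by
  simp [relabel, LinearIsometryEquiv.piLpCongrLeft_apply]

theorem measurePreserving_relabel (e : Fin m ≃ Fin N) :
    MeasurePreserving (relabel e) volume volume :=
  LinearIsometryEquiv.measurePreserving (LinearIsometryEquiv.piLpCongrLeft 2 ℝ ℝ e.symm)

/-- `ℝᴺ ≃ ℝᵏ × ℝᵐ` along a partition of the coordinates. -/
def splitE (e : Fin k ⊕ Fin m ≃ Fin N) : Split (E N) (E k) (E m) where
  toEquiv := (MeasurableEquiv.toLp 2 (Fin N → ℝ)).symm.trans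
    ((MeasurableEquiv.piCongrLeft (fun _ => ℝ) e).symm.trans
      ((MeasurableEquiv.sumPiEquivProdPi fun _ => ℝ).trans
        (MeasurableEquiv.prodCongr (MeasurableEquiv.toLp 2 (Fin k → ℝ))
          (MeasurableEquiv.toLp 2 (Fin m → ℝ)))))
  mp := by
    refine MeasurePreserving.trans
      (EuclideanSpace.volume_preserving_symm_measurableEquiv_toLp (Fin N)) ?_
    refine MeasurePreserving.trans ((volume_measurePreserving_piCongrLeft (fun _ => ℝ) e).symm _) ?_
    refine MeasurePreserving.trans (volume_measurePreserving_sumPiEquivProdPi fun _ => ℝ) ?_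
    exact (PiLp.volume_preserving_toLp (Fin k)).prod (PiLp.volume_preserving_toLp (Fin m))

theorem splitE_fst (e : Fin k ⊕ Fin m ≃ Fin N) (x : E N) (i : Fin k) :
    ((splitE e).toEquiv x).1 i = x (e (Sum.inl i)) := rfl

theorem splitE_snd (e : Fin k ⊕ Fin m ≃ Fin N) (x : E N) (i : Fin m) :
    ((splitE e).toEquiv x).2 i = x (e (Sum.inr i)) := rfl

theorem splitE_symm_inl (e : Fin k ⊕ Fin m ≃ Fin N) (z : E k × E m) (i : Fin k) :
    (splitE e).toEquiv.symm z (e (Sum.inl i)) = z.1 i := by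
  rw [← splitE_fst, MeasurableEquiv.apply_symm_apply]

theorem splitE_symm_inr (e : Fin k ⊕ Fin m ≃ Fin N) (z : E k × E m) (i : Fin m) :
    (splitE e).toEquiv.symm z (e (Sum.inr i)) = z.2 i := by
  rw [← splitE_snd, MeasurableEquiv.apply_symm_apply]

theorem splitE_symm_eq (e : Fin k ⊕ Fin m ≃ Fin N) (z : E k × E m) (x : E N)
    (h1 : ∀ i, x (e (Sum.inl i)) = z.1 i) (h2 : ∀ i, x (e (Sum.inr i)) = z.2 i) :
    (splitE e).toEquiv.symm z = x := by
  rw [MeasurableEquiv.symm_apply_eq]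
  refine Prod.ext ?_ ?_
  · ext i; rw [splitE_fst, h1]
  · ext i; rw [splitE_snd, h2]

theorem continuous_splitE_symm (e : Fin k ⊕ Fin m ≃ Fin N) :
    Continuous (splitE e).toEquiv.symm := by
  refine (PiLp.continuous_toLp 2 _).comp (continuous_pi fun i => ?_)
  obtain ⟨s, rfl⟩ := e.surjective i
  rcases s with j | j
  · exact (by fun_prop : Continuous fun z : E k × E m => z.1 j).congr
      fun z => (splitE_symm_inl e z j).symm
  · exact (by fun_prop : Continuous fun z : E k × E m => z.2 j).congr
      fun z => (splitE_symm_inr e z j).symm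

theorem sum_splitE {M : Type*} [AddCommMonoid M] (e : Fin k ⊕ Fin m ≃ Fin N) (F : Fin N → M) :
    ∑ i, F i = ∑ i, F (e (Sum.inl i)) + ∑ i, F (e (Sum.inr i)) := by
  rw [← Fintype.sum_sum_type fun s => F (e s)]
  exact (Equiv.sum_comp e F).symm

theorem prod_splitE {M : Type*} [CommMonoid M] (e : Fin k ⊕ Fin m ≃ Fin N) (F : Fin N → M) :
    ∏ i, F i = (∏ i, F (e (Sum.inl i))) * ∏ i, F (e (Sum.inr i)) := by
  rw [← Fintype.prod_sum_type fun s => F (e s)]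
  exact (Equiv.prod_comp e F).symm

theorem norm_sq_splitE (e : Fin k ⊕ Fin m ≃ Fin N) (x : E N) :
    ‖x‖ ^ 2 = ‖((splitE e).toEquiv x).1‖ ^ 2 + ‖((splitE e).toEquiv x).2‖ ^ 2 := by
  simp_rw [EuclideanSpace.real_norm_sq_eq]
  exact sum_splitE e fun i => x i ^ 2

theorem inner_splitE (e : Fin k ⊕ Fin m ≃ Fin N) (x y : E N) :
    ⟪x, y⟫_ℝ = ⟪((splitE e).toEquiv x).1, ((splitE e).toEquiv y).1⟫_ℝ
      + ⟪((splitE e).toEquiv x).2, ((splitE e).toEquiv y).2⟫_ℝ := by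
  simp_rw [PiLp.inner_apply]
  exact sum_splitE e fun i => ⟪x i, y i⟫_ℝ

theorem card_splitE (e : Fin k ⊕ Fin m ≃ Fin N) : k + m = N := by
  simpa using Fintype.card_congr e

/-- The partial inner product with a bosonic function does not depend on the choice of the
coordinates. -/
theorem IsBosonic.C_eq {ψ : L2 N} (hψ : IsBosonic ψ) (e e' : Fin k ⊕ Fin m ≃ Fin N) (f : L2 k) :
    (splitE e).C f ψ = (splitE e').C f ψ := by
  refine ext_inner_left ℂ fun φ => ?_
  rw [Split.inner_C, Split.inner_C, inner_eq_integral, inner_eq_integral]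
  -- The permutation relating the two choices of coordinates; the symmetry of ψ absorbs it.
  set σ : Equiv.Perm (Fin N) := e.symm.trans e' with hσ
  have hr : ∀ x : E N, WithLp.toLp 2 (fun i => x (σ i)) = relabel σ x := fun x => by
    ext i; rw [relabel_apply]
  have hs1 : ∀ x, ((splitE e).toEquiv (relabel σ x)).1 = ((splitE e').toEquiv x).1 := fun x => by
    ext i; rw [splitE_fst, splitE_fst, relabel_apply, hσ]; simp
  have hs2 : ∀ x, ((splitE e).toEquiv (relabel σ x)).2 = ((splitE e').toEquiv x).2 := fun x => by
    ext i; rw [splitE_snd, splitE_snd, relabel_apply, hσ]; simp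
  rw [← (measurePreserving_relabel σ).integral_comp (relabel σ).measurableEmbedding]
  refine integral_congr_ae ?_
  filter_upwards [hψ σ, (measurePreserving_relabel σ).quasiMeasurePreserving.ae
    ((splitE e).T_coe f φ), (splitE e').T_coe f φ] with x h1 h2 h3
  rw [h2, h3, hs1, hs2, ← h1, hr]

end SplitE

/-! ### Gaussian wave packets -/

section Gauss

variable {n : ℕ}

theorem gaussHat_re (τ : ℝ) : (-2 * Real.pi ^ 2 * (1 + Complex.I * τ) : ℂ).re < 0 := by
  have : (-2 * Real.pi ^ 2 * (1 + Complex.I * τ) : ℂ).re = -2 * Real.pi ^ 2 := by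
    simp [← Complex.ofReal_pow]
  rw [this]
  nlinarith [Real.pi_pos, sq_pos_of_pos Real.pi_pos]

/-- The Fourier transform of a Gaussian centred at `x`, evolved freely for time `τ`. -/
def gaussHat (x : E n) (τ : ℝ) : L2 n :=
  (memLp_gaussFn (gaussHat_re τ) (-2 * Real.pi * Complex.I) 0 x 2).toLp _

theorem gaussHat_coe (x : E n) (τ : ℝ) : gaussHat x τ =ᵐ[volume]
    gaussFn (-2 * Real.pi ^ 2 * (1 + Complex.I * τ)) (-2 * Real.pi * Complex.I) 0 x :=
  MemLp.coeFn_toLp _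

/-- A Gaussian centred at `x`, evolved freely for time `τ`. -/
def gauss (x : E n) (τ : ℝ) : L2 n := (FT n).symm (gaussHat x τ)

theorem FT_gauss (x : E n) (τ : ℝ) : FT n (gauss x τ) = gaussHat x τ :=
  LinearIsometryEquiv.apply_symm_apply _ _

theorem freeGroup_gauss (x : E n) (τ τ' : ℝ) :
    freeGroup n τ (gauss x τ') = gauss x (τ' + τ) := by
  rw [freeGroup, fourierMultiplier_apply, FT_gauss, gauss]
  congr 1
  refine Lp.ext ?_
  filter_upwards [mulL_coe (freeSymbol n τ) (memLp_freeSymbol n τ) (gaussHat x τ'),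
    gaussHat_coe x τ', gaussHat_coe x (τ' + τ)] with ξ h1 h2 h3
  rw [h1, h2, h3, freeSymbol, gaussFn, gaussFn, ← Complex.exp_add]
  congr 1
  push_cast
  ring

/-- The exponents of `gauss`. -/
def gaussA (τ : ℝ) : ℂ := -(1 / (2 * (1 + Complex.I * τ)))

/-- The exponents of `gauss`. -/
def gaussB (τ : ℝ) : ℂ := 1 / (1 + Complex.I * τ)

/-- The exponents of `gauss`. -/
def gaussD (x : E n) (τ : ℝ) : ℂ :=
  gaussA τ * ((‖x‖ ^ 2 : ℝ) : ℂ)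
    + (n / 2 : ℂ) * Complex.log (1 / (2 * Real.pi * (1 + Complex.I * τ)))

theorem one_add_I_mul_ne_zero (τ : ℝ) : (1 + Complex.I * τ : ℂ) ≠ 0 := fun h => by
  have := congrArg Complex.re h
  simp at this

theorem gaussA_re (τ : ℝ) : (gaussA τ).re = -(1 / (2 * (1 + τ ^ 2))) := by
  have : gaussA τ = ((-(1 / (2 * (1 + τ ^ 2))) : ℝ) : ℂ) * (1 - Complex.I * τ) := by
    rw [gaussA]
    have h1 := one_add_I_mul_ne_zero τ
    have h2 : ((1 : ℂ) + τ ^ 2) ≠ 0 := by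
      have : (0 : ℝ) < 1 + τ ^ 2 := by positivity
      exact_mod_cast this.ne'
    push_cast
    field_simp
    ring_nf
    rw [Complex.I_sq]
    ring
  rw [this, Complex.re_ofReal_mul]
  simp

theorem gaussA_re_neg (τ : ℝ) : (gaussA τ).re < 0 := by
  rw [gaussA_re]
  exact neg_neg_of_pos (by positivity)

/-- Fourier inversion of a Gaussian. The prefactor, a complex power, is written as the exponential
of a logarithm so that it joins the constant exponent and can be differentiated there. -/
theorem gauss_coe (x : E n) (τ : ℝ) :
    gauss x τ =ᵐ[volume] gaussFn (gaussA τ) (gaussB τ) (gaussD x τ) x := by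
  have hint : Integrable (gaussHat x τ : E n → ℂ) :=
    (memLp_one_iff_integrable.mp (memLp_gaussFn (gaussHat_re τ) (-2 * Real.pi * Complex.I) 0 x 1)).congr
      (gaussHat_coe x τ).symm
  filter_upwards [FT_symm_ae_eq (gaussHat x τ) hint] with y hy
  have h0 := one_add_I_mul_ne_zero τ
  have hpi : (Real.pi : ℂ) ≠ 0 := by exact_mod_cast Real.pi_ne_zero
  have hb : 0 < (2 * Real.pi ^ 2 * (1 + Complex.I * τ) : ℂ).re := by
    have := gaussHat_re τ
    rw [show (-2 * Real.pi ^ 2 * (1 + Complex.I * τ) : ℂ)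
      = -(2 * Real.pi ^ 2 * (1 + Complex.I * τ)) by ring, Complex.neg_re] at this
    linarith
  have hc : 𝓕⁻ (gaussHat x τ : E n → ℂ) y
      = 𝓕 (fun v : E n => Complex.exp (-(2 * Real.pi ^ 2 * (1 + Complex.I * τ)) * ‖v‖ ^ 2
        + 2 * Real.pi * Complex.I * ⟪-x, v⟫_ℝ)) (-y) := by
    rw [Real.fourierInv_eq_fourier_neg, Real.fourier_eq, Real.fourier_eq]
    refine integral_congr_ae ?_
    filter_upwards [gaussHat_coe x τ] with ξ h
    rw [h, gaussFn]
    congr 2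
    rw [inner_neg_left]
    push_cast
    ring
  rw [gauss, hy, hc, fourier_gaussian_innerProductSpace' hb, finrank_euclideanSpace,
    Fintype.card_fin]
  have h1 : (Real.pi : ℂ) / (2 * Real.pi ^ 2 * (1 + Complex.I * τ))
      = 1 / (2 * Real.pi * (1 + Complex.I * τ)) := by field_simp
  rw [h1, Complex.cpow_def_of_ne_zero (by
    exact one_div_ne_zero (mul_ne_zero (mul_ne_zero two_ne_zero hpi) h0)), ← Complex.exp_add,
    gaussFn]
  congr 1
  have h2 : ‖-x - -y‖ ^ 2 = ‖x‖ ^ 2 - 2 * ⟪x, y⟫_ℝ + ‖y‖ ^ 2 := by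
    rw [show -x - -y = -(x - y) by abel, norm_neg, norm_sub_sq_real]
  have h2' : ((‖-x - -y‖ : ℝ) : ℂ) ^ 2 = ((‖x‖ ^ 2 - 2 * ⟪x, y⟫_ℝ + ‖y‖ ^ 2 : ℝ) : ℂ) := by
    rw [← h2]; push_cast; rfl
  rw [h2', gaussD, gaussA, gaussB]
  push_cast
  field_simp
  ring

/-- Orthogonality to all translates says that the inverse Fourier transform of a Gaussian times ĥ
vanishes; the Gaussian has no zeros, so ĥ = 0. -/
theorem dense_span_gauss : Dense (Submodule.span ℂ (Set.range fun x : E n => gauss x 0) : Set (L2 n)) := by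
  rw [Submodule.dense_iff_topologicalClosure_eq_top, Submodule.topologicalClosure_eq_top_iff,
    Submodule.eq_bot_iff]
  intro h hh
  have h0 : ∀ x : E n, ⟪gauss x 0, h⟫_ℂ = 0 := fun x =>
    hh _ (Submodule.subset_span ⟨x, rfl⟩)
  have hre : (-2 * Real.pi ^ 2 : ℂ).re < 0 := by simpa using gaussHat_re 0
  set G : E n → ℂ := gaussFn (-2 * Real.pi ^ 2) 0 0 (0 : E n) with hG
  have hGm : MemLp G ∞ volume := memLp_gaussFn hre 0 0 0 ∞
  set w := mulL G hGm (FT n h) with hw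
  have hwc := mulL_coe G hGm (FT n h)
  have hint : Integrable (w : E n → ℂ) :=
    (MemLp.integrable_mul (memLp_gaussFn hre 0 0 0 2) (Lp.memLp (FT n h))).congr hwc.symm
  have hz : (FT n).symm w = 0 := by
    refine Lp.ext ?_
    filter_upwards [FT_symm_ae_eq w hint, Lp.coeFn_zero ℂ 2 (volume : Measure (E n))] with y hy hy0
    rw [hy, hy0, Pi.zero_apply, ← h0 y, gauss, LinearIsometryEquiv.inner_map_eq_flip,
      LinearIsometryEquiv.symm_symm, inner_eq_integral, Real.fourierInv_eq']
    refine integral_congr_ae ?_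
    filter_upwards [hwc, gaussHat_coe y 0] with ξ h1 h2
    rw [hw, h1, h2, hG, gaussFn, gaussFn, ← Complex.exp_conj, smul_eq_mul, ← mul_assoc,
      ← Complex.exp_add]
    congr 2
    simp only [map_add, map_mul, map_neg, map_one, map_zero, map_pow, Complex.conj_ofReal,
      Complex.conj_I, map_ofNat]
    rw [real_inner_comm y ξ]
    push_cast
    ring
  rw [LinearIsometryEquiv.map_eq_zero_iff] at hz
  rw [← LinearIsometryEquiv.map_eq_zero_iff (FT n)]
  refine Lp.ext ?_
  rw [← hw, hz] at hwc
  filter_upwards [hwc, Lp.coeFn_zero ℂ 2 (volume : Measure (E n))] with ξ h1 h2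
  rw [h2] at h1 ⊢
  have h3 : G ξ ≠ 0 := Complex.exp_ne_zero _
  simpa [h3] using h1.symm

theorem dense_span_gauss_at (τ : ℝ) :
    Dense (Submodule.span ℂ (Set.range fun x : E n => gauss x τ) : Set (L2 n)) := by
  have h1 : (freeGroup n τ : L2 n → L2 n) '' (Set.range fun x : E n => gauss x 0)
      = Set.range fun x : E n => gauss x τ := by
    rw [← Set.range_comp]
    congr 1
    funext x
    simp [freeGroup_gauss]
  rw [← h1]
  have h2 : DenseRange (freeGroup n τ) :=
    Function.Surjective.denseRange fun f => ⟨_, freeGroup_self_neg n τ f⟩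
  have h3 := h2.dense_image (freeGroup n τ).continuous (dense_span_gauss (n := n))
  refine h3.mono ?_
  rintro _ ⟨f, hf, rfl⟩
  exact Submodule.image_span_subset_span (freeGroup n τ : L2 n →ₗ[ℂ] L2 n) _ ⟨f, hf, rfl⟩

theorem ext_gauss {F : Type*} [NormedAddCommGroup F] [NormedSpace ℂ F] {A B : L2 n →L[ℂ] F} (τ : ℝ)
    (h : ∀ x, A (gauss x τ) = B (gauss x τ)) : A = B :=
  ContinuousLinearMap.ext_on (dense_span_gauss_at τ) (by rintro _ ⟨x, rfl⟩; exact h x)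

end Gauss

/-! ### Tensor factorization of Gaussians, Fourier transform and Green functions -/

section GaussSplit

variable {k m N : ℕ}

theorem T_gauss (e : Fin k ⊕ Fin m ≃ Fin N) (a : E k) (b : E m) (τ : ℝ) :
    (splitE e).T (gauss a τ) (gauss b τ) = gauss ((splitE e).toEquiv.symm (a, b)) τ := by
  refine Lp.ext ?_
  filter_upwards [(splitE e).T_coe (gauss a τ) (gauss b τ), (splitE e).ae_fst (gauss_coe a τ),
    (splitE e).ae_snd (gauss_coe b τ), gauss_coe ((splitE e).toEquiv.symm (a, b)) τ]
    with x h1 h2 h3 h4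
  rw [h1, h2, h3, h4, gaussFn, gaussFn, gaussFn, ← Complex.exp_add, gaussD, gaussD, gaussD,
    norm_sq_splitE e x, inner_splitE e, norm_sq_splitE e ((splitE e).toEquiv.symm (a, b)),
    MeasurableEquiv.apply_symm_apply]
  have hN : (N : ℂ) = k + m := by exact_mod_cast (card_splitE e).symm
  rw [hN]
  congr 1
  push_cast
  ring

theorem T_gaussHat (e : Fin k ⊕ Fin m ≃ Fin N) (a : E k) (b : E m) (τ : ℝ) :
    (splitE e).T (gaussHat a τ) (gaussHat b τ) = gaussHat ((splitE e).toEquiv.symm (a, b)) τ := by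
  refine Lp.ext ?_
  filter_upwards [(splitE e).T_coe (gaussHat a τ) (gaussHat b τ),
    (splitE e).ae_fst (gaussHat_coe a τ), (splitE e).ae_snd (gaussHat_coe b τ),
    gaussHat_coe ((splitE e).toEquiv.symm (a, b)) τ] with x h1 h2 h3 h4
  rw [h1, h2, h3, h4, gaussFn, gaussFn, gaussFn, ← Complex.exp_add,
    norm_sq_splitE e x, inner_splitE e, MeasurableEquiv.apply_symm_apply]
  congr 1
  push_cast
  ring

/-- Checked on Gaussians, extended by totality first in the second factor and then in the first.
Factorization of multipliers follows. -/
theorem FT_T (e : Fin k ⊕ Fin m ≃ Fin N) (f : L2 k) (φ : L2 m) :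
    FT N ((splitE e).T f φ) = (splitE e).T (FT k f) (FT m φ) := by
  have h1 : ∀ (a : E k) (φ : L2 m),
      FT N ((splitE e).T (gauss a 0) φ) = (splitE e).T (FT k (gauss a 0)) (FT m φ) := fun a φ => by
    have : ((FT N).toContinuousLinearEquiv : L2 N →L[ℂ] L2 N) ∘L (splitE e).T (gauss a 0)
        = (splitE e).T (FT k (gauss a 0)) ∘L ((FT m).toContinuousLinearEquiv : L2 m →L[ℂ] L2 m) :=
      ext_gauss 0 fun b => by
        simp only [ContinuousLinearMap.comp_apply]
        change FT N ((splitE e).T (gauss a 0) (gauss b 0))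
          = (splitE e).T (FT k (gauss a 0)) (FT m (gauss b 0))
        rw [T_gauss, FT_gauss, FT_gauss, FT_gauss, T_gaussHat]
    exact congrArg (fun A : L2 m →L[ℂ] L2 N => A φ) this
  have : ((FT N).toContinuousLinearEquiv : L2 N →L[ℂ] L2 N) ∘L (splitE e).swap.T φ
      = (splitE e).swap.T (FT m φ) ∘L ((FT k).toContinuousLinearEquiv : L2 k →L[ℂ] L2 k) :=
    ext_gauss 0 fun a => by
      simp only [ContinuousLinearMap.comp_apply, Split.swap_T]
      exact h1 a φ
  have h2 := congrArg (fun A : L2 k →L[ℂ] L2 N => A f) this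
  simp only [ContinuousLinearMap.comp_apply, Split.swap_T] at h2
  exact h2

theorem FT_symm_T (e : Fin k ⊕ Fin m ≃ Fin N) (f : L2 k) (φ : L2 m) :
    (FT N).symm ((splitE e).T f φ) = (splitE e).T ((FT k).symm f) ((FT m).symm φ) := by
  rw [LinearIsometryEquiv.symm_apply_eq, FT_T, LinearIsometryEquiv.apply_symm_apply,
    LinearIsometryEquiv.apply_symm_apply]

theorem mulL_T (e : Fin k ⊕ Fin m ≃ Fin N) {u : E N → ℂ} {v : E k → ℂ} {w : E m → ℂ}
    (hu : MemLp u ∞ volume) (hv : MemLp v ∞ volume) (hw : MemLp w ∞ volume)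
    (h : ∀ x, u x = v ((splitE e).toEquiv x).1 * w ((splitE e).toEquiv x).2) (f : L2 k) (φ : L2 m) :
    mulL u hu ((splitE e).T f φ) = (splitE e).T (mulL v hv f) (mulL w hw φ) := by
  refine Lp.ext ?_
  filter_upwards [mulL_coe u hu ((splitE e).T f φ), (splitE e).T_coe f φ,
    (splitE e).T_coe (mulL v hv f) (mulL w hw φ), (splitE e).ae_fst (mulL_coe v hv f),
    (splitE e).ae_snd (mulL_coe w hw φ)] with x h1 h2 h3 h4 h5
  rw [h1, h2, h3, h4, h5, h]
  ring

theorem freeGroup_T (e : Fin k ⊕ Fin m ≃ Fin N) (τ : ℝ) (f : L2 k) (φ : L2 m) :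
    freeGroup N τ ((splitE e).T f φ) = (splitE e).T (freeGroup k τ f) (freeGroup m τ φ) := by
  simp only [freeGroup, fourierMultiplier_apply]
  rw [FT_T, mulL_T e _ (memLp_freeSymbol k τ) (memLp_freeSymbol m τ), FT_symm_T]
  intro x
  rw [freeSymbol, freeSymbol, freeSymbol, ← Complex.exp_add, norm_sq_splitE e x]
  congr 1
  push_cast
  ring

/-- The free group factorizes over the two groups of particles; its first factor passes to the
contracted vector with reversed time. -/
theorem C_freeGroup (e : Fin k ⊕ Fin m ≃ Fin N) (τ : ℝ) (f : L2 k) (ψ : L2 N) :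
    (splitE e).C f (freeGroup N τ ψ) = freeGroup m τ ((splitE e).C (freeGroup k (-τ) f) ψ) := by
  refine ext_inner_left ℂ fun φ => ?_
  rw [Split.inner_C, ← neg_neg τ, ← inner_freeGroup_left, ← inner_freeGroup_left, Split.inner_C,
    neg_neg, freeGroup_T]

theorem T_energySymbol (e : Fin k ⊕ Fin m ≃ Fin N) :
    (splitE e).T ((memLp_two_energySymbol k).toLp _) ((memLp_two_energySymbol m).toLp _)
      = (memLp_two_energySymbol N).toLp _ := by
  refine Lp.ext ?_
  filter_upwards [(splitE e).T_coe ((memLp_two_energySymbol k).toLp _)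
    ((memLp_two_energySymbol m).toLp _), (splitE e).ae_fst (memLp_two_energySymbol k).coeFn_toLp,
    (splitE e).ae_snd (memLp_two_energySymbol m).coeFn_toLp,
    (memLp_two_energySymbol N).coeFn_toLp] with x h1 h2 h3 h4
  rw [h1, h2, h3, h4, energySymbol, energySymbol, energySymbol, ← Complex.ofReal_mul,
    prod_splitE e]
  rfl

theorem T_green (e : Fin k ⊕ Fin m ≃ Fin N) (y : E k) (z : E m) :
    (splitE e).T (green y) (green z) = green ((splitE e).toEquiv.symm (y, z)) := by
  rw [green, green, green, ← FT_symm_T, ← T_energySymbol e,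
    mulL_T e _ (memLp_planeWave y) (memLp_planeWave z)]
  intro x
  rw [planeWave, planeWave, planeWave, ← Complex.exp_add, inner_splitE e,
    MeasurableEquiv.apply_symm_apply]
  congr 1
  push_cast
  ring

end GaussSplit

/-! ### Weakly differentiable paths -/

/-- Compare u with the primitive w of v starting at u 0: against each vector of the total set, u - w
has zero derivative and vanishes at 0. Hence u = w and the weak derivative is a norm derivative. -/
theorem hasDerivAt_of_inner {H : Type*} [NormedAddCommGroup H] [InnerProductSpace ℂ H]
    [CompleteSpace H] {u v : ℝ → H} (hv : Continuous v) {G : Set H}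
    (hG : Dense (Submodule.span ℂ G : Set H))
    (h : ∀ g ∈ G, ∀ s, HasDerivAt (fun s => ⟪g, u s⟫_ℂ) ⟪g, v s⟫_ℂ s) (s : ℝ) :
    HasDerivAt u (v s) s := by
  set w : ℝ → H := fun s => u 0 + ∫ r in (0 : ℝ)..s, v r with hw
  have hwd : ∀ s, HasDerivAt w (v s) s := fun s =>
    (intervalIntegral.integral_hasDerivAt_right (hv.intervalIntegrable _ _)
      (hv.stronglyMeasurableAtFilter _ _) hv.continuousAt).const_add _
  have huw : u = w := by
    funext s
    have : innerSL ℂ (u s - w s) = 0 := by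
      refine ContinuousLinearMap.ext_on hG fun g hg => ?_
      have hd : ∀ s, HasDerivAt (fun s => ⟪g, u s - w s⟫_ℂ) 0 s := fun s => by
        have h1 := (h g hg s).sub (((innerSL ℂ g).restrictScalars ℝ).hasFDerivAt.comp_hasDerivAt s (hwd s))
        simp only [ContinuousLinearMap.coe_restrictScalars', innerSL_apply_apply, sub_self] at h1
        refine h1.congr_of_eventuallyEq (Eventually.of_forall fun s => ?_)
        simp
      have hc := is_const_of_deriv_eq_zero (fun s => (hd s).differentiableAt)
        (fun s => (hd s).deriv) s 0
      simp only [hw, intervalIntegral.integral_same, add_zero, sub_self, inner_zero_right] at hc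
      rw [innerSL_apply_apply, ← inner_conj_symm, hc]
      simp
    have h2 := congrArg (fun A => A (u s - w s)) this
    rw [innerSL_apply_apply, _root_.zero_apply, inner_self_eq_zero, sub_eq_zero] at h2
    exact h2
  rw [huw]
  exact hwd s

/-! ### Integral kernels -/

section Kernels

variable {k : ℕ}

theorem HasKernel.unique {A B : Op k} {K : E k → E k → ℂ} (hA : HasKernel A K)
    (hB : HasKernel B K) : A = B := by
  ext1 f
  refine Lp.ext ?_
  filter_upwards [hA f, hB f] with y h1 h2
  rw [h1.2, h2.2]

theorem HasKernel.congr {A : Op k} {K K' : E k → E k → ℂ} (hA : HasKernel A K)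
    (h : ∀ᵐ y, ∀ᵐ y', K y y' = K' y y') : HasKernel A K' := by
  intro f
  filter_upwards [hA f, h] with y h1 h2
  have h3 : (fun y' => K y y' * f y') =ᵐ[volume] fun y' => K' y y' * f y' := by
    filter_upwards [h2] with y' h4
    rw [h4]
  exact ⟨h1.1.congr h3, by rw [h1.2, integral_congr_ae h3]⟩

theorem HasKernel.opOfKernel_eq {A : Op k} {K : E k → E k → ℂ} (hA : HasKernel A K) :
    opOfKernel K = A := by
  have h : ∃ A : Op k, HasKernel A K := ⟨A, hA⟩
  rw [opOfKernel, dif_pos h]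
  exact h.choose_spec.unique hA

/-- The trivial splitting of a product space. -/
def Split.refl (α β : Type*) [MeasureSpace α] [MeasureSpace β] : Split (α × β) α β where
  toEquiv := MeasurableEquiv.refl _
  mp := MeasurePreserving.id _

/-- Bessel's inequality: P is the sum of the orthogonal projections of ψ onto v_i ⊗ L²(β), so ‖P‖² =
⟨P, ψ⟩. -/
theorem Split.sum_norm_sq_C_le {X α β : Type*} [MeasureSpace X] [MeasureSpace α] [MeasureSpace β]
    [SigmaFinite (volume : Measure α)] [SigmaFinite (volume : Measure β)] (p : Split X α β)
    {n : ℕ} {v : Fin n → LL α} (hv : Orthonormal ℂ v) (ψ : LL X) :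
    ∑ i, ‖p.C (v i) ψ‖ ^ 2 ≤ ‖ψ‖ ^ 2 := by
  classical
  set P : LL X := ∑ i, p.T (v i) (p.C (v i) ψ) with hP
  set S := ∑ i, ‖p.C (v i) ψ‖ ^ 2 with hS
  have h1 : ⟪P, ψ⟫_ℂ = (S : ℂ) := by
    rw [hP, sum_inner, hS]
    push_cast
    refine Finset.sum_congr rfl fun i _ => ?_
    rw [← Split.inner_C, inner_self_eq_norm_sq_to_K]
    rfl
  have h2 : ⟪P, P⟫_ℂ = (S : ℂ) := by
    rw [hP, sum_inner, hS]
    push_cast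
    refine Finset.sum_congr rfl fun i _ => ?_
    rw [inner_sum, Finset.sum_eq_single i]
    · rw [Split.inner_T_T, orthonormal_iff_ite.mp hv, if_pos rfl, one_mul,
        inner_self_eq_norm_sq_to_K]
      rfl
    · intro j _ hj
      rw [Split.inner_T_T, orthonormal_iff_ite.mp hv, if_neg hj.symm, zero_mul]
    · simp
  have h3 : ‖P‖ ^ 2 = S := by
    rw [inner_self_eq_norm_sq_to_K] at h2
    exact Complex.ofReal_injective (by push_cast; exact h2)
  have h4 : S ≤ ‖P‖ * ‖ψ‖ := by
    have := norm_inner_le_norm (𝕜 := ℂ) P ψ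
    rw [h1, Complex.norm_real] at this
    exact (Real.le_norm_self S).trans this
  nlinarith [sq_nonneg (‖P‖ - ‖ψ‖), norm_nonneg P, norm_nonneg ψ]

theorem Split.C_add_left {X α β : Type*} [MeasureSpace X] [MeasureSpace α] [MeasureSpace β]
    [SigmaFinite (volume : Measure α)] [SigmaFinite (volume : Measure β)] (p : Split X α β)
    (f g : LL α) (ψ : LL X) : p.C (f + g) ψ = p.C f ψ + p.C g ψ := by
  refine ext_inner_left ℂ fun φ => ?_
  rw [inner_add_right, ← p.inner_swap_C _ φ, ← p.inner_swap_C _ φ, ← p.inner_swap_C _ φ,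
    inner_add_left]

theorem Split.C_smul_left {X α β : Type*} [MeasureSpace X] [MeasureSpace α] [MeasureSpace β]
    [SigmaFinite (volume : Measure α)] [SigmaFinite (volume : Measure β)] (p : Split X α β)
    (c : ℂ) (f : LL α) (ψ : LL X) : p.C (c • f) ψ = conj c • p.C f ψ := by
  refine ext_inner_left ℂ fun φ => ?_
  rw [inner_smul_right, ← p.inner_swap_C _ φ, ← p.inner_swap_C _ φ, inner_smul_left]

theorem inner_star_left (f g : L2 k) : ⟪star f, g⟫_ℂ = ⟪star g, f⟫_ℂ := by
  rw [inner_eq_integral, inner_eq_integral]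
  refine integral_congr_ae ?_
  filter_upwards [Lp.coeFn_star f, Lp.coeFn_star g] with x h1 h2
  rw [h1, h2]
  simp [mul_comm]

theorem inner_star_star (f g : L2 k) : ⟪star f, star g⟫_ℂ = ⟪g, f⟫_ℂ := by
  rw [inner_eq_integral, inner_eq_integral]
  refine integral_congr_ae ?_
  filter_upwards [Lp.coeFn_star f, Lp.coeFn_star g] with x h1 h2
  rw [h1, h2]
  simp [mul_comm]

/-- Square integrable kernels define Hilbert–Schmidt operators. -/
theorem exists_hasKernel {K : E k → E k → ℂ} (hK : MemLp (Function.uncurry K) 2 volume) {M : ℝ}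
    (hM : ∫ z, ‖Function.uncurry K z‖ ^ 2 ≤ M) :
    ∃ A : Op k, HasKernel A K ∧ HSBound A M := by
  -- The operator contracts this vector with `star f`; contraction is antilinear, and the star
  -- restores linearity in `f`.
  set κ : LL (E k × E k) := hK.toLp _ with hκ
  set p := Split.refl (E k) (E k) with hp
  have hadd : ∀ f g : L2 k, p.swap.C (star (f + g)) κ
      = p.swap.C (star f) κ + p.swap.C (star g) κ := fun f g => by
    refine ext_inner_left ℂ fun φ => ?_
    rw [inner_add_right, ← p.swap.inner_swap_C _ φ, ← p.swap.inner_swap_C _ φ,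
      ← p.swap.inner_swap_C _ φ, inner_star_left, inner_star_left f, inner_star_left g,
      inner_add_right]
  have hsmul : ∀ (c : ℂ) (f : L2 k), p.swap.C (star (c • f)) κ = c • p.swap.C (star f) κ :=
    fun c f => by
      refine ext_inner_left ℂ fun φ => ?_
      rw [inner_smul_right, ← p.swap.inner_swap_C _ φ, ← p.swap.inner_swap_C _ φ, inner_star_left,
        inner_star_left f, inner_smul_right]
  have hst : ∀ f : L2 k, ‖star f‖ = ‖f‖ := fun f => by
    have h := inner_star_star f f
    rw [inner_self_eq_norm_sq_to_K, inner_self_eq_norm_sq_to_K] at h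
    exact (sq_eq_sq₀ (norm_nonneg _) (norm_nonneg _)).mp (by exact_mod_cast h)
  set A : Op k := LinearMap.mkContinuous
    { toFun := fun f => p.swap.C (star f) κ
      map_add' := hadd
      map_smul' := hsmul } ‖κ‖ (fun f => by
        change ‖p.swap.C (star f) κ‖ ≤ _
        rw [mul_comm, ← hst f]
        exact p.swap.norm_C_apply_le _ _) with hA
  have hAa : ∀ f, A f = p.swap.C (star f) κ := fun f => rfl
  refine ⟨A, fun f => ?_, fun n v hv => ?_⟩
  · have hκc : ∀ᵐ y, ∀ᵐ y', κ (y, y') = K y y' := Measure.ae_ae_of_ae_prod hK.coeFn_toLp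
    have hκ2 : ∀ᵐ y, MemLp (fun y' => K y y') 2 volume := by
      filter_upwards [((memLp_two_iff_integrable_sq_norm hK.1).mp hK).prod_right_ae,
        hK.1.prodMk_left] with y h1 h2
      exact (memLp_two_iff_integrable_sq_norm h2).mpr h1
    filter_upwards [hκc, hκ2, p.swap.C_coe (star f) κ] with y h1 h2 h3
    refine ⟨MemLp.integrable_mul h2 (Lp.memLp f), ?_⟩
    rw [hAa, h3]
    refine integral_congr_ae ?_
    filter_upwards [h1, Lp.coeFn_star f] with y' h4 h5
    rw [h5, mul_comm, ← h4]
    simp [hp, Split.refl, Split.swap]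
    left
    rfl
  · have hv' : Orthonormal ℂ fun i => star (v i) := by
      classical
      rw [orthonormal_iff_ite] at hv ⊢
      intro i j
      rw [inner_star_star, hv]
      simp [eq_comm]
    have h1 := p.swap.sum_norm_sq_C_le hv' κ
    have h2 : ‖κ‖ ^ 2 = ∫ z, ‖Function.uncurry K z‖ ^ 2 := by
      have e := lintegral_enorm_sq κ
      rw [← ENNReal.ofReal_eq_ofReal_iff (by positivity) (by positivity), ← e,
        ofReal_integral_eq_lintegral_ofReal ((memLp_two_iff_integrable_sq_norm hK.1).mp hK)
        (ae_of_all _ fun x => by positivity)]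
      refine lintegral_congr_ae ?_
      filter_upwards [hK.coeFn_toLp] with z hz
      rw [hz, ENNReal.ofReal_pow (norm_nonneg _), ofReal_norm]
    exact h1.trans (h2.le.trans hM)

end Kernels

/-! ### Marginals -/

section Marginals

variable {k N : ℕ}

/-- The first `k` coordinates and the rest. -/
def joinEquiv (h : k ≤ N) : Fin k ⊕ Fin (N - k) ≃ Fin N :=
  finSumFinEquiv.trans (finCongr (Nat.add_sub_cancel' h))

theorem splitE_joinEquiv_symm (h : k ≤ N) (z : E k × E (N - k)) :
    (splitE (joinEquiv h)).toEquiv.symm z = join z.1 z.2 := by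
  refine splitE_symm_eq _ _ _ (fun i => ?_) fun i => ?_
  · simp [joinEquiv, join]
  · simp [joinEquiv, join]

/-- The reduced density operator. -/
theorem exists_hasKernel_marginal (h : k ≤ N) (ψ : L2 N) :
    ∃ A : Op k, HasKernel A (marginalKernel k ψ) ∧ ∀ f g : L2 k,
      ⟪g, A f⟫_ℂ = ⟪(splitE (joinEquiv h)).C f ψ, (splitE (joinEquiv h)).C g ψ⟫_ℂ := by
  set p := splitE (joinEquiv h) with hp
  have hin : ∀ f g : L2 k, ⟪g, p.swap.C (p.C f ψ) ψ⟫_ℂ = ⟪p.C f ψ, p.C g ψ⟫_ℂ := fun f g =>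
    p.inner_swap_C _ _ _
  -- Contract ψ with `f` over the first group, then contract ψ with the result over the second. Two
  -- antilinear steps make the outcome linear in `f`.
  set A : Op k := LinearMap.mkContinuous
    { toFun := fun f => p.swap.C (p.C f ψ) ψ
      map_add' := fun f g => by
        refine ext_inner_left ℂ fun φ => ?_
        rw [inner_add_right, hin, hin, hin, p.C_add_left, inner_add_left]
      map_smul' := fun c f => by
        refine ext_inner_left ℂ fun φ => ?_
        rw [inner_smul_right, hin, hin, p.C_smul_left, inner_smul_left]
        simp } (‖ψ‖ * ‖ψ‖) (fun f => by
        refine (p.swap.norm_C_apply_le (p.C f ψ) ψ).trans ?_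
        have := p.norm_C_apply_le f ψ
        calc ‖p.C f ψ‖ * ‖ψ‖ ≤ ‖f‖ * ‖ψ‖ * ‖ψ‖ := by gcongr
          _ = _ := by ring) with hA
  have hAa : ∀ f, A f = p.swap.C (p.C f ψ) ψ := fun f => rfl
  refine ⟨A, fun f => ?_, fun f g => hin f g⟩
  have hmeas : AEStronglyMeasurable (fun z : E k × E (N - k) => ψ (join z.1 z.2)) volume := by
    have := (Lp.aestronglyMeasurable ψ).comp_measurePreserving p.mp_symm
    refine this.congr (ae_of_all _ fun z => ?_)
    simp [hp, splitE_joinEquiv_symm]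
  have hψ2 : ∀ᵐ y : E k, MemLp (fun z : E (N - k) => ψ (join y z)) 2 volume := by
    have hi : Integrable (fun z : E k × E (N - k) => ‖ψ (join z.1 z.2)‖ ^ 2) := by
      refine ((memLp_two_iff_integrable_sq_norm
        ((Lp.aestronglyMeasurable ψ).comp_measurePreserving p.mp_symm)).mp
          ((Lp.memLp ψ).comp_measurePreserving p.mp_symm)).congr (ae_of_all _ fun z => ?_)
      simp [hp, splitE_joinEquiv_symm]
    filter_upwards [hi.prod_right_ae, hmeas.prodMk_left] with a h1 h2
    exact (memLp_two_iff_integrable_sq_norm h2).mpr h1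
  filter_upwards [hψ2, p.swap.C_coe (p.C f ψ) ψ] with y hy hCy
  set φ : L2 (N - k) := hy.toLp _ with hφ
  have hφc := hy.coeFn_toLp
  have hint := p.integrable_tensor_mul f φ ψ
  have hint2 : Integrable (fun z : E (N - k) × E k =>
      ψ (join y z.1) * conj (ψ (join z.2 z.1)) * f z.2) (volume.prod volume) := by
    have h0 := (Complex.conjCLE : ℂ →L[ℝ] ℂ).integrable_comp hint
    refine h0.congr ?_
    filter_upwards [Measure.quasiMeasurePreserving_fst.ae hφc] with z hz
    rw [← hφ] at hz
    rw [hz]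
    simp [hp, splitE_joinEquiv_symm]
    ring
  have hint3 := hint2.integral_prod_right
  simp_rw [integral_mul_const] at hint3
  refine ⟨hint3, ?_⟩
  rw [hAa, hCy]
  simp only [marginalKernel]
  simp_rw [← integral_mul_const]
  rw [← integral_integral_swap (f := fun (z : E (N - k)) (y' : E k) =>
    ψ (join y z) * conj (ψ (join y' z)) * f y') hint2]
  refine integral_congr_ae ?_
  filter_upwards [p.C_coe f ψ] with z hz
  rw [hz, ← integral_conj, ← integral_mul_const]
  refine integral_congr_ae (ae_of_all _ fun y' => ?_)
  simp [hp, splitE_joinEquiv_symm, Split.swap_symm_apply]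
  ring

end Marginals

/-! ### Paths of Gaussians -/

theorem tendsto_toLp {X : Type*} [MeasureSpace X] {γ : Type*} {l : Filter γ}
    [l.IsCountablyGenerated] {f : γ → X → ℂ} {f₀ : X → ℂ} (hf : ∀ n, MemLp (f n) 2 volume)
    (hf₀ : MemLp f₀ 2 volume) {b : X → ℝ} (hb : MemLp b 2 volume)
    (hfb : ∀ᶠ n in l, ∀ x, ‖f n x‖ ≤ b x) (hfb₀ : ∀ x, ‖f₀ x‖ ≤ b x)
    (h : ∀ x, Tendsto (fun n => f n x) l (𝓝 (f₀ x))) :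
    Tendsto (fun n => (hf n).toLp (f n)) l (𝓝 (hf₀.toLp f₀)) := by
  rw [tendsto_iff_norm_sub_tendsto_zero]
  have hsq : ∀ n, ‖(hf n).toLp (f n) - hf₀.toLp f₀‖ ^ 2 = ∫ x, ‖f n x - f₀ x‖ ^ 2 := fun n => by
    have e := inner_self_eq_norm_sq (𝕜 := ℂ) ((hf n).toLp (f n) - hf₀.toLp f₀)
    rw [← e, ← MemLp.toLp_sub, inner_eq_integral]
    have : ∫ x, conj (((hf n).sub hf₀).toLp (f n - f₀) x) * ((hf n).sub hf₀).toLp (f n - f₀) x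
        = ∫ x, ((‖f n x - f₀ x‖ ^ 2 : ℝ) : ℂ) := by
      refine integral_congr_ae ?_
      filter_upwards [((hf n).sub hf₀).coeFn_toLp] with x hx
      rw [hx, mul_comm, Complex.mul_conj, Complex.normSq_eq_norm_sq]
      rfl
    rw [this, integral_complex_ofReal]
    simp
  have key : Tendsto (fun n => ∫ x, ‖f n x - f₀ x‖ ^ 2) l (𝓝 (∫ x : X, (0 : ℝ))) := by
    refine tendsto_integral_filter_of_dominated_convergence (fun x => 4 * b x ^ 2)
      (Eventually.of_forall fun n => ((hf n).1.sub hf₀.1).norm.pow 2) ?_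
      (((memLp_two_iff_integrable_sq hb.1).mp hb).const_mul _) (ae_of_all _ fun x => ?_)
    · filter_upwards [hfb] with n hn
      refine ae_of_all _ fun x => ?_
      rw [Real.norm_of_nonneg (by positivity)]
      have h1 : ‖f n x - f₀ x‖ ≤ 2 * b x := (norm_sub_le _ _).trans (by linarith [hn x, hfb₀ x])
      calc _ ≤ (2 * b x) ^ 2 := by gcongr
        _ = _ := by ring
    · simpa using (((h x).sub_const (f₀ x)).norm).pow 2
  simp_rw [← hsq] at key
  rw [integral_zero] at key
  have := (Real.continuous_sqrt.tendsto 0).comp key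
  simpa [Function.comp_def, Real.sqrt_sq (norm_nonneg _)] using this

/-- A product rule for `w` that is merely continuous and differentiable against the single vector `u
s₀`: the increment of `u` is paired with `w s` itself, so no derivative of `w` in norm is needed. -/
theorem hasDerivAt_inner_of_weak {H : Type*} [NormedAddCommGroup H] [InnerProductSpace ℂ H]
    {u w : ℝ → H} {u' : H} {d : ℂ} {s₀ : ℝ} (hu : HasDerivAt u u' s₀) (hw : ContinuousAt w s₀)
    (hd : HasDerivAt (fun s => ⟪u s₀, w s⟫_ℂ) d s₀) :
    HasDerivAt (fun s => ⟪u s, w s⟫_ℂ) (⟪u', w s₀⟫_ℂ + d) s₀ := by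
  have h1 : HasDerivAt (fun s => ⟪u s - u s₀, w s⟫_ℂ) ⟪u', w s₀⟫_ℂ s₀ := by
    rw [hasDerivAt_iff_tendsto_slope] at hu ⊢
    have h2 := hu.inner (𝕜 := ℂ) (hw.tendsto.mono_left nhdsWithin_le_nhds)
    refine h2.congr fun s => ?_
    simp only [slope, vsub_eq_sub, sub_self, inner_zero_left, sub_zero]
    rw [← Complex.coe_smul, inner_smul_left, Complex.conj_ofReal, Complex.real_smul]
  refine (h1.add hd).congr_of_eventuallyEq (Eventually.of_forall fun s => ?_)
  simp

/-! ### Differentiability of Gaussian paths in L² -/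

section GaussPath

variable {n : ℕ}

/-- A quadratic polynomial times a Gaussian. -/
def polyGauss (p q r A B D : ℂ) (x₀ x : E n) : ℂ :=
  (p * ((‖x‖ ^ 2 : ℝ) : ℂ) + q * ((⟪x₀, x⟫_ℝ : ℝ) : ℂ) + r) * gaussFn A B D x₀ x

/-- Half of the Gaussian decay absorbs the polynomial and the linear exponent; the other half
remains as a majorant uniform over bounded coefficients. -/
theorem exists_norm_polyGauss_le {a : ℝ} (ha : 0 < a) (R : ℝ) (hR : 0 ≤ R) (x₀ : E n) :
    ∃ M : ℝ, ∀ p q r A B D : ℂ, ‖p‖ ≤ R → ‖q‖ ≤ R → ‖r‖ ≤ R → A.re ≤ -a → ‖B‖ ≤ R → ‖D‖ ≤ R →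
      ∀ x, ‖polyGauss p q r A B D x₀ x‖ ≤ M * ‖gaussFn (-(a / 2 : ℝ) : ℂ) 0 0 (0 : E n) x‖ := by
  obtain ⟨M, hM⟩ := pow_mul_exp_le (half_pos ha) (R * ‖x₀‖) R 2
  refine ⟨R * (1 + ‖x₀‖) * M, fun p q r A B D hp hq hr hA hB hD x => ?_⟩
  have hin : |⟪x₀, x⟫_ℝ| ≤ ‖x₀‖ * ‖x‖ := abs_real_inner_le_norm _ _
  have h1 : ‖p * ((‖x‖ ^ 2 : ℝ) : ℂ) + q * ((⟪x₀, x⟫_ℝ : ℝ) : ℂ) + r‖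
      ≤ R * (1 + ‖x₀‖) * (1 + ‖x‖) ^ 2 := by
    refine (norm_add₃_le).trans ?_
    rw [norm_mul, norm_mul, Complex.norm_real, Complex.norm_real, Real.norm_eq_abs,
      Real.norm_eq_abs, abs_of_nonneg (by positivity : 0 ≤ ‖x‖ ^ 2)]
    calc _ ≤ R * ‖x‖ ^ 2 + R * (‖x₀‖ * ‖x‖) + R := by gcongr
      _ = R * (‖x‖ ^ 2 + ‖x₀‖ * ‖x‖ + 1) := by ring
      _ ≤ R * ((1 + ‖x₀‖) * (1 + ‖x‖) ^ 2) := by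
        gcongr
        nlinarith [norm_nonneg x, norm_nonneg x₀, mul_nonneg (norm_nonneg x₀) (norm_nonneg x),
          mul_nonneg (norm_nonneg x₀) (sq_nonneg ‖x‖)]
      _ = _ := by ring
  have h2 : ‖gaussFn A B D x₀ x‖ ≤ Real.exp (-(a / 2) * ‖x‖ ^ 2 + R * ‖x₀‖ * ‖x‖ + R)
      * Real.exp (-(a / 2) * ‖x‖ ^ 2) := by
    rw [norm_gaussFn, ← Real.exp_add]
    refine Real.exp_le_exp.mpr ?_
    have e1 : A.re * ‖x‖ ^ 2 ≤ -a * ‖x‖ ^ 2 := by gcongr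
    have e2 : B.re * ⟪x₀, x⟫_ℝ ≤ R * (‖x₀‖ * ‖x‖) := by
      refine (le_abs_self _).trans ?_
      rw [abs_mul]
      gcongr
      exact (Complex.abs_re_le_norm B).trans hB
    have e3 : D.re ≤ R := (Complex.re_le_norm D).trans hD
    linarith
  have h3 : ‖gaussFn (-(a / 2 : ℝ) : ℂ) 0 0 (0 : E n) x‖ = Real.exp (-(a / 2) * ‖x‖ ^ 2) := by
    rw [norm_gaussFn]
    simp
  rw [polyGauss, norm_mul, h3]
  calc _ ≤ (R * (1 + ‖x₀‖) * (1 + ‖x‖) ^ 2) * (Real.exp (-(a / 2) * ‖x‖ ^ 2 + R * ‖x₀‖ * ‖x‖ + R)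
        * Real.exp (-(a / 2) * ‖x‖ ^ 2)) := by gcongr
    _ = R * (1 + ‖x₀‖) * ((1 + ‖x‖) ^ 2 * Real.exp (-(a / 2) * ‖x‖ ^ 2 + R * ‖x₀‖ * ‖x‖ + R))
        * Real.exp (-(a / 2) * ‖x‖ ^ 2) := by ring
    _ ≤ _ := by
        gcongr
        exact hM _ (norm_nonneg x)

theorem continuous_polyGauss (p q r A B D : ℂ) (x₀ : E n) :
    Continuous (polyGauss p q r A B D x₀) := by
  have := continuous_gaussFn A B D x₀
  unfold polyGauss
  fun_prop

theorem memLp_polyGauss {A : ℂ} (hA : A.re < 0) (p q r B D : ℂ) (x₀ : E n) :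
    MemLp (polyGauss p q r A B D x₀) 2 volume := by
  set R := max (max ‖p‖ ‖q‖) (max ‖r‖ (max ‖B‖ ‖D‖)) with hR
  obtain ⟨M, hM⟩ := exists_norm_polyGauss_le (n := n) (a := -A.re) (by linarith) R
    ((norm_nonneg p).trans (by simp [hR])) x₀
  refine (memLp_gaussFn (n := n) (A := (-(-A.re / 2 : ℝ) : ℂ)) ?_ 0 0 0 2).of_le_mul (c := M)
    (continuous_polyGauss p q r A B D x₀).aestronglyMeasurable
    (ae_of_all _ fun x => hM p q r A B D ?_ ?_ ?_ ?_ ?_ ?_ x)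
  · rw [Complex.neg_re, Complex.ofReal_re]; linarith
  all_goals first | linarith | simp [hR]

theorem hasDerivAt_gaussFn {A B D : ℝ → ℂ} {A' B' D' : ℂ} {s : ℝ} (hA : HasDerivAt A A' s)
    (hB : HasDerivAt B B' s) (hD : HasDerivAt D D' s) (x₀ x : E n) :
    HasDerivAt (fun s => gaussFn (A s) (B s) (D s) x₀ x)
      (polyGauss A' B' D' (A s) (B s) (D s) x₀ x) s := by
  have := (((hA.mul_const ((‖x‖ ^ 2 : ℝ) : ℂ)).add (hB.mul_const ((⟪x₀, x⟫_ℝ : ℝ) : ℂ))).add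
    hD).cexp
  refine this.congr_deriv ?_
  rw [polyGauss, gaussFn, mul_comm]
  rfl

/-- A differentiable path of Gaussians is differentiable in `L²`. -/
theorem hasDerivAt_gaussPath {A B D A' B' D' : ℝ → ℂ} (hA : ∀ s, HasDerivAt A (A' s) s)
    (hB : ∀ s, HasDerivAt B (B' s) s) (hD : ∀ s, HasDerivAt D (D' s) s) (hA' : Continuous A')
    (hB' : Continuous B') (hD' : Continuous D') (hre : ∀ s, (A s).re < 0) (x₀ : E n) (s₀ : ℝ) :
    HasDerivAt (fun s => (memLp_gaussFn (hre s) (B s) (D s) x₀ 2).toLp _)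
      ((memLp_polyGauss (hre s₀) (A' s₀) (B' s₀) (D' s₀) (B s₀) (D s₀) x₀).toLp _) s₀ := by
  have hAc : Continuous A := continuous_iff_continuousAt.mpr fun s => (hA s).continuousAt
  have hBc : Continuous B := continuous_iff_continuousAt.mpr fun s => (hB s).continuousAt
  have hDc : Continuous D := continuous_iff_continuousAt.mpr fun s => (hD s).continuousAt
  set a := -(A s₀).re / 2 with ha
  have hapos : 0 < a := by have := hre s₀; rw [ha]; linarith
  set N : ℝ → ℝ := fun s => ‖A' s‖ + ‖B' s‖ + ‖D' s‖ + ‖B s‖ + ‖D s‖ with hN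
  have hNc : Continuous N := by rw [hN]; fun_prop
  set R := N s₀ + 1 with hR
  have hR0 : 0 ≤ R := by rw [hR, hN]; positivity
  obtain ⟨M, hM⟩ := exists_norm_polyGauss_le (n := n) hapos R hR0 x₀
  obtain ⟨δ, hδ, hball⟩ : ∃ δ > 0, ∀ s ∈ Metric.ball s₀ δ, N s < R ∧ (A s).re < -a := by
    have h1 : ∀ᶠ s in 𝓝 s₀, N s < R := hNc.continuousAt.eventually_lt_const (by rw [hR]; linarith)
    have h2 : ∀ᶠ s in 𝓝 s₀, (A s).re < -a :=
      (Complex.continuous_re.comp hAc).continuousAt.eventually_lt_const (by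
        simp only [Function.comp]; rw [ha]; linarith [hre s₀])
    exact Metric.eventually_nhds_iff_ball.mp (h1.and h2)
  have hbd : ∀ s ∈ Metric.ball s₀ δ, ∀ x, ‖polyGauss (A' s) (B' s) (D' s) (A s) (B s) (D s) x₀ x‖
      ≤ M * ‖gaussFn (-(a / 2 : ℝ) : ℂ) 0 0 (0 : E n) x‖ := fun s hs x => by
    obtain ⟨h1, h2⟩ := hball s hs
    simp only [hN] at h1
    have := norm_nonneg (A' s)
    have := norm_nonneg (B' s)
    have := norm_nonneg (D' s)
    have := norm_nonneg (B s)
    have := norm_nonneg (D s)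
    exact hM _ _ _ _ _ _ (by linarith) (by linarith) (by linarith) h2.le (by linarith)
      (by linarith) x
  rw [hasDerivAt_iff_tendsto_slope]
  have hmem : ∀ s, MemLp (fun x => slope (fun s => gaussFn (A s) (B s) (D s) x₀ x) s₀ s) 2
      (volume : Measure (E n)) := fun s =>
    ((memLp_gaussFn (hre s) (B s) (D s) x₀ 2).sub (memLp_gaussFn (hre s₀) (B s₀) (D s₀) x₀ 2)).const_smul
      ((s - s₀)⁻¹)
  have hb : MemLp (fun x => M * ‖gaussFn (-(a / 2 : ℝ) : ℂ) 0 0 (0 : E n) x‖) 2 volume :=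
    ((memLp_gaussFn (by rw [Complex.neg_re, Complex.ofReal_re]; linarith) 0 0 0 2).norm).const_mul M
  have key := tendsto_toLp (l := 𝓝[≠] s₀) hmem
    (memLp_polyGauss (hre s₀) (A' s₀) (B' s₀) (D' s₀) (B s₀) (D s₀) x₀) hb ?_
    (hbd s₀ (Metric.mem_ball_self hδ))
    fun x => hasDerivAt_iff_tendsto_slope.mp (hasDerivAt_gaussFn (hA s₀) (hB s₀) (hD s₀) x₀ x)
  · refine key.congr fun s => ?_
    rw [slope, vsub_eq_sub, ← MemLp.toLp_sub, ← MemLp.toLp_const_smul]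
    rfl
  -- The mean value inequality turns the uniform bound on derivatives into one on difference
  -- quotients.
  · filter_upwards [nhdsWithin_le_nhds (Metric.ball_mem_nhds s₀ hδ), self_mem_nhdsWithin] with s hs hne
    intro x
    have h1 := (convex_ball s₀ δ).norm_image_sub_le_of_norm_hasDerivWithin_le
      (f := fun s => gaussFn (A s) (B s) (D s) x₀ x)
      (fun s _ => (hasDerivAt_gaussFn (hA s) (hB s) (hD s) x₀ x).hasDerivWithinAt)
      (fun s hs => hbd s hs x) (Metric.mem_ball_self hδ) hs
    rw [slope_def_module, norm_smul, norm_inv, inv_mul_le_iff₀ (norm_pos_iff.mpr (sub_ne_zero.mpr hne)),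
      mul_comm]
    exact h1

end GaussPath

/-! ### The lens transform of the `N`-body state -/

section Lens

/-- `log (1 + ω²τ²)`. -/
def lensLog (ω τ : ℝ) : ℝ := Real.log (1 + ω ^ 2 * τ ^ 2)

theorem exp_lensLog (ω τ : ℝ) : Real.exp (lensLog ω τ) = 1 + ω ^ 2 * τ ^ 2 :=
  Real.exp_log (by positivity)

theorem lensFactor_eq (ω τ : ℝ) : lensFactor ω τ = Real.exp (-(lensLog ω τ / 2)) := by
  rw [lensFactor, ← exp_lensLog, Real.exp_neg, Real.exp_half]

theorem lensFactor_pos (ω τ : ℝ) : 0 < lensFactor ω τ := by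
  rw [lensFactor_eq]; exact Real.exp_pos _

theorem lensFactor_le_one (ω τ : ℝ) : lensFactor ω τ ≤ 1 := by
  refine inv_le_one_of_one_le₀ ?_
  rw [Real.one_le_sqrt]
  nlinarith [mul_nonneg (sq_nonneg ω) (sq_nonneg τ)]

theorem lensFactor_sq (ω τ : ℝ) : lensFactor ω τ ^ 2 = (1 + ω ^ 2 * τ ^ 2)⁻¹ := by
  rw [lensFactor, inv_pow, Real.sq_sqrt (by positivity)]

theorem hasDerivAt_lensLog (ω τ : ℝ) :
    HasDerivAt (lensLog ω) (2 * ω ^ 2 * τ * lensFactor ω τ ^ 2) τ := by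
  have h : HasDerivAt (fun τ : ℝ => 1 + ω ^ 2 * τ ^ 2) (ω ^ 2 * (2 * τ)) τ := by
    simpa using ((hasDerivAt_pow 2 τ).const_mul (ω ^ 2)).const_add 1
  refine (h.log (by positivity)).congr_deriv ?_
  rw [lensFactor_sq]
  field_simp

theorem continuous_lensLog (ω : ℝ) : Continuous (lensLog ω) :=
  continuous_iff_continuousAt.mpr fun s => (hasDerivAt_lensLog ω s).continuousAt

theorem continuous_lensFactor (ω : ℝ) : Continuous (lensFactor ω) := by
  have := continuous_lensLog ω
  simp_rw [funext (lensFactor_eq ω)]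
  fun_prop

theorem hasDerivAt_lensTime (ω τ : ℝ) : HasDerivAt (lensTime ω) (lensFactor ω τ ^ 2) τ := by
  by_cases hω : ω = 0
  · have : lensTime ω = id := by funext t; simp [lensTime, hω]
    rw [this, lensFactor_sq, hω]
    simpa using hasDerivAt_id τ
  · have : lensTime ω = fun t => Real.arctan (ω * t) / ω := by funext t; simp [lensTime, hω]
    rw [this, lensFactor_sq]
    refine ((((hasDerivAt_id τ).const_mul ω).arctan).div_const ω).congr_deriv ?_
    simp only [id, mul_one]
    field_simp

theorem lensTime_zero (ω : ℝ) : lensTime ω 0 = 0 := by simp [lensTime]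

/-- The phase and amplitude of the lens transform. -/
def lensPhase (ω : ℝ) (N : ℕ) (τ : ℝ) (y : E N) : ℂ :=
  Complex.exp (((-(N / 4 * lensLog ω τ) : ℝ) : ℂ)
    + Complex.I * ((ω ^ 2 * τ / (1 + ω ^ 2 * τ ^ 2) * (‖y‖ ^ 2 / 2) : ℝ) : ℂ))

variable {N : ℕ}

theorem continuous_lensPhase (ω τ : ℝ) : Continuous (lensPhase ω N τ) := by
  unfold lensPhase
  fun_prop

/-- The amplitude is g^{N/2}, so two of them give exactly the Jacobian g^N of the dilation; this
makes the lens transform isometric. -/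
theorem lensPhase_mul_conj (ω τ : ℝ) (y y' : E N) : lensPhase ω N τ y * conj (lensPhase ω N τ y')
    = ((lensFactor ω τ ^ N : ℝ) : ℂ) * Complex.exp (Complex.I * ((ω ^ 2 * τ / (1 + ω ^ 2 * τ ^ 2)
      * ((‖y‖ ^ 2 - ‖y'‖ ^ 2) / 2) : ℝ) : ℂ)) := by
  rw [lensPhase, lensPhase, ← Complex.exp_conj, ← Complex.exp_add, lensFactor_eq, ← Real.exp_nat_mul,
    Complex.ofReal_exp, ← Complex.exp_add]
  congr 1
  simp only [map_add, map_mul, Complex.conj_ofReal, Complex.conj_I]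
  push_cast
  ring

theorem ae_comp_smul {P : E N → Prop} (h : ∀ᵐ x, P x) {c : ℝ} (hc : c ≠ 0) : ∀ᵐ x, P (c • x) :=
  (Measure.quasiMeasurePreserving_smul volume hc).ae h

theorem integral_comp_lens (ω τ : ℝ) (F : E N → ℂ) :
    ((lensFactor ω τ ^ N : ℝ) : ℂ) * ∫ y : E N, F (lensFactor ω τ • y) = ∫ x, F x := by
  have hg := lensFactor_pos ω τ
  rw [Measure.integral_comp_smul, finrank_euclideanSpace, Fintype.card_fin,
    abs_of_pos (by positivity), Complex.real_smul, ← mul_assoc, ← Complex.ofReal_mul,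
    mul_inv_cancel₀ (by positivity), Complex.ofReal_one, one_mul]

theorem memLp_lensState (ω τ : ℝ) (ψ : L2 N) :
    MemLp (fun y => lensPhase ω N τ y * ψ (lensFactor ω τ • y)) 2 volume := by
  have hg := (lensFactor_pos ω τ).ne'
  have hm : AEStronglyMeasurable (fun y => lensPhase ω N τ y * ψ (lensFactor ω τ • y))
      (volume : Measure (E N)) :=
    (continuous_lensPhase ω τ).aestronglyMeasurable.mul
      ((Lp.aestronglyMeasurable ψ).comp_quasiMeasurePreserving
        (Measure.quasiMeasurePreserving_smul volume hg))
  rw [memLp_two_iff_integrable_sq_norm hm]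
  have h1 := (memLp_two_iff_integrable_sq_norm (Lp.aestronglyMeasurable ψ)).mp (Lp.memLp ψ)
  have h2 := ((integrable_comp_smul_iff volume _ hg).mpr h1).const_mul (lensFactor ω τ ^ N)
  refine h2.congr (ae_of_all _ fun y => ?_)
  simp only
  rw [norm_mul, mul_pow]
  congr 1
  have h3 := lensPhase_mul_conj ω τ y y
  rw [Complex.mul_conj, Complex.normSq_eq_norm_sq] at h3
  simp only [sub_self, zero_div, mul_zero, Complex.ofReal_zero, Complex.exp_zero, mul_one] at h3
  exact_mod_cast h3.symm

/-- The lens transform of an `N`-body state. -/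
def lensState (ω τ : ℝ) (ψ : L2 N) : L2 N := (memLp_lensState ω τ ψ).toLp _

theorem lensState_coe (ω τ : ℝ) (ψ : L2 N) : lensState ω τ ψ =ᵐ[volume]
    fun y => lensPhase ω N τ y * ψ (lensFactor ω τ • y) := MemLp.coeFn_toLp _

theorem norm_lensState (ω τ : ℝ) (ψ : L2 N) : ‖lensState ω τ ψ‖ = ‖ψ‖ := by
  have h : ⟪lensState ω τ ψ, lensState ω τ ψ⟫_ℂ = ⟪ψ, ψ⟫_ℂ := by
    rw [inner_eq_integral, inner_eq_integral, ← integral_comp_lens ω τ (fun x => conj (ψ x) * ψ x),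
      ← integral_const_mul]
    refine integral_congr_ae ?_
    filter_upwards [lensState_coe ω τ ψ] with y hy
    have h3 := lensPhase_mul_conj ω τ y y
    simp only [sub_self, zero_div, mul_zero, Complex.ofReal_zero, Complex.exp_zero, mul_one] at h3
    rw [hy, ← h3, map_mul]
    ring
  rw [inner_self_eq_norm_sq_to_K, inner_self_eq_norm_sq_to_K] at h
  exact (sq_eq_sq₀ (norm_nonneg _) (norm_nonneg _)).mp (by exact_mod_cast h)

theorem IsBosonic.lensState {ψ : L2 N} (hψ : IsBosonic ψ) (ω τ : ℝ) :
    IsBosonic (lensState ω τ ψ) := by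
  intro σ
  have hr : ∀ x : E N, WithLp.toLp 2 (fun i => x (σ i)) = relabel σ x := fun x => by
    ext i; rw [relabel_apply]
  have hn : ∀ x : E N, ‖relabel σ x‖ = ‖x‖ := fun x =>
    (LinearIsometryEquiv.piLpCongrLeft 2 ℝ ℝ σ.symm).norm_map x
  filter_upwards [lensState_coe ω τ ψ, (measurePreserving_relabel σ).quasiMeasurePreserving.ae
    (lensState_coe ω τ ψ), ae_comp_smul (hψ σ) (lensFactor_pos ω τ).ne'] with x h1 h2 h3
  rw [hr, h1, h2, ← h3, lensPhase, lensPhase, hn]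
  congr 2

/-- Lens transform and partial trace commute: the phase depends on |y|² + |z|², so the traced-out
part cancels between the state and its conjugate, and g^{N-k} is the Jacobian of the traced-out
variables. -/
theorem inner_lensMarginal {k : ℕ} (h : k ≤ N) (ω : ℝ) (ψ : ℝ → L2 N) (τ : ℝ) (f g : L2 k) :
    ⟪g, lensMarginal ω ψ k τ f⟫_ℂ
      = ⟪(splitE (joinEquiv h)).C f (lensState ω τ (ψ (lensTime ω τ))),
        (splitE (joinEquiv h)).C g (lensState ω τ (ψ (lensTime ω τ)))⟫_ℂ := by
  set χ := lensState ω τ (ψ (lensTime ω τ)) with hχ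
  obtain ⟨A, hA, hAin⟩ := exists_hasKernel_marginal h χ
  have hK : HasKernel A (invLens ω (fun t => marginalKernel k (ψ t)) τ) := by
    refine hA.congr ?_
    have hc : ∀ᵐ y : E k, ∀ᵐ z : E (N - k), χ (join y z)
        = lensPhase ω N τ (join y z) * ψ (lensTime ω τ) (lensFactor ω τ • join y z) := by
      have h1 := (splitE (joinEquiv h)).mp_symm.quasiMeasurePreserving.ae
        (lensState_coe ω τ (ψ (lensTime ω τ)))
      have h2 := Measure.ae_ae_of_ae_prod h1
      filter_upwards [h2] with y hy
      filter_upwards [hy] with z hz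
      rw [splitE_joinEquiv_symm] at hz
      exact hz
    filter_upwards [hc] with y hy
    filter_upwards [hc] with y' hy'
    have hn : ∀ (y : E k) (z : E (N - k)), ‖join y z‖ ^ 2 = ‖y‖ ^ 2 + ‖z‖ ^ 2 := fun y z => by
      rw [norm_sq_splitE (joinEquiv h), ← splitE_joinEquiv_symm h (y, z),
        MeasurableEquiv.apply_symm_apply]
    have hs : ∀ (y : E k) (z : E (N - k)), lensFactor ω τ • join y z
        = join (lensFactor ω τ • y) (lensFactor ω τ • z) := fun y z => by
      ext i
      simp only [join, PiLp.smul_apply]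
      split_ifs <;> rfl
    have hNk : lensFactor ω τ ^ N = lensFactor ω τ ^ k * lensFactor ω τ ^ (N - k) := by
      rw [← pow_add, Nat.add_sub_cancel' h]
    simp only [marginalKernel, invLens]
    rw [← integral_comp_lens ω τ (fun z => ψ (lensTime ω τ) (join (lensFactor ω τ • y) z)
      * conj (ψ (lensTime ω τ) (join (lensFactor ω τ • y') z))), ← mul_assoc, ← integral_const_mul]
    refine integral_congr_ae ?_
    filter_upwards [hy, hy'] with z hz hz'
    rw [hz, hz', map_mul, hs, hs, mul_mul_mul_comm, lensPhase_mul_conj, hn, hn, hNk,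
      add_sub_add_right_eq_sub]
    push_cast
    ring
  rw [lensMarginal, if_pos h, hK.opOfKernel_eq, hAin]

end Lens

/-! ### The `N`-body equation in lens form -/

section Potential

variable {N : ℕ}

/-- The interaction potential. -/
def potential (V : 𝓢(ℝ, ℝ)) (β : ℝ) (N : ℕ) (x : E N) : ℝ :=
  1 / (N : ℝ) * ∑ i : Fin N, ∑ j ∈ Finset.Ioi i, (N : ℝ) ^ β * V ((N : ℝ) ^ β * (x i - x j))

theorem continuous_potential (V : 𝓢(ℝ, ℝ)) (β : ℝ) (N : ℕ) : Continuous (potential V β N) := by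
  unfold potential
  have := V.continuous
  fun_prop

theorem exists_norm_schwartz_le (V : 𝓢(ℝ, ℝ)) : ∃ M, ∀ x, |V x| ≤ M :=
  ⟨_, fun x => SchwartzMap.norm_le_seminorm ℝ V x⟩

theorem exists_norm_potential_le (V : 𝓢(ℝ, ℝ)) (β : ℝ) (N : ℕ) :
    ∃ M, ∀ x, |potential V β N x| ≤ M := by
  obtain ⟨M, hM⟩ := exists_norm_schwartz_le V
  refine ⟨1 / (N : ℝ) * ∑ i : Fin N, ∑ j ∈ Finset.Ioi i, (N : ℝ) ^ β * M, fun x => ?_⟩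
  rw [potential, abs_mul, abs_of_nonneg (by positivity : (0 : ℝ) ≤ 1 / N)]
  gcongr
  refine (Finset.abs_sum_le_sum_abs _ _).trans (Finset.sum_le_sum fun i _ => ?_)
  refine (Finset.abs_sum_le_sum_abs _ _).trans (Finset.sum_le_sum fun j _ => ?_)
  rw [abs_mul, abs_of_nonneg (by positivity : (0 : ℝ) ≤ (N : ℝ) ^ β)]
  gcongr
  exact hM _

/-- The interaction potential in lens coordinates. -/
def lensPotential (V : 𝓢(ℝ, ℝ)) (ω β : ℝ) (N : ℕ) (τ : ℝ) (y : E N) : ℂ :=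
  ((lensFactor ω τ ^ 2 * potential V β N (lensFactor ω τ • y) : ℝ) : ℂ)

theorem continuous_lensPotential (V : 𝓢(ℝ, ℝ)) (ω β : ℝ) (N : ℕ) :
    Continuous fun p : ℝ × E N => lensPotential V ω β N p.1 p.2 := by
  unfold lensPotential
  have h1 := continuous_lensFactor ω
  have h2 := continuous_potential V β N
  fun_prop

theorem exists_norm_lensPotential_le (V : 𝓢(ℝ, ℝ)) (ω β : ℝ) (N : ℕ) :
    ∃ M, ∀ τ y, ‖lensPotential V ω β N τ y‖ ≤ M := by
  obtain ⟨M, hM⟩ := exists_norm_potential_le V β N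
  refine ⟨M, fun τ y => ?_⟩
  rw [lensPotential, Complex.norm_real, Real.norm_eq_abs, abs_mul]
  calc _ ≤ 1 * M := by
        gcongr
        · rw [abs_of_nonneg (by positivity)]
          exact pow_le_one₀ (lensFactor_pos ω τ).le (lensFactor_le_one ω τ)
        · exact hM _
    _ = M := one_mul M

theorem memLp_lensPotential (V : 𝓢(ℝ, ℝ)) (ω β : ℝ) (N : ℕ) (τ : ℝ) :
    MemLp (lensPotential V ω β N τ) ∞ volume := by
  obtain ⟨M, hM⟩ := exists_norm_lensPotential_le V ω β N
  exact memLp_top_of_bound ((continuous_lensPotential V ω β N).comp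
    (by fun_prop : Continuous fun y : E N => (τ, y))).aestronglyMeasurable M (ae_of_all _ (hM τ))

end Potential

/-! ### Gaussians in lens coordinates -/

section LensGauss

/-- The exponents of the lens transformed Gaussian. -/
def lensA (ω τ : ℝ) : ℂ :=
  -(Complex.I * ω ^ 2 * τ / 2) + gaussA τ * ((1 + ω ^ 2 * τ ^ 2 : ℝ) : ℂ)

/-- The exponents of the lens transformed Gaussian. -/
def lensB (ω τ : ℝ) : ℂ := gaussB τ * ((Real.exp (lensLog ω τ / 2) : ℝ) : ℂ)

/-- The exponents of the lens transformed Gaussian. -/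
def lensD {N : ℕ} (ω : ℝ) (x₀ : E N) (τ : ℝ) : ℂ :=
  gaussD x₀ τ + ((N / 4 * lensLog ω τ : ℝ) : ℂ)

theorem lensA_re_neg (ω τ : ℝ) : (lensA ω τ).re < 0 := by
  have h : (lensA ω τ).re = (gaussA τ).re * (1 + ω ^ 2 * τ ^ 2) := by
    rw [lensA, Complex.add_re, Complex.re_mul_ofReal]
    have : -(Complex.I * ω ^ 2 * τ / 2 : ℂ) = ((-(ω ^ 2 * τ / 2) : ℝ) : ℂ) * Complex.I := by
      push_cast; ring
    rw [this, Complex.re_ofReal_mul]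
    simp
  rw [h]
  exact mul_neg_of_neg_of_pos (gaussA_re_neg τ) (by positivity)

variable {N : ℕ}

/-- This moves the lens transform from the state to the test function: a freely evolved Gaussian
times the conjugate phase is a Gaussian in x = g y. The exponents `lensA`, `lensB`, `lensD` are read
off from this identity. -/
theorem gaussFn_mul_conj_lensPhase (ω τ : ℝ) (x₀ y : E N) :
    gaussFn (gaussA τ) (gaussB τ) (gaussD x₀ τ) x₀ y * conj (lensPhase ω N τ y)
      = ((lensFactor ω τ ^ N : ℝ) : ℂ)
        * gaussFn (lensA ω τ) (lensB ω τ) (lensD ω x₀ τ) x₀ (lensFactor ω τ • y) := by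
  have hE : (1 + ω ^ 2 * τ ^ 2 : ℝ) ≠ 0 := by positivity
  have h2 : lensFactor ω τ ^ 2 * (1 + ω ^ 2 * τ ^ 2) = 1 := by
    rw [lensFactor_sq, inv_mul_cancel₀ hE]
  have h2' : ω ^ 2 * τ / (1 + ω ^ 2 * τ ^ 2) = lensFactor ω τ ^ 2 * (ω ^ 2 * τ) := by
    rw [lensFactor_sq]; field_simp
  have h1 : lensFactor ω τ * Real.exp (lensLog ω τ / 2) = 1 := by
    rw [lensFactor_eq, ← Real.exp_add, neg_add_cancel, Real.exp_zero]
  have h2c : (lensFactor ω τ : ℂ) ^ 2 * (1 + ω ^ 2 * τ ^ 2) = 1 := by exact_mod_cast h2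
  have h1c : (lensFactor ω τ : ℂ) * ((Real.exp (lensLog ω τ / 2) : ℝ) : ℂ) = 1 := by
    exact_mod_cast h1
  have hpow : ((lensFactor ω τ ^ N : ℝ) : ℂ) = Complex.exp ((-(N * (lensLog ω τ / 2)) : ℝ) : ℂ) := by
    rw [lensFactor_eq, ← Real.exp_nat_mul, Complex.ofReal_exp, mul_neg]
  rw [hpow, gaussFn, gaussFn, lensPhase, h2', ← Complex.exp_conj, ← Complex.exp_add,
    ← Complex.exp_add, norm_smul, real_inner_smul_right, Real.norm_of_nonneg (lensFactor_pos ω τ).le,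
    lensA, lensB, lensD]
  congr 1
  simp only [map_add, map_mul, Complex.conj_ofReal, Complex.conj_I]
  push_cast
  push_cast at h1c
  linear_combination (-(gaussA τ * (‖y‖ : ℂ) ^ 2)) * h2c
    - (gaussB τ * ((⟪x₀, y⟫_ℝ : ℝ) : ℂ)) * h1c

/-- The coefficients of `(-½Δ + ½ω²|x|²)` applied to the lens transformed Gaussian. -/
def lensP (ω τ : ℝ) : ℂ := -2 * lensA ω τ ^ 2 + ω ^ 2 / 2

/-- The coefficients of `(-½Δ + ½ω²|x|²)` applied to the lens transformed Gaussian. -/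
def lensQ (ω τ : ℝ) : ℂ := -2 * lensA ω τ * lensB ω τ

/-- The coefficients of `(-½Δ + ½ω²|x|²)` applied to the lens transformed Gaussian. -/
def lensR (ω : ℝ) (x₀ : E N) (τ : ℝ) : ℂ :=
  -(lensB ω τ ^ 2 * ((‖x₀‖ ^ 2 : ℝ) : ℂ) / 2) - lensA ω τ * N

theorem hasDerivAt_one_add_I_mul (τ : ℝ) :
    HasDerivAt (fun τ : ℝ => (1 + Complex.I * τ : ℂ)) Complex.I τ := by
  simpa using ((Complex.ofRealCLM.hasDerivAt (x := τ)).const_mul Complex.I).const_add 1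

theorem hasDerivAt_gaussA (τ : ℝ) :
    HasDerivAt gaussA (Complex.I / (2 * (1 + Complex.I * τ) ^ 2)) τ := by
  have h0 := one_add_I_mul_ne_zero τ
  have h := (((hasDerivAt_one_add_I_mul τ).const_mul 2).fun_inv (mul_ne_zero two_ne_zero h0)).neg
  have e : gaussA = fun τ : ℝ => -(2 * (1 + Complex.I * τ : ℂ))⁻¹ := by
    funext t; rw [gaussA, one_div]
  rw [e]
  refine h.congr_deriv ?_
  field_simp

theorem hasDerivAt_gaussB (τ : ℝ) :
    HasDerivAt gaussB (-(Complex.I / (1 + Complex.I * τ) ^ 2)) τ := by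
  have h0 := one_add_I_mul_ne_zero τ
  have h := (hasDerivAt_one_add_I_mul τ).fun_inv h0
  have e : gaussB = fun τ : ℝ => (1 + Complex.I * τ : ℂ)⁻¹ := by
    funext t; rw [gaussB, one_div]
  rw [e]
  refine h.congr_deriv ?_
  field_simp

theorem hasDerivAt_gaussD (x₀ : E N) (τ : ℝ) :
    HasDerivAt (gaussD x₀) (Complex.I / (2 * (1 + Complex.I * τ) ^ 2) * ((‖x₀‖ ^ 2 : ℝ) : ℂ)
      - N / 2 * (Complex.I / (1 + Complex.I * τ))) τ := by
  have h0 := one_add_I_mul_ne_zero τ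
  have hpi : (Real.pi : ℂ) ≠ 0 := by exact_mod_cast Real.pi_ne_zero
  have h1 : HasDerivAt (fun τ : ℝ => (1 / (2 * Real.pi * (1 + Complex.I * τ)) : ℂ))
      (-(Complex.I / (2 * Real.pi * (1 + Complex.I * τ) ^ 2))) τ := by
    have h := ((hasDerivAt_gaussB τ).const_mul (1 / (2 * Real.pi) : ℂ))
    have e : (fun τ : ℝ => (1 / (2 * Real.pi * (1 + Complex.I * τ)) : ℂ))
        = fun τ : ℝ => (1 / (2 * Real.pi) : ℂ) * gaussB τ := by
      funext t
      rw [gaussB, one_div_mul_one_div]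
    rw [e]
    refine h.congr_deriv ?_
    field_simp
  -- The argument of the logarithm has positive real part, so the principal branch is differentiable
  -- there.
  have hs : (1 / (2 * Real.pi * (1 + Complex.I * τ)) : ℂ) ∈ Complex.slitPlane := by
    left
    have e : (1 / (2 * Real.pi * (1 + Complex.I * τ)) : ℂ) = ((-(1 / Real.pi) : ℝ) : ℂ) * gaussA τ := by
      rw [gaussA]
      push_cast
      field_simp
    rw [e, Complex.re_ofReal_mul]
    exact mul_pos_of_neg_of_neg (by have := Real.pi_pos; simp [this]) (gaussA_re_neg τ)
  have h2 := h1.clog_real hs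
  refine (((hasDerivAt_gaussA τ).mul_const ((‖x₀‖ ^ 2 : ℝ) : ℂ)).add
    (h2.const_mul (N / 2 : ℂ))).congr_deriv ?_
  field_simp
  ring

theorem lensFactor_sq_complex (ω τ : ℝ) :
    ((lensFactor ω τ ^ 2 : ℝ) : ℂ) = (1 + ω ^ 2 * τ ^ 2 : ℂ)⁻¹ := by
  rw [lensFactor_sq]; push_cast; rfl

theorem one_add_sq_ne_zero (ω τ : ℝ) : (1 + ω ^ 2 * τ ^ 2 : ℂ) ≠ 0 := by
  have : (1 + ω ^ 2 * τ ^ 2 : ℝ) ≠ 0 := by positivity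
  exact_mod_cast this

/-- Together with the derivatives of `lensB` and `lensD`, this Riccati system says that the
transformed Gaussian solves the oscillator equation in the time `lensTime`, whose derivative is g².
-/
theorem hasDerivAt_lensA (ω τ : ℝ) :
    HasDerivAt (lensA ω) (-Complex.I * ((lensFactor ω τ ^ 2 : ℝ) : ℂ) * lensP ω τ) τ := by
  have h0 := one_add_I_mul_ne_zero τ
  have hE := one_add_sq_ne_zero ω τ
  have h1 : HasDerivAt (fun τ : ℝ => ((1 + ω ^ 2 * τ ^ 2 : ℝ) : ℂ)) ((ω ^ 2 * (2 * τ) : ℝ) : ℂ) τ := by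
    refine HasDerivAt.ofReal_comp ?_
    simpa using ((hasDerivAt_pow 2 τ).const_mul (ω ^ 2)).const_add 1
  have h2 : HasDerivAt (fun τ : ℝ => -(Complex.I * ω ^ 2 * τ / 2 : ℂ)) (-(Complex.I * ω ^ 2 / 2)) τ := by
    simpa using (((Complex.ofRealCLM.hasDerivAt (x := τ)).const_mul (Complex.I * ω ^ 2)).div_const 2).fun_neg
  refine (h2.add ((hasDerivAt_gaussA τ).mul h1)).congr_deriv ?_
  rw [lensFactor_sq_complex, lensP, lensA, gaussA]
  push_cast
  generalize (1 + Complex.I * τ : ℂ) = L at *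
  field_simp
  ring_nf
  simp only [Complex.I_sq, show Complex.I ^ 3 = -Complex.I from Complex.I_pow_three]
  ring

theorem hasDerivAt_lensB (ω τ : ℝ) :
    HasDerivAt (lensB ω) (-Complex.I * ((lensFactor ω τ ^ 2 : ℝ) : ℂ) * lensQ ω τ) τ := by
  have h0 := one_add_I_mul_ne_zero τ
  have hE := one_add_sq_ne_zero ω τ
  have h1 : HasDerivAt (fun τ : ℝ => ((Real.exp (lensLog ω τ / 2) : ℝ) : ℂ))
      ((Real.exp (lensLog ω τ / 2) * (2 * ω ^ 2 * τ * lensFactor ω τ ^ 2 / 2) : ℝ) : ℂ) τ :=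
    HasDerivAt.ofReal_comp ((hasDerivAt_lensLog ω τ).div_const 2).exp
  refine ((hasDerivAt_gaussB τ).mul h1).congr_deriv ?_
  rw [lensQ, lensB, lensA, gaussA, gaussB]
  generalize Real.exp (lensLog ω τ / 2) = X
  have := lensFactor_sq_complex ω τ
  push_cast at this ⊢
  rw [this]
  generalize (1 + Complex.I * τ : ℂ) = L at *
  field_simp
  ring_nf
  simp only [Complex.I_sq]
  ring

theorem hasDerivAt_lensD (ω : ℝ) (x₀ : E N) (τ : ℝ) :
    HasDerivAt (lensD ω x₀) (-Complex.I * ((lensFactor ω τ ^ 2 : ℝ) : ℂ) * lensR ω x₀ τ) τ := by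
  have h0 := one_add_I_mul_ne_zero τ
  have hE := one_add_sq_ne_zero ω τ
  have h1 : HasDerivAt (fun τ : ℝ => ((N / 4 * lensLog ω τ : ℝ) : ℂ))
      ((N / 4 * (2 * ω ^ 2 * τ * lensFactor ω τ ^ 2) : ℝ) : ℂ) τ :=
    HasDerivAt.ofReal_comp ((hasDerivAt_lensLog ω τ).const_mul _)
  refine ((hasDerivAt_gaussD x₀ τ).add h1).congr_deriv ?_
  have hB : lensB ω τ ^ 2 = (1 + ω ^ 2 * τ ^ 2 : ℂ) / (1 + Complex.I * τ) ^ 2 := by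
    have : Real.exp (lensLog ω τ / 2) ^ 2 = 1 + ω ^ 2 * τ ^ 2 := by
      rw [← exp_lensLog, ← Real.exp_nat_mul]
      congr 1
      push_cast
      ring
    have h3 : (((Real.exp (lensLog ω τ / 2) : ℝ) : ℂ)) ^ 2 = 1 + ω ^ 2 * τ ^ 2 := by
      rw [← Complex.ofReal_pow, this]; push_cast; rfl
    rw [lensB, mul_pow, h3, gaussB]
    field_simp
  rw [lensR, hB, lensA, gaussA]
  have := lensFactor_sq_complex ω τ
  push_cast at this ⊢
  rw [this]
  generalize (1 + Complex.I * τ : ℂ) = L at *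
  field_simp
  ring_nf
  simp only [Complex.I_sq]
  ring

/-- The lens transformed Gaussian. -/
def lensGauss (ω : ℝ) (x₀ : E N) (τ : ℝ) : L2 N :=
  (memLp_gaussFn (lensA_re_neg ω τ) (lensB ω τ) (lensD ω x₀ τ) x₀ 2).toLp _

theorem lensGauss_coe (ω : ℝ) (x₀ : E N) (τ : ℝ) : lensGauss ω x₀ τ =ᵐ[volume]
    gaussFn (lensA ω τ) (lensB ω τ) (lensD ω x₀ τ) x₀ := MemLp.coeFn_toLp _

/-- `(-½Δ + ½ω²|x|²)` applied to the lens transformed Gaussian. -/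
def oscGauss (ω : ℝ) (x₀ : E N) (τ : ℝ) : L2 N :=
  (memLp_polyGauss (lensA_re_neg ω τ) (lensP ω τ) (lensQ ω τ) (lensR ω x₀ τ) (lensB ω τ)
    (lensD ω x₀ τ) x₀).toLp _

theorem oscGauss_coe (ω : ℝ) (x₀ : E N) (τ : ℝ) : oscGauss ω x₀ τ =ᵐ[volume]
    polyGauss (lensP ω τ) (lensQ ω τ) (lensR ω x₀ τ) (lensA ω τ) (lensB ω τ) (lensD ω x₀ τ) x₀ :=
  MemLp.coeFn_toLp _

theorem hasDerivAt_lensGauss (ω : ℝ) (x₀ : E N) (τ : ℝ) :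
    HasDerivAt (lensGauss ω x₀)
      ((-Complex.I * ((lensFactor ω τ ^ 2 : ℝ) : ℂ)) • oscGauss ω x₀ τ) τ := by
  have hg := continuous_lensFactor ω
  have hA : Continuous (lensA ω) :=
    continuous_iff_continuousAt.mpr fun s => (hasDerivAt_lensA ω s).continuousAt
  have hB : Continuous (lensB ω) :=
    continuous_iff_continuousAt.mpr fun s => (hasDerivAt_lensB ω s).continuousAt
  have h := hasDerivAt_gaussPath (hasDerivAt_lensA ω) (hasDerivAt_lensB ω) (hasDerivAt_lensD ω x₀)
    (by unfold lensP; fun_prop) (by unfold lensQ; fun_prop) (by unfold lensR; fun_prop)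
    (lensA_re_neg ω) x₀ τ
  refine h.congr_deriv ?_
  rw [oscGauss, ← MemLp.toLp_const_smul]
  refine MemLp.toLp_congr _ _ (ae_of_all _ fun x => ?_)
  simp only [polyGauss, Pi.smul_apply, smul_eq_mul]
  ring

/-- The change of variables x = g y after moving the phase onto the Gaussian. The multiplier `w`
lets one identity serve both the state itself and the interaction applied to it. -/
theorem inner_gauss_lensState (ω : ℝ) (x₀ : E N) (τ : ℝ) (ψ : L2 N) {w : E N → ℂ}
    (hw : MemLp w ∞ volume) (hw' : MemLp (fun y => w (lensFactor ω τ • y)) ∞ volume) :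
    ⟪gauss x₀ τ, mulL _ hw' (lensState ω τ ψ)⟫_ℂ = ⟪lensGauss ω x₀ τ, mulL w hw ψ⟫_ℂ := by
  have e1 : ⟪lensGauss ω x₀ τ, mulL w hw ψ⟫_ℂ = ∫ x,
      conj (gaussFn (lensA ω τ) (lensB ω τ) (lensD ω x₀ τ) x₀ x) * (w x * ψ x) := by
    rw [inner_eq_integral]
    refine integral_congr_ae ?_
    filter_upwards [lensGauss_coe ω x₀ τ, mulL_coe w hw ψ] with x h1 h2
    rw [h1, h2]
  rw [e1, inner_eq_integral, ← integral_comp_lens ω τ (fun x =>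
      conj (gaussFn (lensA ω τ) (lensB ω τ) (lensD ω x₀ τ) x₀ x) * (w x * ψ x)),
    ← integral_const_mul]
  refine integral_congr_ae ?_
  filter_upwards [gauss_coe x₀ τ, mulL_coe _ hw' (lensState ω τ ψ), lensState_coe ω τ ψ]
    with y h1 h2 h3
  have h4 := congrArg (starRingEnd ℂ) (gaussFn_mul_conj_lensPhase ω τ x₀ y)
  simp only [map_mul, Complex.conj_conj, Complex.conj_ofReal] at h4
  rw [h1, h2, h3]
  linear_combination (w (lensFactor ω τ • y) * ψ (lensFactor ω τ • y)) * h4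

end LensGauss

/-! ### The interaction picture -/

section Interaction

variable {N : ℕ} {V : 𝓢(ℝ, ℝ)} {ω β : ℝ} {ψ : ℝ → L2 N}

/-- The potential as a bounded multiplication operator. -/
theorem memLp_potential (V : 𝓢(ℝ, ℝ)) (β : ℝ) (N : ℕ) :
    MemLp (fun x : E N => (potential V β N x : ℂ)) ∞ volume := by
  obtain ⟨M, hM⟩ := exists_norm_potential_le V β N
  exact memLp_top_of_bound (Complex.continuous_ofReal.comp
    (continuous_potential V β N)).aestronglyMeasurable M
    (ae_of_all _ fun x => by rw [Complex.norm_real]; exact hM x)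

theorem gaussFn_conj (A B D : ℂ) (x₀ x : E N) :
    gaussFn (conj A) (conj B) (conj D) x₀ x = conj (gaussFn A B D x₀ x) := by
  rw [gaussFn, gaussFn, ← Complex.exp_conj]
  simp only [map_add, map_mul, Complex.conj_ofReal]

/-- The pairing in `schrodinger` is bilinear, so the test function is the conjugate of the lens
Gaussian, again Schwartz. The time integrand is continuous, so the integrated equation can be
differentiated. -/
theorem IsNBodyEvolution.hasDerivAt_inner (h : IsNBodyEvolution V ω β N ψ) (x₀ : E N) (τ t : ℝ) :
    HasDerivAt (fun t => ⟪lensGauss ω x₀ τ, ψ t⟫_ℂ) (-Complex.I * (⟪oscGauss ω x₀ τ, ψ t⟫_ℂ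
      + ⟪lensGauss ω x₀ τ, mulL _ (memLp_potential V β N) (ψ t)⟫_ℂ)) t := by
  obtain ⟨F, hF⟩ := exists_schwartz_gaussFn (A := conj (lensA ω τ))
    (by rw [Complex.conj_re]; exact lensA_re_neg ω τ) (conj (lensB ω τ)) (conj (lensD ω x₀ τ)) x₀
  have hF' : (F : E N → ℂ)
      = gaussFn (conj (lensA ω τ)) (conj (lensB ω τ)) (conj (lensD ω x₀ τ)) x₀ := funext hF
  have e1 : ∀ s, ∫ x, ψ s x * F x = ⟪lensGauss ω x₀ τ, ψ s⟫_ℂ := fun s => by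
    rw [inner_eq_integral]
    refine integral_congr_ae ?_
    filter_upwards [lensGauss_coe ω x₀ τ] with x hx
    rw [hF, gaussFn_conj, hx, mul_comm]
  have e2 : ∀ s, ∫ x, ψ s x * hamiltonian V ω β N F x = ⟪oscGauss ω x₀ τ, ψ s⟫_ℂ
      + ⟪lensGauss ω x₀ τ, mulL _ (memLp_potential V β N) (ψ s)⟫_ℂ := fun s => by
    rw [inner_eq_integral, inner_eq_integral, ← integral_add (integrable_conj_mul (Lp.memLp _) (Lp.memLp _))
      (integrable_conj_mul (Lp.memLp _) (Lp.memLp _))]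
    refine integral_congr_ae ?_
    filter_upwards [lensGauss_coe ω x₀ τ, oscGauss_coe ω x₀ τ,
      mulL_coe _ (memLp_potential V β N) (ψ s)] with x h1 h2 h3
    rw [h1, h2, h3, hamiltonian, hF', laplacian_gaussFn, gaussFn_conj, polyGauss, lensP, lensQ, lensR,
      potential]
    simp only [map_mul, map_add, map_sub, map_neg, map_div₀, map_pow, Complex.conj_ofReal,
      map_ofNat, map_natCast]
    push_cast
    ring
  have hcont : Continuous fun s => ⟪oscGauss ω x₀ τ, ψ s⟫_ℂ
      + ⟪lensGauss ω x₀ τ, mulL _ (memLp_potential V β N) (ψ s)⟫_ℂ :=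
    (continuous_const.inner h.continuous).add (continuous_const.inner
      ((mulL _ (memLp_potential V β N)).continuous.comp h.continuous))
  have hs := h.schrodinger F
  simp_rw [e1, e2] at hs
  have h1 := ((intervalIntegral.integral_hasDerivAt_right (a := 0) (b := t)
    (hcont.intervalIntegrable _ _)
    (hcont.stronglyMeasurableAtFilter _ _) hcont.continuousAt).const_mul (-Complex.I)).add_const
      ⟪lensGauss ω x₀ τ, ψ 0⟫_ℂ
  refine h1.congr_of_eventuallyEq (Eventually.of_forall fun s => ?_)
  have := hs s
  exact (sub_eq_iff_eq_add.mp this)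

/-- The `N`-body state in lens coordinates. -/
def lensPath (ω : ℝ) (ψ : ℝ → L2 N) (τ : ℝ) : L2 N := lensState ω τ (ψ (lensTime ω τ))

/-- The `N`-body state in lens coordinates and in the interaction picture. -/
def interPath (ω : ℝ) (ψ : ℝ → L2 N) (τ : ℝ) : L2 N := freeGroup N (-τ) (lensPath ω ψ τ)

theorem norm_lensPath (ω : ℝ) (ψ : ℝ → L2 N) (τ : ℝ) : ‖lensPath ω ψ τ‖ = ‖ψ (lensTime ω τ)‖ :=
  norm_lensState _ _ _

theorem norm_interPath (ω : ℝ) (ψ : ℝ → L2 N) (τ : ℝ) : ‖interPath ω ψ τ‖ = ‖ψ (lensTime ω τ)‖ := by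
  rw [interPath, norm_freeGroup, norm_lensPath]

theorem freeGroup_interPath (ω : ℝ) (ψ : ℝ → L2 N) (τ : ℝ) :
    freeGroup N τ (interPath ω ψ τ) = lensPath ω ψ τ := freeGroup_self_neg _ _ _

/-- The time derivative in the interaction picture. -/
def interVel (V : 𝓢(ℝ, ℝ)) (ω β : ℝ) (ψ : ℝ → L2 N) (τ : ℝ) : L2 N :=
  -Complex.I • freeGroup N (-τ) (mulL _ (memLp_lensPotential V ω β N τ) (lensPath ω ψ τ))

/-- The motion of the lens Gaussian contributes +i g² times the oscillator term and the equation for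
ψ contributes -i g² times the same term. They cancel, and only the interaction remains. -/
theorem IsNBodyEvolution.hasDerivAt_inner_interPath (h : IsNBodyEvolution V ω β N ψ) (x₀ : E N)
    (τ : ℝ) : HasDerivAt (fun τ => ⟪gauss x₀ 0, interPath ω ψ τ⟫_ℂ)
      ⟪gauss x₀ 0, interVel V ω β ψ τ⟫_ℂ τ := by
  have hmove : ∀ (s : ℝ) (f : L2 N), ⟪gauss x₀ 0, freeGroup N (-s) f⟫_ℂ = ⟪gauss x₀ s, f⟫_ℂ :=
    fun s f => by rw [← inner_freeGroup_left, freeGroup_gauss, zero_add]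
  have hid : ∀ f : L2 N, ∀ (hc : MemLp (fun _ : E N => (1 : ℂ)) ∞ volume), mulL _ hc f = f :=
    fun f hc => by
      refine Lp.ext ?_
      filter_upwards [mulL_coe _ hc f] with x hx
      rw [hx, one_mul]
  have e1 : ∀ s, ⟪gauss x₀ 0, interPath ω ψ s⟫_ℂ = ⟪lensGauss ω x₀ s, ψ (lensTime ω s)⟫_ℂ :=
    fun s => by
      have := inner_gauss_lensState ω x₀ s (ψ (lensTime ω s)) (memLp_top_const (1 : ℂ))
        (memLp_top_const (1 : ℂ))
      rw [hid, hid] at this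
      rw [interPath, hmove, lensPath, this]
  have hψ : ContinuousAt (fun s => ψ (lensTime ω s)) τ :=
    h.continuous.continuousAt.comp (hasDerivAt_lensTime ω τ).continuousAt
  have hd := (h.hasDerivAt_inner x₀ τ (lensTime ω τ)).scomp τ (hasDerivAt_lensTime ω τ)
  have key := hasDerivAt_inner_of_weak (hasDerivAt_lensGauss ω x₀ τ) hψ hd
  refine (key.congr_of_eventuallyEq (Eventually.of_forall e1)).congr_deriv ?_
  have hV := memLp_potential V β N
  set c : ℂ := ((lensFactor ω τ ^ 2 : ℝ) : ℂ) with hc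
  have hw : MemLp (fun x : E N => c * (potential V β N x : ℂ)) ∞ volume := hV.const_mul c
  have hw' : MemLp (fun y : E N => c * (potential V β N (lensFactor ω τ • y) : ℂ)) ∞ volume := by
    have e : (fun y : E N => c * (potential V β N (lensFactor ω τ • y) : ℂ))
        = lensPotential V ω β N τ := funext fun y => by rw [lensPotential, Complex.ofReal_mul]
    rw [e]
    exact memLp_lensPotential V ω β N τ
  have e2 := inner_gauss_lensState ω x₀ τ (ψ (lensTime ω τ)) hw hw'
  have e3 : mulL _ hw (ψ (lensTime ω τ)) = c • mulL _ hV (ψ (lensTime ω τ)) := by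
    refine Lp.ext ?_
    filter_upwards [mulL_coe _ hw (ψ (lensTime ω τ)), mulL_coe _ hV (ψ (lensTime ω τ)),
      Lp.coeFn_smul c (mulL _ hV (ψ (lensTime ω τ)))] with x h1 h2 h3
    rw [h1, h3, Pi.smul_apply, h2, smul_eq_mul, mul_assoc]
  have e4 : mulL _ (memLp_lensPotential V ω β N τ) (lensPath ω ψ τ)
      = mulL _ hw' (lensState ω τ (ψ (lensTime ω τ))) := by
    refine Lp.ext ?_
    filter_upwards [mulL_coe _ hw' (lensState ω τ (ψ (lensTime ω τ))),
      mulL_coe _ (memLp_lensPotential V ω β N τ) (lensPath ω ψ τ)] with x h1 h2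
    rw [h2, h1, lensPath, lensPotential, Complex.ofReal_mul]
  rw [interVel, inner_smul_right, hmove, e4, e2, e3, inner_smul_left, inner_smul_right, map_mul,
    map_neg, Complex.conj_I, hc, Complex.conj_ofReal, Complex.real_smul]
  ring

/-- Differentiability against Gaussians gives weak continuity; the norms are continuous because lens
transform and free group are isometric; together they give norm continuity. -/
theorem IsNBodyEvolution.continuous_interPath (h : IsNBodyEvolution V ω β N ψ) :
    Continuous (interPath ω ψ) := by
  have hψ : Continuous fun s => ψ (lensTime ω s) :=
    h.continuous.comp (continuous_iff_continuousAt.mpr fun τ => (hasDerivAt_lensTime ω τ).continuousAt)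
  refine continuous_iff_continuousAt.mpr fun τ => ?_
  have hn : Tendsto (fun s => ‖interPath ω ψ s‖) (𝓝 τ) (𝓝 ‖interPath ω ψ τ‖) := by
    simp_rw [norm_interPath]
    exact hψ.norm.tendsto τ
  refine tendsto_of_weak_of_norm (tendsto_inner_of_total (C := ‖interPath ω ψ τ‖ + 1)
    ((hn.eventually_lt_const (lt_add_one _)).mono fun s hs => hs.le) dense_span_gauss ?_ _) hn
  rintro _ ⟨x, rfl⟩
  exact (h.hasDerivAt_inner_interPath x τ).continuousAt

theorem IsNBodyEvolution.continuous_lensPath (h : IsNBodyEvolution V ω β N ψ) :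
    Continuous (lensPath ω ψ) := by
  refine continuous_iff_continuousAt.mpr fun τ => ?_
  have := continuousAt_freeGroup (continuousAt_id (x := τ)) h.continuous_interPath.continuousAt
  simpa only [id, freeGroup_interPath] using this

theorem IsNBodyEvolution.continuous_interVel (h : IsNBodyEvolution V ω β N ψ) :
    Continuous (interVel V ω β ψ) := by
  obtain ⟨M, hM⟩ := exists_norm_lensPotential_le V ω β N
  refine continuous_iff_continuousAt.mpr fun τ => ?_
  have h1 : ContinuousAt (fun s => mulL _ (memLp_lensPotential V ω β N s) (lensPath ω ψ s)) τ :=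
    continuousAt_mulL _ hM (fun x => ((continuous_lensPotential V ω β N).comp
      (by fun_prop : Continuous fun s : ℝ => (s, x))).continuousAt)
      h.continuous_lensPath.continuousAt
  exact (continuousAt_freeGroup continuousAt_neg h1).const_smul (-Complex.I)

theorem IsNBodyEvolution.hasDerivAt_interPath (h : IsNBodyEvolution V ω β N ψ) (τ : ℝ) :
    HasDerivAt (interPath ω ψ) (interVel V ω β ψ τ) τ := by
  refine hasDerivAt_of_inner h.continuous_interVel dense_span_gauss ?_ τ
  rintro _ ⟨x, rfl⟩ s
  exact h.hasDerivAt_inner_interPath x s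

/-- The potential is real, so the velocity is -i times a symmetric operator applied to the state,
and the squared norm has zero derivative. -/
theorem IsNBodyEvolution.norm_interPath_eq (h : IsNBodyEvolution V ω β N ψ) (τ : ℝ) :
    ‖interPath ω ψ τ‖ = ‖ψ 0‖ := by
  have hd : ∀ τ, HasDerivAt (fun τ => ⟪interPath ω ψ τ, interPath ω ψ τ⟫_ℂ) 0 τ := fun τ => by
    refine (HasDerivAt.inner ℂ (h.hasDerivAt_interPath τ) (h.hasDerivAt_interPath τ)).congr_deriv ?_
    set w := mulL _ (memLp_lensPotential V ω β N τ) (lensPath ω ψ τ) with hw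
    have e : ⟪lensPath ω ψ τ, w⟫_ℂ = ⟪w, lensPath ω ψ τ⟫_ℂ := by
      rw [hw, ← ContinuousLinearMap.adjoint_inner_left, adjoint_mulL]
      congr 1
      refine Lp.ext ?_
      filter_upwards [mulL_coe _ (memLp_lensPotential V ω β N τ) (lensPath ω ψ τ),
        mulL_coe (fun x => conj (lensPotential V ω β N τ x)) (memLp_lensPotential V ω β N τ).star
        (lensPath ω ψ τ)] with x h1 h2
      rw [h1]
      refine h2.trans ?_
      rw [lensPotential, Complex.conj_ofReal]
    rw [interVel, ← hw, interPath, inner_smul_left, inner_smul_right, inner_freeGroup,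
      inner_freeGroup, e]
    simp
  have hc := is_const_of_deriv_eq_zero (fun s => (hd s).differentiableAt)
    (fun s => (hd s).deriv) τ 0
  rw [inner_self_eq_norm_sq_to_K, inner_self_eq_norm_sq_to_K] at hc
  have hc2 : ‖interPath ω ψ τ‖ = ‖interPath ω ψ 0‖ :=
    (sq_eq_sq₀ (norm_nonneg _) (norm_nonneg _)).mp (by exact_mod_cast hc)
  rw [hc2, norm_interPath, lensTime_zero]

end Interaction

/-! ### Pair interactions in a bosonic state -/

section Pairs

/-- The pair interaction `c V(μ(yᵢ - yⱼ))`. -/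
def pairPot {N : ℕ} (V : 𝓢(ℝ, ℝ)) (c μ : ℝ) (i j : Fin N) (y : E N) : ℂ :=
  ((c * V (μ * (y i - y j)) : ℝ) : ℂ)

variable {k m N : ℕ} {V : 𝓢(ℝ, ℝ)} {c μ : ℝ}

theorem memLp_pairPot (V : 𝓢(ℝ, ℝ)) (c μ : ℝ) (i j : Fin N) : MemLp (pairPot V c μ i j) ∞ volume := by
  obtain ⟨M, hM⟩ := exists_norm_schwartz_le V
  have hc : Continuous (pairPot V c μ i j) := by
    unfold pairPot
    have := V.continuous
    fun_prop
  refine memLp_top_of_bound hc.aestronglyMeasurable (|c| * M) (ae_of_all _ fun x => ?_)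
  rw [pairPot, Complex.norm_real, Real.norm_eq_abs, abs_mul]
  gcongr
  exact hM _

/-- Multiplication by the pair interaction. -/
def pairOp (V : 𝓢(ℝ, ℝ)) (c μ : ℝ) (i j : Fin N) : L2 N →L[ℂ] L2 N :=
  mulL _ (memLp_pairPot V c μ i j)

theorem norm_pairOp_le {M : ℝ} (hM : ∀ x, |V x| ≤ M) (i j : Fin N) (ψ : L2 N) :
    ‖pairOp V c μ i j ψ‖ ≤ |c| * M * ‖ψ‖ := by
  refine norm_mulL_apply_le _ _ (fun x => ?_) _
  rw [pairPot, Complex.norm_real, Real.norm_eq_abs, abs_mul]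
  gcongr
  exact hM _

theorem inner_mulL_of_real {X : Type*} [MeasureSpace X] {v : X → ℂ} (hv : MemLp v ∞ volume)
    (hr : ∀ x, conj (v x) = v x) (f g : LL X) : ⟪mulL v hv f, g⟫_ℂ = ⟪f, mulL v hv g⟫_ℂ := by
  rw [inner_eq_integral, inner_eq_integral]
  refine integral_congr_ae ?_
  filter_upwards [mulL_coe v hv f, mulL_coe v hv g] with x h1 h2
  rw [h1, h2, map_mul, hr]
  ring

theorem conj_pairPot (i j : Fin N) (x : E N) :
    conj (pairPot V c μ i j x) = pairPot V c μ i j x := Complex.conj_ofReal _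

/-- An interaction among the traced out particles does not contribute. -/
theorem inner_C_pairOp_of_inr (e : Fin k ⊕ Fin m ≃ Fin N) (i j : Fin m) (f g : L2 k) (χ : L2 N) :
    ⟪(splitE e).C f (pairOp V c μ (e (Sum.inr i)) (e (Sum.inr j)) χ), (splitE e).C g χ⟫_ℂ
      = ⟪(splitE e).C f χ, (splitE e).C g (pairOp V c μ (e (Sum.inr i)) (e (Sum.inr j)) χ)⟫_ℂ := by
  have h : ∀ x, pairPot V c μ (e (Sum.inr i)) (e (Sum.inr j)) x
      = pairPot V c μ i j ((splitE e).toEquiv x).2 := fun x => rfl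
  rw [pairOp, (splitE e).C_mulL (hw := memLp_pairPot V c μ i j) h,
    (splitE e).C_mulL (hw := memLp_pairPot V c μ i j) h,
    inner_mulL_of_real _ (conj_pairPot i j)]

/-- `ℝᵏ⁺¹ ≃ ℝᵏ × ℝ`. -/
def appendEquiv (k : ℕ) : Fin k ⊕ Fin 1 ≃ Fin (k + 1) := finSumFinEquiv

theorem splitE_appendEquiv_symm (z : E k × E 1) :
    (splitE (appendEquiv k)).toEquiv.symm z = append z.1 (z.2 0) := by
  refine splitE_symm_eq _ _ _ (fun i => ?_) fun i => ?_
  · have : appendEquiv k (Sum.inl i) = Fin.castSucc i := rfl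
    rw [this]
    simp [append]
  · have : appendEquiv k (Sum.inr i) = Fin.last k := by
      obtain rfl : i = 0 := Subsingleton.elim _ _
      rfl
    rw [this]
    obtain rfl : i = 0 := Subsingleton.elim _ _
    simp [append]

/-- Move one particle from the second group to the end of the first. -/
def graftEquiv {m' : ℕ} (e : Fin k ⊕ Fin m ≃ Fin N) (e' : Fin m' ⊕ Fin 1 ≃ Fin m) :
    Fin (k + 1) ⊕ Fin m' ≃ Fin N :=
  (((appendEquiv k).symm.sumCongr (Equiv.refl _)).trans (Equiv.sumAssoc _ _ _)).trans
    (((Equiv.refl _).sumCongr ((Equiv.sumComm _ _).trans e')).trans e)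

theorem compat_graft {m' : ℕ} (e : Fin k ⊕ Fin m ≃ Fin N) (e' : Fin m' ⊕ Fin 1 ≃ Fin m) :
    Split.Compat (splitE (graftEquiv e e')).swap (splitE (appendEquiv k)) (splitE e)
      (splitE e') where
  fst x := by
    ext i
    rfl
  mid x := by
    ext i
    change x (graftEquiv e e' (Sum.inl (appendEquiv k (Sum.inl i)))) = x (e (Sum.inl i))
    simp [graftEquiv]
  snd x := by
    ext i
    change x (graftEquiv e e' (Sum.inl (appendEquiv k (Sum.inr i)))) = x (e (Sum.inr (e' (Sum.inr i))))
    simp [graftEquiv]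

/-- The observable by which a pair interaction acts on the `(k+1)`-particle marginal. -/
def pairObs (V : 𝓢(ℝ, ℝ)) (c μ : ℝ) (i : Fin k) (f g : L2 k) : Op (k + 1) :=
  (splitE (appendEquiv k)).T f ∘L (splitE (appendEquiv k)).C g
    ∘L pairOp V c μ (Fin.castSucc i) (Fin.last k)

/-- A pair interaction in terms of the `(k+1)`-particle marginal. -/
theorem IsBosonic.inner_C_pairOp {χ : L2 N} (hχ : IsBosonic χ) {m' : ℕ}
    (e : Fin k ⊕ Fin m ≃ Fin N) {e₀ : Fin (k + 1) ⊕ Fin m' ≃ Fin N} {A : Op (k + 1)}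
    (hA : ∀ f g, ⟪g, A f⟫_ℂ = ⟪(splitE e₀).C f χ, (splitE e₀).C g χ⟫_ℂ) (i : Fin k) (j : Fin m)
    (f g : L2 k) :
    ⟪(splitE e).C f χ, (splitE e).C g (pairOp V c μ (e (Sum.inl i)) (e (Sum.inr j)) χ)⟫_ℂ
      = trace (pairObs V c μ i f g ∘L A) := by
  have hm : m' + 1 = m := by
    have h1 := card_splitE e
    have h2 := card_splitE e₀
    omega
  -- Particle `j` is made the last of its group, so that grafting it onto the first group puts it in
  -- position k + 1. Symmetry of χ permits the reordering.
  obtain ⟨e', he'⟩ : ∃ e' : Fin m' ⊕ Fin 1 ≃ Fin m, e' (Sum.inr 0) = j := by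
    refine ⟨(finSumFinEquiv.trans (finCongr hm)).trans
      (Equiv.swap ((finSumFinEquiv.trans (finCongr hm)) (Sum.inr 0)) j), ?_⟩
    rw [Equiv.trans_apply, Equiv.swap_apply_left]
  set p := splitE (graftEquiv e e') with hp
  have hcomp := compat_graft e e'
  have hA' : ∀ f g, ⟪g, A f⟫_ℂ = ⟪p.C f χ, p.C g χ⟫_ℂ := fun f g => by
    rw [hA, hχ.C_eq e₀ (graftEquiv e e') f, hχ.C_eq e₀ (graftEquiv e e') g]
  have hpot : ∀ x, pairPot V c μ (e (Sum.inl i)) (e (Sum.inr j)) x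
      = pairPot V c μ (Fin.castSucc i) (Fin.last k) (p.swap.toEquiv x).2 := fun x => by
    have h1 : (p.swap.toEquiv x).2 (Fin.castSucc i) = x (e (Sum.inl i)) := by
      change x (graftEquiv e e' (Sum.inl (appendEquiv k (Sum.inl i)))) = x (e (Sum.inl i))
      simp [graftEquiv]
    have h2 : (p.swap.toEquiv x).2 (Fin.last k) = x (e (Sum.inr j)) := by
      change x (graftEquiv e e' (Sum.inl (appendEquiv k (Sum.inr 0)))) = x (e (Sum.inr j))
      rw [← he']
      simp [graftEquiv]
    rw [pairPot, pairPot, h1, h2]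
  -- Contraction over the spectators commutes with everything acting on the k + 1 active particles.
  have key : ∀ b, p.swap.C b ((splitE e).T f ((splitE e).C g
      (pairOp V c μ (e (Sum.inl i)) (e (Sum.inr j)) χ)))
      = pairObs V c μ i f g (p.swap.C b χ) := fun b => by
    rw [hcomp.C_T, ← hcomp.C_C, pairOp,
      p.swap.C_mulL (hw := memLp_pairPot V c μ (Fin.castSucc i) (Fin.last k)) hpot]
    rfl
  have h1 := p.hasSum_partialTrace (ψ := χ) key
  have h2 := (p.nuclearRep_of_inner_C χ hA').hasSum_trace (pairObs V c μ i f g)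
  rw [← h1.unique h2]
  exact ContinuousLinearMap.adjoint_inner_left ((splitE e).T f) _ _

end Pairs

/-! ### Traces of pair observables -/

section PairTrace

variable {k : ℕ} {V : 𝓢(ℝ, ℝ)} {c μ : ℝ}

theorem continuous_append : Continuous fun p : E k × ℝ => append p.1 p.2 := by
  have h : (fun p : E k × ℝ => append p.1 p.2)
      = fun p => (splitE (appendEquiv k)).toEquiv.symm (p.1, WithLp.toLp 2 fun _ => p.2) := by
    funext p
    rw [splitE_appendEquiv_symm]
  rw [h]
  refine (continuous_splitE_symm _).comp (continuous_fst.prodMk ?_)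
  exact (PiLp.continuous_toLp 2 _).comp (continuous_pi fun _ => continuous_snd)

theorem integral_E_one (F : ℝ → ℂ) : ∫ a : E 1, F (a 0) = ∫ r, F r := by
  have h1 := (EuclideanSpace.volume_preserving_symm_measurableEquiv_toLp (Fin 1)).trans
    (volume_preserving_funUnique (Fin 1) ℝ)
  exact h1.integral_comp ((MeasurableEquiv.toLp 2 (Fin 1 → ℝ)).symm.trans
    (MeasurableEquiv.funUnique (Fin 1) ℝ)).measurableEmbedding F

/-- The value of a pair observable in terms of the continuous kernel. -/
def pairIntegrand (V : 𝓢(ℝ, ℝ)) (ε : ℝ) (i : Fin k) (f g : L2 k)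
    (K : E (k + 1) → E (k + 1) → ℂ) (p : (E k × E k) × ℝ) : ℂ :=
  conj (g p.1.1) * f p.1.2 * (V p.2 : ℂ)
    * K (append p.1.1 (p.1.1 i - ε * p.2)) (append p.1.2 (p.1.1 i - ε * p.2))

theorem integrable_pair_bound {f g : L2 k} (hf : Integrable (f : E k → ℂ))
    (hg : Integrable (g : E k → ℂ)) (V : 𝓢(ℝ, ℝ)) :
    Integrable fun p : (E k × E k) × ℝ => ‖g p.1.1‖ * ‖f p.1.2‖ * ‖V p.2‖ :=
  (hg.norm.mul_prod hf.norm).mul_prod V.integrable.norm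

theorem aestronglyMeasurable_pairIntegrand (V : 𝓢(ℝ, ℝ)) (ε : ℝ) (i : Fin k) (f g : L2 k)
    {K : E (k + 1) → E (k + 1) → ℂ} (hK : Continuous (Function.uncurry K)) :
    AEStronglyMeasurable (pairIntegrand V ε i f g K) volume := by
  have h1 : AEStronglyMeasurable (fun p : (E k × E k) × ℝ => conj (g p.1.1)) volume :=
    Complex.continuous_conj.comp_aestronglyMeasurable
      ((Lp.aestronglyMeasurable g).comp_fst.comp_fst)
  have h2 : AEStronglyMeasurable (fun p : (E k × E k) × ℝ => f p.1.2) volume :=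
    (Lp.aestronglyMeasurable f).comp_snd.comp_fst
  have h3 : Continuous fun p : (E k × E k) × ℝ => (V p.2 : ℂ) := by
    have := V.continuous
    fun_prop
  have h4 : Continuous fun p : (E k × E k) × ℝ => append p.1.1 (p.1.1 i - ε * p.2) :=
    continuous_append.comp (by fun_prop : Continuous fun p : (E k × E k) × ℝ =>
      (p.1.1, p.1.1 i - ε * p.2))
  have h5 : Continuous fun p : (E k × E k) × ℝ => append p.1.2 (p.1.1 i - ε * p.2) :=
    continuous_append.comp (by fun_prop : Continuous fun p : (E k × E k) × ℝ =>
      (p.1.2, p.1.1 i - ε * p.2))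
  exact ((h1.mul h2).mul h3.aestronglyMeasurable).mul
    (hK.comp (h4.prodMk h5)).aestronglyMeasurable

theorem norm_pairIntegrand_le {V : 𝓢(ℝ, ℝ)} {ε : ℝ} {i : Fin k} {f g : L2 k}
    {K : E (k + 1) → E (k + 1) → ℂ} {M : ℝ} (hK : ∀ x x', ‖K x x'‖ ≤ M) (p : (E k × E k) × ℝ) :
    ‖pairIntegrand V ε i f g K p‖ ≤ M * (‖g p.1.1‖ * ‖f p.1.2‖ * ‖V p.2‖) := by
  rw [pairIntegrand, norm_mul, norm_mul, norm_mul, RCLike.norm_conj, Complex.norm_real, mul_comm M]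
  gcongr
  exact hK _ _

theorem integrable_pairIntegrand {V : 𝓢(ℝ, ℝ)} {ε : ℝ} {i : Fin k} {f g : L2 k}
    (hf : Integrable (f : E k → ℂ)) (hg : Integrable (g : E k → ℂ))
    {K : E (k + 1) → E (k + 1) → ℂ} (hKc : Continuous (Function.uncurry K)) {M : ℝ}
    (hK : ∀ x x', ‖K x x'‖ ≤ M) : Integrable (pairIntegrand V ε i f g K) :=
  ((integrable_pair_bound hf hg V).const_mul M).mono' (aestronglyMeasurable_pairIntegrand V ε i f g hKc)
    (ae_of_all _ (norm_pairIntegrand_le hK))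

/-- A pair observable in a vector state with continuous bounded wave function. -/
theorem inner_pairObs {f g : L2 k} (hf : Integrable (f : E k → ℂ)) (hg : Integrable (g : E k → ℂ))
    (hμ : 0 < μ) (i : Fin k) {w : L2 (k + 1)} {W : E (k + 1) → ℂ} (hw : w =ᵐ[volume] W)
    (hW : Continuous W) {R : ℝ} (hR : ∀ x, ‖W x‖ ≤ R) :
    ⟪w, pairObs V c μ i f g w⟫_ℂ
      = ((c * μ⁻¹ : ℝ) : ℂ) * ∫ p, pairIntegrand V μ⁻¹ i f g (fun x x' => W x * conj (W x')) p := by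
  set p := splitE (appendEquiv k) with hp
  have hae : ∀ {P : E (k + 1) → Prop}, (∀ᵐ x, P x) → ∀ᵐ a : E 1, ∀ᵐ y : E k, P (append y (a 0)) :=
    fun {P} h => by
      have h1 := Measure.ae_ae_of_ae_prod (p.swap.mp_symm.quasiMeasurePreserving.ae h)
      simpa only [Split.swap_symm_apply, hp, splitE_appendEquiv_symm] using h1
  set Φ : E k × E k → ℝ → ℂ := fun z a => conj (g z.1) * f z.2
    * ((c * V (μ * (z.1 i - a)) : ℝ) : ℂ) * (W (append z.1 a) * conj (W (append z.2 a))) with hΦ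
  have e1 : ⟪w, pairObs V c μ i f g w⟫_ℂ = ∫ a : E 1, ∫ z, Φ z (a 0) := by
    have : ⟪w, pairObs V c μ i f g w⟫_ℂ
        = ⟪p.C f w, p.C g (pairOp V c μ (Fin.castSucc i) (Fin.last k) w)⟫_ℂ :=
      (ContinuousLinearMap.adjoint_inner_left (p.T f) _ _).symm
    rw [this, inner_eq_integral]
    refine integral_congr_ae ?_
    filter_upwards [p.C_coe f w, p.C_coe g (pairOp V c μ (Fin.castSucc i) (Fin.last k) w), hae hw,
      hae (mulL_coe _ (memLp_pairPot V c μ (Fin.castSucc i) (Fin.last k)) w)] with a h1 h2 h3 h4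
    rw [h1, h2, mul_comm, ← integral_conj, ← integral_prod_mul]
    refine integral_congr_ae ?_
    filter_upwards [Measure.quasiMeasurePreserving_fst.ae h3, Measure.quasiMeasurePreserving_snd.ae h3,
      Measure.quasiMeasurePreserving_fst.ae h4] with z h5 h6 h7
    rw [hp, splitE_appendEquiv_symm, splitE_appendEquiv_symm, h6, pairOp, h7, h5, hΦ, pairPot]
    simp only [map_mul, Complex.conj_conj]
    have h8 : append z.1 (a 0) (Fin.castSucc i) = z.1 i := by simp [append]
    have h9 : append z.1 (a 0) (Fin.last k) = a 0 := by simp [append]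
    rw [h8, h9]
    ring
  rw [e1, integral_E_one fun a => ∫ z, Φ z a]
  -- The substitution a = z.1 i - r/μ: the scaled potential becomes V(r), and the last particle sits
  -- at distance |r|/μ from particle i.
  have hsub : ∀ (z : E k × E k) (F : ℝ → ℂ), ∫ a, F a = ((μ⁻¹ : ℝ) : ℂ) * ∫ r, F (z.1 i - μ⁻¹ * r) :=
    fun z F => by
      rw [Measure.integral_comp_mul_left (fun a => F (z.1 i - a)), inv_inv,
        integral_sub_left_eq_self, abs_of_pos hμ, Complex.real_smul, ← mul_assoc,
        ← Complex.ofReal_mul, inv_mul_cancel₀ hμ.ne', Complex.ofReal_one, one_mul]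
  have hΦr : ∀ z r, Φ z (z.1 i - μ⁻¹ * r)
      = (c : ℂ) * pairIntegrand V μ⁻¹ i f g (fun x x' => W x * conj (W x')) (z, r) := fun z r => by
    simp only [hΦ, pairIntegrand]
    rw [show μ * (z.1 i - (z.1 i - μ⁻¹ * r)) = r by field_simp; ring]
    push_cast
    ring
  have hKc : Continuous (Function.uncurry fun x x' => W x * conj (W x')) :=
    (hW.comp continuous_fst).mul (Complex.continuous_conj.comp (hW.comp continuous_snd))
  have hKb : ∀ x x', ‖W x * conj (W x')‖ ≤ R * R := fun x x' => by
    rw [norm_mul, RCLike.norm_conj]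
    have := hR x
    have := hR x'
    have := norm_nonneg (W x)
    gcongr
    linarith
  have hint := integrable_pairIntegrand (V := V) (ε := μ⁻¹) (i := i) hf hg hKc hKb
  have hΦa : ∀ z a, Φ z a = (c : ℂ) * pairIntegrand V μ⁻¹ i f g (fun x x' => W x * conj (W x'))
      (z, μ * (z.1 i - a)) := fun z a => by
    rw [← hΦr, inv_mul_cancel_left₀ hμ.ne', sub_sub_cancel]
  have hΦm : AEStronglyMeasurable (Function.uncurry Φ)
      ((volume : Measure (E k × E k)).prod volume) := by
    have h1 : AEStronglyMeasurable (fun p : (E k × E k) × ℝ => conj (g p.1.1)) volume :=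
      Complex.continuous_conj.comp_aestronglyMeasurable
        ((Lp.aestronglyMeasurable g).comp_fst.comp_fst)
    have h2 : AEStronglyMeasurable (fun p : (E k × E k) × ℝ => f p.1.2) volume :=
      (Lp.aestronglyMeasurable f).comp_snd.comp_fst
    have h3 : Continuous fun p : (E k × E k) × ℝ => ((c * V (μ * (p.1.1 i - p.2)) : ℝ) : ℂ) := by
      have := V.continuous
      fun_prop
    have h4 : Continuous fun p : (E k × E k) × ℝ => append p.1.1 p.2 :=
      continuous_append.comp (by fun_prop : Continuous fun p : (E k × E k) × ℝ => (p.1.1, p.2))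
    have h5 : Continuous fun p : (E k × E k) × ℝ => append p.1.2 p.2 :=
      continuous_append.comp (by fun_prop : Continuous fun p : (E k × E k) × ℝ => (p.1.2, p.2))
    exact ((h1.mul h2).mul h3.aestronglyMeasurable).mul
      (hKc.comp (h4.prodMk h5)).aestronglyMeasurable
  have hsubn : ∀ (z : E k × E k) (F : ℝ → ℝ), ∫ a, F (μ * (z.1 i - a)) = μ⁻¹ * ∫ r, F r :=
    fun z F => by
      rw [integral_sub_left_eq_self (fun a => F (μ * a)), Measure.integral_comp_mul_left,
        abs_of_pos (inv_pos.2 hμ), smul_eq_mul]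
  -- Integrability is carried back from `pairIntegrand` fiberwise, by the same substitution.
  have hΦint : Integrable (Function.uncurry Φ) ((volume : Measure (E k × E k)).prod volume) := by
    refine (integrable_prod_iff hΦm).2 ⟨?_, ?_⟩
    · filter_upwards [hint.prod_right_ae] with z hz
      simp only [Function.uncurry_apply_pair, hΦa]
      exact ((hz.comp_mul_left' hμ.ne').comp_sub_left (z.1 i)).const_mul _
    · simp only [Function.uncurry_apply_pair, hΦa, norm_mul]
      simp_rw [integral_const_mul]
      have := fun z => hsubn z fun r =>
        ‖pairIntegrand V μ⁻¹ i f g (fun x x' => W x * conj (W x')) (z, r)‖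
      simp_rw [this]
      exact (hint.integral_norm_prod_left.const_mul _).const_mul _
  rw [← integral_integral_swap hΦint]
  have hz : ∀ z, ∫ a, Φ z a = ((μ⁻¹ : ℝ) : ℂ) * ∫ r, (c : ℂ)
      * pairIntegrand V μ⁻¹ i f g (fun x x' => W x * conj (W x')) (z, r) := fun z => by
    rw [hsub z]
    simp_rw [hΦr]
  simp_rw [hz]
  rw [integral_const_mul]
  simp_rw [integral_const_mul]
  rw [← integral_prod _ hint, ← Measure.volume_eq_prod]
  push_cast
  ring

theorem norm_sandwichKernel_le {B : Op k} {M : ℝ} (hB : PosTrace B M) (x x' : E k) :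
    ‖sandwichKernel B x x'‖ ≤ M * greenConst k ^ 2 := by
  have h1 := norm_green_le x
  have h2 := norm_green_le x'
  have h3 := hB.bound_nonneg
  calc ‖sandwichKernel B x x'‖ ≤ M * ‖green x'‖ * ‖green x‖ := hB.norm_inner_le _ _
    _ ≤ M * greenConst k * greenConst k := by
        have h4 := greenConst_nonneg k
        gcongr
    _ = _ := by ring

theorem PosTrace.exists_rep {H : Type*} [NormedAddCommGroup H] [InnerProductSpace ℂ H]
    [CompleteSpace H] {B : H →L[ℂ] H} {M : ℝ} (h : PosTrace B M) :
    ∃ x : onb H → H, NuclearRep B x x ∧ ∀ s : Finset (onb H), ∑ e ∈ s, ‖x e‖ ^ 2 ≤ M :=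
  ⟨_, h.rep, h.sum_le⟩

/-- The trace of a pair observable against `L⁻¹ B L⁻¹` in terms of the kernel. -/
theorem trace_pairObs {f g : L2 k} (hf : Integrable (f : E k → ℂ)) (hg : Integrable (g : E k → ℂ))
    (hμ : 0 < μ) (i : Fin k) {B : Op (k + 1)} {M : ℝ} (hB : PosTrace B M) :
    trace (pairObs V c μ i f g ∘L energyWeightInv (k + 1) ∘L B ∘L energyWeightInv (k + 1))
      = ((c * μ⁻¹ : ℝ) : ℂ) * ∫ p, pairIntegrand V μ⁻¹ i f g (sandwichKernel B) p := by
  set G := greenConst (k + 1) with hG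
  -- B is the sum of |x_e⟩⟨x_e|, and `W e` is the continuous bounded representative of L⁻¹x_e.
  -- Summability of ‖x_e‖² allows exchanging this sum with the integral.
  obtain ⟨x, hrep, hsumle⟩ := hB.exists_rep
  set W : onb (L2 (k + 1)) → E (k + 1) → ℂ := fun e y => ⟪green y, x e⟫_ℂ with hW
  have hWc : ∀ e, Continuous (W e) := fun e => continuous_green.inner continuous_const
  have hWb : ∀ e y, ‖W e y‖ ≤ G * ‖x e‖ := fun e y =>
    (norm_inner_le_norm _ _).trans (by gcongr; exact norm_green_le y)
  have hKb : ∀ e y y', ‖W e y * conj (W e y')‖ ≤ G ^ 2 * ‖x e‖ ^ 2 := fun e y y' => by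
    rw [norm_mul, RCLike.norm_conj, ← mul_pow, pow_two]
    have := hWb e y
    have := hWb e y'
    gcongr
    exact (norm_nonneg _).trans (hWb e y)
  have hKc : ∀ e, Continuous (Function.uncurry fun y y' => W e y * conj (W e y')) := fun e =>
    ((hWc e).comp continuous_fst).mul (Complex.continuous_conj.comp ((hWc e).comp continuous_snd))
  have h1 := (hrep.conjugate (energyWeightInv (k + 1))).hasSum_trace (pairObs V c μ i f g)
  rw [adjoint_energyWeightInv] at h1
  have h2 : ∀ e, ⟪energyWeightInv (k + 1) (x e),
      pairObs V c μ i f g (energyWeightInv (k + 1) (x e))⟫_ℂ = ((c * μ⁻¹ : ℝ) : ℂ)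
        * ∫ p, pairIntegrand V μ⁻¹ i f g (fun y y' => W e y * conj (W e y')) p := fun e =>
    inner_pairObs hf hg hμ i (energyWeightInv_coe (x e)) (hWc e) (hWb e)
  simp_rw [h2] at h1
  have hint := fun e => integrable_pairIntegrand (V := V) (ε := μ⁻¹) (i := i) hf hg (hKc e) (hKb e)
  have hsum : Summable fun e => ∫ p, ‖pairIntegrand V μ⁻¹ i f g
      (fun y y' => W e y * conj (W e y')) p‖ := by
    refine Summable.of_nonneg_of_le (fun e => integral_nonneg fun _ => norm_nonneg _) (fun e => ?_)
      (((summable_of_sum_le (fun _ => by positivity) hsumle).mul_left (G ^ 2)).mul_right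
        (∫ p : (E k × E k) × ℝ, ‖g p.1.1‖ * ‖f p.1.2‖ * ‖V p.2‖))
    rw [← integral_const_mul]
    exact integral_mono (hint e).norm ((integrable_pair_bound hf hg V).const_mul _)
      (norm_pairIntegrand_le (hKb e))
  have h3 := (hasSum_integral_of_summable_integral_norm hint hsum).mul_left ((c * μ⁻¹ : ℝ) : ℂ)
  rw [h1.unique h3]
  congr 2
  funext p
  have h4 : ∀ y y', HasSum (fun e => W e y * conj (W e y')) (sandwichKernel B y y') := fun y y' =>
    (hrep.hasSum (green y') (green y)).congr_fun fun e => by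
      rw [hW, ← inner_conj_symm (x e)]
  simp only [pairIntegrand]
  exact ((h4 _ _).mul_left _).tsum_eq

/-- The uniform bound makes the errors u_n - u' and v_n - v' negligible. This is how weak
convergence of B yields convergence of kernels at moving points. -/
theorem tendsto_inner_of_weak {H γ : Type*} [NormedAddCommGroup H] [InnerProductSpace ℂ H]
    {l : Filter γ} {B : γ → H →L[ℂ] H} {B' : H →L[ℂ] H} {M : ℝ}
    (hb : ∀ᶠ n in l, ∀ f g, ‖⟪g, B n f⟫_ℂ‖ ≤ M * ‖f‖ * ‖g‖)
    (hw : ∀ f g, Tendsto (fun n => ⟪g, B n f⟫_ℂ) l (𝓝 ⟪g, B' f⟫_ℂ))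
    {u v : γ → H} {u' v' : H} (hu : Tendsto u l (𝓝 u')) (hv : Tendsto v l (𝓝 v')) :
    Tendsto (fun n => ⟪u n, B n (v n)⟫_ℂ) l (𝓝 ⟪u', B' v'⟫_ℂ) := by
  have h1 : Tendsto (fun n => ⟪u n - u', B n (v n)⟫_ℂ) l (𝓝 0) := by
    have h : Tendsto (fun n => M * ‖v n‖ * ‖u n - u'‖) l (𝓝 (M * ‖v'‖ * ‖u' - u'‖)) :=
      (hv.norm.const_mul M).mul (hu.sub_const u').norm
    rw [sub_self, norm_zero, mul_zero] at h
    exact squeeze_zero_norm' (hb.mono fun n hn => hn _ _) h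
  have h2 : Tendsto (fun n => ⟪u', B n (v n - v')⟫_ℂ) l (𝓝 0) := by
    have h : Tendsto (fun n => M * ‖v n - v'‖ * ‖u'‖) l (𝓝 (M * ‖v' - v'‖ * ‖u'‖)) :=
      ((hv.sub_const v').norm.const_mul M).mul_const _
    rw [sub_self, norm_zero, mul_zero, zero_mul] at h
    exact squeeze_zero_norm' (hb.mono fun n hn => hn _ _) h
  refine (((h1.add h2).add (hw v' u')).congr fun n => ?_).trans_eq (by simp)
  rw [inner_sub_left, map_sub, inner_sub_right]
  ring

theorem tendsto_green_append (y : E k) {γ : Type*} {l : Filter γ} {s : γ → ℝ} {s' : ℝ}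
    (hs : Tendsto s l (𝓝 s')) :
    Tendsto (fun n => green (append y (s n))) l (𝓝 (green (append y s'))) := by
  have hc : Continuous fun a : ℝ => green (append y a) :=
    continuous_green.comp (continuous_append.comp (continuous_const.prodMk continuous_id))
  exact (hc.tendsto s').comp hs

/-- The scale and the operator pass to their limits together: `green` is norm continuous, so the
kernels converge pointwise along points moving with ε, and the uniform kernel bound dominates. -/
theorem tendsto_integral_pairIntegrand {f g : L2 k} (hf : Integrable (f : E k → ℂ))
    (hg : Integrable (g : E k → ℂ)) (i : Fin k) {γ : Type*} {l : Filter γ} [l.IsCountablyGenerated]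
    {B : γ → Op (k + 1)} {B' : Op (k + 1)} {M : ℝ} (hB : ∀ᶠ n in l, PosTrace (B n) M)
    (hw : ∀ f g, Tendsto (fun n => ⟪g, B n f⟫_ℂ) l (𝓝 ⟪g, B' f⟫_ℂ)) {ε : γ → ℝ}
    (hε : Tendsto ε l (𝓝 0)) :
    Tendsto (fun n => ∫ p, pairIntegrand V (ε n) i f g (sandwichKernel (B n)) p) l
      (𝓝 (∫ p, pairIntegrand V 0 i f g (sandwichKernel B') p)) := by
  have hlim : ∀ p : (E k × E k) × ℝ,
      Tendsto (fun n => pairIntegrand V (ε n) i f g (sandwichKernel (B n)) p) l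
        (𝓝 (pairIntegrand V 0 i f g (sandwichKernel B') p)) := fun p => by
    have hs : Tendsto (fun n => p.1.1 i - ε n * p.2) l (𝓝 (p.1.1 i - 0 * p.2)) :=
      Tendsto.const_sub (p.1.1 i) (hε.mul_const p.2)
    have ha := fun y : E k => tendsto_green_append y hs
    have hb : ∀ᶠ n in l, ∀ f g, ‖⟪g, B n f⟫_ℂ‖ ≤ M * ‖f‖ * ‖g‖ :=
      hB.mono fun n hn => hn.norm_inner_le
    have := tendsto_inner_of_weak hb hw (ha p.1.1) (ha p.1.2)
    simp only [pairIntegrand, sandwichKernel]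
    exact Tendsto.const_mul (conj (g p.1.1) * f p.1.2 * (V p.2 : ℂ)) this
  have hmeas : ∀ᶠ n in l, AEStronglyMeasurable
      (pairIntegrand V (ε n) i f g (sandwichKernel (B n))) volume :=
    Eventually.of_forall fun n => aestronglyMeasurable_pairIntegrand V _ i f g
      (continuous_sandwichKernel _)
  have hbd : ∀ᶠ n in l, ∀ᵐ p, ‖pairIntegrand V (ε n) i f g (sandwichKernel (B n)) p‖
      ≤ M * greenConst (k + 1) ^ 2 * (‖g p.1.1‖ * ‖f p.1.2‖ * ‖V p.2‖) :=
    hB.mono fun n hn => ae_of_all _ fun p =>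
      norm_pairIntegrand_le (M := M * greenConst (k + 1) ^ 2)
        (fun x x' => norm_sandwichKernel_le hn x x') p
  exact tendsto_integral_filter_of_dominated_convergence _ hmeas hbd
    ((integrable_pair_bound hf hg V).const_mul _) (ae_of_all _ hlim)

/-- At scale zero the kernel no longer sees the relative coordinate, so ∫V factors out. -/
theorem integral_pairIntegrand_zero (i : Fin k) (f g : L2 k) (K : E (k + 1) → E (k + 1) → ℂ) :
    ∫ p, pairIntegrand V 0 i f g K p = ((∫ r, V r : ℝ) : ℂ)
      * ∫ z : E k × E k, conj (g z.1) * f z.2 * K (append z.1 (z.1 i)) (append z.2 (z.1 i)) := by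
  rw [mul_comm, ← integral_complex_ofReal, ← integral_prod_mul]
  refine integral_congr_ae (ae_of_all _ fun p => ?_)
  simp only [pairIntegrand, zero_mul, sub_zero]
  ring

end PairTrace

/-! ### The BBGKY hierarchy in lens coordinates -/

section BBGKY

variable {k N : ℕ} {V : 𝓢(ℝ, ℝ)} {ω β : ℝ} {ψ : ℝ → L2 N}

/-- `joinEquiv` preserves order and puts the first group below the second, so a pair i < j is inner,
mixed or entirely traced out, and each mixed pair occurs once. -/
theorem sum_pairs {A : Type*} [AddCommMonoid A] (h : k ≤ N) (F : Fin N → Fin N → A) :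
    ∑ i, ∑ j ∈ Finset.Ioi i, F i j
      = (∑ i : Fin k, ∑ j ∈ Finset.Ioi i, F (joinEquiv h (Sum.inl i)) (joinEquiv h (Sum.inl j)))
        + (∑ i : Fin k, ∑ j, F (joinEquiv h (Sum.inl i)) (joinEquiv h (Sum.inr j)))
        + ∑ i : Fin (N - k), ∑ j ∈ Finset.Ioi i,
          F (joinEquiv h (Sum.inr i)) (joinEquiv h (Sum.inr j)) := by
  have hI : ∀ {n : ℕ} (i : Fin n) (G : Fin n → A),
      ∑ j ∈ Finset.Ioi i, G j = ∑ j, if i < j then G j else 0 := fun i G => by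
    rw [← Finset.sum_filter]
    congr 1
    ext j
    simp
  have hl : ∀ i, ((joinEquiv h (Sum.inl i) : Fin N) : ℕ) = i := fun i => by simp [joinEquiv]
  have hr : ∀ i, ((joinEquiv h (Sum.inr i) : Fin N) : ℕ) = k + i := fun i => by simp [joinEquiv]
  simp_rw [hI]
  rw [← (joinEquiv h).sum_comp, Fintype.sum_sum_type]
  simp_rw [← (joinEquiv h).sum_comp, Fintype.sum_sum_type]
  rw [Finset.sum_add_distrib]
  have h1 : ∀ i j, joinEquiv h (Sum.inl i) < joinEquiv h (Sum.inl j) ↔ i < j := fun i j => by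
    rw [Fin.lt_def, hl, hl, Fin.lt_def]
  have h2 : ∀ i j, joinEquiv h (Sum.inl i) < joinEquiv h (Sum.inr j) := fun i j => by
    rw [Fin.lt_def, hl, hr]
    omega
  have h3 : ∀ i j, ¬ joinEquiv h (Sum.inr i) < joinEquiv h (Sum.inl j) := fun i j => by
    rw [Fin.lt_def, hl, hr]
    omega
  have h4 : ∀ i j, joinEquiv h (Sum.inr i) < joinEquiv h (Sum.inr j) ↔ i < j := fun i j => by
    rw [Fin.lt_def, hr, hr, Fin.lt_def]
    omega
  simp [h1, h2, h3, h4]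

theorem mulL_lensPotential (V : 𝓢(ℝ, ℝ)) (ω β : ℝ) (N : ℕ) (τ : ℝ) (χ : L2 N) :
    mulL _ (memLp_lensPotential V ω β N τ) χ = ∑ i, ∑ j ∈ Finset.Ioi i,
      pairOp V (lensFactor ω τ ^ 2 * (1 / (N : ℝ)) * (N : ℝ) ^ β) ((N : ℝ) ^ β * lensFactor ω τ)
        i j χ := by
  refine Lp.ext ?_
  set c := lensFactor ω τ ^ 2 * (1 / (N : ℝ)) * (N : ℝ) ^ β with hc
  set μ := (N : ℝ) ^ β * lensFactor ω τ with hμ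
  have h1 : ∀ᵐ x, ∀ i j : Fin N, pairOp V c μ i j χ x = pairPot V c μ i j x * χ x :=
    ae_all_iff.2 fun i => ae_all_iff.2 fun j => mulL_coe _ (memLp_pairPot V c μ i j) χ
  have hs : ∀ {κ : Type} (s : Finset κ) (F : κ → L2 N),
      (↑(∑ i ∈ s, F i) : E N → ℂ) =ᵐ[volume] fun x => ∑ i ∈ s, F i x := fun s F => by
    classical
    induction s using Finset.induction_on with
    | empty =>
      simp only [Finset.sum_empty]
      exact Lp.coeFn_zero _ _ _
    | insert a s ha ih =>
      simp only [Finset.sum_insert ha]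
      filter_upwards [Lp.coeFn_add (F a) (∑ i ∈ s, F i), ih] with x h1 h2
      rw [h1, Pi.add_apply, h2]
  filter_upwards [mulL_coe _ (memLp_lensPotential V ω β N τ) χ, h1,
    hs Finset.univ fun i => ∑ j ∈ Finset.Ioi i, pairOp V c μ i j χ,
    ae_all_iff.2 fun i => hs (Finset.Ioi i) fun j => pairOp V c μ i j χ] with x h2 h3 h4 h5
  rw [h2, h4]
  simp_rw [h5, h3, ← Finset.sum_mul]
  congr 1
  simp only [lensPotential, potential, pairPot, PiLp.smul_apply, smul_eq_mul, ← Complex.ofReal_sum]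
  congr 1
  simp_rw [← mul_assoc, Finset.mul_sum, hμ, hc]
  refine Finset.sum_congr rfl fun i _ => Finset.sum_congr rfl fun j _ => ?_
  rw [← mul_sub]
  ring_nf

/-- The commutator of a pair interaction with the marginal. -/
def pairCommutator (V : 𝓢(ℝ, ℝ)) (c μ : ℝ) (h : k ≤ N) (i j : Fin N) (f g : L2 k) (χ : L2 N) : ℂ :=
  ⟪(splitE (joinEquiv h)).C f (pairOp V c μ i j χ), (splitE (joinEquiv h)).C g χ⟫_ℂ
    - ⟪(splitE (joinEquiv h)).C f χ, (splitE (joinEquiv h)).C g (pairOp V c μ i j χ)⟫_ℂ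

theorem norm_pairCommutator_le {M : ℝ} (hM : ∀ x, |V x| ≤ M) (c μ : ℝ) (h : k ≤ N) (i j : Fin N)
    (f g : L2 k) (χ : L2 N) :
    ‖pairCommutator V c μ h i j f g χ‖ ≤ 2 * (|c| * M) * (‖f‖ * ‖g‖ * ‖χ‖ ^ 2) := by
  set p := splitE (joinEquiv h) with hp
  have hb : ∀ (f g : L2 k) (u v : L2 N), ‖⟪p.C f u, p.C g v⟫_ℂ‖ ≤ ‖f‖ * ‖u‖ * (‖g‖ * ‖v‖) :=
    fun f g u v => (norm_inner_le_norm _ _).trans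
      (mul_le_mul (p.norm_C_apply_le _ _) (p.norm_C_apply_le _ _) (norm_nonneg _) (by positivity))
  have hP := norm_pairOp_le (c := c) (μ := μ) hM i j χ
  calc _ ≤ ‖f‖ * ‖pairOp V c μ i j χ‖ * (‖g‖ * ‖χ‖) + ‖f‖ * ‖χ‖ * (‖g‖ * ‖pairOp V c μ i j χ‖) :=
        (norm_sub_le _ _).trans (add_le_add (hb _ _ _ _) (hb _ _ _ _))
    _ ≤ ‖f‖ * (|c| * M * ‖χ‖) * (‖g‖ * ‖χ‖) + ‖f‖ * ‖χ‖ * (‖g‖ * (|c| * M * ‖χ‖)) := by gcongr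
    _ = _ := by ring

/-- The equation for the `k`-particle marginal in the interaction picture. -/
theorem IsNBodyEvolution.hasDerivAt_marginal (hψ : IsNBodyEvolution V ω β N ψ) (h : k + 1 ≤ N)
    (f g : L2 k) (s : ℝ) {c μ : ℝ}
    (hc : c = lensFactor ω s ^ 2 * (1 / (N : ℝ)) * (N : ℝ) ^ β)
    (hμ : μ = (N : ℝ) ^ β * lensFactor ω s) :
    HasDerivAt (fun s => ⟪freeGroup k s g, lensMarginal ω ψ k s (freeGroup k s f)⟫_ℂ)
      (Complex.I * ((∑ i : Fin k, ∑ j ∈ Finset.Ioi i,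
          pairCommutator V c μ (Nat.le_of_succ_le h) (joinEquiv (Nat.le_of_succ_le h) (Sum.inl i))
            (joinEquiv (Nat.le_of_succ_le h) (Sum.inl j)) (freeGroup k s f) (freeGroup k s g)
            (lensPath ω ψ s))
        + ∑ i : Fin k, ((N - k : ℕ) : ℂ)
          * (conj (trace (pairObs V c μ i (freeGroup k s g) (freeGroup k s f)
              ∘L lensMarginal ω ψ (k + 1) s))
            - trace (pairObs V c μ i (freeGroup k s f) (freeGroup k s g)
              ∘L lensMarginal ω ψ (k + 1) s)))) s := by
  have hk := Nat.le_of_succ_le h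
  set p := splitE (joinEquiv hk) with hp
  set χ := lensPath ω ψ s with hχ
  have hB : IsBosonic χ := (hψ.bosonic _).lensState ω s
  -- Passing to the interaction picture cancels the evolution of the test vectors; what is left acts
  -- unitarily on the traced-out particles and drops out of the inner product.
  have hq : (fun s => ⟪freeGroup k s g, lensMarginal ω ψ k s (freeGroup k s f)⟫_ℂ)
      = fun s => ⟪p.C f (interPath ω ψ s), p.C g (interPath ω ψ s)⟫_ℂ := by
    funext s
    rw [inner_lensMarginal hk]
    change ⟪p.C _ (lensPath ω ψ s), p.C _ (lensPath ω ψ s)⟫_ℂ = _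
    rw [← freeGroup_interPath, C_freeGroup, C_freeGroup, inner_freeGroup, freeGroup_neg_self,
      freeGroup_neg_self]
  rw [hq]
  have hd := hψ.hasDerivAt_interPath s
  have hC : ∀ f : L2 k, HasDerivAt (fun s => p.C f (interPath ω ψ s))
      (p.C f (interVel V ω β ψ s)) s := fun f => by
    exact ((p.C f).hasFDerivAt.restrictScalars ℝ).comp_hasDerivAt s hd
  refine (HasDerivAt.inner ℂ (hC f) (hC g)).congr_deriv ?_
  set w := mulL _ (memLp_lensPotential V ω β N s) χ with hw
  have hv : ∀ f, p.C f (interVel V ω β ψ s)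
      = -Complex.I • freeGroup (N - k) (-s) (p.C (freeGroup k s f) w) := fun f => by
    rw [interVel, map_smul, C_freeGroup, neg_neg]
  have hη : ∀ f, p.C f (interPath ω ψ s)
      = freeGroup (N - k) (-s) (p.C (freeGroup k s f) χ) := fun f => by
    rw [interPath, C_freeGroup, neg_neg]
  rw [hv, hv, hη, hη, inner_smul_right, inner_smul_left, inner_freeGroup, inner_freeGroup]
  set f' := freeGroup k s f
  set g' := freeGroup k s g
  have hw' : w = ∑ i, ∑ j ∈ Finset.Ioi i, pairOp V c μ i j χ := by
    rw [hw, mulL_lensPotential, hc, hμ]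
  have hcomm : ⟪p.C f' w, p.C g' χ⟫_ℂ - ⟪p.C f' χ, p.C g' w⟫_ℂ
      = ∑ i, ∑ j ∈ Finset.Ioi i, pairCommutator V c μ hk i j f' g' χ := by
    rw [hw']
    simp only [map_sum, sum_inner, inner_sum, pairCommutator, Finset.sum_sub_distrib, ← hp]
  -- The first half of the commutator is the conjugate of the second with `f` and `g` exchanged. The
  -- value does not depend on `j`, whence the factor N - k.
  have hmix : ∀ i j, pairCommutator V c μ hk (joinEquiv hk (Sum.inl i)) (joinEquiv hk (Sum.inr j))
      f' g' χ = conj (trace (pairObs V c μ i g' f' ∘L lensMarginal ω ψ (k + 1) s))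
            - trace (pairObs V c μ i f' g' ∘L lensMarginal ω ψ (k + 1) s) := fun i j => by
    have hA := fun f g => inner_lensMarginal h ω ψ s f g
    rw [pairCommutator, ← inner_conj_symm, hB.inner_C_pairOp (joinEquiv hk) hA i j,
      hB.inner_C_pairOp (joinEquiv hk) hA i j]
  have hfin : ∀ i j, pairCommutator V c μ hk (joinEquiv hk (Sum.inr i)) (joinEquiv hk (Sum.inr j))
      f' g' χ = 0 := fun i j => by
    rw [pairCommutator, inner_C_pairOp_of_inr, sub_self]
  rw [sum_pairs hk] at hcomm
  simp_rw [hmix, hfin, Finset.sum_const_zero, add_zero, Finset.sum_const, Finset.card_univ,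
    Fintype.card_fin, nsmul_eq_mul] at hcomm
  rw [← hcomm]
  simp
  ring

end BBGKY

/-! ### The collision operator -/

section Collision

theorem enorm_inner_le {H : Type*} [NormedAddCommGroup H] [InnerProductSpace ℂ H] (x y : H) :
    ‖⟪x, y⟫_ℂ‖ₑ ≤ ‖x‖ₑ * ‖y‖ₑ := by
  rw [← ofReal_norm, ← ofReal_norm, ← ofReal_norm, ← ENNReal.ofReal_mul (norm_nonneg _)]
  exact ENNReal.ofReal_le_ofReal (norm_inner_le_norm _ _)

theorem enorm_sq_eq_tsum {H : Type*} [NormedAddCommGroup H] [InnerProductSpace ℂ H]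
    [CompleteSpace H] (x : H) : ‖x‖ₑ ^ 2 = ∑' e : onb H, ‖⟪(e : H), x⟫_ℂ‖ₑ ^ 2 := by
  have h := (onbBasis H).hasSum_inner_mul_inner x x
  have h' : HasSum (fun e : onb H => ‖⟪(e : H), x⟫_ℂ‖ ^ 2) (‖x‖ ^ 2) := by
    have h2 := Complex.reCLM.hasSum h
    have h3 : (‖x‖ ^ 2 : ℝ) = Complex.reCLM ⟪x, x⟫_ℂ := by
      rw [inner_self_eq_norm_sq_to_K]
      norm_cast
    rw [h3]
    refine h2.congr_fun fun e => ?_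
    rw [onbBasis_apply, ← inner_conj_symm x, mul_comm, Complex.mul_conj,
      Complex.normSq_eq_norm_sq, Complex.reCLM_apply, Complex.ofReal_re]
  have hn : ∀ r : ℝ, 0 ≤ r → ENNReal.ofReal r ^ 2 = ENNReal.ofReal (r ^ 2) := fun r hr =>
    (ENNReal.ofReal_pow hr 2).symm
  simp_rw [← ofReal_norm]
  rw [hn _ (norm_nonneg _), ← h'.tsum_eq,
    ENNReal.ofReal_tsum_of_nonneg (fun _ => by positivity) h'.summable]
  exact tsum_congr fun e => (hn _ (norm_nonneg _)).symm

theorem PosTrace.exists_rep_cauchySchwarz {H : Type*} [NormedAddCommGroup H]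
    [InnerProductSpace ℂ H] [CompleteSpace H] {B : H →L[ℂ] H} {M : ℝ} (h : PosTrace B M) :
    ∃ x : onb H → H, ∑' e, ‖x e‖ₑ ^ 2 ≤ ENNReal.ofReal M ∧ ∀ f g, ‖⟪g, B f⟫_ℂ‖ₑ ^ 2
      ≤ (∑' e, ‖⟪g, x e⟫_ℂ‖ₑ ^ 2) * ∑' e, ‖⟪f, x e⟫_ℂ‖ₑ ^ 2 := by
  refine ⟨fun e => CFC.sqrt B e, ?_, fun f g => ?_⟩
  · refine le_trans (le_of_eq ?_) (ENNReal.ofReal_le_ofReal h.tsum_le)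
    rw [ENNReal.ofReal_tsum_of_nonneg (fun _ => by positivity) h.summable]
    exact tsum_congr fun e => by
      rw [← ofReal_norm, ENNReal.ofReal_pow (norm_nonneg _)]
  · have hp : ∀ f, ∑' e : onb H, ‖⟪f, CFC.sqrt B e⟫_ℂ‖ₑ ^ 2 = ‖CFC.sqrt B f‖ₑ ^ 2 := fun f => by
      rw [enorm_sq_eq_tsum]
      refine tsum_congr fun e => ?_
      rw [← inner_sqrt_left, ← inner_conj_symm, RCLike.enorm_conj]
    rw [hp, hp, ← mul_pow, ← inner_sqrt_sqrt h.nonneg]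
    gcongr
    exact enorm_inner_le _ _

variable {k : ℕ}

/-- `green` factorizes over the particles, and its last factor is bounded uniformly in position, so
the estimate does not see where particle k + 1 is. -/
theorem enorm_inner_green_append (x : L2 (k + 1)) (y : E k) (a : ℝ) :
    ‖⟪green (append y a), x⟫_ℂ‖ₑ
      ≤ ENNReal.ofReal (greenConst 1) * ‖(splitE (appendEquiv k)).C (green y) x‖ₑ := by
  have h : green (append y a)
      = (splitE (appendEquiv k)).T (green y) (green (WithLp.toLp 2 fun _ => a : E 1)) := by
    rw [T_green, splitE_appendEquiv_symm]
  rw [h, ← Split.inner_C]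
  refine (enorm_inner_le _ _).trans ?_
  gcongr
  rw [← ofReal_norm]
  exact ENNReal.ofReal_le_ofReal (norm_green_le _)

theorem enorm_sq_C_green (x : L2 (k + 1)) (y : E k) :
    ‖(splitE (appendEquiv k)).C (green y) x‖ₑ ^ 2
      = ∑' e : onb (L2 1), ‖⟪green y, (splitE (appendEquiv k)).swap.C e x⟫_ℂ‖ₑ ^ 2 := by
  rw [enorm_sq_eq_tsum]
  exact tsum_congr fun e => by rw [Split.inner_swap_C]

theorem measurable_enorm_sq_C_green (x : L2 (k + 1)) :
    Measurable fun y : E k => ‖(splitE (appendEquiv k)).C (green y) x‖ₑ ^ 2 := by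
  simp_rw [enorm_sq_C_green]
  refine Measurable.tsum fun e => ?_
  exact ((continuous_green.inner continuous_const).enorm.measurable).pow_const 2

/-- For each coefficient v of x in the last variable, the integral of |⟨green y, v⟩|² is ‖L⁻¹v‖² ≤
‖v‖²; these are summed by Parseval. -/
theorem lintegral_enorm_sq_C_green_le (x : L2 (k + 1)) :
    ∫⁻ y : E k, ‖(splitE (appendEquiv k)).C (green y) x‖ₑ ^ 2 ≤ ‖x‖ₑ ^ 2 := by
  simp_rw [enorm_sq_C_green]
  rw [lintegral_tsum fun e => ((continuous_green.inner
    continuous_const).enorm.measurable.pow_const 2).aemeasurable]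
  have hs := (splitE (appendEquiv k)).summable_norm_sq_C x
  rw [← ofReal_norm, ← ENNReal.ofReal_pow (norm_nonneg _), ← hs.tsum_eq,
    ENNReal.ofReal_tsum_of_nonneg (fun _ => by positivity) hs.summable]
  refine ENNReal.tsum_le_tsum fun e => ?_
  set v := (splitE (appendEquiv k)).swap.C e x
  have h1 : ∫⁻ y : E k, ‖⟪green y, v⟫_ℂ‖ₑ ^ 2 = ∫⁻ y, ‖energyWeightInv k v y‖ₑ ^ 2 := by
    refine lintegral_congr_ae ?_
    filter_upwards [energyWeightInv_coe v] with y hy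
    rw [hy]
  rw [h1, lintegral_enorm_sq]
  refine ENNReal.ofReal_le_ofReal ?_
  have h2 := (energyWeightInv k).le_of_opNorm_le (norm_energyWeightInv_le k) v
  rw [one_mul] at h2
  gcongr

/-- The density bounding a sandwich kernel, uniformly in the last particle. -/
theorem exists_density {B : Op (k + 1)} {M : ℝ} (hB : PosTrace B M) :
    ∃ ρ : E k → ℝ≥0∞, Measurable ρ ∧ ∫⁻ y, ρ y ≤ ENNReal.ofReal M ∧ ∀ y y' a a',
      ‖sandwichKernel B (append y a) (append y' a')‖ₑ ^ 2
        ≤ ENNReal.ofReal (greenConst 1) ^ 4 * (ρ y * ρ y') := by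
  -- The density is the diagonal of B weighted by L⁻¹ in the first k variables only, with the last
  -- particle traced out; the constant pays for the weight in the last variable.
  obtain ⟨x, hx, hcs⟩ := hB.exists_rep_cauchySchwarz
  refine ⟨fun y => ∑' e, ‖(splitE (appendEquiv k)).C (green y) (x e)‖ₑ ^ 2,
    Measurable.tsum fun e => measurable_enorm_sq_C_green (x e), ?_, fun y y' a a' => ?_⟩
  · rw [lintegral_tsum fun e => (measurable_enorm_sq_C_green (x e)).aemeasurable]
    exact (ENNReal.tsum_le_tsum fun e => lintegral_enorm_sq_C_green_le (x e)).trans hx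
  · have h : ∀ y a, ∑' e, ‖⟪green (append y a), x e⟫_ℂ‖ₑ ^ 2
        ≤ ENNReal.ofReal (greenConst 1) ^ 2
          * ∑' e, ‖(splitE (appendEquiv k)).C (green y) (x e)‖ₑ ^ 2 := fun y a => by
      rw [← ENNReal.tsum_mul_left]
      refine ENNReal.tsum_le_tsum fun e => ?_
      rw [← mul_pow]
      gcongr
      exact enorm_inner_green_append _ _ _
    refine (hcs _ _).trans ((mul_le_mul' (h y a) (h y' a')).trans (le_of_eq ?_))
    ring

/-- The kernel of the collision operator. -/
def collisionKernel (K : E (k + 1) → E (k + 1) → ℂ) (j : Fin k) (y y' : E k) : ℂ :=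
  K (append y (y j)) (append y' (y j)) - K (append y (y' j)) (append y' (y' j))

theorem continuous_collisionKernel {K : E (k + 1) → E (k + 1) → ℂ}
    (hK : Continuous (Function.uncurry K)) (j : Fin k) :
    Continuous (Function.uncurry (collisionKernel K j)) := by
  have h : ∀ (a b : E k × E k → E k) (c : E k × E k → ℝ), Continuous a → Continuous b →
      Continuous c → Continuous fun z => K (append (a z) (c z)) (append (b z) (c z)) :=
    fun a b c ha hb hc => hK.comp ((continuous_append.comp (ha.prodMk hc)).prodMk
      (continuous_append.comp (hb.prodMk hc)))
  exact (h _ _ (fun z => z.1 j) continuous_fst continuous_snd (by fun_prop)).sub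
    (h _ _ (fun z => z.2 j) continuous_fst continuous_snd (by fun_prop))

/-- The Hilbert-Schmidt bound of the collision operator. -/
def collisionBound (M : ℝ) : ℝ := 4 * greenConst 1 ^ 4 * M ^ 2

/-- Both kernel values are controlled by the same product ρ(y)ρ(y') wherever the contact point lies,
so their difference is square integrable. The factor 4 comes from |a - b| ≤ 2 max(|a|, |b|). -/
theorem exists_collision {B : Op (k + 1)} {M : ℝ} (hB : PosTrace B M) (j : Fin k) :
    ∃ D : Op k, HasKernel D (collisionKernel (sandwichKernel B) j) ∧
      HSBound D (collisionBound M) := by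
  obtain ⟨ρ, hρ, hρM, hK⟩ := exists_density hB
  have hM := hB.bound_nonneg
  have hG := greenConst_nonneg 1
  set G := ENNReal.ofReal (greenConst 1) with hGdef
  have hc := continuous_collisionKernel (continuous_sandwichKernel B) j
  have hpt : ∀ y y', ‖collisionKernel (sandwichKernel B) j y y'‖ₑ ^ 2
      ≤ 4 * G ^ 4 * (ρ y * ρ y') := fun y y' => by
    set s := max ‖sandwichKernel B (append y (y j)) (append y' (y j))‖ₑ
      ‖sandwichKernel B (append y (y' j)) (append y' (y' j))‖ₑ with hs
    have h1 : s ^ 2 ≤ G ^ 4 * (ρ y * ρ y') := by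
      rcases max_choice ‖sandwichKernel B (append y (y j)) (append y' (y j))‖ₑ
        ‖sandwichKernel B (append y (y' j)) (append y' (y' j))‖ₑ with h | h
      · rw [hs, h]
        exact hK _ _ _ _
      · rw [hs, h]
        exact hK _ _ _ _
    have h2 : ‖collisionKernel (sandwichKernel B) j y y'‖ₑ ≤ 2 * s := by
      refine (enorm_sub_le).trans ?_
      rw [two_mul]
      exact add_le_add (le_max_left _ _) (le_max_right _ _)
    calc _ ≤ (2 * s) ^ 2 := by gcongr
      _ = 4 * s ^ 2 := by ring
      _ ≤ 4 * (G ^ 4 * (ρ y * ρ y')) := by gcongr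
      _ = _ := by ring
  have hI : ∫⁻ z, ‖Function.uncurry (collisionKernel (sandwichKernel B) j) z‖ₑ ^ 2
      ≤ ENNReal.ofReal (collisionBound M) := by
    calc _ ≤ ∫⁻ z : E k × E k, 4 * G ^ 4 * (ρ z.1 * ρ z.2) := lintegral_mono fun z => hpt z.1 z.2
      _ = 4 * G ^ 4 * ((∫⁻ y, ρ y) * ∫⁻ y, ρ y) := by
          rw [lintegral_const_mul _ (by fun_prop : Measurable fun z : E k × E k => ρ z.1 * ρ z.2),
            Measure.volume_eq_prod, lintegral_prod_mul hρ.aemeasurable hρ.aemeasurable]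
      _ ≤ 4 * G ^ 4 * (ENNReal.ofReal M * ENNReal.ofReal M) := by gcongr
      _ = _ := by
          rw [collisionBound, ENNReal.ofReal_mul (by positivity), ENNReal.ofReal_mul (by norm_num),
            ENNReal.ofReal_pow hG, pow_two M, ENNReal.ofReal_mul hM, hGdef]
          norm_num
  have hbn : 0 ≤ collisionBound M := by
    rw [collisionBound]
    positivity
  have hmem : MemLp (Function.uncurry (collisionKernel (sandwichKernel B) j)) 2 volume := by
    refine ⟨hc.aestronglyMeasurable, ?_⟩
    rw [eLpNorm_lt_top_iff_lintegral_rpow_enorm_lt_top (by norm_num) (by norm_num)]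
    simpa using hI.trans_lt ENNReal.ofReal_lt_top
  refine exists_hasKernel hmem ?_
  have hm : AEStronglyMeasurable (fun z => ‖Function.uncurry
      (collisionKernel (sandwichKernel B) j) z‖ ^ 2) volume := (hc.norm.pow 2).aestronglyMeasurable
  rw [integral_eq_lintegral_of_nonneg_ae (ae_of_all _ fun _ => by positivity) hm]
  refine ENNReal.toReal_le_of_le_ofReal hbn (le_trans (le_of_eq (lintegral_congr fun z => ?_)) hI)
  rw [ENNReal.ofReal_pow (norm_nonneg _), ofReal_norm]

theorem norm_collisionKernel_le {B : Op (k + 1)} {M : ℝ} (hB : PosTrace B M) (j : Fin k)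
    (y y' : E k) :
    ‖collisionKernel (sandwichKernel B) j y y'‖ ≤ 2 * (M * greenConst (k + 1) ^ 2) := by
  refine (norm_sub_le _ _).trans ?_
  rw [two_mul]
  exact add_le_add (norm_sandwichKernel_le hB _ _) (norm_sandwichKernel_le hB _ _)

/-- Matrix elements of an operator with a bounded kernel. -/
theorem HasKernel.inner_eq {D : Op k} {K : E k → E k → ℂ} (hD : HasKernel D K)
    (hc : Continuous (Function.uncurry K)) {R : ℝ} (hR : ∀ y y', ‖K y y'‖ ≤ R) {f g : L2 k}
    (hf : Integrable (f : E k → ℂ)) (hg : Integrable (g : E k → ℂ)) :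
    Integrable (fun z : E k × E k => conj (g z.1) * f z.2 * K z.1 z.2) ∧
    ⟪g, D f⟫_ℂ = ∫ z : E k × E k, conj (g z.1) * f z.2 * K z.1 z.2 := by
  have hcg : Integrable fun y => conj (g y) := by
    refine hg.norm.mono' (Complex.continuous_conj.comp_aestronglyMeasurable hg.1)
      (ae_of_all _ fun y => ?_)
    simp
  have hint : Integrable fun z : E k × E k => conj (g z.1) * f z.2 * K z.1 z.2 :=
    (hcg.mul_prod hf).mul_bdd (c := R) hc.aestronglyMeasurable (ae_of_all _ fun z => hR z.1 z.2)
  refine ⟨hint, ?_⟩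
  rw [Measure.volume_eq_prod] at hint ⊢
  rw [integral_prod _ hint, inner_eq_integral]
  refine integral_congr_ae ?_
  filter_upwards [hD f] with y hy
  rw [hy.2, ← integral_const_mul]
  refine integral_congr_ae (ae_of_all _ fun y' => ?_)
  simp only
  ring

end Collision

/-! ### Matrix elements of the collision operator -/

section CollisionElements

/-- The test set is enlarged in one slot at a time; the other slot is reached through the adjoints,
which obey the same bound. -/
theorem tendsto_inner_of_total₂ {H γ : Type*} [NormedAddCommGroup H] [InnerProductSpace ℂ H]
    [CompleteSpace H] {l : Filter γ} {A : γ → H →L[ℂ] H} {A' : H →L[ℂ] H} {R : ℝ}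
    (hb : ∀ᶠ n in l, ‖A n‖ ≤ R) {G : Set H} (hG : Dense (Submodule.span ℂ G : Set H))
    (h : ∀ f ∈ G, ∀ g ∈ G, Tendsto (fun n => ⟪g, A n f⟫_ℂ) l (𝓝 ⟪g, A' f⟫_ℂ)) (f g : H) :
    Tendsto (fun n => ⟪g, A n f⟫_ℂ) l (𝓝 ⟪g, A' f⟫_ℂ) := by
  have h1 : ∀ f ∈ G, ∀ g, Tendsto (fun n => ⟪g, A n f⟫_ℂ) l (𝓝 ⟪g, A' f⟫_ℂ) := fun f hf g =>
    tendsto_inner_of_total (hb.mono fun n hn => (A n).le_of_opNorm_le hn f) hG (h f hf) g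
  have hadj : ∀ (D : H →L[ℂ] H) f, ⟪f, ContinuousLinearMap.adjoint D g⟫_ℂ = conj ⟪g, D f⟫_ℂ :=
    fun D f => by rw [ContinuousLinearMap.adjoint_inner_right, inner_conj_symm]
  have h2 : Tendsto (fun n => ⟪f, ContinuousLinearMap.adjoint (A n) g⟫_ℂ) l
      (𝓝 ⟪f, ContinuousLinearMap.adjoint A' g⟫_ℂ) := by
    refine tendsto_inner_of_total (C := R * ‖g‖) (hb.mono fun n hn =>
      ContinuousLinearMap.le_of_opNorm_le _ ?_ g) hG (fun f hf => ?_) f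
    · rwa [LinearIsometryEquiv.norm_map]
    · simp_rw [hadj]
      exact (Complex.continuous_conj.tendsto _).comp (h1 f hf g)
  simp_rw [hadj] at h2
  simpa only [Function.comp_def, Complex.conj_conj] using (Complex.continuous_conj.tendsto _).comp h2

variable {k n : ℕ}

/-- A Gaussian dominating the evolved Gaussians up to time `T`. -/
def gaussDom (T : ℝ) (x y : E n) : ℝ := Real.exp (-(1 / (2 * (1 + T ^ 2))) * ‖y - x‖ ^ 2)

theorem integrable_gaussDom (T : ℝ) (x : E n) : Integrable (gaussDom T x) := by
  set a : ℝ := 1 / (2 * (1 + T ^ 2)) with ha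
  have hpos : 0 < a := by positivity
  have h := (memLp_one_iff_integrable.1 (memLp_gaussFn (A := ((-a : ℝ) : ℂ)) (by simpa using hpos)
    0 0 (0 : E n) 1)).norm.comp_sub_right x
  refine h.congr (ae_of_all _ fun y => ?_)
  simp only [norm_gaussFn, gaussDom, Complex.ofReal_re, Complex.zero_re, zero_mul, add_zero, ← ha]

/-- Completing the square leaves exp(Re `gaussA` s · |y - x|²) times a prefactor of modulus at most
one; the Gaussian widens as |s| grows, so the one at T dominates. -/
theorem norm_gauss_le {T s : ℝ} (hs : |s| ≤ |T|) (x : E n) :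
    ∀ᵐ y, ‖gauss x s y‖ ≤ gaussDom T x y := by
  filter_upwards [gauss_coe x s] with y hy
  rw [hy, norm_gaussFn, gaussDom, Real.exp_le_exp]
  have hB : (gaussB s).re = -2 * (gaussA s).re := by
    have : gaussB s = ((-2 : ℝ) : ℂ) * gaussA s := by
      have := one_add_I_mul_ne_zero s
      rw [gaussA, gaussB]
      push_cast
      field_simp
    rw [this, Complex.re_ofReal_mul]
  have hlog : ((n / 2 : ℂ) * Complex.log (1 / (2 * Real.pi * (1 + Complex.I * s)))).re ≤ 0 := by
    have h1 : (n / 2 : ℂ) = ((n / 2 : ℝ) : ℂ) := by push_cast; rfl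
    rw [h1, Complex.re_ofReal_mul, Complex.log_re]
    refine mul_nonpos_of_nonneg_of_nonpos (by positivity) (Real.log_nonpos (norm_nonneg _) ?_)
    rw [norm_div, norm_one, norm_mul]
    have h2 : 1 ≤ ‖(1 + Complex.I * s : ℂ)‖ := by
      have := Complex.abs_re_le_norm (1 + Complex.I * s : ℂ)
      simpa using this
    have h3 : 1 ≤ ‖(2 * Real.pi : ℂ)‖ := by
      have := Real.pi_gt_three
      rw [norm_mul, Complex.norm_real, Real.norm_eq_abs, abs_of_pos Real.pi_pos]
      norm_num
      linarith
    exact div_le_one_of_le₀ (one_le_mul_of_one_le_of_one_le h3 h2) (by positivity)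
  have hD : (gaussD x s).re ≤ (gaussA s).re * ‖x‖ ^ 2 := by
    rw [gaussD, Complex.add_re, mul_comm (gaussA s), Complex.re_ofReal_mul, mul_comm (‖x‖ ^ 2)]
    linarith
  have hA : (gaussA s).re ≤ -(1 / (2 * (1 + T ^ 2))) := by
    rw [gaussA_re]
    have := sq_le_sq.2 hs
    have h1 : 1 / (2 * (1 + T ^ 2)) ≤ 1 / (2 * (1 + s ^ 2)) := by gcongr
    linarith
  calc _ ≤ (gaussA s).re * ‖y‖ ^ 2 + -2 * (gaussA s).re * ⟪x, y⟫_ℝ + (gaussA s).re * ‖x‖ ^ 2 := by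
        rw [hB]
        linarith
    _ = (gaussA s).re * ‖y - x‖ ^ 2 := by
        rw [norm_sub_sq_real, real_inner_comm x y]
        ring
    _ ≤ _ := by gcongr

theorem integrable_gauss (x : E n) (s : ℝ) : Integrable (gauss x s : E n → ℂ) :=
  (integrable_gaussDom s x).mono' (Lp.aestronglyMeasurable _) (norm_gauss_le le_rfl x)

theorem conj_sandwichKernel {B : Op n} {M : ℝ} (hB : PosTrace B M) (y y' : E n) :
    conj (sandwichKernel B y y') = sandwichKernel B y' y := by
  have hs : IsSelfAdjoint B := IsSelfAdjoint.of_nonneg hB.nonneg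
  rw [sandwichKernel, sandwichKernel, inner_conj_symm, ← ContinuousLinearMap.adjoint_inner_right,
    ← ContinuousLinearMap.star_eq_adjoint, hs.star_eq]

/-- The contact value appearing in the limit of the pair observables. -/
def contact (K : E (k + 1) → E (k + 1) → ℂ) (i : Fin k) (f g : L2 k) : ℂ :=
  ∫ z : E k × E k, conj (g z.1) * f z.2 * K (append z.1 (z.1 i)) (append z.2 (z.1 i))

/-- Hermitian symmetry of the kernel moves the contact point of the exchanged term from z.1 i to z.2
i; the difference is then the collision kernel with reversed sign. -/
theorem conj_contact_sub {B : Op (k + 1)} {M : ℝ} (hB : PosTrace B M) {D : Op k} {i : Fin k}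
    (hD : HasKernel D (collisionKernel (sandwichKernel B) i)) {f g : L2 k}
    (hf : Integrable (f : E k → ℂ)) (hg : Integrable (g : E k → ℂ)) :
    conj (contact (sandwichKernel B) i g f) - contact (sandwichKernel B) i f g
      = -⟪g, D f⟫_ℂ := by
  have hc := continuous_sandwichKernel B
  have hcg : Integrable fun y => conj (g y) := by
    refine hg.norm.mono' (Complex.continuous_conj.comp_aestronglyMeasurable hg.1)
      (ae_of_all _ fun y => ?_)
    simp
  have hi : ∀ c : E k × E k → ℝ, Continuous c → Integrable fun z : E k × E k =>
      conj (g z.1) * f z.2 * sandwichKernel B (append z.1 (c z)) (append z.2 (c z)) := fun c hcc =>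
    (hcg.mul_prod hf).mul_bdd (c := M * greenConst (k + 1) ^ 2)
      (hc.comp ((continuous_append.comp (continuous_fst.prodMk hcc)).prodMk
        (continuous_append.comp (continuous_snd.prodMk hcc)))).aestronglyMeasurable
      (ae_of_all _ fun z => norm_sandwichKernel_le hB _ _)
  have h1 := hi (fun z => z.1 i) (by fun_prop)
  have h2 := hi (fun z => z.2 i) (by fun_prop)
  have h3 : conj (contact (sandwichKernel B) i g f) = ∫ z : E k × E k,
      conj (g z.1) * f z.2 * sandwichKernel B (append z.1 (z.2 i)) (append z.2 (z.2 i)) := by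
    rw [contact, ← integral_conj, Measure.volume_eq_prod, ← integral_prod_swap]
    refine integral_congr_ae (ae_of_all _ fun z => ?_)
    simp only [map_mul, Complex.conj_conj, conj_sandwichKernel hB, Prod.fst_swap, Prod.snd_swap]
    ring
  rw [(hD.inner_eq (continuous_collisionKernel hc i) (norm_collisionKernel_le hB i) hf hg).2, h3,
    contact, ← integral_sub h2 h1, ← integral_neg]
  refine integral_congr_ae (ae_of_all _ fun z => ?_)
  simp only [collisionKernel]
  ring

/-- A weakly continuous path of energy bounded operators. -/
structure EnergyPath (T M : ℝ) (B : ℝ → Op n) : Prop where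
  posTrace : ∀ s ∈ Set.Icc 0 T, PosTrace (B s) M
  continuousOn : ∀ f g, ContinuousOn (fun s => ⟪g, B s f⟫_ℂ) (Set.Icc 0 T)

variable {T M ω : ℝ} {B : ℝ → Op (k + 1)} {D : ℝ → Op k} {i : Fin k}

/-- Along an energy bounded path the collision operators are weakly continuous. -/
theorem EnergyPath.continuousOn_collision (hB : EnergyPath T M B)
    (hD : ∀ s ∈ Set.Icc 0 T, HasKernel (D s) (collisionKernel (sandwichKernel (B s)) i) ∧
      HSBound (D s) (collisionBound M)) (f g : L2 k) :
    ContinuousOn (fun s => ⟪g, D s f⟫_ℂ) (Set.Icc 0 T) := by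
  intro s hs
  have hev : ∀ᶠ r in 𝓝[Set.Icc 0 T] s, r ∈ Set.Icc 0 T := eventually_mem_nhdsWithin
  -- The uniform bound reduces the test to Gaussians, which are integrable, so that matrix elements
  -- are absolutely convergent kernel integrals.
  refine tendsto_inner_of_total₂ (R := √(collisionBound M))
    (hev.mono fun r hr => (hD r hr).2.norm_le) dense_span_gauss ?_ f g
  rintro _ ⟨x, rfl⟩ _ ⟨y, rfl⟩
  have hf := integrable_gauss x 0
  have hg := integrable_gauss y 0
  have hform : ∀ r ∈ Set.Icc 0 T, ⟪gauss y 0, D r (gauss x 0)⟫_ℂ = ∫ z : E k × E k,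
      conj (gauss y 0 z.1) * gauss x 0 z.2 * collisionKernel (sandwichKernel (B r)) i z.1 z.2 :=
    fun r hr => ((hD r hr).1.inner_eq
      (continuous_collisionKernel (continuous_sandwichKernel _) i)
      (norm_collisionKernel_le (hB.posTrace r hr) i) hf hg).2
  rw [hform s hs]
  refine Tendsto.congr' (hev.mono fun r hr => (hform r hr).symm) ?_
  have hmeas : ∀ᶠ r in 𝓝[Set.Icc 0 T] s, AEStronglyMeasurable (fun z : E k × E k =>
      conj (gauss y 0 z.1) * gauss x 0 z.2 * collisionKernel (sandwichKernel (B r)) i z.1 z.2)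
      volume := hev.mono fun r hr => ((hD r hr).1.inner_eq
      (continuous_collisionKernel (continuous_sandwichKernel _) i)
      (norm_collisionKernel_le (hB.posTrace r hr) i) hf hg).1.1
  refine tendsto_integral_filter_of_dominated_convergence
    (fun z => ‖gauss y 0 z.1‖ * ‖gauss x 0 z.2‖ * (2 * (M * greenConst (k + 1) ^ 2))) hmeas
    (hev.mono fun r hr => ae_of_all _ fun z => ?_) ((hg.norm.mul_prod hf.norm).mul_const _)
    (ae_of_all _ fun z => ?_)
  · rw [norm_mul, norm_mul, RCLike.norm_conj]
    gcongr
    exact norm_collisionKernel_le (hB.posTrace r hr) i _ _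
  · simp only [collisionKernel, sandwichKernel]
    exact ((hB.continuousOn _ _ s hs).sub (hB.continuousOn _ _ s hs)).const_mul _

theorem inner_freeEvolution (τ : ℝ) (A : Op n) (f g : L2 n) :
    ⟪g, freeEvolution τ A f⟫_ℂ = ⟪freeGroup n (-τ) g, A (freeGroup n (-τ) f)⟫_ℂ := by
  rw [inner_freeGroup_left, neg_neg]
  rfl

theorem hsBound_freeEvolution {A : Op n} {R : ℝ} (hA : HSBound A R) (τ s : ℝ) :
    HSBound (freeEvolution τ ((lensFactor ω s : ℂ) • A)) R := by
  have h := (hA.smul (lensFactor ω s : ℂ)).comp (U := freeGroup n τ) (U' := freeGroup n (-τ))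
    (fun x => (norm_freeGroup _ _ _).le) (fun x y => inner_freeGroup _ _ _ _)
  intro m v hv
  refine (h m v hv).trans ?_
  rw [Complex.norm_real, Real.norm_eq_abs, abs_of_pos (lensFactor_pos ω s)]
  exact mul_le_of_le_one_left hA.bound_nonneg
    (pow_le_one₀ (lensFactor_pos ω s).le (lensFactor_le_one ω s))

/-- The collision integrals converge as Bochner integrals. -/
theorem EnergyPath.intervalIntegrable (hB : EnergyPath T M B)
    (hD : ∀ s ∈ Set.Icc 0 T, HasKernel (D s) (collisionKernel (sandwichKernel (B s)) i) ∧
      HSBound (D s) (collisionBound M)) {τ : ℝ} (hτ : τ ∈ Set.Icc 0 T) :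
    IntervalIntegrable (fun s => freeEvolution (τ - s) ((lensFactor ω s : ℂ) • D s)) volume 0 τ := by
  rw [intervalIntegrable_iff_integrableOn_Ioc_of_le hτ.1]
  have hsub : Set.Ioc 0 τ ⊆ Set.Icc 0 T := fun s hs => ⟨hs.1.le, hs.2.trans hτ.2⟩
  have hmem : ∀ᵐ s ∂(volume.restrict (Set.Ioc 0 τ)), s ∈ Set.Icc 0 T :=
    (ae_restrict_mem measurableSet_Ioc).mono fun s hs => hsub hs
  have hmeas : AEStronglyMeasurable
      (fun s => freeEvolution (τ - s) ((lensFactor ω s : ℂ) • D s)) (volume.restrict (Set.Ioc 0 τ)) := by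
    -- Weak continuity in `s` suffices for measurability in operator norm because the values are
    -- Hilbert–Schmidt.
    refine aestronglyMeasurable_of_hsBound
      (hmem.mono fun s hs => ⟨_, hsBound_freeEvolution (hD s hs).2 _ s⟩) fun f g => ?_
    have hcont : ContinuousOn (fun s => ⟪g, freeEvolution (τ - s) ((lensFactor ω s : ℂ) • D s) f⟫_ℂ)
        (Set.Icc 0 T) := by
      intro s hs
      have hev : ∀ᶠ r in 𝓝[Set.Icc 0 T] s, r ∈ Set.Icc 0 T := eventually_mem_nhdsWithin
      have hu : ∀ u : L2 k, Tendsto (fun r => freeGroup k (-(τ - r)) u) (𝓝[Set.Icc 0 T] s)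
          (𝓝 (freeGroup k (-(τ - s)) u)) := fun u =>
        (continuousAt_freeGroup (P := ℝ) (τ := fun r => -(τ - r)) (u := fun _ => u)
          (by fun_prop) continuousAt_const).tendsto.mono_left nhdsWithin_le_nhds
      have h := tendsto_inner_of_weak (M := √(collisionBound M)) (B := D) (B' := D s)
        (hev.mono fun r hr f g => ?_) (fun f g => hB.continuousOn_collision hD f g s hs)
        (hu g) (hu f)
      · have h2 : Tendsto (fun r => (lensFactor ω r : ℂ)) (𝓝[Set.Icc 0 T] s)
            (𝓝 (lensFactor ω s : ℂ)) :=
          ((Complex.continuous_ofReal.comp (continuous_lensFactor ω)).tendsto s).mono_left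
            nhdsWithin_le_nhds
        have h3 : ∀ r, ⟪g, freeEvolution (τ - r) ((lensFactor ω r : ℂ) • D r) f⟫_ℂ
            = lensFactor ω r * ⟪freeGroup k (-(τ - r)) g, D r (freeGroup k (-(τ - r)) f)⟫_ℂ :=
          fun r => by rw [inner_freeEvolution, _root_.smul_apply, inner_smul_right]
        simp only [ContinuousWithinAt, h3]
        exact h2.mul h
      · calc _ ≤ ‖g‖ * ‖D r f‖ := norm_inner_le_norm _ _
          _ ≤ ‖g‖ * (√(collisionBound M) * ‖f‖) := by
              gcongr
              exact (D r).le_of_opNorm_le (hD r hr).2.norm_le f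
          _ = _ := by ring
    exact (hcont.mono hsub).aestronglyMeasurable measurableSet_Ioc
  refine Integrable.mono' (g := fun _ => √(collisionBound M)) (integrable_const _) hmeas
    (hmem.mono fun s hs => (hsBound_freeEvolution (hD s hs).2 _ s).norm_le)

/-- A matrix element is a bounded functional and passes under the Bochner integral; testing at time
τ with evolved Gaussians turns U(τ - s) into Gaussians at time s. -/
theorem inner_integral_collision {τ : ℝ}
    (hint : IntervalIntegrable (fun s => freeEvolution (τ - s) ((lensFactor ω s : ℂ) • D s))
      volume 0 τ) (x y : E k) :
    IntervalIntegrable (fun s => (lensFactor ω s : ℂ) * ⟪gauss y s, D s (gauss x s)⟫_ℂ) volume 0 τ ∧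
    ⟪gauss y τ, (∫ s in (0 : ℝ)..τ, freeEvolution (τ - s) ((lensFactor ω s : ℂ) • D s)) (gauss x τ)⟫_ℂ
      = ∫ s in (0 : ℝ)..τ, (lensFactor ω s : ℂ) * ⟪gauss y s, D s (gauss x s)⟫_ℂ := by
  set L := (innerSL ℂ (gauss y τ)).comp (ContinuousLinearMap.apply ℂ (L2 k) (gauss x τ)) with hL
  have hLs : ∀ s, L (freeEvolution (τ - s) ((lensFactor ω s : ℂ) • D s))
      = (lensFactor ω s : ℂ) * ⟪gauss y s, D s (gauss x s)⟫_ℂ := fun s => by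
    change ⟪gauss y τ, freeEvolution (τ - s) ((lensFactor ω s : ℂ) • D s) (gauss x τ)⟫_ℂ = _
    rw [inner_freeEvolution, freeGroup_gauss, freeGroup_gauss, _root_.smul_apply, inner_smul_right,
      neg_sub, add_sub_cancel]
  have h1 := L.intervalIntegral_comp_comm hint
  have h2 : IntervalIntegrable (fun s => L (freeEvolution (τ - s) ((lensFactor ω s : ℂ) • D s)))
      volume 0 τ := ⟨L.integrable_comp hint.1, L.integrable_comp hint.2⟩
  simp_rw [hLs] at h1 h2
  exact ⟨h2, h1.symm⟩

end CollisionElements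

/-! ### Energy bounded limit points -/

section LimitPoint

variable {k : ℕ} {T : ℝ}

/-- `energy` is an infimum, so one unit is added to obtain a strict inequality and hence a
competitor; `max c 0` keeps the bound nonnegative. -/
theorem exists_posTrace_of_energy {A : Op k} {c : ℝ} (h : energy A ≤ ENNReal.ofReal c) :
    ∃ B : Op k, PosTrace B (max c 0 + 1) ∧ A = energyWeightInv k ∘L B ∘L energyWeightInv k := by
  have hc : (0 : ℝ) ≤ max c 0 + 1 := by positivity
  have hlt : energy A < ENNReal.ofReal (max c 0 + 1) :=
    h.trans_lt ((ENNReal.ofReal_lt_ofReal_iff (by positivity)).2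
      ((le_max_left c 0).trans_lt (lt_add_one _)))
  obtain ⟨B, hB⟩ := iInf_lt_iff.1 hlt
  obtain ⟨⟨hpos, hA⟩, hB⟩ := iInf_lt_iff.1 hB
  exact ⟨B, posTrace_of_traceNorm hc hpos hB.le, hA⟩

/-- The weight cancels on the left by injectivity and on the right by density of its range. -/
theorem energyWeightInv_cancel {B B' : Op k}
    (h : energyWeightInv k ∘L B ∘L energyWeightInv k = energyWeightInv k ∘L B' ∘L energyWeightInv k) :
    B = B' := by
  refine ContinuousLinearMap.coeFn_injective ?_
  refine (denseRange_energyWeightInv k).equalizer B.continuous B'.continuous (funext fun f => ?_)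
  refine sub_eq_zero.1 (energyWeightInv_injective k _ ?_)
  rw [map_sub, sub_eq_zero]
  exact congrArg (fun A : Op k => A f) h

/-- A diagonal choice: the n-th index serves the components up to n with tolerance 1/(n + 1), so a
single subsequence converges in every component. -/
theorem IsLimitPoint.exists_subsequence {J : (k : ℕ) → ℕ → Op k} {ΓN : ℕ → (k : ℕ) → ℝ → Op k}
    {Γ : (k : ℕ) → ℝ → Op k} (h : IsLimitPoint J T ΓN Γ) :
    ∃ φ : ℕ → ℕ, StrictMono φ ∧ ∀ k, 1 ≤ k →
      Tendsto (fun n => pathDist (J k) T (ΓN (φ n) k) (Γ k)) atTop (𝓝 0) := by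
  obtain ⟨φ, hφ, hp⟩ := extraction_forall_of_frequently fun n : ℕ =>
    h.2 n ((n : ℝ≥0∞) + 1)⁻¹ (ENNReal.inv_pos.2 (by simp))
  refine ⟨φ, hφ, fun k hk => ?_⟩
  have hz : Tendsto (fun n : ℕ => ((n : ℝ≥0∞) + 1)⁻¹) atTop (𝓝 0) := by
    have := (ENNReal.tendsto_inv_nat_nhds_zero).comp (tendsto_add_atTop_nat 1)
    refine this.congr fun n => ?_
    simp
  refine tendsto_of_tendsto_of_tendsto_of_le_of_le' tendsto_const_nhds hz
    (Eventually.of_forall fun _ => zero_le) ?_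
  filter_upwards [eventually_ge_atTop k] with n hn
  exact (hp n k hk hn).le

theorem nuclearBound_sandwich {B : Op k} {M : ℝ} (hB : PosTrace B M) :
    NuclearBound (energyWeightInv k ∘L B ∘L energyWeightInv k) M :=
  hB.nuclearBound.conjugate (adjoint_energyWeightInv k) (norm_energyWeightInv_le k)

/-- A limit of energy bounded paths is an energy bounded path. -/
theorem exists_energyPath {J : ℕ → Op k} (hJ : IsObservableFamily J) {A : ℕ → ℝ → Op k}
    {Γ : ℝ → Op k} {c : ℝ}
    (hA : ∀ᶠ n in atTop, ∀ s ∈ Set.Icc 0 T, energy (A n s) ≤ ENNReal.ofReal c)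
    (hd : Tendsto (fun n => pathDist J T (A n) Γ) atTop (𝓝 0)) (hΓ : IsWeakContinuousPath J T Γ) :
    ∃ (M : ℝ) (B : ℝ → Op k) (Bn : ℕ → ℝ → Op k), EnergyPath T M B ∧
      (∀ s ∈ Set.Icc 0 T, Γ s = energyWeightInv k ∘L B s ∘L energyWeightInv k) ∧
      (∀ᶠ n in atTop, ∀ s ∈ Set.Icc 0 T, PosTrace (Bn n s) M ∧
        A n s = energyWeightInv k ∘L Bn n s ∘L energyWeightInv k) ∧
      ∀ s ∈ Set.Icc 0 T, ∀ f g, Tendsto (fun n => ⟪g, Bn n s f⟫_ℂ) atTop (𝓝 ⟪g, B s f⟫_ℂ) := by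
  classical
  set M := max c 0 + 1 with hM
  set Bn : ℕ → ℝ → Op k := fun n s =>
    if h : energy (A n s) ≤ ENNReal.ofReal c then (exists_posTrace_of_energy h).choose else 0 with hBn
  have hBn' : ∀ᶠ n in atTop, ∀ s ∈ Set.Icc 0 T, PosTrace (Bn n s) M ∧
      A n s = energyWeightInv k ∘L Bn n s ∘L energyWeightInv k := by
    filter_upwards [hA] with n hn s hs
    have h := hn s hs
    simp only [hBn, dif_pos h]
    exact (exists_posTrace_of_energy h).choose_spec
  have hw : ∀ s ∈ Set.Icc 0 T, Tendsto (fun n => weakDist J (A n s) (Γ s)) atTop (𝓝 0) :=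
    fun s hs => tendsto_of_tendsto_of_tendsto_of_le_of_le tendsto_const_nhds hd
      (fun _ => zero_le) fun n => le_iSup₂ (f := fun τ _ => weakDist J (A n τ) (Γ τ)) s hs
  have hin : ∀ s ∈ Set.Icc 0 T, ∀ f g, Tendsto (fun n => ⟪g, A n s f⟫_ℂ) atTop (𝓝 ⟪g, Γ s f⟫_ℂ) :=
    fun s hs => hJ.tendsto_inner (M := M)
      (hBn'.mono fun n hn => (hn s hs).2 ▸ nuclearBound_sandwich (hn s hs).1)
      (hΓ.1 s hs).nuclearBound (tendsto_trace_of_weakDist (hw s hs))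
  have hex : ∀ s, ∃ B : Op k, s ∈ Set.Icc 0 T → PosTrace B M ∧
      Γ s = energyWeightInv k ∘L B ∘L energyWeightInv k ∧
      ∀ f g, Tendsto (fun n => ⟪g, Bn n s f⟫_ℂ) atTop (𝓝 ⟪g, B f⟫_ℂ) := fun s => by
    by_cases hs : s ∈ Set.Icc 0 T
    · obtain ⟨B, hB⟩ := exists_weak_limit (hBn'.mono fun n hn => (hn s hs).1)
        (adjoint_energyWeightInv k) (denseRange_energyWeightInv k) (A := Γ s) fun f g =>
          (hin s hs f g).congr' (hBn'.mono fun n hn => by rw [(hn s hs).2])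
      exact ⟨B, fun _ => hB⟩
    · exact ⟨0, fun h => absurd h hs⟩
  choose B hB using hex
  refine ⟨M, B, Bn, ⟨fun s hs => (hB s hs).1, fun f g s hs => ?_⟩, fun s hs => (hB s hs).2.1, hBn',
    fun s hs => (hB s hs).2.2⟩
  have hev : ∀ᶠ r in 𝓝[Set.Icc 0 T] s, r ∈ Set.Icc 0 T := eventually_mem_nhdsWithin
  have hne : (𝓝[Set.Icc 0 T] s).NeBot := mem_closure_iff_nhdsWithin_neBot.1 (subset_closure hs)
  have hc : ∀ f g, Tendsto (fun r => ⟪g, Γ r f⟫_ℂ) (𝓝[Set.Icc 0 T] s) (𝓝 ⟪g, Γ s f⟫_ℂ) :=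
    hJ.tendsto_inner (M := M)
      (hev.mono fun r hr => (hB r hr).2.1 ▸ nuclearBound_sandwich (hB r hr).1)
      (hΓ.1 s hs).nuclearBound (tendsto_trace_of_weakDist (hΓ.2 s hs))
  -- Weak continuity lifts from Γ to B: the weak limit of B r exists, and cancelling the weights
  -- identifies it with B s.
  obtain ⟨B', -, hΓ', hlim⟩ := exists_weak_limit (hev.mono fun r hr => (hB r hr).1)
    (adjoint_energyWeightInv k) (denseRange_energyWeightInv k) (A := Γ s) fun f g =>
      (hc f g).congr' (hev.mono fun r hr => by rw [(hB r hr).2.1])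
  have := energyWeightInv_cancel (hΓ'.symm.trans (hB s hs).2.1)
  rw [this] at hlim
  exact hlim f g

end LimitPoint

/-! ### Convergence of the hierarchy -/

section Convergence

variable {k : ℕ} {V : 𝓢(ℝ, ℝ)} {ω β T M : ℝ}

theorem norm_integral_pairIntegrand_le {ε : ℝ} {i : Fin k} {f g : L2 k}
    (hf : Integrable (f : E k → ℂ)) (hg : Integrable (g : E k → ℂ)) {B : Op (k + 1)}
    (hB : PosTrace B M) {F G : ℝ} (hF : ∫ y, ‖f y‖ ≤ F) (hG : ∫ y, ‖g y‖ ≤ G) :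
    ‖∫ p, pairIntegrand V ε i f g (sandwichKernel B) p‖
      ≤ M * greenConst (k + 1) ^ 2 * (G * F * ∫ r, ‖V r‖) := by
  have hM := hB.bound_nonneg
  have hG0 : 0 ≤ G := (integral_nonneg fun _ => norm_nonneg _).trans hG
  have hV0 : 0 ≤ ∫ r, ‖V r‖ := integral_nonneg fun _ => norm_nonneg _
  refine (norm_integral_le_of_norm_le ((integrable_pair_bound hf hg V).const_mul _) (ae_of_all _
    (norm_pairIntegrand_le (M := M * greenConst (k + 1) ^ 2)
      (fun x x' => norm_sandwichKernel_le hB x x')))).trans ?_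
  have h2 : ∫ p : (E k × E k) × ℝ, ‖g p.1.1‖ * ‖f p.1.2‖ * ‖V p.2‖
      = (∫ y, ‖g y‖) * (∫ y, ‖f y‖) * ∫ r, ‖V r‖ := by
    rw [Measure.volume_eq_prod,
      integral_prod_mul (fun z : E k × E k => ‖g z.1‖ * ‖f z.2‖) fun r => ‖V r‖,
      Measure.volume_eq_prod, integral_prod_mul (fun y => ‖g y‖) fun y => ‖f y‖]
  rw [integral_const_mul, h2]
  have hf0 : 0 ≤ ∫ y, ‖f y‖ := integral_nonneg fun _ => norm_nonneg _
  gcongr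

theorem integral_norm_gauss_le {s : ℝ} (hs : |s| ≤ |T|) (x : E k) :
    ∫ y, ‖gauss x s y‖ ≤ ∫ y, gaussDom T x y :=
  integral_mono_ae (integrable_gauss x s).norm (integrable_gaussDom T x) (norm_gauss_le hs x)

theorem norm_gauss (x : E k) (s : ℝ) : ‖gauss x s‖ = ‖gauss x 0‖ := by
  rw [← norm_freeGroup k s (gauss x 0), freeGroup_gauss, zero_add]

/-- The interaction terms with traced out particles. -/
def mixedTerm (V : 𝓢(ℝ, ℝ)) (ω β : ℝ) (k N : ℕ) (B : Op (k + 1)) (s : ℝ) (f g : L2 k)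
    (i : Fin k) : ℂ :=
  ((lensFactor ω s * ((N - k : ℕ) / (N : ℝ)) : ℝ) : ℂ)
    * (conj (∫ p, pairIntegrand V ((N : ℝ) ^ β * lensFactor ω s)⁻¹ i g f (sandwichKernel B) p)
      - ∫ p, pairIntegrand V ((N : ℝ) ^ β * lensFactor ω s)⁻¹ i f g (sandwichKernel B) p)

/-- The Jacobian 1/μ reduces c to c/μ = g/N, and the N - k equal pairs turn 1/N into (N - k)/N. -/
theorem mixedTerm_eq {N : ℕ} (hN : 1 ≤ N) {B : Op (k + 1)} (hB : PosTrace B M) {s : ℝ} {f g : L2 k}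
    (hf : Integrable (f : E k → ℂ)) (hg : Integrable (g : E k → ℂ)) (i : Fin k) {c μ : ℝ}
    (hc : c = lensFactor ω s ^ 2 * (1 / (N : ℝ)) * (N : ℝ) ^ β)
    (hμ : μ = (N : ℝ) ^ β * lensFactor ω s) {A : Op (k + 1)}
    (hA : A = energyWeightInv (k + 1) ∘L B ∘L energyWeightInv (k + 1)) :
    ((N - k : ℕ) : ℂ) * (conj (trace (pairObs V c μ i g f ∘L A)) - trace (pairObs V c μ i f g ∘L A))
      = mixedTerm V ω β k N B s f g i := by
  have hN' : (0 : ℝ) < N := by exact_mod_cast hN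
  have hg0 := lensFactor_pos ω s
  have hp : (0 : ℝ) < (N : ℝ) ^ β := Real.rpow_pos_of_pos hN' β
  have hμ0 : 0 < μ := by
    rw [hμ]
    positivity
  have hcμ : c * μ⁻¹ = lensFactor ω s * (1 / (N : ℝ)) := by
    rw [hc, hμ]
    field_simp
  rw [hA, trace_pairObs hg hf hμ0 i hB, trace_pairObs hf hg hμ0 i hB, hcμ, hμ, mixedTerm, map_mul,
    Complex.conj_ofReal]
  push_cast
  ring

theorem norm_mixedTerm_le {N : ℕ} {B : Op (k + 1)} (hB : PosTrace B M) {s : ℝ}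
    {f g : L2 k} (hf : Integrable (f : E k → ℂ)) (hg : Integrable (g : E k → ℂ)) (i : Fin k)
    {F G : ℝ} (hF : ∫ y, ‖f y‖ ≤ F) (hG : ∫ y, ‖g y‖ ≤ G) :
    ‖mixedTerm V ω β k N B s f g i‖
      ≤ 2 * (M * greenConst (k + 1) ^ 2 * (G * F * ∫ r, ‖V r‖)) := by
  have h1 : |lensFactor ω s * ((N - k : ℕ) / (N : ℝ))| ≤ 1 := by
    have := lensFactor_pos ω s
    rw [abs_of_nonneg (by positivity)]
    refine mul_le_one₀ (lensFactor_le_one ω s) (by positivity) (div_le_one_of_le₀ ?_ (by positivity))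
    exact_mod_cast Nat.sub_le N k
  rw [mixedTerm, norm_mul, Complex.norm_real, Real.norm_eq_abs]
  refine (mul_le_of_le_one_left (norm_nonneg _) h1).trans ((norm_sub_le _ _).trans ?_)
  rw [RCLike.norm_conj, two_mul]
  refine add_le_add ((norm_integral_pairIntegrand_le hg hf hB hG hF).trans (le_of_eq ?_))
    (norm_integral_pairIntegrand_le hf hg hB hF hG)
  ring

/-- The interaction range (N^β g)⁻¹ vanishes because β > 0, the fraction (N - k)/N tends to 1, and
the sign is that of `conj_contact_sub`. -/
theorem tendsto_mixedTerm (hβ : 0 < β) {φ : ℕ → ℕ} (hφ : Tendsto φ atTop atTop) {Bn : ℕ → Op (k + 1)}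
    {B : Op (k + 1)} (hBn : ∀ᶠ n in atTop, PosTrace (Bn n) M) (hB : PosTrace B M)
    (hw : ∀ f g, Tendsto (fun n => ⟪g, Bn n f⟫_ℂ) atTop (𝓝 ⟪g, B f⟫_ℂ)) (s : ℝ) {f g : L2 k}
    (hf : Integrable (f : E k → ℂ)) (hg : Integrable (g : E k → ℂ)) {i : Fin k} {D : Op k}
    (hD : HasKernel D (collisionKernel (sandwichKernel B) i)) :
    Tendsto (fun n => mixedTerm V ω β k (φ n) (Bn n) s f g i) atTop
      (𝓝 (-((∫ r, V r : ℝ) : ℂ) * ((lensFactor ω s : ℂ) * ⟪g, D f⟫_ℂ))) := by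
  have hcast : Tendsto (fun n => (φ n : ℝ)) atTop atTop := tendsto_natCast_atTop_atTop.comp hφ
  have hg0 := lensFactor_pos ω s
  have hε : Tendsto (fun n => ((φ n : ℝ) ^ β * lensFactor ω s)⁻¹) atTop (𝓝 0) :=
    (((tendsto_rpow_atTop hβ).comp hcast).atTop_mul_const hg0).inv_tendsto_atTop
  have h1 := tendsto_integral_pairIntegrand (V := V) hf hg i hBn hw hε
  have h2 := (Complex.continuous_conj.tendsto _).comp
    (tendsto_integral_pairIntegrand (V := V) hg hf i hBn hw hε)
  have h3 : Tendsto (fun n => lensFactor ω s * ((φ n - k : ℕ) / (φ n : ℝ))) atTop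
      (𝓝 (lensFactor ω s)) := by
    have h : Tendsto (fun n => 1 - (k : ℝ) / (φ n : ℝ)) atTop (𝓝 (1 - 0)) :=
      (tendsto_const_nhds.div_atTop hcast).const_sub 1
    have h' := h.const_mul (lensFactor ω s)
    rw [sub_zero, mul_one] at h'
    refine h'.congr' ?_
    filter_upwards [hφ.eventually_ge_atTop (max k 1)] with n hn
    have hk : k ≤ φ n := (le_max_left _ _).trans hn
    have h0 : (φ n : ℝ) ≠ 0 := by
      have : 1 ≤ φ n := (le_max_right _ _).trans hn
      positivity
    rw [Nat.cast_sub hk, sub_div, div_self h0]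
  have h4 := ((Complex.continuous_ofReal.tendsto _).comp h3).mul (h2.sub h1)
  refine (h4.congr fun n => rfl).trans_eq (congrArg 𝓝 ?_)
  rw [integral_pairIntegrand_zero, integral_pairIntegrand_zero, map_mul, Complex.conj_ofReal,
    ← mul_sub]
  have := conj_contact_sub hB hD hf hg
  simp only [contact] at this
  rw [this]
  ring

/-- The interaction terms among the first `k` particles. -/
def innerTerm (V : 𝓢(ℝ, ℝ)) (ω β : ℝ) {k N : ℕ} (h : k ≤ N) (s : ℝ) (f g : L2 k) (χ : L2 N) : ℂ :=
  ∑ i : Fin k, ∑ j ∈ Finset.Ioi i,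
    pairCommutator V (lensFactor ω s ^ 2 * (1 / (N : ℝ)) * (N : ℝ) ^ β)
      ((N : ℝ) ^ β * lensFactor ω s) h (joinEquiv h (Sum.inl i)) (joinEquiv h (Sum.inl j)) f g χ

/-- There are at most k² pairs, each of size N^{β-1} times the supremum of |V|; for β < 1 the sum is
negligible. -/
theorem norm_innerTerm_le {R : ℝ} (hR : ∀ x, |V x| ≤ R) {N : ℕ} (hN : 1 ≤ N) (h : k ≤ N) (s : ℝ)
    (f g : L2 k) {χ : L2 N} (hχ : ‖χ‖ = 1) :
    ‖innerTerm V ω β h s f g χ‖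
      ≤ (N : ℝ) ^ (β - 1) * ((k : ℝ) * (k * (2 * R * (‖f‖ * ‖g‖)))) := by
  have hN' : (0 : ℝ) < N := by exact_mod_cast hN
  have hR0 : 0 ≤ R := (abs_nonneg _).trans (hR 0)
  have hg0 := lensFactor_pos ω s
  have hc : |lensFactor ω s ^ 2 * (1 / (N : ℝ)) * (N : ℝ) ^ β| ≤ (N : ℝ) ^ (β - 1) := by
    rw [abs_of_nonneg (by positivity), Real.rpow_sub_one hN'.ne']
    have h1 := pow_le_one₀ (n := 2) hg0.le (lensFactor_le_one ω s)
    have h2 : 0 ≤ (N : ℝ) ^ β / N := by positivity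
    calc _ = lensFactor ω s ^ 2 * ((N : ℝ) ^ β / N) := by ring
      _ ≤ _ := mul_le_of_le_one_left h2 h1
  set b := (N : ℝ) ^ (β - 1) * (2 * R * (‖f‖ * ‖g‖)) with hb
  have hterm : ∀ i j : Fin N, ‖pairCommutator V (lensFactor ω s ^ 2 * (1 / (N : ℝ)) * (N : ℝ) ^ β)
      ((N : ℝ) ^ β * lensFactor ω s) h i j f g χ‖ ≤ b := fun i j => by
    refine (norm_pairCommutator_le hR _ _ h i j f g χ).trans ?_
    rw [hχ, hb]
    calc _ = |lensFactor ω s ^ 2 * (1 / (N : ℝ)) * (N : ℝ) ^ β| * (2 * R * (‖f‖ * ‖g‖)) := by ring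
      _ ≤ _ := by gcongr
  have hb0 : 0 ≤ b := by positivity
  have hinner : ∀ i : Fin k, ‖∑ j ∈ Finset.Ioi i,
      pairCommutator V (lensFactor ω s ^ 2 * (1 / (N : ℝ)) * (N : ℝ) ^ β)
      ((N : ℝ) ^ β * lensFactor ω s) h (joinEquiv h (Sum.inl i)) (joinEquiv h (Sum.inl j)) f g χ‖
      ≤ k * b := fun i => by
    refine (norm_sum_le_of_le _ fun j _ => hterm _ _).trans ?_
    rw [Finset.sum_const, nsmul_eq_mul]
    gcongr
    simpa using (Finset.Ioi i).card_le_univ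
  refine (norm_sum_le_of_le _ fun i _ => hinner i).trans (le_of_eq ?_)
  rw [Finset.sum_const, nsmul_eq_mul, Finset.card_univ, Fintype.card_fin, hb]
  ring

/-- The limit of the marginals satisfies the hierarchy, tested with Gaussians. -/
theorem integral_equation_gauss (hβ : β ∈ Set.Ioo (0 : ℝ) 1) {ψ : (N : ℕ) → ℝ → L2 N}
    (hψ : ∀ N, 1 ≤ N → IsNBodyEvolution V ω β N (ψ N)) (hψ_norm : ∀ N, 1 ≤ N → ‖ψ N 0‖ = 1)
    {φ : ℕ → ℕ} (hφ : Tendsto φ atTop atTop) {B : ℝ → Op (k + 1)} {Bn : ℕ → ℝ → Op (k + 1)}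
    (hB : EnergyPath T M B)
    (hBn : ∀ᶠ n in atTop, ∀ s ∈ Set.Icc 0 T, PosTrace (Bn n s) M ∧
      lensMarginal ω (ψ (φ n)) (k + 1) s
        = energyWeightInv (k + 1) ∘L Bn n s ∘L energyWeightInv (k + 1))
    (hlim : ∀ s ∈ Set.Icc 0 T, ∀ f g, Tendsto (fun n => ⟪g, Bn n s f⟫_ℂ) atTop (𝓝 ⟪g, B s f⟫_ℂ))
    {Γ : ℝ → Op k} (hΓ : ∀ s ∈ Set.Icc 0 T, ∀ f g,
      Tendsto (fun n => ⟪g, lensMarginal ω (ψ (φ n)) k s f⟫_ℂ) atTop (𝓝 ⟪g, Γ s f⟫_ℂ))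
    {D : Fin k → ℝ → Op k} (hD : ∀ i, ∀ s ∈ Set.Icc 0 T,
      HasKernel (D i s) (collisionKernel (sandwichKernel (B s)) i))
    {τ : ℝ} (hτ : τ ∈ Set.Icc 0 T) (x y : E k) :
    ⟪gauss y τ, Γ τ (gauss x τ)⟫_ℂ - ⟪gauss y 0, Γ 0 (gauss x 0)⟫_ℂ
      = ∫ s in (0 : ℝ)..τ, Complex.I * ∑ i, -((∫ r, V r : ℝ) : ℂ)
        * ((lensFactor ω s : ℂ) * ⟪gauss y s, D i s (gauss x s)⟫_ℂ) := by
  have hsub : Set.uIcc 0 τ ⊆ Set.Icc 0 T := by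
    rw [Set.uIcc_of_le hτ.1]
    exact Set.Icc_subset_Icc_right hτ.2
  have hsub' : Set.uIoc 0 τ ⊆ Set.Icc 0 T := Set.uIoc_subset_uIcc.trans hsub
  have habs : ∀ s ∈ Set.Icc 0 T, |s| ≤ |T| := fun s hs => by
    rw [abs_of_nonneg hs.1]
    exact hs.2.trans (le_abs_self T)
  obtain ⟨R, hR⟩ := exists_norm_schwartz_le V
  have hg : ∀ s, freeGroup k s (gauss y 0) = gauss y s := fun s => by rw [freeGroup_gauss, zero_add]
  have hf : ∀ s, freeGroup k s (gauss x 0) = gauss x s := fun s => by rw [freeGroup_gauss, zero_add]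
  set q : ℕ → ℝ → ℂ := fun n s => ⟪gauss y s, lensMarginal ω (ψ (φ n)) k s (gauss x s)⟫_ℂ with hq
  set C₁ := (k : ℝ) * (k * (2 * R * (‖gauss x 0‖ * ‖gauss y 0‖))) with hC₁
  set C₂ := ∑ _i : Fin k, 2 * (M * greenConst (k + 1) ^ 2
    * ((∫ z, gaussDom T y z) * (∫ z, gaussDom T x z) * ∫ r, ‖V r‖)) with hC₂
  -- The error `e` collects the pairs among the first k particles.
  have hder : ∀ᶠ n in atTop, ∀ s ∈ Set.Icc 0 T, ∃ e : ℂ, ‖e‖ ≤ (φ n : ℝ) ^ (β - 1) * C₁ ∧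
      HasDerivAt (q n) (Complex.I * (e + ∑ i, mixedTerm V ω β k (φ n) (Bn n s) s (gauss x s)
        (gauss y s) i)) s := by
    filter_upwards [hφ.eventually_ge_atTop (k + 1), hBn] with n hn hBn s hs
    have h1 : 1 ≤ φ n := by omega
    have hχ : ‖lensPath ω (ψ (φ n)) s‖ = 1 := by
      rw [norm_lensPath, ← norm_interPath, (hψ _ h1).norm_interPath_eq, hψ_norm _ h1]
    refine ⟨innerTerm V ω β (Nat.le_of_succ_le hn) s (gauss x s) (gauss y s)
      (lensPath ω (ψ (φ n)) s), ?_, ?_⟩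
    · have := norm_innerTerm_le (ω := ω) (β := β) hR h1 (Nat.le_of_succ_le hn) s (gauss x s)
        (gauss y s) hχ
      rwa [norm_gauss x s, norm_gauss y s] at this
    · have h := (hψ _ h1).hasDerivAt_marginal hn (gauss x 0) (gauss y 0) s rfl rfl
      simp_rw [hg, hf] at h
      refine h.congr_deriv ?_
      congr 2
      exact Finset.sum_congr rfl fun i _ => mixedTerm_eq h1 (hBn s hs).1 (integrable_gauss x s)
        (integrable_gauss y s) i rfl rfl (hBn s hs).2
  have hpow : Tendsto (fun n => (φ n : ℝ) ^ (β - 1)) atTop (𝓝 0) := by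
    have h := (tendsto_rpow_neg_atTop (sub_pos.2 hβ.2)).comp
      ((tendsto_natCast_atTop_atTop (R := ℝ)).comp hφ)
    rwa [neg_sub] at h
  have hC₁0 : 0 ≤ C₁ := by
    have : 0 ≤ R := (abs_nonneg _).trans (hR 0)
    positivity
  -- `gaussDom` bounds the L¹ norms of the evolved Gaussians uniformly up to time T.
  have hmix : ∀ᶠ n in atTop, ∀ s ∈ Set.Icc 0 T,
      ‖∑ i, mixedTerm V ω β k (φ n) (Bn n s) s (gauss x s) (gauss y s) i‖ ≤ C₂ := by
    filter_upwards [hBn] with n hBn s hs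
    exact norm_sum_le_of_le _ fun i _ => norm_mixedTerm_le (hBn s hs).1 (integrable_gauss x s)
      (integrable_gauss y s) i (integral_norm_gauss_le (habs s hs) x)
      (integral_norm_gauss_le (habs s hs) y)
  have hbound : ∀ᶠ n in atTop, ∀ s ∈ Set.Icc 0 T, ‖deriv (q n) s‖ ≤ C₁ + C₂ := by
    filter_upwards [hder, hmix, hpow.eventually_le_const zero_lt_one] with n h1 h2 h3 s hs
    obtain ⟨e, he, hd⟩ := h1 s hs
    rw [hd.deriv, norm_mul, Complex.norm_I, one_mul]
    exact (norm_add_le _ _).trans (add_le_add (he.trans (mul_le_of_le_one_left hC₁0 h3)) (h2 s hs))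
  -- A derivative is automatically measurable, so boundedness alone gives its integrability; its
  -- continuity in time need not be shown.
  have hftc : ∀ᶠ n in atTop, ∫ s in (0 : ℝ)..τ, deriv (q n) s = q n τ - q n 0 := by
    filter_upwards [hder, hbound] with n h1 h2
    refine intervalIntegral.integral_eq_sub_of_hasDerivAt (fun s hs => ?_) ?_
    · obtain ⟨e, -, hd⟩ := h1 s (hsub hs)
      exact hd.differentiableAt.hasDerivAt
    · refine IntervalIntegrable.mono_fun' (g := fun _ => C₁ + C₂) intervalIntegrable_const
        (measurable_deriv _).aestronglyMeasurable ?_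
      exact (ae_restrict_mem measurableSet_uIoc).mono fun s hs => h2 s (hsub' hs)
  have hpt : ∀ s ∈ Set.Icc 0 T, Tendsto (fun n => deriv (q n) s) atTop
      (𝓝 (Complex.I * ∑ i, -((∫ r, V r : ℝ) : ℂ)
        * ((lensFactor ω s : ℂ) * ⟪gauss y s, D i s (gauss x s)⟫_ℂ))) := fun s hs => by
    have h1 : Tendsto (fun n => ∑ i, mixedTerm V ω β k (φ n) (Bn n s) s (gauss x s) (gauss y s) i)
        atTop (𝓝 (∑ i, -((∫ r, V r : ℝ) : ℂ)
          * ((lensFactor ω s : ℂ) * ⟪gauss y s, D i s (gauss x s)⟫_ℂ))) :=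
      tendsto_finsetSum _ fun i _ => tendsto_mixedTerm hβ.1 hφ (hBn.mono fun n hn => (hn s hs).1)
        (hB.posTrace s hs) (hlim s hs) s (integrable_gauss x s) (integrable_gauss y s) (hD i s hs)
    have h2 : Tendsto (fun n => deriv (q n) s - Complex.I
        * ∑ i, mixedTerm V ω β k (φ n) (Bn n s) s (gauss x s) (gauss y s) i) atTop (𝓝 0) := by
      have h := hpow.mul_const C₁
      rw [zero_mul] at h
      refine squeeze_zero_norm' (hder.mono fun n hn => ?_) h
      obtain ⟨e, he, hd⟩ := hn s hs
      rw [hd.deriv, ← mul_sub, add_sub_cancel_right, norm_mul, Complex.norm_I, one_mul]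
      exact he
    have h3 := h2.add (h1.const_mul Complex.I)
    rw [zero_add] at h3
    exact h3.congr fun n => by ring
  have hconv := intervalIntegral.tendsto_integral_filter_of_dominated_convergence
    (μ := volume) (a := 0) (b := τ) (F := fun n s => deriv (q n) s) (l := atTop) (fun _ => C₁ + C₂)
    (Eventually.of_forall fun n => (measurable_deriv _).aestronglyMeasurable)
    (hbound.mono fun n hn => ae_of_all _ fun s hs => hn s (hsub' hs))
    intervalIntegrable_const (ae_of_all _ fun s hs => hpt s (hsub' hs))
  have hleft := (hΓ τ hτ (gauss x τ) (gauss y τ)).sub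
    (hΓ 0 ⟨le_rfl, hτ.1.trans hτ.2⟩ (gauss x 0) (gauss y 0))
  exact tendsto_nhds_unique (hleft.congr' (hftc.mono fun n hn => hn.symm)) hconv

end Convergence

/-! ### Factorized initial data -/

section Initial

variable {k m N : ℕ}

theorem measurePreserving_coord_zero : MeasurePreserving (fun y : E 1 => y 0) volume volume :=
  (EuclideanSpace.volume_preserving_symm_measurableEquiv_toLp (Fin 1)).trans
    (volume_preserving_funUnique (Fin 1) ℝ)

/-- A function on the line as a function on `ℝ¹`. -/
def oneState (φ : Lp ℂ 2 (volume : Measure ℝ)) : L2 1 :=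
  ((Lp.memLp φ).comp_measurePreserving measurePreserving_coord_zero).toLp _

theorem oneState_coe (φ : Lp ℂ 2 (volume : Measure ℝ)) :
    oneState φ =ᵐ[volume] fun y => φ (y 0) := MemLp.coeFn_toLp _

/-- The tensor powers `φ^{⊗k}` for `k ≥ 1`. -/
def prodState (φ : Lp ℂ 2 (volume : Measure ℝ)) : (k : ℕ) → L2 k
  | 0 => 0
  | 1 => oneState φ
  | k + 2 => (splitE (appendEquiv (k + 1))).T (prodState φ (k + 1)) (oneState φ)

theorem prodState_succ (φ : Lp ℂ 2 (volume : Measure ℝ)) (hk : 1 ≤ k) :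
    prodState φ (k + 1) = (splitE (appendEquiv k)).T (prodState φ k) (oneState φ) := by
  obtain ⟨k, rfl⟩ := Nat.exists_eq_add_of_le' hk
  rfl

theorem prodState_coe (φ : Lp ℂ 2 (volume : Measure ℝ)) (hk : 1 ≤ k) :
    prodState φ k =ᵐ[volume] fun y => ∏ j, φ (y j) := by
  induction k, hk using Nat.le_induction with
  | base =>
    filter_upwards [oneState_coe φ] with y hy
    rw [Fin.prod_univ_one]
    exact hy
  | succ k hk ih =>
    rw [prodState_succ φ hk]
    filter_upwards [(splitE (appendEquiv k)).T_coe (prodState φ k) (oneState φ),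
      (splitE (appendEquiv k)).ae_fst ih, (splitE (appendEquiv k)).ae_snd (oneState_coe φ)]
      with y h1 h2 h3
    rw [h1, h2, h3, Fin.prod_univ_castSucc]
    rfl

theorem norm_prodState {φ : Lp ℂ 2 (volume : Measure ℝ)} (h : ‖oneState φ‖ = 1) (hk : 1 ≤ k) :
    ‖prodState φ k‖ = 1 := by
  induction k, hk using Nat.le_induction with
  | base => exact h
  | succ k hk ih => rw [prodState_succ φ hk, Split.norm_T_apply, ih, h, one_mul]

theorem hasKernel_rankOne_prodState (φ : Lp ℂ 2 (volume : Measure ℝ)) (hk : 1 ≤ k) :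
    HasKernel (InnerProductSpace.rankOne ℂ (prodState φ k) (prodState φ k)) (pureKernel φ k) := by
  set Φ := prodState φ k with hΦ
  have h : HasKernel (InnerProductSpace.rankOne ℂ Φ Φ) (fun y y' => Φ y * conj (Φ y')) := by
    intro f
    have hint : Integrable fun y' => conj (Φ y') * f y' := integrable_conj_mul (Lp.memLp _) (Lp.memLp _)
    filter_upwards [Lp.coeFn_smul ⟪Φ, f⟫_ℂ Φ] with y hy
    simp_rw [mul_assoc]
    refine ⟨hint.const_mul _, ?_⟩
    rw [integral_const_mul, InnerProductSpace.rankOne_apply, hy, Pi.smul_apply, smul_eq_mul,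
      inner_eq_integral, mul_comm]
  refine h.congr ?_
  have hc := prodState_coe φ hk
  filter_upwards [hc] with y hy
  filter_upwards [hc] with y' hy'
  rw [hΦ, hy, hy', pureKernel, map_prod, Finset.prod_mul_distrib]

theorem IsBosonic.norm_C_eq {ψ : L2 N} (hψ : IsBosonic ψ) {m' : ℕ} (e : Fin k ⊕ Fin m ≃ Fin N)
    (e' : Fin k ⊕ Fin m' ≃ Fin N) (f : L2 k) :
    ‖(splitE e).C f ψ‖ = ‖(splitE e').C f ψ‖ := by
  obtain rfl : m = m' := by
    have := card_splitE e
    have := card_splitE e'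
    omega
  rw [hψ.C_eq e e']

/-- The part of `ψ` orthogonal to `f` in the first factor. -/
theorem norm_sq_sub_T_C (e : Fin k ⊕ Fin m ≃ Fin N) {f : L2 k} (hf : ‖f‖ = 1) (ψ : L2 N) :
    ‖ψ - (splitE e).T f ((splitE e).C f ψ)‖ ^ 2 = ‖ψ‖ ^ 2 - ‖(splitE e).C f ψ‖ ^ 2 := by
  rw [@norm_sub_sq ℂ, Split.norm_T_apply, hf, one_mul, ← inner_conj_symm, ← Split.inner_C,
    inner_self_eq_norm_sq_to_K]
  rw [RCLike.conj_re, ← RCLike.ofReal_pow, RCLike.ofReal_re]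
  ring

/-- Split off one particle of the second group. -/
def pluckEquiv {m' : ℕ} (e : Fin k ⊕ Fin m ≃ Fin N) (e' : Fin m' ⊕ Fin 1 ≃ Fin m) :
    Fin 1 ⊕ Fin (k + m') ≃ Fin N :=
  (((Equiv.refl _).sumCongr finSumFinEquiv.symm).trans
    ((Equiv.sumComm _ _).trans (Equiv.sumAssoc _ _ _))).trans
    (((Equiv.refl _).sumCongr e').trans e)

theorem compat_pluck {m' : ℕ} (e : Fin k ⊕ Fin m ≃ Fin N) (e' : Fin m' ⊕ Fin 1 ≃ Fin m) :
    Split.Compat (splitE e) (splitE e').swap (splitE (pluckEquiv e e'))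
      (splitE (finSumFinEquiv : Fin k ⊕ Fin m' ≃ Fin (k + m'))) where
  fst x := by
    ext i
    change x (e (Sum.inl i)) = x (pluckEquiv e e' (Sum.inr (finSumFinEquiv (Sum.inl i))))
    simp [pluckEquiv]
  mid x := by
    ext i
    change x (e (Sum.inr (e' (Sum.inr i)))) = x (pluckEquiv e e' (Sum.inl i))
    simp [pluckEquiv]
  snd x := by
    ext i
    change x (e (Sum.inr (e' (Sum.inl i))))
      = x (pluckEquiv e e' (Sum.inr (finSumFinEquiv (Sum.inr i))))
    simp [pluckEquiv]

theorem C_C_graft {m' : ℕ} (e : Fin k ⊕ Fin m ≃ Fin N) (e' : Fin m' ⊕ Fin 1 ≃ Fin m) (f : L2 k)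
    (b : L2 1) (ψ : L2 N) : (splitE e').swap.C b ((splitE e).C f ψ)
      = (splitE (graftEquiv e e')).C ((splitE (appendEquiv k)).T f b) ψ := by
  refine ext_inner_left ℂ fun c => ?_
  rw [Split.inner_C, Split.inner_C, Split.inner_C, Split.swap_T, ← (compat_graft e e').T_T,
    Split.swap_T]

/-- Replace ψ by its part χ in which one further particle is in the state `b`. On χ, contraction
with f has the same norm as contraction of ψ with f ⊗ b; the remainder is orthogonal to `b` in that
particle. -/
theorem norm_C_le_graft {m' : ℕ} (e : Fin k ⊕ Fin m ≃ Fin N) (e' : Fin m' ⊕ Fin 1 ≃ Fin m)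
    {f : L2 k} (hf : ‖f‖ = 1) {b : L2 1} (hb : ‖b‖ = 1) (ψ : L2 N) :
    ‖(splitE e).C f ψ‖ ≤ ‖(splitE (graftEquiv e e')).C ((splitE (appendEquiv k)).T f b) ψ‖
      + ‖ψ - (splitE (pluckEquiv e e')).T b ((splitE (pluckEquiv e e')).C b ψ)‖ := by
  set χ := (splitE (pluckEquiv e e')).T b ((splitE (pluckEquiv e e')).C b ψ) with hχ
  have h1 : (splitE e).C f ψ = (splitE e).C f χ + (splitE e).C f (ψ - χ) := by
    rw [map_sub, add_sub_cancel]
  have h2 : ‖(splitE e).C f χ‖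
      = ‖(splitE (graftEquiv e e')).C ((splitE (appendEquiv k)).T f b) ψ‖ := by
    rw [hχ, (compat_pluck e e').C_T, Split.norm_T_apply, hb, one_mul, ← (compat_pluck e e').C_C,
      C_C_graft]
  rw [h1]
  refine (norm_add_le _ _).trans (add_le_add h2.le (((splitE e).norm_C_apply_le _ _).trans ?_))
  rw [hf, one_mul]

/-- Complete condensation of one particle implies that of `k` particles. -/
theorem eventually_overlap {ψ : (N : ℕ) → L2 N} (hψ : ∀ N, 1 ≤ N → IsBosonic (ψ N))
    (hn : ∀ N, 1 ≤ N → ‖ψ N‖ = 1) {φ : Lp ℂ 2 (volume : Measure ℝ)} (hφ : ‖oneState φ‖ = 1)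
    (h1 : ∀ ε > 0, ∀ᶠ N in atTop, ∀ (m : ℕ) (e : Fin 1 ⊕ Fin m ≃ Fin N),
      1 - ε ≤ ‖(splitE e).C (oneState φ) (ψ N)‖) (hk : 1 ≤ k) :
    ∀ ε > 0, ∀ᶠ N in atTop, ∀ (m : ℕ) (e : Fin k ⊕ Fin m ≃ Fin N),
      1 - ε ≤ ‖(splitE e).C (prodState φ k) (ψ N)‖ := by
  induction k, hk using Nat.le_induction with
  | base => exact h1
  | succ k hk ih =>
    intro ε hε
    -- The one-particle tolerance (ε/2)²/2 makes the orthogonal remainder r at most ε/2, because r²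
    -- = 1 - c² ≤ 2(1 - c) for an overlap c.
    filter_upwards [ih (ε / 2) (half_pos hε), h1 ((ε / 2) ^ 2 / 2) (by positivity),
      eventually_ge_atTop (k + 1)] with N h2 h3 hN m e
    have hN1 : 1 ≤ N := by omega
    set e₀ := joinEquiv (Nat.le_of_succ_le hN) with he₀
    set e' : Fin (N - k - 1) ⊕ Fin 1 ≃ Fin (N - k) :=
      finSumFinEquiv.trans (finCongr (by omega)) with he'
    have h4 := norm_C_le_graft e₀ e' (norm_prodState hφ hk) hφ (ψ N)
    have h5 := norm_sq_sub_T_C (pluckEquiv e₀ e') hφ (ψ N)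
    set r := ‖ψ N - (splitE (pluckEquiv e₀ e')).T (oneState φ)
      ((splitE (pluckEquiv e₀ e')).C (oneState φ) (ψ N))‖ with hr
    have h6 := h3 _ (pluckEquiv e₀ e')
    have h7 := h2 _ e₀
    have h8 : r ≤ ε / 2 := by
      refine le_of_sq_le_sq ?_ (by positivity)
      rw [hn N hN1] at h5
      have := norm_nonneg ((splitE (pluckEquiv e₀ e')).C (oneState φ) (ψ N))
      nlinarith [sq_nonneg (‖(splitE (pluckEquiv e₀ e')).C (oneState φ) (ψ N)‖ - 1)]
    rw [← prodState_succ φ hk, (hψ N hN1).norm_C_eq _ e] at h4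
    linarith

end Initial

/-! ### Condensation and the marginals at time zero -/

section InitialLimit

theorem NuclearBound.norm_trace_le {H : Type*} [NormedAddCommGroup H] [InnerProductSpace ℂ H]
    [CompleteSpace H] {A : H →L[ℂ] H} {M : ℝ} (h : NuclearBound A M) : ‖trace A‖ ≤ M := by
  obtain ⟨x, y, hxy, hle⟩ := h
  have h1 := hxy.norm_trace_le (ContinuousLinearMap.id ℂ H)
  rw [ContinuousLinearMap.id_comp] at h1
  have h2 : ‖ContinuousLinearMap.id ℂ H‖ ≤ 1 := ContinuousLinearMap.norm_id_le
  have h3 : 0 ≤ ∑' i, ‖x i‖ * ‖y i‖ := tsum_nonneg fun _ => by positivity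
  exact h1.trans ((mul_le_of_le_one_left h3 h2).trans hle)

theorem nuclearRep_rankOne {H : Type*} [NormedAddCommGroup H] [InnerProductSpace ℂ H]
    [CompleteSpace H] (x : H) :
    NuclearRep (InnerProductSpace.rankOne ℂ x x) (fun _ : Unit => x) (fun _ : Unit => x) where
  summable := (hasSum_fintype _).summable
  hasSum f g := by
    convert hasSum_fintype (fun _ : Unit => ⟪g, x⟫_ℂ * ⟪x, f⟫_ℂ) using 1
    simp [InnerProductSpace.rankOne_apply, mul_comm]

variable {k N : ℕ}

theorem trace_of_inner_C {m : ℕ} (e : Fin k ⊕ Fin m ≃ Fin N) (ψ : L2 N) {A : Op k}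
    (hA : ∀ f g, ⟪g, A f⟫_ℂ = ⟪(splitE e).C f ψ, (splitE e).C g ψ⟫_ℂ) :
    trace A = ((‖ψ‖ ^ 2 : ℝ) : ℂ) := by
  have h1 := ((splitE e).nuclearRep_of_inner_C ψ hA).hasSum_trace (ContinuousLinearMap.id ℂ (L2 k))
  rw [ContinuousLinearMap.id_comp] at h1
  refine h1.unique (((Complex.hasSum_ofReal).2 ((splitE e).summable_norm_sq_C ψ)).congr_fun
    fun i => ?_)
  rw [ContinuousLinearMap.id_apply, inner_self_eq_norm_sq_to_K]
  norm_cast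

variable {ψ : (N : ℕ) → L2 N} {φ : Lp ℂ 2 (volume : Measure ℝ)}

/-- Convergence of the one-particle marginals means complete condensation. -/
theorem condensation (hn : ∀ N, 1 ≤ N → ‖ψ N‖ = 1)
    (h : Tendsto (fun N => traceNorm (marginal 1 (ψ N) - pureState φ 1)) atTop (𝓝 0))
    (hb : ∀ N, 1 ≤ N → IsBosonic (ψ N)) :
    ‖oneState φ‖ = 1 ∧ ∀ ε > 0, ∀ᶠ N in atTop, ∀ (m : ℕ) (e : Fin 1 ⊕ Fin m ≃ Fin N),
      1 - ε ≤ ‖(splitE e).C (oneState φ) (ψ N)‖ := by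
  set ι := oneState φ with hι
  have hP : pureState φ 1 = InnerProductSpace.rankOne ℂ ι ι :=
    (hasKernel_rankOne_prodState φ le_rfl).opOfKernel_eq
  rw [hP] at h
  set t : ℕ → ℝ := fun N => (traceNorm (marginal 1 (ψ N) - InnerProductSpace.rankOne ℂ ι ι)).toReal
    with ht
  have ht0 : Tendsto t atTop (𝓝 0) := (ENNReal.tendsto_toReal ENNReal.zero_ne_top).comp h
  have hnb : ∀ᶠ N in atTop, NuclearBound (marginal 1 (ψ N) - InnerProductSpace.rankOne ℂ ι ι) (t N) :=
    (h.eventually_lt_const ENNReal.zero_lt_top).mono fun N hN => IsTraceClass.nuclearBound hN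
  have hA : ∀ N (h1 : 1 ≤ N) (f g : L2 1), ⟪g, marginal 1 (ψ N) f⟫_ℂ
      = ⟪(splitE (joinEquiv h1)).C f (ψ N), (splitE (joinEquiv h1)).C g (ψ N)⟫_ℂ := fun N h1 => by
    obtain ⟨A, hA, hin⟩ := exists_hasKernel_marginal h1 (ψ N)
    rw [marginal, hA.opOfKernel_eq]
    exact hin
  have htr : trace (InnerProductSpace.rankOne ℂ ι ι) = ((‖ι‖ ^ 2 : ℝ) : ℂ) := by
    have h1 := (nuclearRep_rankOne ι).hasSum_trace (ContinuousLinearMap.id ℂ (L2 1))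
    rw [ContinuousLinearMap.id_comp] at h1
    rw [h1.unique (hasSum_fintype _), Fintype.sum_unique, ContinuousLinearMap.id_apply,
      inner_self_eq_norm_sq_to_K]
    norm_cast
  -- The marginals have trace 1 and the trace is continuous in trace norm, so φ₀ is automatically
  -- normalized.
  have hnorm : ‖ι‖ = 1 := by
    have hle : ∀ᶠ N in atTop, |1 - ‖ι‖ ^ 2| ≤ t N := by
      filter_upwards [hnb, eventually_ge_atTop 1] with N h1 h2
      have h3 := h1.norm_trace_le
      have h4 := ((splitE (joinEquiv h2)).nuclearRep_of_inner_C (ψ N) (hA N h2)).trace_comp_sub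
        (nuclearRep_rankOne ι) (ContinuousLinearMap.id ℂ (L2 1))
      simp only [ContinuousLinearMap.id_comp] at h4
      rw [h4, trace_of_inner_C _ (ψ N) (hA N h2), htr, hn N h2, ← Complex.ofReal_sub,
        Complex.norm_real, one_pow] at h3
      exact h3
    have h0 := ge_of_tendsto ht0 hle
    have h1 : 1 - ‖ι‖ ^ 2 = 0 := abs_eq_zero.1 (le_antisymm h0 (abs_nonneg _))
    nlinarith [norm_nonneg ι]
  refine ⟨hnorm, fun ε hε => ?_⟩
  filter_upwards [hnb, eventually_ge_atTop 1, ht0.eventually_le_const hε] with N h1 h2 h3 m e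
  rw [(hb N h2).norm_C_eq e (joinEquiv h2)]
  have h4 := h1.norm_inner_le ι ι
  set c := ‖(splitE (joinEquiv h2)).C ι (ψ N)‖ with hc
  have h5 : c ≤ 1 := by
    have := (splitE (joinEquiv h2)).norm_C_apply_le ι (ψ N)
    rwa [hnorm, hn N h2, one_mul] at this
  have h6 : ⟪ι, (marginal 1 (ψ N) - InnerProductSpace.rankOne ℂ ι ι) ι⟫_ℂ = ((c ^ 2 - 1 : ℝ) : ℂ) := by
    rw [_root_.sub_apply, inner_sub_right, hA N h2, InnerProductSpace.rankOne_apply,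
      inner_smul_right, inner_self_eq_norm_sq_to_K, inner_self_eq_norm_sq_to_K, hnorm]
    push_cast
    simp [hc]
  rw [h6, Complex.norm_real, hnorm, Real.norm_eq_abs, mul_one, mul_one] at h4
  have h7 := (abs_le.1 h4).1
  nlinarith [norm_nonneg ((splitE (joinEquiv h2)).C ι (ψ N))]

/-- The marginals of a condensate converge weakly to the pure state. -/
theorem tendsto_inner_C_of_overlap {Φ : L2 k} (hΦ : ‖Φ‖ = 1) (hn : ∀ N, 1 ≤ N → ‖ψ N‖ = 1)
    (h : ∀ ε > 0, ∀ᶠ N in atTop, ∀ (m : ℕ) (e : Fin k ⊕ Fin m ≃ Fin N),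
      1 - ε ≤ ‖(splitE e).C Φ (ψ N)‖) (f g : L2 k) :
    ∀ ε > 0, ∀ᶠ N in atTop, ∀ (m : ℕ) (e : Fin k ⊕ Fin m ≃ Fin N),
      ‖⟪(splitE e).C f (ψ N), (splitE e).C g (ψ N)⟫_ℂ - ⟪g, Φ⟫_ℂ * ⟪Φ, f⟫_ℂ‖ ≤ ε := by
  intro ε hε
  set L := ‖f‖ * ‖g‖ with hL
  -- The part of ψ off Φ will have norm at most δ; it enters the error twice linearly, and once
  -- squared through 1 - ‖χ‖².
  obtain ⟨δ, hδ, hδ1, hδε⟩ : ∃ δ : ℝ, 0 < δ ∧ δ ≤ 1 ∧ (2 * δ + δ ^ 2) * L ≤ ε := by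
    refine ⟨min 1 (ε / (3 * (L + 1))), by positivity, min_le_left _ _, ?_⟩
    have hL0 : 0 ≤ L := by positivity
    set δ := min 1 (ε / (3 * (L + 1))) with hδ
    have h1 : δ ≤ 1 := min_le_left _ _
    have h2 : δ * (3 * (L + 1)) ≤ ε := (le_div_iff₀ (by positivity)).1 (min_le_right _ _)
    have h3 : 0 ≤ δ := by positivity
    nlinarith [mul_nonneg h3 hL0, mul_nonneg h3 (sub_nonneg.2 h1)]
  filter_upwards [h (δ ^ 2 / 2) (by positivity), eventually_ge_atTop 1] with N h1 h2 m e
  set p := splitE e with hp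
  set χ := p.C Φ (ψ N) with hχ
  set r := ψ N - p.T Φ χ with hr
  have h3 := norm_sq_sub_T_C e hΦ (ψ N)
  have h4 := h1 m e
  have hχ1 : ‖χ‖ ≤ 1 := by
    have := p.norm_C_apply_le Φ (ψ N)
    rwa [hΦ, hn N h2, one_mul] at this
  have hrδ : ‖r‖ ≤ δ := by
    refine le_of_sq_le_sq ?_ hδ.le
    rw [hr, h3, hn N h2]
    nlinarith [sq_nonneg (‖χ‖ - 1)]
  have hC : ∀ f, p.C f (ψ N) = ⟪f, Φ⟫_ℂ • χ + p.C f r := fun f => by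
    rw [← p.C_T, ← map_add, hr, add_sub_cancel]
  have hb : ∀ f, ‖p.C f r‖ ≤ ‖f‖ * δ := fun f =>
    (p.norm_C_apply_le f r).trans (by gcongr)
  have hb' : ∀ f, ‖⟪f, Φ⟫_ℂ • χ‖ ≤ ‖f‖ := fun f => by
    rw [norm_smul]
    have := norm_inner_le_norm (𝕜 := ℂ) f Φ
    rw [hΦ, mul_one] at this
    exact (mul_le_of_le_one_right (norm_nonneg _) hχ1).trans this
  have hmain : ⟪⟪f, Φ⟫_ℂ • χ, ⟪g, Φ⟫_ℂ • χ⟫_ℂ - ⟪g, Φ⟫_ℂ * ⟪Φ, f⟫_ℂ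
      = -(⟪g, Φ⟫_ℂ * ⟪Φ, f⟫_ℂ * ((‖r‖ ^ 2 : ℝ) : ℂ)) := by
    rw [inner_smul_left, inner_smul_right, inner_conj_symm, inner_self_eq_norm_sq_to_K, hr, h3, hn N h2]
    push_cast
    simp only [Complex.coe_algebraMap]
    ring
  have hm : ‖⟪⟪f, Φ⟫_ℂ • χ, ⟪g, Φ⟫_ℂ • χ⟫_ℂ - ⟪g, Φ⟫_ℂ * ⟪Φ, f⟫_ℂ‖ ≤ δ ^ 2 * L := by
    rw [hmain, norm_neg, norm_mul, norm_mul, Complex.norm_real, norm_pow, norm_norm]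
    have h5 := norm_inner_le_norm (𝕜 := ℂ) g Φ
    have h6 := norm_inner_le_norm (𝕜 := ℂ) Φ f
    rw [hΦ, mul_one] at h5
    rw [hΦ, one_mul] at h6
    calc _ ≤ ‖g‖ * ‖f‖ * δ ^ 2 := by gcongr
      _ = _ := by rw [hL]; ring
  have e1 : ⟪p.C f (ψ N), p.C g (ψ N)⟫_ℂ - ⟪g, Φ⟫_ℂ * ⟪Φ, f⟫_ℂ
      = (⟪⟪f, Φ⟫_ℂ • χ, ⟪g, Φ⟫_ℂ • χ⟫_ℂ - ⟪g, Φ⟫_ℂ * ⟪Φ, f⟫_ℂ)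
        + ⟪p.C f (ψ N), p.C g r⟫_ℂ + ⟪p.C f r, ⟪g, Φ⟫_ℂ • χ⟫_ℂ := by
    conv_lhs => rw [hC g, inner_add_right]
    conv_lhs => rw [hC f, inner_add_left, inner_add_left]
    rw [hC f, inner_add_left]
    ring
  have hf1 : ‖p.C f (ψ N)‖ ≤ ‖f‖ := by
    have := p.norm_C_apply_le f (ψ N)
    rwa [hn N h2, mul_one] at this
  rw [e1]
  calc _ ≤ δ ^ 2 * L + ‖f‖ * (‖g‖ * δ) + ‖f‖ * δ * ‖g‖ := by
        refine (norm_add_le _ _).trans (add_le_add ((norm_add_le _ _).trans (add_le_add hm ?_)) ?_)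
        · exact (norm_inner_le_norm _ _).trans (mul_le_mul hf1 (hb g) (norm_nonneg _) (norm_nonneg _))
        · exact (norm_inner_le_norm _ _).trans (mul_le_mul (hb f) (hb' g) (norm_nonneg _) (by positivity))
    _ = (2 * δ + δ ^ 2) * L := by rw [hL]; ring
    _ ≤ ε := hδε

theorem lensState_zero (ω : ℝ) (ψ : L2 N) : lensState ω 0 ψ = ψ := by
  refine Lp.ext ?_
  filter_upwards [lensState_coe ω 0 ψ] with y hy
  have h : lensFactor ω 0 = 1 := by simp [lensFactor]
  rw [hy, h, one_smul, lensPhase]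
  simp [lensLog]

end InitialLimit

/-! ### Operators tested on Gaussians, and the initial limit -/

section Main

variable {k : ℕ}

theorem inner_sandwich (B : Op k) (f g : L2 k) :
    ⟪g, (energyWeightInv k ∘L B ∘L energyWeightInv k) f⟫_ℂ
      = ⟪energyWeightInv k g, B (energyWeightInv k f)⟫_ℂ := by
  rw [← ContinuousLinearMap.adjoint_inner_right, adjoint_energyWeightInv]
  rfl

theorem ext_inner_gauss {A B : Op k} (τ : ℝ)
    (h : ∀ x y, ⟪gauss y τ, A (gauss x τ)⟫_ℂ = ⟪gauss y τ, B (gauss x τ)⟫_ℂ) : A = B := by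
  refine ext_gauss τ fun x => ?_
  have h1 : innerSL ℂ (A (gauss x τ)) = innerSL ℂ (B (gauss x τ)) := by
    refine ext_gauss τ fun y => ?_
    have := congrArg conj (h x y)
    rwa [inner_conj_symm, inner_conj_symm] at this
  exact ext_inner_right ℂ fun v => congrArg (fun L : L2 k →L[ℂ] ℂ => L v) h1

/-- The marginals of a condensate converge at time `0`. -/
theorem tendsto_lensMarginal_zero {ψ : (N : ℕ) → ℝ → L2 N} {ω : ℝ}
    {φ₀ : Lp ℂ 2 (volume : Measure ℝ)} (hψ : ∀ N, 1 ≤ N → IsBosonic (ψ N 0))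
    (hψ_norm : ∀ N, 1 ≤ N → ‖ψ N 0‖ = 1)
    (hψ_fact : Tendsto (fun N => traceNorm (marginal 1 (ψ N 0) - pureState φ₀ 1)) atTop (𝓝 0))
    (hk : 1 ≤ k) (f g : L2 k) :
    Tendsto (fun N => ⟪g, lensMarginal ω (ψ N) k 0 f⟫_ℂ) atTop
      (𝓝 ⟪g, InnerProductSpace.rankOne ℂ (prodState φ₀ k) (prodState φ₀ k) f⟫_ℂ) := by
  obtain ⟨h1, h2⟩ := condensation hψ_norm hψ_fact hψ
  have h3 := tendsto_inner_C_of_overlap (norm_prodState h1 hk) hψ_norm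
    (eventually_overlap hψ hψ_norm h1 h2 hk) f g
  rw [Metric.tendsto_atTop']
  intro ε hε
  obtain ⟨N₀, hN₀⟩ := eventually_atTop.1 ((h3 (ε / 2) (half_pos hε)).and (eventually_ge_atTop k))
  refine ⟨N₀, fun N hN => ?_⟩
  obtain ⟨h4, h5⟩ := hN₀ N hN.le
  rw [inner_lensMarginal h5, lensTime_zero, lensState_zero, dist_eq_norm,
    InnerProductSpace.rankOne_apply, inner_smul_right, mul_comm ⟪prodState φ₀ k, f⟫_ℂ]
  exact (h4 _ _).trans_lt (half_lt_self hε)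

end Main

end GPHierarchy

end

open GPHierarchy

theorem mainTheorem6
    (V : 𝓢(ℝ, ℝ)) (hV_even : ∀ x, V (-x) = V x) (hV_int : ∫ x, V x ≤ 0)
    (ω β : ℝ) (hβ : β ∈ Set.Ioo (0 : ℝ) 1)
    (φ₀ : Lp ℂ 2 (volume : Measure ℝ))
    (ψ : (N : ℕ) → ℝ → L2 N)
    (hψ : ∀ N, 1 ≤ N → IsNBodyEvolution V ω β N (ψ N))
    (hψ_norm : ∀ N, 1 ≤ N → ‖ψ N 0‖ = 1)
    (hψ_fact : Tendsto (fun N => traceNorm (marginal 1 (ψ N 0) - pureState φ₀ 1)) atTop (𝓝 0))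
    (T : ℝ) (hT : 0 < T)
    (C : ℝ)
    (hC : ∀ k, 1 ≤ k → ∀ᶠ N in atTop, ∀ τ ∈ Set.Icc (0 : ℝ) T,
      energy (lensMarginal ω (ψ N) k τ) ≤ ENNReal.ofReal (C ^ k))
    (J : (k : ℕ) → ℕ → Op k) (hJ : ∀ k, 1 ≤ k → IsObservableFamily (J k))
    (Γ : (k : ℕ) → ℝ → Op k)
    (hΓ : IsLimitPoint J T (fun N => lensMarginal ω (ψ N)) Γ) :
    SolvesLensGP ω |∫ x, V x| T φ₀ Γ := by
  obtain ⟨φ, hφ, hlim⟩ := hΓ.exists_subsequence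
  have hφt := hφ.tendsto_atTop
  -- Both levels are needed along the same subsequence: k for weak convergence of the marginals, k +
  -- 1 for the collision terms.
  have hpath : ∀ k, 1 ≤ k → _ := fun k hk => exists_energyPath (hJ k hk)
    (A := fun n => lensMarginal ω (ψ (φ n)) k) (hφt.eventually (hC k hk)) (hlim k hk) (hΓ.1 k hk)
  intro k hk
  obtain ⟨M', B', Bn', -, hΓ', hBn', hw'⟩ := hpath k hk
  obtain ⟨M, B, Bn, hB, hΓB, hBn, hw⟩ := hpath (k + 1) (by omega)
  have h0T : (0 : ℝ) ∈ Set.Icc 0 T := ⟨le_rfl, hT.le⟩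
  have hweak : ∀ s ∈ Set.Icc 0 T, ∀ f g,
      Tendsto (fun n => ⟪g, lensMarginal ω (ψ (φ n)) k s f⟫_ℂ) atTop (𝓝 ⟪g, Γ k s f⟫_ℂ) :=
    fun s hs f g => by
      rw [hΓ' s hs, inner_sandwich]
      refine (hw' s hs _ _).congr' (hBn'.mono fun n hn => ?_)
      simp only [(hn s hs).2, inner_sandwich]
  have hinit : HasKernel (Γ k 0) (pureKernel φ₀ k) := by
    -- Two weak limits of the same subsequence of marginals at time zero must agree.
    have h : Γ k 0 = InnerProductSpace.rankOne ℂ (prodState φ₀ k) (prodState φ₀ k) :=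
      ContinuousLinearMap.ext fun f => ext_inner_left ℂ fun g =>
        tendsto_nhds_unique (hweak 0 h0T f g)
          ((tendsto_lensMarginal_zero (fun N hN => (hψ N hN).bosonic 0) hψ_norm hψ_fact hk f g).comp
            hφt)
    rw [h]
    exact hasKernel_rankOne_prodState φ₀ hk
  have hex : ∀ (j : Fin k) (s : ℝ), ∃ D : Op k, s ∈ Set.Icc 0 T →
      HasKernel D (collisionKernel (sandwichKernel (B s)) j) ∧ HSBound D (collisionBound M) :=
    fun j s => by
      by_cases hs : s ∈ Set.Icc 0 T
      · obtain ⟨D, hD⟩ := exists_collision (hB.posTrace s hs) j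
        exact ⟨D, fun _ => hD⟩
      · exact ⟨0, fun h => absurd h hs⟩
  choose D hD using hex
  refine ⟨hinit, D, fun j s hs => ⟨sandwichKernel (B s), continuous_sandwichKernel _, ?_,
    (hD j s hs).1⟩, fun τ hτ => ?_⟩
  · rw [hΓB s hs]
    exact hasKernel_sandwich _
  have hint : ∀ j, IntervalIntegrable
      (fun s => freeEvolution (τ - s) ((lensFactor ω s : ℂ) • D j s)) volume 0 τ := fun j =>
    hB.intervalIntegrable (hD j) hτ
  -- Testing with Gaussians evolved to time τ absorbs the free propagators into the test vectors.
  refine ⟨hint, ext_inner_gauss τ fun x y => ?_⟩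
  have hmain := integral_equation_gauss hβ hψ hψ_norm hφt hB hBn hw hweak
    (fun i s hs => (hD i s hs).1) hτ x y
  -- The focusing sign: for ∫V ≤ 0 the factor -∫V in the limit equation is b₀.
  have hb₀ : ((|∫ r, V r| : ℝ) : ℂ) = -((∫ r, V r : ℝ) : ℂ) := by
    rw [abs_of_nonpos hV_int, Complex.ofReal_neg]
  have hsum := fun j => inner_integral_collision (hint j) x y
  have hstart : ⟪gauss y τ, freeEvolution τ (Γ k 0) (gauss x τ)⟫_ℂ
      = ⟪gauss y 0, Γ k 0 (gauss x 0)⟫_ℂ := by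
    rw [inner_freeEvolution, freeGroup_gauss, freeGroup_gauss, add_neg_cancel]
  rw [sub_eq_iff_eq_add'.1 hmain, _root_.add_apply, inner_add_right, hstart, _root_.smul_apply,
    inner_smul_right, _root_.sum_apply, inner_sum, hb₀]
  congr 1
  rw [intervalIntegral.integral_const_mul,
    intervalIntegral.integral_finsetSum fun j _ => (hsum j).1.const_mul _, mul_assoc,
    Finset.mul_sum Finset.univ _ (-((∫ r, V r : ℝ) : ℂ))]
  refine congrArg (Complex.I * ·) (Finset.sum_congr rfl fun j _ => ?_)
  rw [intervalIntegral.integral_const_mul, (hsum j).2]
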